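/- **Theorem (BV area estimates).** *Setting.* Fix a coupling constant $\mathfrak e\ge 0$. For $v_0>0$ let $\mathcal D=\mathcal D(0,v_0)=\{(u,v):0\le u<v\le v_0\}$, with closure $\overline{\mathcal D}$ and axis $\Gamma=\{u=v\}$; on $\overline{\mathcal D}$ partial derivatives are one-sided at the boundary. The spherically symmetric Einstein–Maxwell–charged scalar field system in double-null coordinates and the gauge $A_v=0$ has the unknowns $r,\Omega,A_u,Q$ (real) and $\phi$ (complex), and, with $D_u\phi=\partial_u\phi+i\mathfrak e A_u\phi$ and $\dagger$ denoting complex conjugation, reads $$r\,\partial_v\partial_u r+\partial_v r\,\partial_u r=-\tfrac{\Omega^2}{4}\Big(1-\tfrac{Q^2}{r^2}\Big),$$ $$r^2\,\partial_u\partial_v\log\Omega=-2\pi r^2\big(D_u\phi(\partial_v\phi)^\dagger+\partial_v\phi(D_u\phi)^\dagger\big)-\tfrac12\Omega^2\tfrac{Q^2}{r^2}+\tfrac14\Omega^2+\partial_u r\,\partial_v r,$$ $$\partial_u\big(\Omega^{-2}\partial_u r\big)=-4\pi r\,\Omega^{-2}|D_u\phi|^2,\qquad \partial_v\big(\Omega^{-2}\partial_v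 r\big)=-4\pi r\,\Omega^{-2}|\partial_v\phi|^2,$$ $$r\,\partial_u\partial_v\phi+\partial_u r\,\partial_v\phi+\partial_v r\,\partial_u\phi+i\mathfrak e\Big(A_u\,\partial_v(r\phi)-\tfrac{\Omega^2}{4}\tfrac{Q}{r}\phi\Big)=0,$$ $$\partial_uQ=4\pi\mathfrak e\,r^2\,\mathrm{Im}\big(\phi^\dagger D_u\phi\big),\qquad \partial_vQ=-4\pi\mathfrak e\,r^2\,\mathrm{Im}\big(\phi^\dagger\partial_v\phi\big),\qquad Q=-2r^2\Omega^{-2}\partial_vA_u .$$ The Hawking mass $m$ and mass ratio $\mu$ are given by $1-\tfrac{2m}{r}=-4\Omega^{-2}\partial_ur\,\partial_vr$ and $\mu=\tfrac{2m}{r}$. A *$C^1$ solution on $\mathcal D$ in the regular region* is a solution of these equations on $\mathcal D$ such that: $r,\Omega>0$, $\partial_vr>0$ and $\partial_ur<0$ on $\mathcal D$; $\partial_ur$ is bounded below; $r$ is differentiable on $\overline{\mathcal D}$; the functions $\partial_vr,\ \partial_ur,\ \phi,\ r\partial_v\phi,\ r\partial_u\phi,\ Q/r$ are $C^1$ on $\overline{\mathcal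 D}$ (with $Q/r:=0$ on $\Gamma$), and $\Omega,A_u$ are $C^1$ on $\mathcal D$; on $\Gamma$ one has $r=0$ and $\partial_vr=-\partial_ur$, and $m,Q,A_u\to0$ as $v\to u^+$ for each $u\in[0,v_0)$; the coordinates are normalized by $v=2r(0,v)$ for $0\le v\le v_0$ and $\Omega(0,v)\to1$ as $v\to0^+$. *Notation.* Put $\phi_0=\phi(0,0)$, $\tilde\phi=\phi-\phi_0$, $\lambda=\partial_vr$, $\nu=\partial_ur$, $\tilde{\mathfrak a}=\partial_v(r\tilde\phi)$, $\tilde{\mathfrak b}=\partial_u(r\tilde\phi)$, and $\tilde{\tilde{\mathfrak b}}=\tilde{\mathfrak b}+i\mathfrak eA_ur\phi$. With $TV_I$ the total variation on $I$, let $$D=TV_{\{0\}\times(0,v_0)}[\tilde{\mathfrak a}],\quad X=\sup_{u\in(0,v_0)}\int_u^{v_0}|\partial_v\phi|(u,v)\,dv,\quad Y=\sup_{v\in(0,v_0)}\int_0^{v}|\partial_u\phi|(u,v)\,du,\quad Z=\max\{X,Y\},$$ $$A[f,g]=\int_{\mathcal D}\big|\partial_uf\,\partial_vg-\partial_vf\,\partial_ug\big|\,du\,dv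 .$$ For a function $F$ continuous up to $\Gamma$, $F|_\Gamma(u)=F(u,u)$. Finally let $$C_1=\frac{4\pi\mathfrak e\,\big(\sup_{0<v\le v_0}\partial_vr(0,v)\big)^{1/2}}{\big(1-\sup_{0<v\le v_0}\mu(0,v)\big)^{1/2}}\left(\frac{\sup_{0<v\le v_0}|\phi(0,v)|}{\sqrt{4\pi}}+\frac1{\sqrt{8\pi^2\exp(1)^2}}\right).$$ *Statement.* For every $\mathfrak e\ge0$ and $\rho\ge0$ there are constants $\varepsilon_0\in(0,1]$ and $c\ge0$, depending only on $\mathfrak e$ and $\rho$, with the following property. Let $v_0>0$ and let $(r,\Omega,\phi,A_u,Q)$ be a $C^1$ solution on $\mathcal D(0,v_0)$ in the regular region, as above, with $|\phi_0|=\rho$. Assume that $$v_0\le\min\left\{\frac12,\ \frac{\sqrt2}{C_1},\ \frac2{9\mathfrak e},\ \frac1{\sqrt{384\,\mathfrak e^2|\phi_0|(|\phi_0|+12)}},\ \frac1{\sqrt{1536}\,\mathfrak e\sqrt{|\phi_0|+12}},\ \frac3{128\,\mathfrak e(|\phi_0|+12)}\right\}$$ (a quotient with zero denominator is no restriction), that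 $$\inf_{\mathcal D}\partial_vr\ge\tfrac5{12},\qquad \sup_{\mathcal D}(-\partial_ur)\le\tfrac23,\qquad \sup_{\mathcal D}\mu\le\tfrac13,$$ and that $Z\le\varepsilon_0$ and $D\le\varepsilon_0$. Then $$Z\le cD,$$ $$\sup_{u\in(0,v_0)}TV_{\{u\}\times(u,v_0)}[\tilde{\mathfrak a}]\le cD,\qquad \sup_{v\in(0,v_0)}TV_{(0,v)\times\{v\}}[\tilde{\tilde{\mathfrak b}}]\le cD,\qquad TV_{(0,v_0)}[\tilde{\mathfrak a}|_\Gamma]\le cD,$$ $$\sup_{u\in(0,v_0)}TV_{\{u\}\times(u,v_0)}[\log\lambda]\le cD^2,\qquad \sup_{v\in(0,v_0)}TV_{(0,v)\times\{v\}}[\log|\nu|]\le cD^2,\qquad TV_{(0,v_0)}[\log(\lambda|_\Gamma)]\le cD^2,$$ $$A[\tilde\phi^\dagger,\tilde{\mathfrak a}/\lambda]\le cD^2,\qquad A[\tilde\phi^\dagger,\tilde{\tilde{\mathfrak b}}/\nu]\le cD^2,\qquad A[\lambda,\tilde\phi]\le cD^3,\qquad A[\nu,\tilde\phi]\le cD^3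 .$$ -/

import Mathlib

open Set Filter Topology MeasureTheory
open scoped ENNReal NNReal

noncomputable section

namespace ChargedScalar

/-! ### The domain and partial derivatives in double-null coordinates `p = (u, v)` -/

/-- The domain of dependence `𝒟(0, v₀) = {(u, v) : u ∈ [0, v₀), v ∈ (u, v₀]}`. -/
def dom (v₀ : ℝ) : Set (ℝ × ℝ) := {p | 0 ≤ p.1 ∧ p.1 < p.2 ∧ p.2 ≤ v₀}

/-- The closure of `𝒟(0, v₀)` for `v₀ > 0`: the closed triangle containing the axis `u = v`. -/
def cdom (v₀ : ℝ) : Set (ℝ × ℝ) := {p | 0 ≤ p.1 ∧ p.1 ≤ p.2 ∧ p.2 ≤ v₀}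

/-- `∂_u f`, one-sided on the boundary of the closed triangle. -/
def pu {E : Type*} [NormedAddCommGroup E] [NormedSpace ℝ E] (v₀ : ℝ) (f : ℝ × ℝ → E)
    (p : ℝ × ℝ) : E :=
  fderivWithin ℝ f (cdom v₀) p (1, 0)

/-- `∂_v f`, one-sided on the boundary of the closed triangle. -/
def pv {E : Type*} [NormedAddCommGroup E] [NormedSpace ℝ E] (v₀ : ℝ) (f : ℝ × ℝ → E)
    (p : ℝ × ℝ) : E :=
  fderivWithin ℝ f (cdom v₀) p (0, 1)

/-! ### The spherically symmetric Einstein-Maxwell-charged scalar field system -/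

/-- The unknowns, in the gauge `A_v = 0`: area radius `r`, lapse `Ω`, charged scalar field `φ`,
electromagnetic potential `A = A_u` and charge `Q`. -/
structure Fields where
  r : ℝ × ℝ → ℝ
  Ω : ℝ × ℝ → ℝ
  φ : ℝ × ℝ → ℂ
  A : ℝ × ℝ → ℝ
  Q : ℝ × ℝ → ℝ

namespace Fields

variable (S : Fields) (e v₀ : ℝ)

/-- `λ = ∂_v r`. -/
def lam : ℝ × ℝ → ℝ := pv v₀ S.r

/-- `ν = ∂_u r`. -/
def nu : ℝ × ℝ → ℝ := pu v₀ S.r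

/-- The Hawking mass `m`, given by `1 - 2m/r = -4 Ω⁻² ∂_u r ∂_v r`. -/
def mass (p : ℝ × ℝ) : ℝ := S.r p / 2 * (1 + 4 * S.nu v₀ p * S.lam v₀ p / S.Ω p ^ 2)

/-- The mass ratio `μ = 2m/r`. -/
def mu (p : ℝ × ℝ) : ℝ := 2 * S.mass v₀ p / S.r p

/-- The gauge covariant derivative `D_u φ = ∂_u φ + i e A_u φ`. -/
def Duφ (p : ℝ × ℝ) : ℂ := pu v₀ S.φ p + Complex.I * e * S.A p * S.φ p

/-- `Ψ(A) = A_u ∂_v(rφ) - (Ω²/4)(Q/r) φ`. -/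
def Psi (p : ℝ × ℝ) : ℂ :=
  S.A p * pv v₀ (fun q => (S.r q : ℂ) * S.φ q) p
    - ((S.Ω p ^ 2 / 4 * (S.Q p / S.r p) : ℝ) : ℂ) * S.φ p

/-- The evolution and constraint equations at the point `p`; `A_u` generates the charge by
`Q = -2 r² Ω⁻² ∂_v A_u`. -/
structure EquationsAt (p : ℝ × ℝ) : Prop where
  /-- Wave equation for `r`. -/
  wave_r : S.r p * pv v₀ (pu v₀ S.r) p + pv v₀ S.r p * pu v₀ S.r p
      = -(S.Ω p ^ 2 / 4) * (1 - S.Q p ^ 2 / S.r p ^ 2)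
  /-- Wave equation for `log Ω`. For a `C¹` solution `∂_v log Ω` need only be differentiable in
  the direction of `u`, hence the derivative of the slice. -/
  wave_Ω : ∃ w : ℝ,
      HasDerivWithinAt (fun u => pv v₀ (fun q => Real.log (S.Ω q)) (u, p.2)) w (Ico 0 p.2) p.1 ∧
      S.r p ^ 2 * w
        = -2 * Real.pi * S.r p ^ 2 *
            (S.Duφ e v₀ p * (starRingEnd ℂ) (pv v₀ S.φ p)
              + pv v₀ S.φ p * (starRingEnd ℂ) (S.Duφ e v₀ p)).re
          - 1 / 2 * S.Ω p ^ 2 * (S.Q p ^ 2 / S.r p ^ 2) + 1 / 4 * S.Ω p ^ 2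
          + pu v₀ S.r p * pv v₀ S.r p
  /-- Raychaudhuri equation along incoming null curves. -/
  raych_u : pu v₀ (fun q => pu v₀ S.r q / S.Ω q ^ 2) p
      = -4 * Real.pi * S.r p / S.Ω p ^ 2 * ‖S.Duφ e v₀ p‖ ^ 2
  /-- Raychaudhuri equation along outgoing null curves. -/
  raych_v : pv v₀ (fun q => pv v₀ S.r q / S.Ω q ^ 2) p
      = -4 * Real.pi * S.r p / S.Ω p ^ 2 * ‖pv v₀ S.φ p‖ ^ 2
  /-- Wave equation for `φ`. -/
  wave_φ : S.r p * pu v₀ (pv v₀ S.φ) p + pu v₀ S.r p * pv v₀ S.φ p + pv v₀ S.r p * pu v₀ S.φ p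
      + e * Complex.I * S.Psi v₀ p = 0
  /-- Maxwell equation for `∂_u Q`. -/
  maxwell_u : pu v₀ S.Q p
      = 4 * Real.pi * e * S.r p ^ 2 * ((starRingEnd ℂ) (S.φ p) * S.Duφ e v₀ p).im
  /-- Maxwell equation for `∂_v Q`. -/
  maxwell_v : pv v₀ S.Q p
      = -4 * Real.pi * e * S.r p ^ 2 * ((starRingEnd ℂ) (S.φ p) * pv v₀ S.φ p).im
  /-- The charge in terms of the potential. -/
  potential : S.Q p = -2 * S.r p ^ 2 / S.Ω p ^ 2 * pv v₀ S.A p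

/-- `S` is a `C¹` solution on `𝒟(0, v₀)`, contained in the regular region, in the normalized
double-null gauge (`u = v` on the axis `Γ`, `v = 2r` on `C₀⁺ = {u = 0}`, `Ω(0,0) = 1`,
`A_u|_Γ = 0`). -/
structure IsC1Solution : Prop where
  r_pos : ∀ p ∈ dom v₀, 0 < S.r p
  Ω_pos : ∀ p ∈ dom v₀, 0 < S.Ω p
  -- no anti-trapped spheres, and `𝒟(0, v₀)` lies in the regular region
  nu_neg : ∀ p ∈ dom v₀, S.nu v₀ p < 0
  lam_pos : ∀ p ∈ dom v₀, 0 < S.lam v₀ p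
  -- the unknowns are differentiable
  r_diff : DifferentiableOn ℝ S.r (cdom v₀)
  Ω_C1 : ContDiffOn ℝ 1 S.Ω (dom v₀)
  A_C1 : ContDiffOn ℝ 1 S.A (dom v₀)
  -- `∂_u r` is bounded below; the six quantities are `C¹` up to the boundary
  nu_bdd : BddBelow (S.nu v₀ '' dom v₀)
  lam_C1 : ContDiffOn ℝ 1 (S.lam v₀) (cdom v₀)
  nu_C1 : ContDiffOn ℝ 1 (S.nu v₀) (cdom v₀)
  φ_C1 : ContDiffOn ℝ 1 S.φ (cdom v₀)
  rφv_C1 : ContDiffOn ℝ 1 (fun p => (S.r p : ℂ) * pv v₀ S.φ p) (cdom v₀)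
  rφu_C1 : ContDiffOn ℝ 1 (fun p => (S.r p : ℂ) * pu v₀ S.φ p) (cdom v₀)
  -- on the axis the quotient is read as `0`, its limit there by the Maxwell equations
  Qr_C1 : ContDiffOn ℝ 1 (fun p => S.Q p / S.r p) (cdom v₀)
  -- the equations
  equations : ∀ p ∈ dom v₀, S.EquationsAt e v₀ p
  -- boundary conditions on the axis
  r_axis : ∀ u ∈ Icc 0 v₀, S.r (u, u) = 0
  lam_axis : ∀ u ∈ Icc 0 v₀, S.lam v₀ (u, u) = -S.nu v₀ (u, u)
  mass_axis : ∀ u ∈ Ico 0 v₀, Tendsto (fun v => S.mass v₀ (u, v)) (𝓝[>] u) (𝓝 0)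
  Q_axis : ∀ u ∈ Ico 0 v₀, Tendsto (fun v => S.Q (u, v)) (𝓝[>] u) (𝓝 0)
  A_axis : ∀ u ∈ Ico 0 v₀, Tendsto (fun v => S.A (u, v)) (𝓝[>] u) (𝓝 0)
  -- normalization of the coordinates
  gauge_r : ∀ v ∈ Icc 0 v₀, v = 2 * S.r (0, v)
  gauge_Ω : Tendsto (fun v => S.Ω (0, v)) (𝓝[>] 0) (𝓝 1)

/-! ### Renormalized quantities -/

/-- `φ₀ = φ(0,0)`. -/
def φ₀ : ℂ := S.φ (0, 0)

/-- `φ̃ = φ - φ₀`. -/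
def φt (p : ℝ × ℝ) : ℂ := S.φ p - S.φ₀

/-- `ã = ∂_v(r φ̃)`. -/
def atil : ℝ × ℝ → ℂ := pv v₀ (fun q => (S.r q : ℂ) * S.φt q)

/-- `b̃ = ∂_u(r φ̃)`. -/
def btil : ℝ × ℝ → ℂ := pu v₀ (fun q => (S.r q : ℂ) * S.φt q)

/-- The doubly renormalized quantity `b̃ + i e A_u r φ`. -/
def btt (p : ℝ × ℝ) : ℂ := S.btil v₀ p + Complex.I * e * S.A p * S.r p * S.φ p

/-! ### Sizes: total variations, `D`, `X`, `Y`, `Z` and areas -/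

/-- `D`, the total variation of `ã` on `{0} × (0, v₀)`. -/
def D : ℝ≥0∞ := eVariationOn (fun v => S.atil v₀ (0, v)) (Ioo 0 v₀)

/-- `X = sup_{u ∈ (0, v₀)} ∫_u^{v₀} |∂_v φ|(u, v) dv`. -/
def X : ℝ≥0∞ := ⨆ u ∈ Ioo 0 v₀, ∫⁻ v in Ioo u v₀, ‖pv v₀ S.φ (u, v)‖ₑ

/-- `Y = sup_{v ∈ (0, v₀)} ∫_0^v |∂_u φ|(u, v) du`. -/
def Y : ℝ≥0∞ := ⨆ v ∈ Ioo 0 v₀, ∫⁻ u in Ioo 0 v, ‖pu v₀ S.φ (u, v)‖ₑ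

/-- `Z = max {X, Y}`. -/
def Z : ℝ≥0∞ := max (S.X v₀) (S.Y v₀)

end Fields

/-- `sup_{u ∈ (0, v₀)} TV_{{u} × (u, v₀)}[f]`. -/
def supTVout {E : Type*} [PseudoEMetricSpace E] (v₀ : ℝ) (f : ℝ × ℝ → E) : ℝ≥0∞ :=
  ⨆ u ∈ Ioo 0 v₀, eVariationOn (fun v => f (u, v)) (Ioo u v₀)

/-- `sup_{v ∈ (0, v₀)} TV_{(0, v) × {v}}[f]`. -/
def supTVin {E : Type*} [PseudoEMetricSpace E] (v₀ : ℝ) (f : ℝ × ℝ → E) : ℝ≥0∞ :=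
  ⨆ v ∈ Ioo 0 v₀, eVariationOn (fun u => f (u, v)) (Ioo 0 v)

/-- `TV_{(0, v₀)}[f|_Γ]`, for `f` continuous up to the axis `Γ = {u = v}`, so that
`f|_Γ(u) = lim_{v → u⁺} f(u, v) = f(u, u)`. -/
def tvAxis {E : Type*} [PseudoEMetricSpace E] (v₀ : ℝ) (f : ℝ × ℝ → E) : ℝ≥0∞ :=
  eVariationOn (fun u => f (u, u)) (Ioo 0 v₀)

/-- The Jacobian `∂(f, g)/∂(u, v)`. -/
def jac (v₀ : ℝ) (f g : ℝ × ℝ → ℂ) (p : ℝ × ℝ) : ℂ :=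
  pu v₀ f p * pv v₀ g p - pv v₀ f p * pu v₀ g p

/-- The area `A[f, g] = ∫_{𝒟(0, v₀)} |∂(f, g)/∂(u, v)| du dv`. -/
def area (v₀ : ℝ) (f g : ℝ × ℝ → ℂ) : ℝ≥0∞ := ∫⁻ p in dom v₀, ‖jac v₀ f g p‖ₑ

namespace Fields

variable (S : Fields) (e v₀ : ℝ)

/-! ### Smallness of `v₀` -/

/-- The constant `C₁(0, v₀; χ)`, built from the suprema over `v ∈ (0, v₀]` of `∂_v r`, `μ`
and `|φ|` along `C₀⁺`. -/
def C₁ (χ : ℝ) : ℝ :=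
  4 * Real.pi * e * √(sSup ((fun v => S.lam v₀ (0, v)) '' Ioc 0 v₀))
      / √(1 - sSup ((fun v => S.mu v₀ (0, v)) '' Ioc 0 v₀))
    * (sSup ((fun v => ‖S.φ (0, v)‖) '' Ioc 0 v₀) / √(4 * Real.pi)
        + 1 / √(16 * Real.pi ^ 2 * χ * Real.exp 1 ^ 2))

/-- `v₀ ≤ min {1/2, √2 / C₁, 2/(9e), 1/√(384 e² |φ₀|(|φ₀|+12)), 1/(√1536 e √(|φ₀|+12)),
3/(128 e (|φ₀|+12))}`, where a quotient with vanishing denominator is no restriction. -/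
structure SmallV₀ : Prop where
  pos : 0 < v₀
  le_half : v₀ ≤ 1 / 2
  le_C₁ : S.C₁ e v₀ (1 / 2) * v₀ ≤ √2
  le₁ : 9 * e * v₀ ≤ 2
  le₂ : √(384 * e ^ 2 * ‖S.φ₀‖ * (‖S.φ₀‖ + 12)) * v₀ ≤ 1
  le₃ : √1536 * e * √(‖S.φ₀‖ + 12) * v₀ ≤ 1
  le₄ : 128 * e * (‖S.φ₀‖ + 12) * v₀ ≤ 3

/-- `inf ∂_v r ≥ 5/12`, `sup (-∂_u r) ≤ 2/3` and `sup μ ≤ 1/3` over `𝒟(0, v₀)`. -/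
structure PointwiseBounds : Prop where
  lam_ge : ∀ p ∈ dom v₀, 5 / 12 ≤ S.lam v₀ p
  nu_le : ∀ p ∈ dom v₀, -S.nu v₀ p ≤ 2 / 3
  mu_le : ∀ p ∈ dom v₀, S.mu v₀ p ≤ 1 / 3

end Fields

end ChargedScalar

end

open Set Filter Topology MeasureTheory
open scoped ENNReal NNReal

noncomputable section

namespace ChargedScalar

/-! ### Total variation and integrals of derivatives in one variable. -/

section OneVariable

variable {E : Type*} [NormedAddCommGroup E]

/-! The estimates close because, after renormalization, every quadratic term in the derivatives of
the unknowns is a Jacobian. Write δ = Z + D (`dl`), w = v₀, x = ã/λ - φ̃ = (r/λ) ∂_vφ and y = b̃̃/ν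
- φ̃ = (r/ν) D_uφ, with b̃̃ the doubly renormalized b̃.

Pointwise control. The Raychaudhuri equations make λ/(1-μ) nonincreasing in u and |ν|/(1-μ)
nondecreasing in v. This fixes the sizes of λ, ν and Ω², and integration of the wave and Maxwell
equations gives x, y = O(δ) (`norm_x_le`, `norm_y_le`). As e(|φ₀|+2)w ≤ 3/128, each charge term is
at most a small number times Z/w (`eMA_le`, `norm_ePsi_le`), and the factor 1/w is removed by
integration over a slice.

Null structure. The u-derivative of ∂_vã - φ̃ ∂_vλ is the Jacobian of λ and φ̃ plus a charge term
(`g_u`), and its mirror image ∂_u b̃̃ - φ̃ ∂_uν behaves in the same way in v (`hh_v`). Likewise ∂_v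
log(λ/(1-μ)) - 4π⟨∂_vφ, y⟩ has u-derivative 4π Re J2 plus charge (`Lh_u`), and its mirror image has
v-derivative -4π Re J1 (`Nh_v`).

From areas to variations. Integrating such an identity in u from u = 0, where λ = 1/2, dominates the
quantity by a function of v alone, whose integral is the data plus an area (`MajV.of_initial`). That
function survives the limit to the axis, where λ = -ν and the cross derivatives vanish, and there it
supplies the data for the outgoing integration of the mirror quantity (`MajU.of_axis`).

From variations to areas. A bound on all slices in one direction times a majorant in the transverse
variable is an area bound, by Tonelli (`In.mul_majV`, `Out.mul_majU`). Algebra between the Jacobians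
reduces all areas to such products. Where a factor 1/r is left over, the quantity solves P' = S - κP
with κ ≥ 0 of size 1/r, and the Hardy-type inequality ∫κ|P| ≤ ∫|S| disposes of it
(`setLIntegral_mul_norm_le`); this handles `out_mu`, `tri_Jff` and `tri_J4`.

Closing. If the areas are at most 1 on a smaller triangle they are in fact O(δ) there, so they are
small on the whole triangle by continuous induction (`areas_one`). Further passes through
`areas_step` improve them to orders δ² and δ³. The Hardy inequality applied to x and y then recovers
∂φ and gives Z ≤ (18/5) D + Z/5 + o(δ), hence Z ≤ 6D (`Z_le_D`). The charge terms enter linearly in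
Z, so it is the smallness of v₀, not of δ, that allows their absorption. -/

theorem setLIntegral_Ioo_le_of_forall_Icc {a b : ℝ} {g : ℝ → ℝ≥0∞} {K : ℝ≥0∞}
    (h : ∀ c d, a < c → c ≤ d → d < b → ∫⁻ x in Icc c d, g x ≤ K) :
    ∫⁻ x in Ioo a b, g x ≤ K := by
  rcases le_or_gt b a with hab | hab
  · simp [Ioo_eq_empty (not_lt.2 hab)]
  obtain ⟨c, hc_anti, hc_mem, hc_lim⟩ := exists_seq_strictAnti_tendsto' hab
  obtain ⟨d, hd_mono, hd_mem, hd_lim⟩ := exists_seq_strictMono_tendsto' hab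
  have hU : Ioo a b = ⋃ n, Icc (c n) (d n) := by
    ext x
    simp only [mem_Ioo, mem_iUnion, mem_Icc]
    constructor
    · rintro ⟨h1, h2⟩
      obtain ⟨n, hn⟩ := ((hc_lim.eventually_lt_const h1).and
        (hd_lim.eventually_const_lt h2)).exists
      exact ⟨n, hn.1.le, hn.2.le⟩
    · rintro ⟨n, h1, h2⟩
      exact ⟨(hc_mem n).1.trans_le h1, h2.trans_lt (hd_mem n).2⟩
  have hmono : Monotone fun n => Icc (c n) (d n) := fun m n hmn =>
    Icc_subset_Icc (hc_anti.antitone hmn) (hd_mono.monotone hmn)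
  rw [hU, setLIntegral_iUnion_of_directed _ hmono.directed_le]
  refine iSup_le fun n => ?_
  rcases le_or_gt (c n) (d n) with hcd | hcd
  · exact h _ _ (hc_mem n).1 hcd (hd_mem n).2
  · simp [Icc_eq_empty (not_le.2 hcd)]

variable [NormedSpace ℝ E]

/-- With values in `ℝ≥0∞` no integrability is needed: either the right side is infinite or the
fundamental theorem of calculus applies. -/
theorem enorm_sub_le_setLIntegral_deriv [CompleteSpace E] {a b : ℝ} (hab : a ≤ b) {F F' : ℝ → E}
    (hF : ContinuousOn F (Icc a b)) (hd : ∀ x ∈ Ioo a b, HasDerivAt F (F' x) x)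
    (hF' : ContinuousOn F' (Ioo a b)) : ‖F b - F a‖ₑ ≤ ∫⁻ x in Ioo a b, ‖F' x‖ₑ := by
  by_cases hfin : ∫⁻ x in Ioo a b, ‖F' x‖ₑ = ⊤
  · rw [hfin]; exact le_top
  have hi : IntegrableOn F' (Ioo a b) :=
    ⟨hF'.aestronglyMeasurable measurableSet_Ioo, lt_top_iff_ne_top.2 hfin⟩
  have hi' : IntervalIntegrable F' volume a b := by
    rw [intervalIntegrable_iff_integrableOn_Ioo_of_le hab]; exact hi
  rw [← intervalIntegral.integral_eq_sub_of_hasDerivAt_of_le hab hF hd hi',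
    intervalIntegral.integral_of_le hab, ← integral_Ioc_eq_integral_Ioo.symm]
  exact enorm_integral_le_lintegral_enorm _

theorem eVariationOn_Ioo_le_setLIntegral_deriv [CompleteSpace E] {a b : ℝ} {F F' : ℝ → E}
    (hd : ∀ x ∈ Ioo a b, HasDerivAt F (F' x) x) (hF' : ContinuousOn F' (Ioo a b)) :
    eVariationOn F (Ioo a b) ≤ ∫⁻ x in Ioo a b, ‖F' x‖ₑ := by
  refine iSup_le ?_
  rintro ⟨n, u, hu, hus⟩
  have key : ∀ n : ℕ, ∑ i ∈ Finset.range n, edist (F (u (i + 1))) (F (u i))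
      ≤ ∫⁻ x in Ioo (u 0) (u n), ‖F' x‖ₑ := by
    intro n
    induction n with
    | zero => simp
    | succ n ih =>
      rw [Finset.sum_range_succ]
      have hsub : Icc (u n) (u (n + 1)) ⊆ Ioo a b := fun x hx =>
        ⟨(hus n).1.trans_le hx.1, hx.2.trans_lt (hus (n + 1)).2⟩
      have h1 : edist (F (u (n + 1))) (F (u n)) ≤ ∫⁻ x in Ioo (u n) (u (n + 1)), ‖F' x‖ₑ := by
        rw [edist_eq_enorm_sub]
        exact enorm_sub_le_setLIntegral_deriv (hu n.le_succ)
          (fun x hx => (hd x (hsub hx)).continuousAt.continuousWithinAt)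
          (fun x hx => hd x (hsub (Ioo_subset_Icc_self hx)))
          (hF'.mono (Ioo_subset_Icc_self.trans hsub))
      have hdisj : Disjoint (Ioo (u 0) (u n)) (Ioo (u n) (u (n + 1))) :=
        Set.disjoint_left.2 fun x hx hx' => (hx.2.trans hx'.1).false
      refine (add_le_add ih h1).trans ?_
      rw [← lintegral_union measurableSet_Ioo hdisj]
      refine lintegral_mono_set (union_subset ?_ ?_)
      · exact Ioo_subset_Ioo_right (hu n.le_succ)
      · exact Ioo_subset_Ioo_left (hu n.zero_le)
  refine (key n).trans (lintegral_mono_set ?_)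
  exact Ioo_subset_Ioo (hus 0).1.le (hus n).2.le

/-- On a compact subinterval `F'` is uniformly continuous, so `F` is almost affine on each cell of a
fine partition and its increment there nearly equals the integral of the norm of `F'`. The
inequality turns the hypothesis on D into a bound for the integral of |∂_vã| on u = 0. -/
theorem setLIntegral_deriv_le_eVariationOn_Ioo {a b : ℝ} {F F' : ℝ → E}
    (hd : ∀ x ∈ Ioo a b, HasDerivAt F (F' x) x) (hF' : ContinuousOn F' (Ioo a b)) :
    ∫⁻ x in Ioo a b, ‖F' x‖ₑ ≤ eVariationOn F (Ioo a b) := by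
  refine setLIntegral_Ioo_le_of_forall_Icc fun c d hac hcd hdb => ?_
  have hsub : Icc c d ⊆ Ioo a b := fun x hx => ⟨hac.trans_le hx.1, hx.2.trans_lt hdb⟩
  refine le_trans ?_ (eVariationOn.mono F hsub)
  have huc := isCompact_Icc.uniformContinuousOn_of_continuous (hF'.mono hsub)
  rw [Metric.uniformContinuousOn_iff_le] at huc
  have hlen : (0 : ℝ) ≤ d - c := sub_nonneg.2 hcd
  have main : ∀ ε : ℝ, 0 < ε → ∫⁻ x in Icc c d, ‖F' x‖ₑ
      ≤ eVariationOn F (Icc c d) + ENNReal.ofReal (2 * ε * (d - c)) := by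
    intro ε hε
    -- On cells of length h ≤ δ the derivative varies by at most ε. The error 2εh per cell has one
    -- part from replacing `F'` by its left value and one from the mean value inequality.
    obtain ⟨δ, hδ, hδε⟩ := huc ε hε
    obtain ⟨n, hn⟩ := exists_nat_gt ((d - c) / δ)
    have hn0 : (0 : ℝ) < n := lt_of_le_of_lt (div_nonneg hlen hδ.le) hn
    have hstep : (d - c) / n ≤ δ := by
      rw [div_le_iff₀ hn0]; rw [div_lt_iff₀ hδ] at hn; linarith
    set h : ℝ := (d - c) / n with hh
    have hh0 : 0 ≤ h := div_nonneg hlen hn0.le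
    let I : ℕ → ℝ := fun i => c + i * h
    have hI : Monotone I := fun i j hij => by
      have : (i : ℝ) ≤ j := by exact_mod_cast hij
      show c + i * h ≤ c + j * h
      gcongr
    have hI0 : I 0 = c := by simp [I]
    have hIn : I n = d := by simp only [I, hh]; field_simp; ring
    have piece : ∀ i < n, ∫⁻ x in Icc (I i) (I (i + 1)), ‖F' x‖ₑ
        ≤ eVariationOn F (Icc (I i) (I (i + 1))) + ENNReal.ofReal (2 * ε * h) := by
      intro i hi
      have hIi : I (i + 1) - I i = h := by simp only [I]; push_cast; ring
      have hle : I i ≤ I (i + 1) := hI i.le_succ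
      have hs : Icc (I i) (I (i + 1)) ⊆ Icc c d := by
        rw [← hI0, ← hIn]; exact Icc_subset_Icc (hI i.zero_le) (hI (Nat.succ_le_of_lt hi))
      have hclose : ∀ x ∈ Icc (I i) (I (i + 1)), ‖F' x - F' (I i)‖ ≤ ε := by
        intro x hx
        rw [← dist_eq_norm]
        refine hδε x (hs hx) (I i) (hs (left_mem_Icc.2 hle)) ?_
        rw [Real.dist_eq, abs_of_nonneg (sub_nonneg.2 hx.1)]
        linarith [hx.2]
      -- Mean value inequality for `F` minus its linearization at the left endpoint.
      have hmv : ‖(F (I (i + 1)) - I (i + 1) • F' (I i)) - (F (I i) - I i • F' (I i))‖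
          ≤ ε * ‖I (i + 1) - I i‖ := by
        refine Convex.norm_image_sub_le_of_norm_hasDerivWithin_le
          (f := fun x => F x - x • F' (I i)) (f' := fun x => F' x - F' (I i))
          (s := Icc (I i) (I (i + 1))) ?_ hclose (convex_Icc _ _) (left_mem_Icc.2 hle)
          (right_mem_Icc.2 hle)
        intro x hx
        have h2 := (hasDerivAt_id x).smul_const (F' (I i))
        have h1 := (hd x (hsub (hs hx))).sub h2
        rw [one_smul] at h1
        exact h1.hasDerivWithinAt
      rw [hIi, Real.norm_of_nonneg hh0] at hmv
      have hdiff : h * ‖F' (I i)‖ ≤ ‖F (I (i + 1)) - F (I i)‖ + ε * h := by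
        have e1 : h • F' (I i) = (F (I (i + 1)) - F (I i)) -
            ((F (I (i + 1)) - I (i + 1) • F' (I i)) - (F (I i) - I i • F' (I i))) := by
          rw [← hIi, sub_smul]; abel
        calc h * ‖F' (I i)‖ = ‖h • F' (I i)‖ := by rw [norm_smul, Real.norm_of_nonneg hh0]
          _ ≤ _ := by rw [e1]; exact (norm_sub_le _ _).trans (by linarith)
      calc ∫⁻ x in Icc (I i) (I (i + 1)), ‖F' x‖ₑ
          ≤ ∫⁻ _ in Icc (I i) (I (i + 1)), ENNReal.ofReal (‖F' (I i)‖ + ε) := by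
            refine setLIntegral_mono' measurableSet_Icc fun x hx => ?_
            rw [← ofReal_norm]
            refine ENNReal.ofReal_le_ofReal ?_
            have := norm_sub_norm_le (F' x) (F' (I i))
            linarith [hclose x hx]
        _ = ENNReal.ofReal ((‖F' (I i)‖ + ε) * h) := by
            rw [setLIntegral_const, Real.volume_Icc, hIi,
              ← ENNReal.ofReal_mul (by positivity)]
        _ ≤ ENNReal.ofReal (‖F (I (i + 1)) - F (I i)‖ + 2 * ε * h) :=
            ENNReal.ofReal_le_ofReal (by linarith)
        _ ≤ ENNReal.ofReal ‖F (I (i + 1)) - F (I i)‖ + ENNReal.ofReal (2 * ε * h) :=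
            ENNReal.ofReal_add_le
        _ ≤ _ := by
            gcongr
            rw [ofReal_norm, ← edist_eq_enorm_sub]
            exact eVariationOn.edist_le F (right_mem_Icc.2 hle) (left_mem_Icc.2 hle)
    have hsum : ∀ m ≤ n, ∫⁻ x in Icc (I 0) (I m), ‖F' x‖ₑ
        ≤ ∑ i ∈ Finset.range m, ∫⁻ x in Icc (I i) (I (i + 1)), ‖F' x‖ₑ := by
      intro m
      induction m with
      | zero => intro _; simp
      | succ m ih =>
        intro hm
        rw [Finset.sum_range_succ, ← Icc_union_Icc_eq_Icc (hI m.zero_le) (hI m.le_succ)]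
        exact (lintegral_union_le _ _ _).trans (by gcongr; exact ih (by omega))
    have h3 := hsum n le_rfl
    rw [hI0, hIn] at h3
    refine h3.trans ?_
    calc ∑ i ∈ Finset.range n, ∫⁻ x in Icc (I i) (I (i + 1)), ‖F' x‖ₑ
        ≤ ∑ i ∈ Finset.range n, (eVariationOn F (Icc (I i) (I (i + 1)))
            + ENNReal.ofReal (2 * ε * h)) :=
          Finset.sum_le_sum fun i hi => piece i (Finset.mem_range.1 hi)
      _ = eVariationOn F (Icc c d) + ENNReal.ofReal (2 * ε * (d - c)) := by
          rw [Finset.sum_add_distrib, eVariationOn.sum' F hI, hI0, hIn, Finset.sum_const,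
            Finset.card_range, nsmul_eq_mul, ← ENNReal.ofReal_natCast,
            ← ENNReal.ofReal_mul hn0.le]
          congr 2
          rw [hh]; field_simp
  refine ENNReal.le_of_forall_pos_le_add fun ε hε _ => ?_
  have hpos : 0 < 2 * (d - c) + 1 := by linarith
  refine (main (ε / (2 * (d - c) + 1)) (by positivity)).trans ?_
  gcongr
  rw [← ENNReal.ofReal_coe_nnreal]
  refine ENNReal.ofReal_le_ofReal ?_
  have hε' : (0 : ℝ) < ε := hε
  rw [show 2 * ((ε : ℝ) / (2 * (d - c) + 1)) * (d - c) = ε * (2 * (d - c)) / (2 * (d - c) + 1) by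
    ring, div_le_iff₀ hpos]
  nlinarith

/-- Comparison with a scalar primitive `B`. Derivatives exist only in the open interval, so the
comparison starts at an interior point c, and c tends to `a` by continuity. -/
theorem norm_sub_le_sub_of_norm_deriv_le {a b : ℝ} (hab : a ≤ b) {F F' : ℝ → E} {B B' : ℝ → ℝ}
    (hF : ContinuousOn F (Icc a b)) (hd : ∀ x ∈ Ioo a b, HasDerivAt F (F' x) x)
    (hB : ContinuousOn B (Icc a b)) (hBd : ∀ x ∈ Ioo a b, HasDerivAt B (B' x) x)
    (h : ∀ x ∈ Ioo a b, ‖F' x‖ ≤ B' x) : ‖F b - F a‖ ≤ B b - B a := by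
  rcases hab.eq_or_lt with rfl | hab
  · simp
  have key : ∀ c ∈ Ioo a b, ‖F b - F c‖ ≤ B b - B c := by
    intro c hc
    have hs : Icc c b ⊆ Icc a b := Icc_subset_Icc_left hc.1.le
    have hs' : Ico c b ⊆ Ioo a b := fun x hx => ⟨hc.1.trans_le hx.1, hx.2⟩
    exact image_norm_le_of_norm_deriv_right_le_deriv_boundary'
      (f := fun x => F x - F c) (f' := F') (B := fun x => B x - B c) (B' := B')
      ((hF.mono hs).sub continuousOn_const)
      (fun x hx => by simpa using ((hd x (hs' hx)).sub_const (F c)).hasDerivWithinAt)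
      (by simp) ((hB.mono hs).sub continuousOn_const)
      (fun x hx => by simpa using ((hBd x (hs' hx)).sub_const (B c)).hasDerivWithinAt)
      (fun x hx => h x (hs' hx)) (right_mem_Icc.2 hc.2.le)
  have hmem : Ioo a b ∈ 𝓝[>] a := Ioo_mem_nhdsGT hab
  have hle : 𝓝[>] a ≤ 𝓝[Icc a b] a :=
    (nhdsWithin_le_of_mem (mem_of_superset hmem Ioo_subset_Icc_self))
  have h1 : Tendsto (fun c => ‖F b - F c‖) (𝓝[>] a) (𝓝 ‖F b - F a‖) :=
    (((hF a (left_mem_Icc.2 hab.le)).tendsto.mono_left hle).const_sub _).norm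
  have h2 : Tendsto (fun c => B b - B c) (𝓝[>] a) (𝓝 (B b - B a)) :=
    ((hB a (left_mem_Icc.2 hab.le)).tendsto.mono_left hle).const_sub _
  exact le_of_tendsto_of_tendsto h1 h2 (by filter_upwards [hmem] with c hc using key c hc)

end OneVariable

end ChargedScalar
end

open Set Filter Topology MeasureTheory
open scoped ENNReal NNReal

noncomputable section

namespace ChargedScalar

/-! ### A Hardy-type inequality for damped linear equations. -/

section Hardy

variable {E : Type*} [NormedAddCommGroup E] [InnerProductSpace ℝ E]

/-- Formally |P|' ≤ |S| - κ|P|; integrate and drop the nonnegative end value |P(d)|. -/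
theorem integral_mul_norm_le_of_hasDerivAt {s d : ℝ} (hsd : s ≤ d) {P S : ℝ → E} {κ : ℝ → ℝ}
    (hP : ∀ x ∈ Icc s d, HasDerivAt P (S x - κ x • P x) x) (hκ : ContinuousOn κ (Icc s d))
    (hκ0 : ∀ x ∈ Icc s d, 0 ≤ κ x) (hS : ContinuousOn S (Icc s d)) :
    ∫ x in s..d, κ x * ‖P x‖ ≤ (∫ x in s..d, ‖S x‖) + ‖P s‖ := by
  have hPc : ContinuousOn P (Icc s d) := fun x hx => (hP x hx).continuousAt.continuousWithinAt
  have hu : uIcc s d = Icc s d := uIcc_of_le hsd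
  have iκ : IntervalIntegrable κ volume s d := (hu ▸ hκ).intervalIntegrable
  have iS : IntervalIntegrable (fun x => ‖S x‖) volume s d := (hu ▸ hS.norm).intervalIntegrable
  have iκP : IntervalIntegrable (fun x => κ x * ‖P x‖) volume s d :=
    (hu ▸ hκ.mul hPc.norm).intervalIntegrable
  -- The loss ε(1 + ∫κ) comes from the regularized norm: ε at the left endpoint and ε∫κ in the
  -- damping term.
  have main : ∀ ε : ℝ, 0 < ε → ∫ x in s..d, κ x * ‖P x‖ ≤
      (∫ x in s..d, ‖S x‖) + ‖P s‖ + ε * (1 + ∫ x in s..d, κ x) := by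
    intro ε hε
    -- A smooth substitute for |P|, which need not be differentiable at zeros of P.
    let N : ℝ → ℝ := fun x => √(‖P x‖ ^ 2 + ε ^ 2)
    have hN0 : ∀ x, 0 < N x := fun x => Real.sqrt_pos.2 (by positivity)
    have hNsq : ∀ x, N x ^ 2 = ‖P x‖ ^ 2 + ε ^ 2 := fun x => Real.sq_sqrt (by positivity)
    have hNle : ∀ x, N x ≤ ‖P x‖ + ε := fun x =>
      (Real.sqrt_le_left (by positivity)).2 (by nlinarith [norm_nonneg (P x)])
    have hNge : ∀ x, ‖P x‖ ≤ N x := fun x => Real.le_sqrt_of_sq_le (by nlinarith)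
    let N' : ℝ → ℝ := fun x => inner ℝ (P x) (S x - κ x • P x) / N x
    have hN' : ∀ x ∈ Icc s d, HasDerivAt N (N' x) x := by
      intro x hx
      have h1 := ((hP x hx).norm_sq.add_const (ε ^ 2)).sqrt (by positivity)
      refine h1.congr_deriv ?_
      simp only [N', N]
      field_simp
    have hNc : ContinuousOn N (Icc s d) := fun x hx => (hN' x hx).continuousAt.continuousWithinAt
    have hN'c : ContinuousOn N' (Icc s d) :=
      (hPc.inner (𝕜 := ℝ) (hS.sub (hκ.smul hPc))).div hNc fun x _ => (hN0 x).ne'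
    have hftc : ∫ x in s..d, N' x = N d - N s :=
      intervalIntegral.integral_eq_sub_of_hasDerivAt (by rwa [hu]) (hu ▸ hN'c).intervalIntegrable
    have hpt : ∀ x ∈ Icc s d, κ x * ‖P x‖ ≤ ‖S x‖ - N' x + ε * κ x := by
      intro x hx
      have h1 : N' x ≤ ‖S x‖ - κ x * (‖P x‖ - ε) := by
        simp only [N']
        rw [div_le_iff₀ (hN0 x), inner_sub_right, inner_smul_right, real_inner_self_eq_norm_sq]
        have h2 := real_inner_le_norm (P x) (S x)
        have h3 : ‖P x‖ * ‖S x‖ ≤ N x * ‖S x‖ := by gcongr; exact hNge x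
        have h4 : (‖P x‖ - ε) * N x ≤ ‖P x‖ ^ 2 := by
          rcases le_or_gt (‖P x‖) ε with h | h
          · nlinarith [hN0 x, sq_nonneg (‖P x‖)]
          · nlinarith [hNle x]
        nlinarith [mul_le_mul_of_nonneg_left h4 (hκ0 x hx)]
      linarith
    have hint : ∫ x in s..d, κ x * ‖P x‖ ≤ ∫ x in s..d, (‖S x‖ - N' x + ε * κ x) :=
      intervalIntegral.integral_mono_on hsd iκP
        ((iS.sub (hu ▸ hN'c).intervalIntegrable).add (iκ.const_mul ε)) hpt
    rw [intervalIntegral.integral_add (iS.sub (hu ▸ hN'c).intervalIntegrable) (iκ.const_mul ε),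
      intervalIntegral.integral_sub iS (hu ▸ hN'c).intervalIntegrable, hftc,
      intervalIntegral.integral_const_mul] at hint
    have := hNle s
    have := hN0 d
    linarith
  have hK : 0 ≤ ∫ x in s..d, κ x := intervalIntegral.integral_nonneg hsd hκ0
  refine le_of_forall_pos_le_add fun ε hε => ?_
  refine (main (ε / (1 + ∫ x in s..d, κ x)) (by positivity)).trans ?_
  rw [div_mul_cancel₀ _ (by positivity)]

/-- In the applications κ is of size 1/r and is not integrable at the axis, so the compact
inequality is used from s > a, and the boundary term P(s) disappears as s → a. -/
theorem setLIntegral_mul_norm_le {a b : ℝ} {P S : ℝ → E} {κ : ℝ → ℝ}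
    (hP : ∀ x ∈ Ioo a b, HasDerivAt P (S x - κ x • P x) x) (hκ : ContinuousOn κ (Ioo a b))
    (hκ0 : ∀ x ∈ Ioo a b, 0 ≤ κ x) (hS : ContinuousOn S (Ioo a b))
    (h0 : Tendsto P (𝓝[>] a) (𝓝 0)) :
    ∫⁻ x in Ioo a b, ENNReal.ofReal (κ x * ‖P x‖) ≤ ∫⁻ x in Ioo a b, ENNReal.ofReal ‖S x‖ := by
  refine setLIntegral_Ioo_le_of_forall_Icc fun c d hac hcd hdb => ?_
  have hlim : Tendsto (fun s => (∫⁻ x in Ioo a b, ENNReal.ofReal ‖S x‖) + ENNReal.ofReal ‖P s‖)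
      (𝓝[>] a) (𝓝 ((∫⁻ x in Ioo a b, ENNReal.ofReal ‖S x‖) + 0)) := by
    refine tendsto_const_nhds.add ?_
    have := ENNReal.tendsto_ofReal h0.norm
    simpa using this
  rw [add_zero] at hlim
  refine ge_of_tendsto hlim ?_
  filter_upwards [Ioo_mem_nhdsGT hac] with s hs
  have hsd : s ≤ d := hs.2.le.trans hcd
  have hsub : Icc s d ⊆ Ioo a b := fun x hx => ⟨hs.1.trans_le hx.1, hx.2.trans_lt hdb⟩
  have hPc : ContinuousOn P (Icc s d) := fun x hx =>
    (hP x (hsub hx)).continuousAt.continuousWithinAt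
  have key := integral_mul_norm_le_of_hasDerivAt hsd (fun x hx => hP x (hsub hx)) (hκ.mono hsub)
    (fun x hx => hκ0 x (hsub hx)) (hS.mono hsub)
  have i1 : IntegrableOn (fun x => κ x * ‖P x‖) (Icc s d) :=
    ((hκ.mono hsub).mul hPc.norm).integrableOn_Icc
  have i2 : IntegrableOn (fun x => ‖S x‖) (Icc s d) := (hS.mono hsub).norm.integrableOn_Icc
  rw [intervalIntegral.integral_of_le hsd, intervalIntegral.integral_of_le hsd,
    ← integral_Icc_eq_integral_Ioc, ← integral_Icc_eq_integral_Ioc] at key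
  calc ∫⁻ x in Icc c d, ENNReal.ofReal (κ x * ‖P x‖)
      ≤ ∫⁻ x in Icc s d, ENNReal.ofReal (κ x * ‖P x‖) :=
        lintegral_mono_set (Icc_subset_Icc_left hs.2.le)
    _ = ENNReal.ofReal (∫ x in Icc s d, κ x * ‖P x‖) := by
        rw [ofReal_integral_eq_lintegral_ofReal i1]
        filter_upwards [ae_restrict_mem measurableSet_Icc] with x hx
        exact mul_nonneg (hκ0 x (hsub hx)) (norm_nonneg _)
    _ ≤ ENNReal.ofReal (∫ x in Icc s d, ‖S x‖) + ENNReal.ofReal ‖P s‖ :=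
        (ENNReal.ofReal_le_ofReal key).trans ENNReal.ofReal_add_le
    _ = (∫⁻ x in Icc s d, ENNReal.ofReal ‖S x‖) + ENNReal.ofReal ‖P s‖ := by
        rw [ofReal_integral_eq_lintegral_ofReal i2]
        filter_upwards with x
        exact norm_nonneg _
    _ ≤ _ := by gcongr

/-- Reflection x ↦ -x of the previous inequality, for incoming lines, which reach the axis at their
right end. -/
theorem setLIntegral_mul_norm_le' {a b : ℝ} {P S : ℝ → E} {κ : ℝ → ℝ}
    (hP : ∀ x ∈ Ioo a b, HasDerivAt P (S x + κ x • P x) x) (hκ : ContinuousOn κ (Ioo a b))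
    (hκ0 : ∀ x ∈ Ioo a b, 0 ≤ κ x) (hS : ContinuousOn S (Ioo a b))
    (h0 : Tendsto P (𝓝[<] b) (𝓝 0)) :
    ∫⁻ x in Ioo a b, ENNReal.ofReal (κ x * ‖P x‖) ≤ ∫⁻ x in Ioo a b, ENNReal.ofReal ‖S x‖ := by
  have hmaps : ∀ x ∈ Ioo (-b) (-a), -x ∈ Ioo a b := fun x hx =>
    ⟨by linarith [hx.2], by linarith [hx.1]⟩
  have hmt : MapsTo (fun x : ℝ => -x) (Ioo (-b) (-a)) (Ioo a b) := hmaps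
  have h := setLIntegral_mul_norm_le (a := -b) (b := -a) (P := fun x => P (-x))
    (S := fun x => -S (-x)) (κ := fun x => κ (-x))
    (fun x hx => by
      have h1 := (hP (-x) (hmaps x hx)).scomp x (hasDerivAt_neg x)
      refine h1.congr_deriv ?_
      simp only [neg_smul, one_smul, neg_add]
      abel)
    (hκ.comp continuous_neg.continuousOn hmt) (fun x hx => hκ0 _ (hmaps x hx))
    ((hS.comp continuous_neg.continuousOn hmt).neg)
    (h0.comp (by
      have : Tendsto (fun x : ℝ => -x) (𝓝[>] (-b)) (𝓝[<] (- -b)) := tendsto_neg_nhdsGT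
      rwa [neg_neg] at this))
  have hchange : ∀ g : ℝ → ℝ≥0∞, ∫⁻ x in Ioo (-b) (-a), g (-x) = ∫⁻ x in Ioo a b, g x := by
    intro g
    have e := (Measure.measurePreserving_neg (volume : Measure ℝ)).setLIntegral_comp_preimage_emb
      (MeasurableEquiv.neg ℝ).measurableEmbedding g (Ioo a b)
    rw [← e]
    congr 2
    ext x
    simp only [mem_Ioo, mem_preimage]
    constructor <;> rintro ⟨h1, h2⟩ <;> constructor <;> linarith
  simp only [norm_neg] at h
  rw [hchange (fun x => ENNReal.ofReal (κ x * ‖P x‖)), hchange (fun x => ENNReal.ofReal ‖S x‖)] at h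
  exact h

end Hardy

/-! ### Symmetry of mixed partial derivatives when only one of them is known. -/

section Mixed

variable {E : Type*} [NormedAddCommGroup E] [NormedSpace ℝ E] [CompleteSpace E]

/-- The unknowns are too rough for the usual symmetry theorem: only one mixed derivative is given,
by an equation. Writing F(x,y) - F(u,y) as the integral of `Fu` and differentiating under the
integral in y shows that `Fv` is a primitive of the continuous `Fuv`. -/
theorem hasDerivAt_fst_of_mixed {F Fu Fv Fuv : ℝ × ℝ → E} {O : Set (ℝ × ℝ)} (hO : IsOpen O)
    (hFu : ∀ p ∈ O, HasDerivAt (fun x => F (x, p.2)) (Fu p) p.1)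
    (hFv : ∀ p ∈ O, HasDerivAt (fun y => F (p.1, y)) (Fv p) p.2)
    (hFuv : ∀ p ∈ O, HasDerivAt (fun y => Fu (p.1, y)) (Fuv p) p.2)
    (cFu : ContinuousOn Fu O) (cFuv : ContinuousOn Fuv O) {p : ℝ × ℝ} (hp : p ∈ O) :
    HasDerivAt (fun x => Fv (x, p.2)) (Fuv p) p.1 := by
  obtain ⟨u, v⟩ := p
  obtain ⟨ε, hε, hball⟩ := Metric.nhds_basis_closedBall.mem_iff.1 (hO.mem_nhds hp)
  rw [← closedBall_prod_same] at hball
  obtain ⟨C, hC⟩ := ((isCompact_closedBall u ε).prod (isCompact_closedBall v ε)).exists_bound_of_continuousOn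
    (cFuv.mono hball)
  have hmem : ∀ x ∈ Metric.closedBall u ε, ∀ y ∈ Metric.closedBall v ε, (x, y) ∈ O :=
    fun x hx y hy => hball ⟨hx, hy⟩
  have hu : u ∈ Metric.closedBall u ε := Metric.mem_closedBall_self hε.le
  have hv : v ∈ Metric.closedBall v ε := Metric.mem_closedBall_self hε.le
  have hseg : ∀ x ∈ Metric.closedBall u ε, uIcc u x ⊆ Metric.closedBall u ε := by
    intro x hx
    rw [Real.closedBall_eq_Icc] at hx hu ⊢
    exact uIcc_subset_Icc hu hx
  have hslice : ∀ (G : ℝ × ℝ → E), ContinuousOn G O → ∀ y ∈ Metric.closedBall v ε,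
      ContinuousOn (fun s => G (s, y)) (Metric.closedBall u ε) := fun G hG y hy =>
    hG.comp (by fun_prop) fun s hs => hmem s hs y hy
  have hint : ∀ x ∈ Metric.closedBall u ε, ∀ y ∈ Metric.closedBall v ε,
      ∫ s in u..x, Fu (s, y) = F (x, y) - F (u, y) := fun x hx y hy =>
    intervalIntegral.integral_eq_sub_of_hasDerivAt (f := fun s => F (s, y))
      (fun s hs => hFu (s, y) (hmem s (hseg x hx hs) y hy))
      ((hslice Fu cFu y hy).mono (hseg x hx)).intervalIntegrable
  -- The y-derivative of F(x,y) - F(u,y) is computed directly and under the integral sign; the two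
  -- values agree by uniqueness.
  have hkey : ∀ x ∈ Metric.closedBall u ε,
      Fv (x, v) = Fv (u, v) + ∫ s in u..x, Fuv (s, v) := by
    intro x hx
    have h1 := intervalIntegral.hasDerivAt_integral_of_dominated_loc_of_deriv_le
      (F := fun y s => Fu (s, y)) (F' := fun y s => Fuv (s, y)) (x₀ := v) (a := u) (b := x)
      (μ := volume) (bound := fun _ => C) (Metric.closedBall_mem_nhds v hε)
      (by
        filter_upwards [Metric.closedBall_mem_nhds v hε] with y hy
        exact (((hslice Fu cFu y hy).mono (hseg x hx)).mono uIoc_subset_uIcc).aestronglyMeasurable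
          measurableSet_uIoc)
      ((hslice Fu cFu v hv).mono (hseg x hx)).intervalIntegrable
      ((((hslice Fuv cFuv v hv).mono (hseg x hx)).mono uIoc_subset_uIcc).aestronglyMeasurable
        measurableSet_uIoc)
      (ae_of_all _ fun s hs y hy => hC (s, y) ⟨hseg x hx (uIoc_subset_uIcc hs), hy⟩)
      intervalIntegrable_const
      (ae_of_all _ fun s hs y hy => hFuv (s, y) (hmem s (hseg x hx (uIoc_subset_uIcc hs)) y hy))
    have h2 : HasDerivAt (fun y => ∫ s in u..x, Fu (s, y)) (Fv (x, v) - Fv (u, v)) v := by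
      refine ((hFv (x, v) (hmem x hx v hv)).sub (hFv (u, v) hp)).congr_of_eventuallyEq ?_
      filter_upwards [Metric.closedBall_mem_nhds v hε] with y hy
      exact hint x hx y hy
    rw [h1.2.unique h2]
    abel
  have hcont : ContinuousAt (fun s => Fuv (s, v)) u :=
    (hslice Fuv cFuv v hv).continuousAt (Metric.closedBall_mem_nhds u hε)
  have hmeas : StronglyMeasurableAtFilter (fun s => Fuv (s, v)) (𝓝 u) volume :=
    ⟨Metric.closedBall u ε, Metric.closedBall_mem_nhds u hε,
      (hslice Fuv cFuv v hv).aestronglyMeasurable Metric.isClosed_closedBall.measurableSet⟩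
  have h3 : HasDerivAt (fun x => Fv (u, v) + ∫ s in u..x, Fuv (s, v)) (Fuv (u, v)) u := by
    have := intervalIntegral.integral_hasDerivAt_right (a := u) (b := u)
      (by simp) hmeas hcont
    simpa using this.const_add (Fv (u, v))
  refine h3.congr_of_eventuallyEq ?_
  filter_upwards [Metric.closedBall_mem_nhds u hε] with x hx
  exact hkey x hx

theorem hasDerivAt_snd_of_mixed {F Fu Fv Fvu : ℝ × ℝ → E} {O : Set (ℝ × ℝ)} (hO : IsOpen O)
    (hFu : ∀ p ∈ O, HasDerivAt (fun x => F (x, p.2)) (Fu p) p.1)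
    (hFv : ∀ p ∈ O, HasDerivAt (fun y => F (p.1, y)) (Fv p) p.2)
    (hFvu : ∀ p ∈ O, HasDerivAt (fun x => Fv (x, p.2)) (Fvu p) p.1)
    (cFv : ContinuousOn Fv O) (cFvu : ContinuousOn Fvu O) {p : ℝ × ℝ} (hp : p ∈ O) :
    HasDerivAt (fun y => Fu (p.1, y)) (Fvu p) p.2 := by
  have hO' : IsOpen (Prod.swap ⁻¹' O) := hO.preimage continuous_swap
  exact hasDerivAt_fst_of_mixed (F := F ∘ Prod.swap) (Fu := Fv ∘ Prod.swap)
    (Fv := Fu ∘ Prod.swap) (Fuv := Fvu ∘ Prod.swap) hO' (fun q hq => hFv q.swap hq)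
    (fun q hq => hFu q.swap hq) (fun q hq => hFvu q.swap hq)
    (cFv.comp continuous_swap.continuousOn fun q hq => hq)
    (cFvu.comp continuous_swap.continuousOn fun q hq => hq) (p := p.swap) (by simpa using hp)

end Mixed

end ChargedScalar
end

open Set Filter Topology MeasureTheory
open scoped ENNReal NNReal

noncomputable section

namespace ChargedScalar

/-! ### Integral bounds on the triangle and on its characteristic slices -/

/-- The triangle `0 ≤ u < v < w`. -/
def reg (w : ℝ) : Set (ℝ × ℝ) := {p | 0 ≤ p.1 ∧ p.1 < p.2 ∧ p.2 < w}

theorem measurableSet_reg (w : ℝ) : MeasurableSet (reg w) :=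
  (measurableSet_le measurable_const measurable_fst).inter
    ((measurableSet_lt measurable_fst measurable_snd).inter
      (measurableSet_lt measurable_snd measurable_const))

/-- Length measure on the outgoing line with first coordinate `u`. -/
def outMeas (u : ℝ) : Measure (ℝ × ℝ) := volume.map fun v : ℝ => (u, v)

/-- Length measure on the incoming line with second coordinate `v`. -/
def inMeas (v : ℝ) : Measure (ℝ × ℝ) := volume.map fun u : ℝ => (u, v)

theorem setLIntegral_outMeas {u w : ℝ} (hu : 0 ≤ u) (G : ℝ × ℝ → ℝ≥0∞) :
    ∫⁻ p in reg w, G p ∂(outMeas u) = ∫⁻ v in Ioo u w, G (u, v) := by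
  rw [outMeas, (measurableEmbedding_prodMk_left u).restrict_map,
    (measurableEmbedding_prodMk_left u).lintegral_map]
  congr 2
  ext v
  simp [reg, hu]

theorem setLIntegral_inMeas {v w : ℝ} (hv : v < w) (G : ℝ × ℝ → ℝ≥0∞) :
    ∫⁻ p in reg w, G p ∂(inMeas v) = ∫⁻ u in Ioo 0 v, G (u, v) := by
  rw [inMeas, (measurableEmbedding_prod_mk_right v).restrict_map,
    (measurableEmbedding_prod_mk_right v).lintegral_map, setLIntegral_congr Ioo_ae_eq_Ico]
  congr 2
  ext u
  simp [reg, hv]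

theorem setLIntegral_reg_eq_out {w : ℝ} {G : ℝ × ℝ → ℝ≥0∞}
    (hG : AEMeasurable G (volume.restrict (reg w))) :
    ∫⁻ p in reg w, G p = ∫⁻ u in Ioo 0 w, ∫⁻ v in Ioo u w, G (u, v) := by
  rw [← lintegral_indicator (measurableSet_reg w), Measure.volume_eq_prod,
    lintegral_prod _ (by
      rw [← Measure.volume_eq_prod]
      exact (aemeasurable_indicator_iff (measurableSet_reg w)).2 hG),
    setLIntegral_congr Ioo_ae_eq_Ico, ← lintegral_indicator measurableSet_Ico]
  refine lintegral_congr fun u => ?_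
  by_cases hu : u ∈ Ico 0 w
  · rw [indicator_of_mem hu, ← lintegral_indicator measurableSet_Ioo]
    refine lintegral_congr fun v => ?_
    by_cases hv : v ∈ Ioo u w
    · rw [indicator_of_mem hv, indicator_of_mem (show (u, v) ∈ reg w from ⟨hu.1, hv.1, hv.2⟩)]
    · rw [indicator_of_notMem hv, indicator_of_notMem]
      exact fun h => hv ⟨h.2.1, h.2.2⟩
  · rw [indicator_of_notMem hu, lintegral_eq_zero_of_ae_eq_zero]
    refine ae_of_all _ fun v => ?_
    show (reg w).indicator G (u, v) = 0
    rw [indicator_of_notMem]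
    exact fun h => hu ⟨h.1, h.2.1.trans h.2.2⟩

theorem setLIntegral_reg_eq_in {w : ℝ} {G : ℝ × ℝ → ℝ≥0∞}
    (hG : AEMeasurable G (volume.restrict (reg w))) :
    ∫⁻ p in reg w, G p = ∫⁻ v in Ioo 0 w, ∫⁻ u in Ioo 0 v, G (u, v) := by
  rw [← lintegral_indicator (measurableSet_reg w), Measure.volume_eq_prod,
    lintegral_prod_symm _ (by
      rw [← Measure.volume_eq_prod]
      exact (aemeasurable_indicator_iff (measurableSet_reg w)).2 hG),
    ← lintegral_indicator measurableSet_Ioo]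
  refine lintegral_congr fun v => ?_
  by_cases hv : v ∈ Ioo 0 w
  · rw [indicator_of_mem hv, setLIntegral_congr Ioo_ae_eq_Ico,
      ← lintegral_indicator measurableSet_Ico]
    refine lintegral_congr fun u => ?_
    by_cases hu : u ∈ Ico 0 v
    · rw [indicator_of_mem hu, indicator_of_mem (show (u, v) ∈ reg w from ⟨hu.1, hu.2, hv.2⟩)]
    · rw [indicator_of_notMem hu, indicator_of_notMem]
      exact fun h => hu ⟨h.1, h.2.1⟩
  · rw [indicator_of_notMem hv, lintegral_eq_zero_of_ae_eq_zero]
    refine ae_of_all _ fun u => ?_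
    show (reg w).indicator G (u, v) = 0
    rw [indicator_of_notMem]
    exact fun h => hv ⟨h.1.trans_lt h.2.1, h.2.2⟩

theorem ContinuousOn.aemeasurable_ofReal_reg {w : ℝ} {F : ℝ × ℝ → ℝ} {m : Measure (ℝ × ℝ)}
    (h : ContinuousOn F (reg w)) :
    AEMeasurable (fun p => ENNReal.ofReal (F p)) (m.restrict (reg w)) :=
  (h.aemeasurable (measurableSet_reg w)).ennreal_ofReal

/-- `∫_{reg w} F⁺ dm ≤ c` for a function continuous on the triangle. -/
structure Bd (w : ℝ) (m : Measure (ℝ × ℝ)) (F : ℝ × ℝ → ℝ) (c : ℝ) : Prop where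
  nonneg : 0 ≤ c
  cont : ContinuousOn F (reg w)
  le : ∫⁻ p in reg w, ENNReal.ofReal (F p) ∂m ≤ ENNReal.ofReal c

namespace Bd

variable {w : ℝ} {m : Measure (ℝ × ℝ)} {F G : ℝ × ℝ → ℝ} {c d : ℝ}

theorem mono (hG : Bd w m G c) (hF : ContinuousOn F (reg w)) (h : ∀ p ∈ reg w, F p ≤ G p)
    (hcd : c ≤ d) : Bd w m F d where
  nonneg := hG.nonneg.trans hcd
  cont := hF
  le := (setLIntegral_mono' (measurableSet_reg w) fun p hp =>
    ENNReal.ofReal_le_ofReal (h p hp)).trans (hG.le.trans (ENNReal.ofReal_le_ofReal hcd))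

theorem mono_const (hF : Bd w m F c) (hcd : c ≤ d) : Bd w m F d :=
  hF.mono hF.cont (fun _ _ => le_rfl) hcd

theorem add (hF : Bd w m F c) (hG : Bd w m G d) : Bd w m (fun p => F p + G p) (c + d) where
  nonneg := add_nonneg hF.nonneg hG.nonneg
  cont := hF.cont.add hG.cont
  le := by
    rw [ENNReal.ofReal_add hF.nonneg hG.nonneg]
    refine le_trans (lintegral_mono fun p => ENNReal.ofReal_add_le) ?_
    rw [lintegral_add_left' (ContinuousOn.aemeasurable_ofReal_reg hF.cont)]
    exact add_le_add hF.le hG.le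

theorem const_mul (hF : Bd w m F c) {k : ℝ} (hk : 0 ≤ k) :
    Bd w m (fun p => k * F p) (k * c) where
  nonneg := mul_nonneg hk hF.nonneg
  cont := hF.cont.const_mul k
  le := by
    simp only [ENNReal.ofReal_mul hk]
    rw [lintegral_const_mul' _ _ ENNReal.ofReal_ne_top]
    gcongr
    exact hF.le

end Bd

/-- `∫ F(u, v) dv ≤ c` along every outgoing slice. -/
def Out (w : ℝ) (F : ℝ × ℝ → ℝ) (c : ℝ) : Prop := ∀ u, 0 ≤ u → Bd w (outMeas u) F c

/-- `∫ F(u, v) du ≤ c` along every incoming slice. -/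
def In (w : ℝ) (F : ℝ × ℝ → ℝ) (c : ℝ) : Prop := ∀ v, v < w → Bd w (inMeas v) F c

/-- `∬ F du dv ≤ c` over the triangle. -/
abbrev Tri (w : ℝ) (F : ℝ × ℝ → ℝ) (c : ℝ) : Prop := Bd w volume F c

/-- `F(u, v) ≤ g(v)` with `∫ g dv ≤ c`. -/
structure MajV (w : ℝ) (F : ℝ × ℝ → ℝ) (c : ℝ) : Prop where
  nonneg : 0 ≤ c
  cont : ContinuousOn F (reg w)
  ex : ∃ g : ℝ → ℝ≥0∞, (∀ p ∈ reg w, ENNReal.ofReal (F p) ≤ g p.2) ∧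
    ∫⁻ v in Ioo 0 w, g v ≤ ENNReal.ofReal c

/-- `F(u, v) ≤ h(u)` for `u > 0`, with `∫ h du ≤ c`. -/
structure MajU (w : ℝ) (F : ℝ × ℝ → ℝ) (c : ℝ) : Prop where
  nonneg : 0 ≤ c
  cont : ContinuousOn F (reg w)
  ex : ∃ h : ℝ → ℝ≥0∞, (∀ p ∈ reg w, 0 < p.1 → ENNReal.ofReal (F p) ≤ h p.1) ∧
    ∫⁻ u in Ioo 0 w, h u ≤ ENNReal.ofReal c

section Rules

variable {w : ℝ} {F G : ℝ × ℝ → ℝ} {c d : ℝ}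

theorem Out.intro (hc : 0 ≤ c) (hF : ContinuousOn F (reg w))
    (h : ∀ u, 0 ≤ u → u < w → ∫⁻ v in Ioo u w, ENNReal.ofReal (F (u, v)) ≤ ENNReal.ofReal c) :
    Out w F c := fun u hu =>
  ⟨hc, hF, by
    rw [setLIntegral_outMeas hu]
    rcases lt_or_ge u w with huw | huw
    · exact h u hu huw
    · simp [Ioo_eq_empty (not_lt.2 huw)]⟩

theorem In.intro (hc : 0 ≤ c) (hF : ContinuousOn F (reg w))
    (h : ∀ v, 0 < v → v < w → ∫⁻ u in Ioo 0 v, ENNReal.ofReal (F (u, v)) ≤ ENNReal.ofReal c) :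
    In w F c := fun v hv =>
  ⟨hc, hF, by
    rw [setLIntegral_inMeas hv]
    rcases lt_or_ge 0 v with hv0 | hv0
    · exact h v hv0 hv
    · simp [Ioo_eq_empty (not_lt.2 hv0)]⟩

theorem Out.le (h : Out w F c) {u : ℝ} (hu : 0 ≤ u) :
    ∫⁻ v in Ioo u w, ENNReal.ofReal (F (u, v)) ≤ ENNReal.ofReal c := by
  rw [← setLIntegral_outMeas hu (fun p => ENNReal.ofReal (F p))]; exact (h u hu).le

theorem In.le (h : In w F c) {v : ℝ} (hv : v < w) :
    ∫⁻ u in Ioo 0 v, ENNReal.ofReal (F (u, v)) ≤ ENNReal.ofReal c := by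
  rw [← setLIntegral_inMeas hv (fun p => ENNReal.ofReal (F p))]; exact (h v hv).le

theorem Out.mono (hG : Out w G c) (hF : ContinuousOn F (reg w)) (h : ∀ p ∈ reg w, F p ≤ G p)
    (hcd : c ≤ d) : Out w F d := fun u hu => (hG u hu).mono hF h hcd

theorem In.mono (hG : In w G c) (hF : ContinuousOn F (reg w)) (h : ∀ p ∈ reg w, F p ≤ G p)
    (hcd : c ≤ d) : In w F d := fun v hv => (hG v hv).mono hF h hcd

theorem Out.add (hF : Out w F c) (hG : Out w G d) : Out w (fun p => F p + G p) (c + d) :=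
  fun u hu => (hF u hu).add (hG u hu)

theorem In.add (hF : In w F c) (hG : In w G d) : In w (fun p => F p + G p) (c + d) :=
  fun v hv => (hF v hv).add (hG v hv)

theorem Out.const_mul (hF : Out w F c) {k : ℝ} (hk : 0 ≤ k) : Out w (fun p => k * F p) (k * c) :=
  fun u hu => (hF u hu).const_mul hk

theorem In.const_mul (hF : In w F c) {k : ℝ} (hk : 0 ≤ k) : In w (fun p => k * F p) (k * c) :=
  fun v hv => (hF v hv).const_mul hk

theorem Out.nonneg (hF : Out w F c) : 0 ≤ c := (hF 0 le_rfl).nonneg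

theorem In.nonneg (hF : In w F c) : 0 ≤ c := (hF (w - 1) (by linarith)).nonneg

theorem Out.cont (hF : Out w F c) : ContinuousOn F (reg w) := (hF 0 le_rfl).cont

theorem In.cont (hF : In w F c) : ContinuousOn F (reg w) := (hF (w - 1) (by linarith)).cont

theorem MajV.mono (hG : MajV w G c) (hF : ContinuousOn F (reg w)) (h : ∀ p ∈ reg w, F p ≤ G p)
    (hcd : c ≤ d) : MajV w F d := by
  obtain ⟨g, hg, hgc⟩ := hG.ex
  exact ⟨hG.nonneg.trans hcd, hF, g,
    fun p hp => (ENNReal.ofReal_le_ofReal (h p hp)).trans (hg p hp),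
    hgc.trans (ENNReal.ofReal_le_ofReal hcd)⟩

theorem MajU.mono (hG : MajU w G c) (hF : ContinuousOn F (reg w)) (h : ∀ p ∈ reg w, F p ≤ G p)
    (hcd : c ≤ d) : MajU w F d := by
  obtain ⟨g, hg, hgc⟩ := hG.ex
  exact ⟨hG.nonneg.trans hcd, hF, g,
    fun p hp hp0 => (ENNReal.ofReal_le_ofReal (h p hp)).trans (hg p hp hp0),
    hgc.trans (ENNReal.ofReal_le_ofReal hcd)⟩

/-- A constant of size c/w integrates to c over a length w. In this form the charge terms, all
carrying 1/w, become scale-free. -/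
theorem majV_const (hw : 0 < w) (hc : 0 ≤ c) : MajV w (fun _ => c / w) c :=
  ⟨hc, continuousOn_const, fun _ => ENNReal.ofReal (c / w), fun _ _ => le_rfl, by
    rw [setLIntegral_const, Real.volume_Ioo, ← ENNReal.ofReal_mul (by positivity), sub_zero,
      div_mul_cancel₀ _ hw.ne']⟩

theorem majU_const (hw : 0 < w) (hc : 0 ≤ c) : MajU w (fun _ => c / w) c :=
  ⟨hc, continuousOn_const, fun _ => ENNReal.ofReal (c / w), fun _ _ _ => le_rfl, by
    rw [setLIntegral_const, Real.volume_Ioo, ← ENNReal.ofReal_mul (by positivity), sub_zero,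
      div_mul_cancel₀ _ hw.ne']⟩

theorem MajV.out (h : MajV w F c) : Out w F c := by
  obtain ⟨g, hg, hgc⟩ := h.ex
  refine Out.intro h.nonneg h.cont fun u hu _ => ?_
  refine (setLIntegral_mono' measurableSet_Ioo fun v hv => hg (u, v) ⟨hu, hv.1, hv.2⟩).trans ?_
  exact (lintegral_mono_set (Ioo_subset_Ioo_left hu)).trans hgc

theorem MajU.inn (h : MajU w F c) : In w F c := by
  obtain ⟨g, hg, hgc⟩ := h.ex
  refine In.intro h.nonneg h.cont fun v _ hv => ?_
  refine (setLIntegral_mono' measurableSet_Ioo fun u hu =>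
    hg (u, v) ⟨hu.1.le, hu.2, hv⟩ hu.1).trans ?_
  exact (lintegral_mono_set (Ioo_subset_Ioo_right hv.le)).trans hgc

/-- Tonelli: for fixed v the majorant is constant on the slice, so the slice integral of `F` factors
out and ∫g remains. A bound for `G` on outgoing slices alone would not suffice; this is why
majorants are tracked separately from `Out` and `In`. -/
theorem In.mul_majV (hF : In w F c) (hG : MajV w G d) (hF0 : ∀ p, 0 ≤ F p) :
    Tri w (fun p => F p * G p) (c * d) where
  nonneg := mul_nonneg hF.nonneg hG.nonneg
  cont := hF.cont.mul hG.cont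
  le := by
    obtain ⟨g, hg, hgc⟩ := hG.ex
    rw [setLIntegral_reg_eq_in (G := fun p => ENNReal.ofReal (F p * G p))
        (ContinuousOn.aemeasurable_ofReal_reg (hF.cont.mul hG.cont)),
      ENNReal.ofReal_mul hF.nonneg]
    refine le_trans ?_ (mul_le_mul_right hgc _)
    rw [← lintegral_const_mul' _ _ ENNReal.ofReal_ne_top]
    refine setLIntegral_mono' measurableSet_Ioo fun v hv => ?_
    have hsl : ContinuousOn (fun u => F (u, v)) (Ioo 0 v) :=
      hF.cont.comp (by fun_prop) fun u hu => ⟨hu.1.le, hu.2, hv.2⟩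
    calc ∫⁻ u in Ioo 0 v, ENNReal.ofReal (F (u, v) * G (u, v))
        ≤ ∫⁻ u in Ioo 0 v, ENNReal.ofReal (F (u, v)) * g v := by
          refine setLIntegral_mono' measurableSet_Ioo fun u hu => ?_
          rw [ENNReal.ofReal_mul (hF0 _)]
          gcongr
          exact hg (u, v) ⟨hu.1.le, hu.2, hv.2⟩
      _ = (∫⁻ u in Ioo 0 v, ENNReal.ofReal (F (u, v))) * g v :=
          lintegral_mul_const'' _ (hsl.aemeasurable measurableSet_Ioo).ennreal_ofReal
      _ ≤ _ := by gcongr; exact hF.le hv.2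

theorem Out.mul_majU (hF : Out w F c) (hG : MajU w G d) (hF0 : ∀ p, 0 ≤ F p) :
    Tri w (fun p => F p * G p) (c * d) where
  nonneg := mul_nonneg hF.nonneg hG.nonneg
  cont := hF.cont.mul hG.cont
  le := by
    obtain ⟨g, hg, hgc⟩ := hG.ex
    rw [setLIntegral_reg_eq_out (G := fun p => ENNReal.ofReal (F p * G p))
        (ContinuousOn.aemeasurable_ofReal_reg (hF.cont.mul hG.cont)),
      ENNReal.ofReal_mul hF.nonneg]
    refine le_trans ?_ (mul_le_mul_right hgc _)
    rw [← lintegral_const_mul' _ _ ENNReal.ofReal_ne_top]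
    refine setLIntegral_mono' measurableSet_Ioo fun u hu => ?_
    have hsl : ContinuousOn (fun v => F (u, v)) (Ioo u w) :=
      hF.cont.comp (by fun_prop) fun v hv => ⟨hu.1.le, hv.1, hv.2⟩
    calc ∫⁻ v in Ioo u w, ENNReal.ofReal (F (u, v) * G (u, v))
        ≤ ∫⁻ v in Ioo u w, ENNReal.ofReal (F (u, v)) * g u := by
          refine setLIntegral_mono' measurableSet_Ioo fun v hv => ?_
          rw [ENNReal.ofReal_mul (hF0 _)]
          gcongr
          exact hg (u, v) ⟨hu.1.le, hv.1, hv.2⟩ hu.1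
      _ = (∫⁻ v in Ioo u w, ENNReal.ofReal (F (u, v))) * g u :=
          lintegral_mul_const'' _ (hsl.aemeasurable measurableSet_Ioo).ennreal_ofReal
      _ ≤ _ := by gcongr; exact hF.le hu.1.le

theorem In.tri_div (hw : 0 < w) (hF : In w F c) (hF0 : ∀ p, 0 ≤ F p) (hd : 0 ≤ d) :
    Tri w (fun p => F p * (d / w)) (c * d) := hF.mul_majV (majV_const hw hd) hF0

theorem Out.tri_div (hw : 0 < w) (hF : Out w F c) (hF0 : ∀ p, 0 ≤ F p) (hd : 0 ≤ d) :
    Tri w (fun p => F p * (d / w)) (c * d) := hF.mul_majU (majU_const hw hd) hF0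

theorem tri_const (hw : 0 < w) (hd : 0 ≤ d) : Tri w (fun _ => d / w ^ 2) d := by
  have h := (majV_const hw zero_le_one).out.tri_div hw (fun _ => by positivity) hd
  refine h.mono continuousOn_const (fun p _ => le_of_eq ?_) (by simp)
  field_simp

/-- Transfers a Hardy inequality proved on each outgoing line to areas. The line u = 0 is null and
may be omitted. -/
theorem Tri.of_slices (hG : Tri w G c) (hF : ContinuousOn F (reg w))
    (h : ∀ u, 0 < u → u < w → ∫⁻ v in Ioo u w, ENNReal.ofReal (F (u, v)) ≤
      ∫⁻ v in Ioo u w, ENNReal.ofReal (G (u, v))) : Tri w F c where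
  nonneg := hG.nonneg
  cont := hF
  le := by
    refine le_trans ?_ hG.le
    rw [setLIntegral_reg_eq_out (ContinuousOn.aemeasurable_ofReal_reg hF),
      setLIntegral_reg_eq_out (ContinuousOn.aemeasurable_ofReal_reg hG.cont)]
    exact setLIntegral_mono' measurableSet_Ioo fun u hu => h u hu.1 hu.2

end Rules

/-! ### Slice derivatives -/

section Slices

variable {E : Type*} [NormedAddCommGroup E] [NormedSpace ℝ E] {w : ℝ}

/-- `f'` is the derivative of `f` in `u`, at the points with `u > 0`. -/
def HasU (w : ℝ) (f f' : ℝ × ℝ → E) : Prop :=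
  ∀ u v, 0 < u → u < v → v < w → HasDerivAt (fun x => f (x, v)) (f' (u, v)) u

/-- `f'` is the derivative of `f` in `v`. -/
def HasV (w : ℝ) (f f' : ℝ × ℝ → E) : Prop :=
  ∀ u v, 0 ≤ u → u < v → v < w → HasDerivAt (fun y => f (u, y)) (f' (u, v)) v

/-- `f'` is the derivative of `f` in `v`, at the points with `u > 0`. -/
def HasVi (w : ℝ) (f f' : ℝ × ℝ → E) : Prop :=
  ∀ u v, 0 < u → u < v → v < w → HasDerivAt (fun y => f (u, y)) (f' (u, v)) v

theorem HasV.toVi {f f' : ℝ × ℝ → E} (h : HasV w f f') : HasVi w f f' :=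
  fun u v hu huv hv => h u v hu.le huv hv

theorem isOpen_tri (w : ℝ) : IsOpen {p : ℝ × ℝ | 0 < p.1 ∧ p.1 < p.2 ∧ p.2 < w} :=
  (isOpen_lt continuous_const continuous_fst).inter
    ((isOpen_lt continuous_fst continuous_snd).inter (isOpen_lt continuous_snd continuous_const))

theorem tri_subset_reg (w : ℝ) : {p : ℝ × ℝ | 0 < p.1 ∧ p.1 < p.2 ∧ p.2 < w} ⊆ reg w :=
  fun _ hp => ⟨hp.1.le, hp.2⟩

variable [CompleteSpace E]

theorem HasU.mixed {F Fu Fv Fuv : ℝ × ℝ → E} (hFu : HasU w F Fu) (hFv : HasVi w F Fv)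
    (hFuv : HasVi w Fu Fuv) (cFu : ContinuousOn Fu (reg w)) (cFuv : ContinuousOn Fuv (reg w)) :
    HasU w Fv Fuv := fun u v hu huv hv =>
  hasDerivAt_fst_of_mixed (isOpen_tri w) (fun p hp => hFu p.1 p.2 hp.1 hp.2.1 hp.2.2)
    (fun p hp => hFv p.1 p.2 hp.1 hp.2.1 hp.2.2) (fun p hp => hFuv p.1 p.2 hp.1 hp.2.1 hp.2.2)
    (cFu.mono (tri_subset_reg w)) (cFuv.mono (tri_subset_reg w)) (p := (u, v)) ⟨hu, huv, hv⟩

theorem HasVi.mixed {F Fu Fv Fvu : ℝ × ℝ → E} (hFu : HasU w F Fu) (hFv : HasVi w F Fv)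
    (hFvu : HasU w Fv Fvu) (cFv : ContinuousOn Fv (reg w)) (cFvu : ContinuousOn Fvu (reg w)) :
    HasVi w Fu Fvu := fun u v hu huv hv =>
  hasDerivAt_snd_of_mixed (isOpen_tri w) (fun p hp => hFu p.1 p.2 hp.1 hp.2.1 hp.2.2)
    (fun p hp => hFv p.1 p.2 hp.1 hp.2.1 hp.2.2) (fun p hp => hFvu p.1 p.2 hp.1 hp.2.1 hp.2.2)
    (cFv.mono (tri_subset_reg w)) (cFvu.mono (tri_subset_reg w)) (p := (u, v)) ⟨hu, huv, hv⟩

theorem slice_u_continuousOn {X : Type*} [TopologicalSpace X] {F : ℝ × ℝ → X}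
    (hF : ContinuousOn F (reg w)) {v : ℝ} (hv : v < w) :
    ContinuousOn (fun x => F (x, v)) (Ico 0 v) :=
  hF.comp (by fun_prop) fun _ hx => ⟨hx.1, hx.2, hv⟩

theorem slice_v_continuousOn {X : Type*} [TopologicalSpace X] {F : ℝ × ℝ → X}
    (hF : ContinuousOn F (reg w)) {u : ℝ} (hu : 0 ≤ u) :
    ContinuousOn (fun y => F (u, y)) (Ioo u w) :=
  hF.comp (by fun_prop) fun _ hy => ⟨hu, hy.1, hy.2⟩

/-- The bound |F(0,v)| + ∫₀ᵛ |∂_uF| du does not depend on u, and its integral over v is the size of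
the data plus the area of ∂_uF. This is how an area estimate becomes a bounded-variation estimate.
-/
theorem MajV.of_initial {F Fu : ℝ × ℝ → E} {c d : ℝ} (hF : ContinuousOn F (reg w))
    (hU : HasU w F Fu) (cFu : ContinuousOn Fu (reg w)) (hc : 0 ≤ c)
    (h0 : ∫⁻ v in Ioo 0 w, ENNReal.ofReal ‖F (0, v)‖ ≤ ENNReal.ofReal c)
    (hT : Tri w (fun p => ‖Fu p‖) d) : MajV w (fun p => ‖F p‖) (c + d) := by
  refine ⟨add_nonneg hc hT.nonneg, hF.norm, fun v => ENNReal.ofReal ‖F (0, v)‖ +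
    ∫⁻ u in Ioo 0 v, ENNReal.ofReal ‖Fu (u, v)‖, ?_, ?_⟩
  · rintro ⟨u, v⟩ ⟨hu, huv, hv⟩
    simp only at hu huv hv ⊢
    have hs : Icc 0 u ⊆ Ico 0 v := fun x hx => ⟨hx.1, hx.2.trans_lt huv⟩
    have h1 := enorm_sub_le_setLIntegral_deriv hu ((slice_u_continuousOn hF hv).mono hs)
      (fun x hx => hU x v hx.1 (hx.2.trans huv) hv)
      ((slice_u_continuousOn cFu hv).mono (Ioo_subset_Icc_self.trans hs))
    rw [ofReal_norm, ofReal_norm]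
    calc ‖F (u, v)‖ₑ = ‖F (0, v) + (F (u, v) - F (0, v))‖ₑ := by congr 1; abel
      _ ≤ ‖F (0, v)‖ₑ + ‖F (u, v) - F (0, v)‖ₑ := enorm_add_le _ _
      _ ≤ _ := by
        gcongr
        refine h1.trans ?_
        simp only [ofReal_norm]
        exact lintegral_mono_set (Ioo_subset_Ioo_right huv.le)
  · rw [lintegral_add_left', ENNReal.ofReal_add hc hT.nonneg]
    · refine add_le_add h0 ?_
      rw [← setLIntegral_reg_eq_in (G := fun p => ENNReal.ofReal ‖Fu p‖)
        (ContinuousOn.aemeasurable_ofReal_reg hT.cont)]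
      exact hT.le
    · have : ContinuousOn (fun v => ‖F (0, v)‖) (Ioo 0 w) :=
        slice_v_continuousOn hF.norm le_rfl
      exact (this.aemeasurable measurableSet_Ioo).ennreal_ofReal

/-- Counterpart of `MajV.of_initial` with data on the axis. `F` is only known to have a limit there,
so the integration starts at y > u and y → u. -/
theorem MajU.of_axis {F Fv : ℝ × ℝ → E} {h : ℝ → E} {g : ℝ → ℝ≥0∞} {c d : ℝ}
    (hF : ContinuousOn F (reg w)) (hV : HasVi w F Fv) (cFv : ContinuousOn Fv (reg w))
    (hlim : ∀ u, 0 < u → u < w → Tendsto (fun v => F (u, v)) (𝓝[>] u) (𝓝 (h u)))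
    (hg : ∀ u, 0 < u → u < w → ‖h u‖ₑ ≤ g u) (hc : 0 ≤ c)
    (hgc : ∫⁻ u in Ioo 0 w, g u ≤ ENNReal.ofReal c)
    (hT : Tri w (fun p => ‖Fv p‖) d) : MajU w (fun p => ‖F p‖) (c + d) := by
  refine ⟨add_nonneg hc hT.nonneg, hF.norm, fun u => g u +
    ∫⁻ v in Ioo u w, ENNReal.ofReal ‖Fv (u, v)‖, ?_, ?_⟩
  · rintro ⟨u, v⟩ ⟨-, huv, hv⟩ hu
    simp only at hu huv hv ⊢
    have huw := huv.trans hv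
    rw [ofReal_norm]
    have hl : Tendsto (fun y => ‖F (u, y)‖ₑ + ∫⁻ y in Ioo u w, ENNReal.ofReal ‖Fv (u, y)‖)
        (𝓝[>] u) (𝓝 (‖h u‖ₑ + ∫⁻ y in Ioo u w, ENNReal.ofReal ‖Fv (u, y)‖)) :=
      (hlim u hu huw).enorm.add tendsto_const_nhds
    have hle : ‖F (u, v)‖ₑ ≤ ‖h u‖ₑ + ∫⁻ y in Ioo u w, ENNReal.ofReal ‖Fv (u, y)‖ := by
      refine ge_of_tendsto hl ?_
      filter_upwards [Ioo_mem_nhdsGT huv] with y hy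
      have hs : Icc y v ⊆ Ioo u w := fun x hx => ⟨hy.1.trans_le hx.1, hx.2.trans_lt hv⟩
      have h1 := enorm_sub_le_setLIntegral_deriv hy.2.le
        ((slice_v_continuousOn hF hu.le).mono hs)
        (fun x hx => hV u x hu (hy.1.trans hx.1) (hx.2.trans hv))
        ((slice_v_continuousOn cFv hu.le).mono (Ioo_subset_Icc_self.trans hs))
      calc ‖F (u, v)‖ₑ = ‖F (u, y) + (F (u, v) - F (u, y))‖ₑ := by congr 1; abel
        _ ≤ ‖F (u, y)‖ₑ + ‖F (u, v) - F (u, y)‖ₑ := enorm_add_le _ _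
        _ ≤ _ := by
          gcongr
          refine h1.trans ?_
          simp only [ofReal_norm]
          exact lintegral_mono_set (Ioo_subset_Icc_self.trans hs)
    exact hle.trans (by gcongr; exact hg u hu huw)
  -- Measurability in u of the slice integral, from Tonelli for the indicator of the triangle.
  · have hm : AEMeasurable (fun u => ∫⁻ v in Ioo u w, ENNReal.ofReal ‖Fv (u, v)‖)
        (volume.restrict (Ioo 0 w)) := by
      have h1 : AEMeasurable ((reg w).indicator fun p => ENNReal.ofReal ‖Fv p‖)
          ((volume : Measure ℝ).prod volume) := by
        rw [← Measure.volume_eq_prod]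
        exact (aemeasurable_indicator_iff (measurableSet_reg w)).2
          (ContinuousOn.aemeasurable_ofReal_reg hT.cont)
      refine (h1.lintegral_prod_right'.mono_measure Measure.restrict_le_self).congr ?_
      filter_upwards [ae_restrict_mem measurableSet_Ioo] with u hu
      rw [← lintegral_indicator measurableSet_Ioo]
      refine lintegral_congr fun v => ?_
      by_cases hv : v ∈ Ioo u w
      · rw [indicator_of_mem hv,
          indicator_of_mem (show (u, v) ∈ reg w from ⟨hu.1.le, hv.1, hv.2⟩)]
      · rw [indicator_of_notMem hv, indicator_of_notMem]
        exact fun h => hv ⟨h.2.1, h.2.2⟩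
    rw [lintegral_add_right' _ hm, ENNReal.ofReal_add hc hT.nonneg]
    refine add_le_add hgc ?_
    rw [← setLIntegral_reg_eq_out (G := fun p => ENNReal.ofReal ‖Fv p‖)
      (ContinuousOn.aemeasurable_ofReal_reg hT.cont)]
    exact hT.le

end Slices

end ChargedScalar
end

open Set Filter Topology MeasureTheory
open scoped ENNReal NNReal

noncomputable section

namespace ChargedScalar

/-! ### Comparison and integration starting at the axis. -/

theorem le_of_hasDerivAt_nonneg {a b : ℝ} (hab : a ≤ b) {F F' : ℝ → ℝ}
    (hF : ContinuousOn F (Icc a b)) (hd : ∀ x ∈ Ioo a b, HasDerivAt F (F' x) x)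
    (h : ∀ x ∈ Ioo a b, 0 ≤ F' x) : F a ≤ F b := by
  refine monotoneOn_of_hasDerivWithinAt_nonneg (convex_Icc a b) hF (f' := F')
    (fun x hx => ?_) (fun x hx => ?_) (left_mem_Icc.2 hab) (right_mem_Icc.2 hab) hab
  · rw [interior_Icc] at hx
    exact (hd x hx).hasDerivWithinAt
  · rw [interior_Icc] at hx
    exact h x hx

section AxisIntegration

variable {E : Type*} [NormedAddCommGroup E] [NormedSpace ℝ E] {w : ℝ}

theorem HasV.enorm_sub_axis_le [CompleteSpace E] {F Fv : ℝ × ℝ → E} (hV : HasV w F Fv)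
    (cF : ContinuousOn F (reg w)) (cFv : ContinuousOn Fv (reg w)) {u v : ℝ} (hu : 0 ≤ u)
    (huv : u < v) (hv : v < w) {L : E} (hL : Tendsto (fun y => F (u, y)) (𝓝[>] u) (𝓝 L)) :
    ‖F (u, v) - L‖ₑ ≤ ∫⁻ y in Ioo u v, ‖Fv (u, y)‖ₑ := by
  refine le_of_tendsto (hL.const_sub (F (u, v))).enorm ?_
  filter_upwards [Ioo_mem_nhdsGT huv] with y hy
  have hs : Icc y v ⊆ Ioo u w := fun x hx => ⟨hy.1.trans_le hx.1, hx.2.trans_lt hv⟩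
  exact (enorm_sub_le_setLIntegral_deriv hy.2.le ((slice_v_continuousOn cF hu).mono hs)
    (fun x hx => hV u x hu (hy.1.trans hx.1) (hx.2.trans hv))
    ((slice_v_continuousOn cFv hu).mono (Ioo_subset_Icc_self.trans hs))).trans
    (lintegral_mono_set (Ioo_subset_Ioo_left hy.1.le))

theorem HasV.norm_sub_axis_le {F Fv : ℝ × ℝ → E} (hV : HasV w F Fv)
    (cF : ContinuousOn F (reg w)) {u v : ℝ} (hu : 0 ≤ u)
    (huv : u < v) (hv : v < w) {L : E} (hL : Tendsto (fun y => F (u, y)) (𝓝[>] u) (𝓝 L))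
    {C : ℝ} (hC : ∀ y, u < y → y < v → ‖Fv (u, y)‖ ≤ C) :
    ‖F (u, v) - L‖ ≤ C * (v - u) := by
  have hr : Tendsto (fun y => C * (v - y)) (𝓝[>] u) (𝓝 (C * (v - u))) :=
    (Continuous.tendsto (by fun_prop) u).mono_left nhdsWithin_le_nhds
  refine le_of_tendsto_of_tendsto (hL.const_sub (F (u, v))).norm hr ?_
  filter_upwards [Ioo_mem_nhdsGT huv] with y hy
  have hs : Icc y v ⊆ Ioo u w := fun x hx => ⟨hy.1.trans_le hx.1, hx.2.trans_lt hv⟩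
  have := norm_sub_le_sub_of_norm_deriv_le (B := fun x => C * x) (B' := fun _ => C) hy.2.le
    ((slice_v_continuousOn cF hu).mono hs)
    (fun x hx => hV u x hu (hy.1.trans hx.1) (hx.2.trans hv)) (by fun_prop)
    (fun x _ => by simpa using (hasDerivAt_id x).const_mul C)
    (fun x hx => hC x (hy.1.trans hx.1) hx.2)
  linarith

theorem HasV.axis_le {F Fv : ℝ × ℝ → ℝ} (hV : HasV w F Fv) (cF : ContinuousOn F (reg w)) {u v : ℝ}
    (hu : 0 ≤ u) (huv : u < v) (hv : v < w) {L : ℝ}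
    (hL : Tendsto (fun y => F (u, y)) (𝓝[>] u) (𝓝 L))
    (h : ∀ y, u < y → y < v → 0 ≤ Fv (u, y)) : L ≤ F (u, v) := by
  refine le_of_tendsto hL ?_
  filter_upwards [Ioo_mem_nhdsGT huv] with y hy
  have hs : Icc y v ⊆ Ioo u w := fun x hx => ⟨hy.1.trans_le hx.1, hx.2.trans_lt hv⟩
  exact le_of_hasDerivAt_nonneg hy.2.le ((slice_v_continuousOn cF hu).mono hs)
    (fun x hx => hV u x hu (hy.1.trans hx.1) (hx.2.trans hv))
    (fun x hx => h x (hy.1.trans hx.1) hx.2)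

end AxisIntegration

/-! ### The reduced first-order system -/

/-- The unknowns of the characteristic initial value problem on `reg w`, together with their
first derivatives: `f = φ - φ(0,0)`, `q = Q / r`, `lamv = ∂_v λ`, `nuu = ∂_u ν`,
`atv = ∂_v ã`, `bu = ∂_u b̃`. -/
structure Reduced where
  (e w M Z D : ℝ)
  (r lam nu mu q A lamv nuu Au : ℝ × ℝ → ℝ)
  (f fu fv atv bu : ℝ × ℝ → ℂ)
  φ0 : ℂ
  (la lΓ : ℝ → ℝ)
  gΓ : ℝ → ℂ

namespace Reduced

open Complex (I)

section Definitions

variable (s : Reduced) (p : ℝ × ℝ)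

/-- The scalar field. -/
def φ : ℂ := s.f p + s.φ0

/-- `Ω² / 4`. -/
def W : ℝ := -(s.lam p * s.nu p) / (1 - s.mu p)

/-- `(μ - q²) / (1 - μ)`. -/
def pm : ℝ := (s.mu p - s.q p ^ 2) / (1 - s.mu p)

/-- `∂_u λ = ∂_v ν`. -/
def lk : ℝ := s.lam p * s.nu p * (s.pm p / s.r p)

/-- `D_u φ`. -/
def Du : ℂ := s.fu p + I * ((s.e * s.A p : ℝ) : ℂ) * s.φ p

/-- `ã / λ - φ̃`. -/
def x : ℂ := ((s.r p / s.lam p : ℝ) : ℂ) * s.fv p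

/-- The doubly renormalized `b̃` divided by `ν`, minus `φ̃`. -/
def y : ℂ := ((s.r p / s.nu p : ℝ) : ℂ) * s.Du p

/-- The charge term `e Ψ` in the wave equation. -/
def ePsi : ℂ := ((s.e * s.A p : ℝ) : ℂ) * (s.r p * s.fv p + s.lam p * s.φ p)
  - ((s.e * s.W p * s.q p : ℝ) : ℂ) * s.φ p

/-- `ã`. -/
def at' : ℂ := s.r p * s.fv p + s.lam p * s.f p

/-- The doubly renormalized `b̃`. -/
def bt : ℂ := s.r p * s.Du p + s.nu p * s.f p

/-- `∂_v log (|ν| / (1 - μ))`. -/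
def Nv : ℝ := 4 * Real.pi * s.r p * ‖s.fv p‖ ^ 2 / s.lam p

/-- `∂_u log (λ / (1 - μ))`. -/
def Lu : ℝ := 4 * Real.pi * s.r p * ‖s.Du p‖ ^ 2 / s.nu p

/-- `∂_u ∂_v φ`. -/
def fuv : ℂ := -(s.nu p * s.fv p + s.lam p * s.fu p + I * s.ePsi p) / s.r p

/-- `∂_u` of the doubly renormalized `b̃`. -/
def btu : ℂ := s.bu p + I * (((s.e * (s.Au p * s.r p + s.A p * s.nu p) : ℝ) : ℂ) * s.φ p
  + ((s.e * (s.A p * s.r p) : ℝ) : ℂ) * s.fu p)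

/-- `∂_v` of the doubly renormalized `b̃`. -/
def btv : ℂ := s.lk p * s.f p - I * ((s.e * s.W p * s.q p : ℝ) : ℂ) * s.φ p

/-- `∂_u ã`. -/
def atu : ℂ := s.lk p * s.f p - I * s.ePsi p

/-- `∂_v q`. -/
def qv : ℝ := -(4 * Real.pi * s.e * s.r p * ((starRingEnd ℂ) (s.φ p) * s.fv p).im)
  - s.lam p * s.q p / s.r p

/-- `∂_u q`. -/
def qu : ℝ := 4 * Real.pi * s.e * s.r p * ((starRingEnd ℂ) (s.φ p) * s.Du p).im
  - s.nu p * s.q p / s.r p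

/-- `∂_v μ`. -/
def muv : ℝ := (1 - s.mu p) * (s.Nv p - s.lam p * (s.pm p / s.r p))

/-- `∂_u μ`. -/
def muu : ℝ := (1 - s.mu p) * (s.Lu p - s.nu p * (s.pm p / s.r p))

/-- `∂_v A_u`. -/
def Av : ℝ := -2 * s.W p * s.q p / s.r p

end Definitions

/-- The reduced system with its boundary conditions and smallness assumptions. -/
structure IsSol (s : Reduced) : Prop where
  e_nonneg : 0 ≤ s.e
  w_pos : 0 < s.w
  M_ge : 2 ≤ s.M
  φ0_le : ‖s.φ0‖ ≤ s.M - 2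
  -- The only form in which the smallness of v₀ is used; `M` dominates |φ|, and `w` is the length of
  -- the triangle.
  small : s.e * s.M * s.w ≤ 3 / 128
  Z_nonneg : 0 ≤ s.Z
  D_nonneg : 0 ≤ s.D
  ZD_le : s.Z + s.D ≤ 1 / 100
  cr : ContinuousOn s.r (reg s.w)
  clam : ContinuousOn s.lam (reg s.w)
  cnu : ContinuousOn s.nu (reg s.w)
  cmu : ContinuousOn s.mu (reg s.w)
  cq : ContinuousOn s.q (reg s.w)
  cA : ContinuousOn s.A (reg s.w)
  clamv : ContinuousOn s.lamv (reg s.w)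
  cnuu : ContinuousOn s.nuu (reg s.w)
  cAu : ContinuousOn s.Au (reg s.w)
  cf : ContinuousOn s.f (reg s.w)
  cfu : ContinuousOn s.fu (reg s.w)
  cfv : ContinuousOn s.fv (reg s.w)
  catv : ContinuousOn s.atv (reg s.w)
  cbu : ContinuousOn s.bu (reg s.w)
  r_pos : ∀ p ∈ reg s.w, 0 < s.r p
  lam_ge : ∀ p ∈ reg s.w, 5 / 12 ≤ s.lam p
  nu_neg : ∀ p ∈ reg s.w, s.nu p < 0
  nu_ge : ∀ p ∈ reg s.w, -(2 / 3) ≤ s.nu p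
  mu_le : ∀ p ∈ reg s.w, s.mu p ≤ 1 / 3
  -- Purely qualitative: `B` serves to identify limits at the axis and to run the continuity
  -- argument, and appears in no final constant.
  bdd : ∃ B : ℝ, ∀ p ∈ reg s.w, |s.lamv p| ≤ B ∧ |s.nuu p| ≤ B ∧ ‖s.fu p‖ ≤ B ∧ ‖s.fv p‖ ≤ B ∧
    ‖s.atv p‖ ≤ B ∧ ‖s.bu p‖ ≤ B ∧ |s.lk p| ≤ B
  r_u : HasU s.w s.r s.nu
  r_v : HasV s.w s.r s.lam
  lam_u : HasU s.w s.lam s.lk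
  lam_v : HasV s.w s.lam s.lamv
  nu_u : HasU s.w s.nu s.nuu
  nu_v : HasV s.w s.nu s.lk
  f_u : HasU s.w s.f s.fu
  f_v : HasV s.w s.f s.fv
  fu_v : HasV s.w s.fu s.fuv
  fv_u : HasU s.w s.fv s.fuv
  at_v : HasV s.w s.at' s.atv
  b_u : HasU s.w (fun p => s.r p * s.fu p + s.nu p * s.f p) s.bu
  A_u : HasU s.w s.A s.Au
  A_v : HasV s.w s.A s.Av
  mu_u : HasU s.w s.mu s.muu
  mu_v : HasV s.w s.mu s.muv
  q_u : HasU s.w s.q s.qu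
  q_v : HasV s.w s.q s.qv
  lam_init : ∀ v, 0 < v → v < s.w → s.lam (0, v) = 1 / 2
  lamv_init : ∀ v, 0 < v → v < s.w → s.lamv (0, v) = 0
  f_origin : Tendsto (fun v => s.f (0, v)) (𝓝[>] 0) (𝓝 0)
  at_origin : Tendsto (fun v => s.at' (0, v)) (𝓝[>] 0) (𝓝 0)
  X_le : ∀ u, 0 ≤ u → u < s.w → ∫⁻ v in Ioo u s.w, ENNReal.ofReal ‖s.fv (u, v)‖ ≤ ENNReal.ofReal s.Z
  Y_le : ∀ v, 0 < v → v < s.w → ∫⁻ u in Ioo 0 v, ENNReal.ofReal ‖s.fu (u, v)‖ ≤ ENNReal.ofReal s.Z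
  D_le : ∫⁻ v in Ioo 0 s.w, ENNReal.ofReal ‖s.atv (0, v)‖ ≤ ENNReal.ofReal s.D
  r_axis : ∀ u, 0 ≤ u → u < s.w → Tendsto (fun v => s.r (u, v)) (𝓝[>] u) (𝓝 0)
  mu_axis : ∀ u, 0 ≤ u → u < s.w → Tendsto (fun v => s.mu (u, v)) (𝓝[>] u) (𝓝 0)
  q_axis : ∀ u, 0 ≤ u → u < s.w → Tendsto (fun v => s.q (u, v)) (𝓝[>] u) (𝓝 0)
  A_axis : ∀ u, 0 ≤ u → u < s.w → Tendsto (fun v => s.A (u, v)) (𝓝[>] u) (𝓝 0)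
  nu_axis : ∀ u, 0 ≤ u → u < s.w → Tendsto (fun v => s.nu (u, v)) (𝓝[>] u) (𝓝 (-s.la u))
  la_ge : ∀ u, 0 ≤ u → u < s.w → 5 / 12 ≤ s.la u
  nuu_axis : ∀ u, 0 < u → u < s.w → Tendsto (fun v => s.nuu (u, v)) (𝓝[>] u) (𝓝 (-s.lΓ u))
  b_axis : ∀ u, 0 < u → u < s.w →
    Tendsto (fun v => s.bu (u, v) - s.f (u, v) * s.nuu (u, v)) (𝓝[>] u) (𝓝 (-s.gΓ u))
  lk_axis : ∀ u, 0 < u → u < s.w → Tendsto (fun v => s.lk (u, v)) (𝓝[>] u) (𝓝 0)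
  lk_axis' : ∀ v, 0 < v → v < s.w → Tendsto (fun u => s.lk (u, v)) (𝓝[<] v) (𝓝 0)
  lam_axis' : ∀ v, 0 < v → v < s.w → Tendsto (fun u => s.lam (u, v)) (𝓝[<] v) (𝓝 (s.la v))
  lamv_axis' : ∀ v, 0 < v → v < s.w → Tendsto (fun u => s.lamv (u, v)) (𝓝[<] v) (𝓝 (s.lΓ v))
  g_axis' : ∀ v, 0 < v → v < s.w →
    Tendsto (fun u => s.atv (u, v) - s.f (u, v) * s.lamv (u, v)) (𝓝[<] v) (𝓝 (s.gΓ v))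

attribute [fun_prop] IsSol.cr IsSol.clam IsSol.cnu IsSol.cmu IsSol.cq IsSol.cA IsSol.clamv
  IsSol.cnuu IsSol.cAu IsSol.cf IsSol.cfu IsSol.cfv IsSol.catv IsSol.cbu

variable {s : Reduced}

namespace IsSol

/-! ### Continuity of the derived quantities -/

theorem r_ne (h : s.IsSol) : ∀ p ∈ reg s.w, s.r p ≠ 0 := fun p hp => (h.r_pos p hp).ne'

theorem lam_pos (h : s.IsSol) {p : ℝ × ℝ} (hp : p ∈ reg s.w) : 0 < s.lam p := by
  linarith [h.lam_ge p hp]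

theorem lam_ne (h : s.IsSol) : ∀ p ∈ reg s.w, s.lam p ≠ 0 := fun _ hp => (h.lam_pos hp).ne'

theorem nu_ne (h : s.IsSol) : ∀ p ∈ reg s.w, s.nu p ≠ 0 := fun p hp => (h.nu_neg p hp).ne

theorem one_sub_mu_pos (h : s.IsSol) {p : ℝ × ℝ} (hp : p ∈ reg s.w) : 0 < 1 - s.mu p := by
  linarith [h.mu_le p hp]

theorem one_sub_mu_ne (h : s.IsSol) : ∀ p ∈ reg s.w, 1 - s.mu p ≠ 0 :=
  fun _ hp => (h.one_sub_mu_pos hp).ne'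

theorem r_ne' (h : s.IsSol) : ∀ p ∈ reg s.w, (s.r p : ℂ) ≠ 0 := fun p hp =>
  Complex.ofReal_ne_zero.2 (h.r_ne p hp)

theorem lam_ne' (h : s.IsSol) : ∀ p ∈ reg s.w, (s.lam p : ℂ) ≠ 0 := fun p hp =>
  Complex.ofReal_ne_zero.2 (h.lam_ne p hp)

theorem nu_ne' (h : s.IsSol) : ∀ p ∈ reg s.w, (s.nu p : ℂ) ≠ 0 := fun p hp =>
  Complex.ofReal_ne_zero.2 (h.nu_ne p hp)

@[fun_prop]
theorem cφ (h : s.IsSol) : ContinuousOn s.φ (reg s.w) := by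
  unfold φ; fun_prop (disch := assumption)

@[fun_prop]
theorem cW (h : s.IsSol) : ContinuousOn s.W (reg s.w) := by
  have := h.one_sub_mu_ne
  unfold W; fun_prop (disch := assumption)

@[fun_prop]
theorem cpm (h : s.IsSol) : ContinuousOn s.pm (reg s.w) := by
  have := h.one_sub_mu_ne
  unfold pm; fun_prop (disch := assumption)

@[fun_prop]
theorem clk (h : s.IsSol) : ContinuousOn s.lk (reg s.w) := by
  have := h.r_ne
  unfold lk; fun_prop (disch := assumption)

@[fun_prop]
theorem cDu (h : s.IsSol) : ContinuousOn s.Du (reg s.w) := by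
  unfold Du; fun_prop (disch := assumption)

@[fun_prop]
theorem cx (h : s.IsSol) : ContinuousOn s.x (reg s.w) := by
  have := h.lam_ne
  unfold x; fun_prop (disch := assumption)

@[fun_prop]
theorem cy (h : s.IsSol) : ContinuousOn s.y (reg s.w) := by
  have := h.nu_ne
  unfold y; fun_prop (disch := assumption)

@[fun_prop]
theorem cePsi (h : s.IsSol) : ContinuousOn s.ePsi (reg s.w) := by
  unfold ePsi; fun_prop (disch := assumption)

@[fun_prop]
theorem cat' (h : s.IsSol) : ContinuousOn s.at' (reg s.w) := by
  unfold at'; fun_prop (disch := assumption)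

@[fun_prop]
theorem cbt (h : s.IsSol) : ContinuousOn s.bt (reg s.w) := by
  unfold bt; fun_prop (disch := assumption)

@[fun_prop]
theorem cNv (h : s.IsSol) : ContinuousOn s.Nv (reg s.w) := by
  have := h.lam_ne
  unfold Nv; fun_prop (disch := assumption)

@[fun_prop]
theorem cLu (h : s.IsSol) : ContinuousOn s.Lu (reg s.w) := by
  have := h.nu_ne
  unfold Lu; fun_prop (disch := assumption)

@[fun_prop]
theorem cfuv (h : s.IsSol) : ContinuousOn s.fuv (reg s.w) := by
  have := h.r_ne'
  unfold fuv; fun_prop (disch := assumption)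

@[fun_prop]
theorem cbtu (h : s.IsSol) : ContinuousOn s.btu (reg s.w) := by
  unfold btu; fun_prop (disch := assumption)

@[fun_prop]
theorem cbtv (h : s.IsSol) : ContinuousOn s.btv (reg s.w) := by
  unfold btv; fun_prop (disch := assumption)

@[fun_prop]
theorem catu (h : s.IsSol) : ContinuousOn s.atu (reg s.w) := by
  unfold atu; fun_prop (disch := assumption)

@[fun_prop]
theorem cqv (h : s.IsSol) : ContinuousOn s.qv (reg s.w) := by
  have := h.r_ne
  unfold qv
  refine ContinuousOn.sub (ContinuousOn.neg (ContinuousOn.mul (by fun_prop (disch := assumption))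
    (Complex.continuous_im.comp_continuousOn ?_))) ?_ <;> fun_prop (disch := assumption)

@[fun_prop]
theorem cqu (h : s.IsSol) : ContinuousOn s.qu (reg s.w) := by
  have := h.r_ne
  unfold qu
  refine ContinuousOn.sub (ContinuousOn.mul (by fun_prop (disch := assumption))
    (Complex.continuous_im.comp_continuousOn ?_)) ?_ <;> fun_prop (disch := assumption)

@[fun_prop]
theorem cAv (h : s.IsSol) : ContinuousOn s.Av (reg s.w) := by
  have := h.r_ne
  unfold Av; fun_prop (disch := assumption)

/-! ### Evolution equations -/

theorem φ_u (h : s.IsSol) : HasU s.w s.φ s.fu := fun u v hu huv hv =>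
  (h.f_u u v hu huv hv).add_const _

theorem φ_v (h : s.IsSol) : HasV s.w s.φ s.fv := fun u v hu huv hv =>
  (h.f_v u v hu huv hv).add_const _

/-- The wave equation for φ is regular when written for ∂_u∂_v(rφ̃): the factor 1/r in `fuv`
cancels. -/
theorem at_u (h : s.IsSol) : HasU s.w s.at' s.atu := by
  intro u v hu huv hv
  have hr : (s.r (u, v) : ℂ) ≠ 0 := h.r_ne' _ ⟨hu.le, huv, hv⟩
  refine (((h.r_u u v hu huv hv).ofReal_comp.mul (h.fv_u u v hu huv hv)).add
    ((h.lam_u u v hu huv hv).ofReal_comp.mul (h.f_u u v hu huv hv))).congr_deriv ?_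
  simp only [atu, fuv]
  field_simp
  ring

theorem bt_u (h : s.IsSol) : HasU s.w s.bt s.btu := by
  intro u v hu huv hv
  have h1 := ((h.A_u u v hu huv hv).mul (h.r_u u v hu huv hv)).ofReal_comp.mul
    (h.φ_u u v hu huv hv)
  have h2 := (h.b_u u v hu huv hv).add (h1.const_mul (I * s.e))
  refine (h2.congr_deriv ?_).congr_of_eventuallyEq (Eventually.of_forall fun x => ?_)
  · simp only [btu, Pi.mul_apply]; push_cast; ring
  · simp only [bt, Du, Pi.add_apply, Pi.mul_apply]; push_cast; ring

/-- Adding i e A r φ to b̃ removes the terms containing A from its v-equation: ∂_v(A r φ) cancels A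
∂_v(rφ), and r ∂_vA = -2Wq reverses the sign of the term in Wqφ. Only e W q φ survives. -/
theorem bt_v (h : s.IsSol) : HasV s.w s.bt s.btv := by
  intro u v hu huv hv
  have hr : (s.r (u, v) : ℂ) ≠ 0 := h.r_ne' _ ⟨hu, huv, hv⟩
  have hrR : s.r (u, v) ≠ 0 := h.r_ne _ ⟨hu, huv, hv⟩
  have h1 := ((h.A_v u v hu huv hv).mul (h.r_v u v hu huv hv)).ofReal_comp.mul
    (h.φ_v u v hu huv hv)
  have h0 := ((h.r_v u v hu huv hv).ofReal_comp.mul (h.fu_v u v hu huv hv)).add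
    ((h.nu_v u v hu huv hv).ofReal_comp.mul (h.f_v u v hu huv hv))
  have h2 := h0.add (h1.const_mul (I * s.e))
  refine (h2.congr_deriv ?_).congr_of_eventuallyEq (Eventually.of_forall fun x => ?_)
  · simp only [btv, fuv, ePsi, Av, Pi.mul_apply]; push_cast; field_simp; ring
  · simp only [bt, Du, Pi.add_apply, Pi.mul_apply]; push_cast; ring

end IsSol
end Reduced

end ChargedScalar
end

open Set Filter Topology MeasureTheory
open scoped ENNReal NNReal

noncomputable section

namespace ChargedScalar

namespace Reduced

open Complex (I)

variable {s : Reduced}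

/-- The size of the data. -/
def dl (s : Reduced) : ℝ := s.Z + s.D

namespace IsSol

/-! ### Pointwise bounds -/

theorem Lu_nonpos (h : s.IsSol) {p : ℝ × ℝ} (hp : p ∈ reg s.w) : s.Lu p ≤ 0 := by
  have := h.r_pos p hp
  exact div_nonpos_of_nonneg_of_nonpos (by positivity) (h.nu_neg p hp).le

theorem Nv_nonneg (h : s.IsSol) {p : ℝ × ℝ} (hp : p ∈ reg s.w) : 0 ≤ s.Nv p := by
  have := h.r_pos p hp
  have := h.lam_pos hp
  unfold Nv; positivity

/-- rμ is twice the Hawking mass. It vanishes on the axis, and ∂_v(rμ) = r(1-μ)`Nv` + λq² ≥ 0. -/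
theorem mu_nonneg (h : s.IsSol) {p : ℝ × ℝ} (hp : p ∈ reg s.w) : 0 ≤ s.mu p := by
  obtain ⟨u, v⟩ := p
  obtain ⟨hu, huv, hv⟩ : 0 ≤ u ∧ u < v ∧ v < s.w := hp
  have hV : HasV s.w (fun p => s.r p * s.mu p)
      (fun p => s.r p * ((1 - s.mu p) * s.Nv p) + s.lam p * s.q p ^ 2) := by
    intro u v hu huv hv
    have hr := h.r_ne _ (⟨hu, huv, hv⟩ : (u, v) ∈ reg s.w)
    have hm := h.one_sub_mu_ne _ (⟨hu, huv, hv⟩ : (u, v) ∈ reg s.w)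
    refine ((h.r_v u v hu huv hv).mul (h.mu_v u v hu huv hv)).congr_deriv ?_
    simp only [muv, pm]
    field_simp
    ring
  have hL : Tendsto (fun y => s.r (u, y) * s.mu (u, y)) (𝓝[>] u) (𝓝 0) := by
    simpa using (h.r_axis u hu (huv.trans hv)).mul (h.mu_axis u hu (huv.trans hv))
  have := hV.axis_le (by fun_prop (disch := assumption)) hu huv hv hL fun y hy1 hy2 => by
    have hy : (u, y) ∈ reg s.w := ⟨hu, hy1, hy2.trans hv⟩
    have := h.r_pos _ hy
    have := h.one_sub_mu_pos hy
    have := h.Nv_nonneg hy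
    have := h.lam_pos hy
    positivity
  exact nonneg_of_mul_nonneg_right this (h.r_pos _ ⟨hu, huv, hv⟩)

/-- λ/(1-μ) is nonincreasing in u, its logarithmic derivative being `Lu` ≤ 0. On u = 0 it is at most
(1/2)/(1-1/3) = 3/4. -/
theorem lam_le (h : s.IsSol) {p : ℝ × ℝ} (hp : p ∈ reg s.w) :
    s.lam p ≤ 3 / 4 * (1 - s.mu p) := by
  obtain ⟨u, v⟩ := p
  obtain ⟨hu, huv, hv⟩ : 0 ≤ u ∧ u < v ∧ v < s.w := hp
  have hs : Icc 0 u ⊆ Ico 0 v := fun x hx => ⟨hx.1, hx.2.trans_lt huv⟩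
  have hne := h.one_sub_mu_ne
  have c : ContinuousOn (fun p => -(s.lam p / (1 - s.mu p))) (reg s.w) := by
    fun_prop (disch := assumption)
  have key := le_of_hasDerivAt_nonneg hu ((slice_u_continuousOn c hv).mono hs)
    (F' := fun x => -(s.lam (x, v) * s.Lu (x, v) / (1 - s.mu (x, v))))
    (fun x hx => by
      have hm := hne _ (⟨hx.1.le, hx.2.trans huv, hv⟩ : (x, v) ∈ reg s.w)
      have hr := h.r_ne _ (⟨hx.1.le, hx.2.trans huv, hv⟩ : (x, v) ∈ reg s.w)
      refine ((h.lam_u x v hx.1 (hx.2.trans huv) hv).div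
        ((h.mu_u x v hx.1 (hx.2.trans huv) hv).const_sub 1) hm).neg.congr_deriv ?_
      simp only [muu, lk]
      field_simp
      ring)
    (fun x hx => by
      have hx' : (x, v) ∈ reg s.w := ⟨hx.1.le, hx.2.trans huv, hv⟩
      have h1 := h.Lu_nonpos hx'
      have h2 := h.lam_pos hx'
      have h3 := h.one_sub_mu_pos hx'
      rw [neg_nonneg]
      exact div_nonpos_of_nonpos_of_nonneg (mul_nonpos_of_nonneg_of_nonpos h2.le h1) h3.le)
  have h0 : (0, v) ∈ reg s.w := ⟨le_rfl, hu.trans_lt huv, hv⟩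
  have h1 := h.one_sub_mu_pos h0
  have h2 := h.mu_le _ h0
  rw [h.lam_init v (hu.trans_lt huv) hv] at key
  have h3 : 1 / 2 / (1 - s.mu (0, v)) ≤ 3 / 4 := by
    rw [div_le_iff₀ h1]; linarith
  rw [← div_le_iff₀ (h.one_sub_mu_pos ⟨hu, huv, hv⟩)]
  linarith

theorem lam_le' (h : s.IsSol) {p : ℝ × ℝ} (hp : p ∈ reg s.w) : s.lam p ≤ 3 / 4 := by
  linarith [h.lam_le hp, h.mu_nonneg hp]

theorem r_le (h : s.IsSol) {p : ℝ × ℝ} (hp : p ∈ reg s.w) : s.r p ≤ 3 / 4 * (p.2 - p.1) := by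
  obtain ⟨u, v⟩ := p
  obtain ⟨hu, huv, hv⟩ : 0 ≤ u ∧ u < v ∧ v < s.w := hp
  have := h.r_v.norm_sub_axis_le h.cr hu huv hv (h.r_axis u hu (huv.trans hv)) (C := 3 / 4)
    fun y hy1 hy2 => by
      have hy : (u, y) ∈ reg s.w := ⟨hu, hy1, hy2.trans hv⟩
      rw [Real.norm_of_nonneg (h.lam_pos hy).le]
      exact h.lam_le' hy
  rw [sub_zero] at this
  exact (le_abs_self _).trans this

theorem r_le_w (h : s.IsSol) {p : ℝ × ℝ} (hp : p ∈ reg s.w) : s.r p ≤ 3 / 4 * s.w := by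
  linarith [h.r_le hp, hp.1, hp.2.2]

theorem r_mono (h : s.IsSol) {u y v : ℝ} (hu : 0 ≤ u) (huy : u < y) (hyv : y ≤ v) (hv : v < s.w) :
    s.r (u, y) ≤ s.r (u, v) := by
  have hs : Icc y v ⊆ Ioo u s.w := fun x hx => ⟨huy.trans_le hx.1, hx.2.trans_lt hv⟩
  exact le_of_hasDerivAt_nonneg hyv ((slice_v_continuousOn h.cr hu).mono hs)
    (fun x hx => h.r_v u x hu (huy.trans hx.1) (hx.2.trans hv))
    (fun x hx => (h.lam_pos ⟨hu, huy.trans hx.1, hx.2.trans hv⟩).le)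

theorem r_axis' (h : s.IsSol) {v : ℝ} (hv0 : 0 < v) (hv : v < s.w) :
    Tendsto (fun x => s.r (x, v)) (𝓝[<] v) (𝓝 0) := by
  have hl : Tendsto (fun x => 3 / 4 * (v - x)) (𝓝[<] v) (𝓝 0) := by
    have : Tendsto (fun x => 3 / 4 * (v - x)) (𝓝 v) (𝓝 (3 / 4 * (v - v))) :=
      Continuous.tendsto (by fun_prop) v
    simpa using this.mono_left nhdsWithin_le_nhds
  refine squeeze_zero' ?_ ?_ hl
  · filter_upwards [Ioo_mem_nhdsLT hv0] with x hx using (h.r_pos _ ⟨hx.1.le, hx.2, hv⟩).le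
  · filter_upwards [Ioo_mem_nhdsLT hv0] with x hx using h.r_le ⟨hx.1.le, hx.2, hv⟩

/-- |ν|/(1-μ) is nondecreasing in v and equals `la` ≥ 5/12 on the axis; with 1-μ ≥ 2/3 this gives
5/18. -/
theorem nu_le (h : s.IsSol) {p : ℝ × ℝ} (hp : p ∈ reg s.w) : s.nu p ≤ -(5 / 18) := by
  obtain ⟨u, v⟩ := p
  obtain ⟨hu, huv, hv⟩ : 0 ≤ u ∧ u < v ∧ v < s.w := hp
  have hne := h.one_sub_mu_ne
  have hV : HasV s.w (fun p => -s.nu p / (1 - s.mu p))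
      (fun p => -s.nu p * s.Nv p / (1 - s.mu p)) := by
    intro u v hu huv hv
    have hr := h.r_ne _ (⟨hu, huv, hv⟩ : (u, v) ∈ reg s.w)
    have hm := hne _ (⟨hu, huv, hv⟩ : (u, v) ∈ reg s.w)
    refine ((h.nu_v u v hu huv hv).neg.div ((h.mu_v u v hu huv hv).const_sub 1) hm).congr_deriv ?_
    simp only [muv, lk, Pi.neg_apply]
    field_simp
    ring
  have hL : Tendsto (fun y => -s.nu (u, y) / (1 - s.mu (u, y))) (𝓝[>] u) (𝓝 (s.la u)) := by
    have := (h.nu_axis u hu (huv.trans hv)).neg.div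
      ((h.mu_axis u hu (huv.trans hv)).const_sub 1) (by norm_num)
    rw [neg_neg, sub_zero, div_one] at this
    exact this
  have key := hV.axis_le (by fun_prop (disch := assumption)) hu huv hv hL fun y hy1 hy2 => by
    have hy : (u, y) ∈ reg s.w := ⟨hu, hy1, hy2.trans hv⟩
    have h1 := h.one_sub_mu_pos hy
    have h2 := h.Nv_nonneg hy
    have h3 := neg_pos.2 (h.nu_neg _ hy)
    positivity
  have h1 := (h.la_ge u hu (huv.trans hv)).trans key
  have h2 := h.one_sub_mu_pos (⟨hu, huv, hv⟩ : (u, v) ∈ reg s.w)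
  rw [le_div_iff₀ h2] at h1
  linarith [h.mu_le _ (⟨hu, huv, hv⟩ : (u, v) ∈ reg s.w)]

/-- Integrate from the origin along u = 0 and then along an incoming line; each leg costs at most Z.
-/
theorem norm_f_le (h : s.IsSol) {p : ℝ × ℝ} (hp : p ∈ reg s.w) : ‖s.f p‖ ≤ 2 * s.Z := by
  obtain ⟨u, v⟩ := p
  obtain ⟨hu, huv, hv⟩ : 0 ≤ u ∧ u < v ∧ v < s.w := hp
  have hv0 := hu.trans_lt huv
  have h1 := h.f_v.enorm_sub_axis_le h.cf h.cfv le_rfl hv0 hv h.f_origin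
  have h1' : ‖s.f (0, v)‖ ≤ s.Z := by
    rw [sub_zero] at h1
    have h2 := h1.trans ((lintegral_mono_set (Ioo_subset_Ioo_right hv.le)).trans
      (by simpa only [ofReal_norm] using h.X_le 0 le_rfl h.w_pos))
    rw [← ofReal_norm] at h2
    exact (ENNReal.ofReal_le_ofReal_iff h.Z_nonneg).1 h2
  have hs : Icc 0 u ⊆ Ico 0 v := fun x hx => ⟨hx.1, hx.2.trans_lt huv⟩
  have h3 := enorm_sub_le_setLIntegral_deriv hu ((slice_u_continuousOn h.cf hv).mono hs)
    (fun x hx => h.f_u x v hx.1 (hx.2.trans huv) hv)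
    ((slice_u_continuousOn h.cfu hv).mono (Ioo_subset_Icc_self.trans hs))
  have h3' : ‖s.f (u, v) - s.f (0, v)‖ ≤ s.Z := by
    have h4 := h3.trans ((lintegral_mono_set (Ioo_subset_Ioo_right huv.le)).trans
      (by simpa only [ofReal_norm] using h.Y_le v hv0 hv))
    rw [← ofReal_norm] at h4
    exact (ENNReal.ofReal_le_ofReal_iff h.Z_nonneg).1 h4
  linarith [norm_sub_norm_le (s.f (u, v)) (s.f (0, v))]

theorem Z_le (h : s.IsSol) : s.Z ≤ 1 / 100 := by linarith [h.ZD_le, h.D_nonneg]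

theorem Z_le_dl (h : s.IsSol) : s.Z ≤ s.dl := by unfold dl; linarith [h.D_nonneg]

theorem dl_nonneg (h : s.IsSol) : 0 ≤ s.dl := add_nonneg h.Z_nonneg h.D_nonneg

theorem dl_le (h : s.IsSol) : s.dl ≤ 1 / 100 := h.ZD_le

theorem norm_φ_le (h : s.IsSol) {p : ℝ × ℝ} (hp : p ∈ reg s.w) : ‖s.φ p‖ ≤ s.M := by
  have := norm_add_le (s.f p) s.φ0
  have := h.norm_f_le hp
  have := h.φ0_le
  have := h.Z_le
  unfold φ
  linarith

theorem M_pos (h : s.IsSol) : 0 < s.M := by linarith [h.M_ge]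

theorem eM_nonneg (h : s.IsSol) : 0 ≤ s.e * s.M := mul_nonneg h.e_nonneg h.M_pos.le

theorem eM_le (h : s.IsSol) : s.e * s.M ≤ 3 / 128 / s.w := by
  rw [le_div_iff₀ h.w_pos]; exact h.small

/-- Here rq is the charge Q. The Maxwell equation is integrated from the axis; since r increases in
v, the weight r² under the integral is at most its end value, and one power of r is cancelled
against rq. The constant uses 4π · 3/128 ≤ 3/10. -/
theorem abs_q_le (h : s.IsSol) {p : ℝ × ℝ} (hp : p ∈ reg s.w) :
    |s.q p| ≤ 3 / 10 * (s.Z / s.w) * s.r p := by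
  obtain ⟨u, v⟩ := p
  obtain ⟨hu, huv, hv⟩ : 0 ≤ u ∧ u < v ∧ v < s.w := hp
  have hp : (u, v) ∈ reg s.w := ⟨hu, huv, hv⟩
  have hr := h.r_pos _ hp
  have hM := h.M_pos
  have he := h.e_nonneg
  have hV : HasV s.w (fun p => s.r p * s.q p)
      (fun p => -(4 * Real.pi * s.e * s.r p ^ 2 * ((starRingEnd ℂ) (s.φ p) * s.fv p).im)) := by
    intro u v hu huv hv
    have hr := h.r_ne _ (⟨hu, huv, hv⟩ : (u, v) ∈ reg s.w)
    refine ((h.r_v u v hu huv hv).mul (h.q_v u v hu huv hv)).congr_deriv ?_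
    simp only [qv]
    field_simp
    ring
  have hL : Tendsto (fun y => s.r (u, y) * s.q (u, y)) (𝓝[>] u) (𝓝 0) := by
    simpa using (h.r_axis u hu (huv.trans hv)).mul (h.q_axis u hu (huv.trans hv))
  have hc : ContinuousOn (fun p => -(4 * Real.pi * s.e * s.r p ^ 2 *
      ((starRingEnd ℂ) (s.φ p) * s.fv p).im)) (reg s.w) :=
    (ContinuousOn.mul (by fun_prop (disch := assumption))
      (Complex.continuous_im.comp_continuousOn (by fun_prop (disch := assumption)))).neg
  have h1 := hV.enorm_sub_axis_le (by fun_prop (disch := assumption)) hc hu huv hv hL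
  have h2 : ∫⁻ y in Ioo u v, ‖(-(4 * Real.pi * s.e * s.r (u, y) ^ 2 *
      ((starRingEnd ℂ) (s.φ (u, y)) * s.fv (u, y)).im))‖ₑ ≤
      ENNReal.ofReal (4 * Real.pi * (s.e * s.M) * s.r (u, v) ^ 2 * s.Z) := by
    rw [ENNReal.ofReal_mul (by positivity)]
    refine le_trans ?_ (mul_le_mul_right (h.X_le u hu (huv.trans hv)) _)
    rw [← lintegral_const_mul' _ _ ENNReal.ofReal_ne_top]
    refine le_trans ?_ (lintegral_mono_set (Ioo_subset_Ioo_right hv.le))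
    refine setLIntegral_mono' measurableSet_Ioo fun y hy => ?_
    have hy' : (u, y) ∈ reg s.w := ⟨hu, hy.1, hy.2.trans hv⟩
    rw [← ENNReal.ofReal_mul (by positivity), ← ofReal_norm]
    refine ENNReal.ofReal_le_ofReal ?_
    rw [norm_neg, norm_mul, Real.norm_of_nonneg (by positivity)]
    have h3 : ‖((starRingEnd ℂ) (s.φ (u, y)) * s.fv (u, y)).im‖ ≤ s.M * ‖s.fv (u, y)‖ := by
      refine (Complex.abs_im_le_norm _).trans ?_
      rw [norm_mul, RCLike.norm_conj]
      gcongr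
      exact h.norm_φ_le hy'
    have h4 : s.r (u, y) ^ 2 ≤ s.r (u, v) ^ 2 := by
      have := h.r_pos _ hy'
      have := h.r_mono hu hy.1 hy.2.le hv
      gcongr
    calc 4 * Real.pi * s.e * s.r (u, y) ^ 2 * ‖((starRingEnd ℂ) (s.φ (u, y)) * s.fv (u, y)).im‖
        ≤ 4 * Real.pi * s.e * s.r (u, v) ^ 2 * (s.M * ‖s.fv (u, y)‖) := by gcongr
      _ = _ := by ring
  have h3 := h1.trans h2
  rw [sub_zero, ← ofReal_norm, ENNReal.ofReal_le_ofReal_iff (by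
    have := h.Z_nonneg; positivity), norm_mul, Real.norm_of_nonneg hr.le, Real.norm_eq_abs] at h3
  have h4 : |s.q (u, v)| ≤ 4 * Real.pi * (s.e * s.M) * s.r (u, v) * s.Z := by
    refine le_of_mul_le_mul_left ?_ hr
    calc _ ≤ _ := h3
      _ = _ := by ring
  have h5 : 4 * Real.pi * (s.e * s.M) ≤ 3 / 10 / s.w := by
    have := h.eM_le
    have := Real.pi_lt_d2
    have hw := h.w_pos
    calc 4 * Real.pi * (s.e * s.M) ≤ 4 * 3.15 * (3 / 128 / s.w) := by
          have := h.eM_nonneg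
          gcongr
      _ ≤ _ := by
          rw [← mul_div_assoc]
          gcongr
          norm_num
  calc |s.q (u, v)| ≤ 4 * Real.pi * (s.e * s.M) * s.r (u, v) * s.Z := h4
    _ ≤ 3 / 10 / s.w * s.r (u, v) * s.Z := by
      have := h.Z_nonneg
      gcongr
    _ = _ := by ring

theorem Zw_nonneg (h : s.IsSol) : 0 ≤ s.Z / s.w := div_nonneg h.Z_nonneg h.w_pos.le

theorem Zw2_nonneg (h : s.IsSol) : 0 ≤ s.Z / s.w ^ 2 := div_nonneg h.Z_nonneg (sq_nonneg _)

theorem abs_q_le' (h : s.IsSol) {p : ℝ × ℝ} (hp : p ∈ reg s.w) : |s.q p| ≤ s.Z / 4 := by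
  have h1 := h.abs_q_le hp
  have h2 : 3 / 10 * (s.Z / s.w) * s.r p ≤ 3 / 10 * (s.Z / s.w) * (3 / 4 * s.w) := by
    have := h.Zw_nonneg
    gcongr
    exact h.r_le_w hp
  have h3 : 3 / 10 * (s.Z / s.w) * (3 / 4 * s.w) = 9 / 40 * s.Z := by
    have := h.w_pos.ne'
    field_simp
    ring
  linarith [h.Z_nonneg]

theorem q_sq_div_le (h : s.IsSol) {p : ℝ × ℝ} (hp : p ∈ reg s.w) :
    s.q p ^ 2 / s.r p ≤ s.Z * (s.Z / s.w) / 10 := by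
  have hr := h.r_pos p hp
  have h0 := h.Zw_nonneg
  rw [div_le_iff₀ hr, ← sq_abs]
  calc |s.q p| ^ 2 = |s.q p| * |s.q p| := sq _
    _ ≤ (s.Z / 4) * (3 / 10 * (s.Z / s.w) * s.r p) :=
      mul_le_mul (h.abs_q_le' hp) (h.abs_q_le hp) (abs_nonneg _)
        (div_nonneg h.Z_nonneg (by norm_num))
    _ ≤ _ := by
      have : 0 ≤ s.Z * (s.Z / s.w) * s.r p := by have := h.Z_nonneg; positivity
      linarith

theorem eMq_le (h : s.IsSol) {p : ℝ × ℝ} (hp : p ∈ reg s.w) :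
    s.e * s.M * |s.q p| ≤ s.Z / s.w / 100 := by
  have h0 := h.Zw_nonneg
  have hw := h.w_pos
  calc s.e * s.M * |s.q p| ≤ 3 / 128 / s.w * (s.Z / 4) := by
        have := h.eM_nonneg
        have := h.Z_nonneg
        gcongr
        · exact h.eM_le
        · exact h.abs_q_le' hp
    _ = 3 / 512 * (s.Z / s.w) := by ring
    _ ≤ _ := by linarith

theorem eMqr_le (h : s.IsSol) {p : ℝ × ℝ} (hp : p ∈ reg s.w) :
    s.e * s.M * (|s.q p| / s.r p) ≤ s.Z / s.w ^ 2 / 100 := by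
  have h0 := h.Zw2_nonneg
  have hw := h.w_pos
  have hr := h.r_pos p hp
  calc s.e * s.M * (|s.q p| / s.r p) ≤ 3 / 128 / s.w * (3 / 10 * (s.Z / s.w)) := by
        have := h.eM_nonneg
        have := h.Zw_nonneg
        gcongr
        · exact h.eM_le
        · rw [div_le_iff₀ hr]; exact h.abs_q_le hp
    _ = 9 / 1280 * (s.Z / s.w ^ 2) := by field_simp; ring
    _ ≤ _ := by linarith

theorem W_pos (h : s.IsSol) {p : ℝ × ℝ} (hp : p ∈ reg s.w) : 0 < s.W p := by
  have := h.lam_pos hp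
  have := neg_pos.2 (h.nu_neg p hp)
  have := h.one_sub_mu_pos hp
  unfold W
  rw [← mul_neg]
  positivity

theorem W_le (h : s.IsSol) {p : ℝ × ℝ} (hp : p ∈ reg s.w) : s.W p ≤ 1 / 2 := by
  unfold W
  rw [div_le_iff₀ (h.one_sub_mu_pos hp)]
  nlinarith [h.lam_le hp, h.lam_pos hp, h.nu_ge p hp, h.nu_neg p hp, h.one_sub_mu_pos hp]

theorem W_ge (h : s.IsSol) {p : ℝ × ℝ} (hp : p ∈ reg s.w) : 1 / 9 ≤ s.W p := by
  unfold W
  rw [le_div_iff₀ (h.one_sub_mu_pos hp)]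
  nlinarith [h.lam_ge p hp, h.nu_le hp, h.mu_nonneg hp]

theorem abs_Av_le (h : s.IsSol) {p : ℝ × ℝ} (hp : p ∈ reg s.w) : |s.Av p| ≤ |s.q p| / s.r p := by
  have hr := h.r_pos p hp
  have := h.W_pos hp
  have := h.W_le hp
  unfold Av
  rw [abs_div, abs_of_pos hr, abs_mul, abs_mul, abs_of_pos (h.W_pos hp)]
  norm_num
  gcongr
  nlinarith [abs_nonneg (s.q p)]

theorem eMAv_le (h : s.IsSol) {p : ℝ × ℝ} (hp : p ∈ reg s.w) :
    s.e * s.M * |s.Av p| ≤ s.Z / s.w ^ 2 / 100 :=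
  (mul_le_mul_of_nonneg_left (h.abs_Av_le hp) h.eM_nonneg).trans (h.eMqr_le hp)

theorem abs_A_le (h : s.IsSol) {p : ℝ × ℝ} (hp : p ∈ reg s.w) :
    |s.A p| ≤ 3 / 10 * (s.Z / s.w) * (p.2 - p.1) := by
  obtain ⟨u, v⟩ := p
  obtain ⟨hu, huv, hv⟩ : 0 ≤ u ∧ u < v ∧ v < s.w := hp
  have := h.A_v.norm_sub_axis_le h.cA hu huv hv (h.A_axis u hu (huv.trans hv))
    (C := 3 / 10 * (s.Z / s.w)) fun y hy1 hy2 => by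
      have hy : (u, y) ∈ reg s.w := ⟨hu, hy1, hy2.trans hv⟩
      refine (h.abs_Av_le hy).trans ?_
      rw [div_le_iff₀ (h.r_pos _ hy)]
      exact h.abs_q_le hy
  rwa [sub_zero] at this

theorem eMA_le (h : s.IsSol) {p : ℝ × ℝ} (hp : p ∈ reg s.w) :
    s.e * s.M * |s.A p| ≤ s.Z / s.w / 100 := by
  have h0 := h.Zw_nonneg
  have hw := h.w_pos
  have h1 : p.2 - p.1 ≤ s.w := by linarith [hp.1, hp.2.2]
  calc s.e * s.M * |s.A p| ≤ 3 / 128 / s.w * (3 / 10 * (s.Z / s.w) * s.w) := by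
        have := h.eM_nonneg
        gcongr
        · exact h.eM_le
        · exact (h.abs_A_le hp).trans (by gcongr)
    _ = 9 / 1280 * (s.Z / s.w) := by field_simp; ring
    _ ≤ _ := by linarith

/-- Exhibits the sign: W > 0 and μ ≥ 0, so only q² can make `lk` positive. -/
theorem lk_eq (h : s.IsSol) {p : ℝ × ℝ} (hp : p ∈ reg s.w) :
    s.lk p = s.W p * ((s.q p ^ 2 - s.mu p) / s.r p) := by
  have := h.one_sub_mu_ne p hp
  have := h.r_ne p hp
  unfold lk W pm
  field_simp
  ring

theorem lk_le (h : s.IsSol) {p : ℝ × ℝ} (hp : p ∈ reg s.w) :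
    s.lk p ≤ s.Z * (s.Z / s.w) / 20 := by
  rw [h.lk_eq hp]
  have hr := h.r_pos p hp
  have h1 := h.q_sq_div_le hp
  have h2 : (s.q p ^ 2 - s.mu p) / s.r p ≤ s.q p ^ 2 / s.r p := by
    gcongr
    linarith [h.mu_nonneg hp]
  have h3 := h.W_pos hp
  have h4 := h.W_le hp
  have h5 : 0 ≤ s.q p ^ 2 / s.r p := by positivity
  calc _ ≤ s.W p * (s.q p ^ 2 / s.r p) := by gcongr
    _ ≤ 1 / 2 * (s.q p ^ 2 / s.r p) := by gcongr
    _ ≤ _ := by linarith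

/-- Up to a small charge term |lk| is -lk, which is the u-derivative of -λ and the v-derivative of
-ν. Its integrals are therefore controlled by the pointwise bounds on λ and ν, with no smallness
assumption on `lk`. -/
theorem abs_lk_le (h : s.IsSol) {p : ℝ × ℝ} (hp : p ∈ reg s.w) :
    |s.lk p| ≤ -s.lk p + s.Z * (s.Z / s.w) / 10 := by
  have h1 := h.lk_le hp
  have : 0 ≤ s.Z * (s.Z / s.w) := mul_nonneg h.Z_nonneg h.Zw_nonneg
  rw [abs_le]
  constructor <;> linarith

theorem e_abs_A_le (h : s.IsSol) {p : ℝ × ℝ} (hp : p ∈ reg s.w) :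
    s.e * |s.A p| ≤ s.Z / s.w / 200 := by
  have h1 := h.eMA_le hp
  have h2 : s.e * 2 * |s.A p| ≤ s.e * s.M * |s.A p| := by
    have := h.e_nonneg
    have := h.M_ge
    gcongr
  linarith

theorem norm_eA_φ_le (h : s.IsSol) {p : ℝ × ℝ} (hp : p ∈ reg s.w) :
    ‖((s.e * s.A p : ℝ) : ℂ) * s.φ p‖ ≤ s.Z / s.w / 100 := by
  rw [norm_mul, Complex.norm_real, Real.norm_eq_abs, abs_mul, abs_of_nonneg h.e_nonneg]
  refine le_trans ?_ (h.eMA_le hp)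
  calc s.e * |s.A p| * ‖s.φ p‖ ≤ s.e * |s.A p| * s.M := by
        have := h.e_nonneg
        gcongr
        exact h.norm_φ_le hp
    _ = _ := by ring

theorem norm_eWq_φ_le (h : s.IsSol) {p : ℝ × ℝ} (hp : p ∈ reg s.w) :
    ‖((s.e * s.W p * s.q p : ℝ) : ℂ) * s.φ p‖ ≤ s.Z / s.w / 200 := by
  rw [norm_mul, Complex.norm_real, Real.norm_eq_abs, abs_mul, abs_mul, abs_of_nonneg h.e_nonneg,
    abs_of_pos (h.W_pos hp)]
  have h1 := h.eMq_le hp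
  have he := h.e_nonneg
  have hM := h.M_pos
  calc s.e * s.W p * |s.q p| * ‖s.φ p‖ ≤ s.e * (1 / 2) * |s.q p| * s.M := by
        have := h.W_le hp
        gcongr
        exact h.norm_φ_le hp
    _ = 1 / 2 * (s.e * s.M * |s.q p|) := by ring
    _ ≤ _ := by linarith

/-- Splitting ∂_v(rφ) into ã and λφ₀ leaves the still unknown ã with a coefficient O(Z/w), small
enough for later absorption. -/
theorem norm_ePsi_le_at (h : s.IsSol) {p : ℝ × ℝ} (hp : p ∈ reg s.w) :
    ‖s.ePsi p‖ ≤ s.Z / s.w / 200 * ‖s.at' p‖ + s.Z / s.w / 80 := by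
  have e1 : s.ePsi p = ((s.e * s.A p : ℝ) : ℂ) * s.at' p
      + (s.lam p : ℂ) * (((s.e * s.A p : ℝ) : ℂ) * s.φ0)
      - ((s.e * s.W p * s.q p : ℝ) : ℂ) * s.φ p := by
    simp only [ePsi, at', φ]; ring
  have h1 : ‖((s.e * s.A p : ℝ) : ℂ) * s.at' p‖ ≤ s.Z / s.w / 200 * ‖s.at' p‖ := by
    rw [norm_mul, Complex.norm_real, Real.norm_eq_abs, abs_mul, abs_of_nonneg h.e_nonneg]
    gcongr
    exact h.e_abs_A_le hp
  have h2 : ‖(s.lam p : ℂ) * (((s.e * s.A p : ℝ) : ℂ) * s.φ0)‖ ≤ 3 / 4 * (s.Z / s.w / 100) := by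
    rw [norm_mul, Complex.norm_real, Real.norm_of_nonneg (h.lam_pos hp).le]
    gcongr
    · exact h.lam_le' hp
    · rw [norm_mul, Complex.norm_real, Real.norm_eq_abs, abs_mul, abs_of_nonneg h.e_nonneg]
      refine le_trans ?_ (h.eMA_le hp)
      have he := h.e_nonneg
      calc s.e * |s.A p| * ‖s.φ0‖ ≤ s.e * |s.A p| * s.M := by
            gcongr
            linarith [h.φ0_le]
        _ = _ := by ring
  have h3 := h.norm_eWq_φ_le hp
  rw [e1]
  refine (norm_sub_le _ _).trans ?_
  have := norm_add_le (((s.e * s.A p : ℝ) : ℂ) * s.at' p)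
    ((s.lam p : ℂ) * (((s.e * s.A p : ℝ) : ℂ) * s.φ0))
  linarith

theorem norm_lk_f_le (h : s.IsSol) {p : ℝ × ℝ} (hp : p ∈ reg s.w) :
    ‖(s.lk p : ℂ) * s.f p‖ ≤ 2 * s.Z * (-s.lk p + s.Z * (s.Z / s.w) / 10) := by
  rw [norm_mul, Complex.norm_real, Real.norm_eq_abs, mul_comm]
  have := h.Z_nonneg
  gcongr
  · exact h.norm_f_le hp
  · exact h.abs_lk_le hp

/-- Integration of ∂_uã from u = 0, where |ã| ≤ D because ã vanishes at the origin. The part lk·φ̃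
is paid for by the variation of λ; the charge part contains ã itself and is absorbed. -/
theorem norm_at_le (h : s.IsSol) {p : ℝ × ℝ} (hp : p ∈ reg s.w) : ‖s.at' p‖ ≤ 2 * s.dl := by
  obtain ⟨u, v⟩ := p
  obtain ⟨hu, huv, hv⟩ : 0 ≤ u ∧ u < v ∧ v < s.w := hp
  have hv0 := hu.trans_lt huv
  have hs : Icc 0 u ⊆ Ico 0 v := fun x hx => ⟨hx.1, hx.2.trans_lt huv⟩
  have hcs := (slice_u_continuousOn h.cat' hv).mono hs
  -- The maximum of |ã| on the segment bounds |ã| in the charge term by one number `S`, to be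
  -- absorbed at the end.
  obtain ⟨x0, hx0, hmax⟩ := isCompact_Icc.exists_isMaxOn (nonempty_Icc.2 hu) hcs.norm
  set S := ‖s.at' (x0, v)‖ with hS
  have hinit : ‖s.at' (0, v)‖ ≤ s.D := by
    have h1 := h.at_v.enorm_sub_axis_le h.cat' h.catv le_rfl hv0 hv h.at_origin
    rw [sub_zero] at h1
    have h2 := h1.trans ((lintegral_mono_set (Ioo_subset_Ioo_right hv.le)).trans
      (by simpa only [ofReal_norm] using h.D_le))
    rw [← ofReal_norm] at h2
    exact (ENNReal.ofReal_le_ofReal_iff h.D_nonneg).1 h2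
  have hw := h.w_pos
  have hZ := h.Z_nonneg
  set m := s.Z * (s.Z / s.w) / 10 with hm
  set c := s.Z / s.w / 200 * S + s.Z / s.w / 80 with hc
  have hs0 : Icc 0 x0 ⊆ Icc 0 u := Icc_subset_Icc_right hx0.2
  have key := norm_sub_le_sub_of_norm_deriv_le hx0.1 (F := fun x => s.at' (x, v))
    (F' := fun x => s.atu (x, v))
    (B := fun x => 2 * s.Z * (-s.lam (x, v) + m * x) + c * x)
    (B' := fun x => 2 * s.Z * (-s.lk (x, v) + m) + c) (hcs.mono hs0)
    (fun x hx => h.at_u x v hx.1 ((hx.2.trans_le hx0.2).trans huv) hv)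
    (by
      have := ((slice_u_continuousOn h.clam hv).mono hs).mono hs0
      fun_prop)
    (fun x hx => by
      have h1 := ((h.lam_u x v hx.1 ((hx.2.trans_le hx0.2).trans huv) hv).neg.add
        ((hasDerivAt_id x).const_mul m)).const_mul (2 * s.Z)
      have h2 := h1.add ((hasDerivAt_id x).const_mul c)
      refine h2.congr_deriv ?_
      ring)
    (fun x hx => by
      have hx' : (x, v) ∈ reg s.w := ⟨hx.1.le, (hx.2.trans_le hx0.2).trans huv, hv⟩
      have hle : ‖s.at' (x, v)‖ ≤ S := hmax ⟨hx.1.le, hx.2.le.trans hx0.2⟩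
      have h1 := h.norm_ePsi_le_at hx'
      have h2 := h.norm_lk_f_le hx'
      have h3 : ‖I * s.ePsi (x, v)‖ = ‖s.ePsi (x, v)‖ := by simp
      have h4 : s.Z / s.w / 200 * ‖s.at' (x, v)‖ ≤ s.Z / s.w / 200 * S := by
        have := h.Zw_nonneg
        gcongr
      refine (norm_sub_le _ _).trans ?_
      rw [h3]
      rw [← hm] at h2
      linarith)
  rw [h.lam_init v hv0 hv] at key
  have hl := h.lam_ge (x0, v) ⟨hx0.1, hx0.2.trans_lt huv, hv⟩
  have hxw : x0 ≤ s.w := (hx0.2.trans huv.le).trans hv.le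
  have hSnn : 0 ≤ S := norm_nonneg _
  have hmx : m * x0 ≤ s.Z * s.Z / 10 := by
    calc m * x0 ≤ m * s.w := by gcongr
      _ = _ := by rw [hm]; field_simp
  have hcx : c * x0 ≤ s.Z * S / 200 + s.Z / 80 := by
    calc c * x0 ≤ c * s.w := by gcongr
      _ = _ := by rw [hc]; field_simp
  have hZ1 := h.Z_le
  -- λ starts at 1/2 and stays above 5/12; the difference is the 1/12.
  have h5 : S ≤ s.D + (2 * s.Z * (1 / 12 + 1 / 1000) + S / 200 + s.Z / 80) := by
    have h6 := norm_sub_norm_le (s.at' (x0, v)) (s.at' (0, v))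
    have h7 : 2 * s.Z * (-s.lam (x0, v) + m * x0 + 1 / 2) ≤ 2 * s.Z * (1 / 12 + 1 / 1000) :=
      mul_le_mul_of_nonneg_left (by nlinarith) (by positivity)
    have h8 : s.Z * S ≤ S := by nlinarith
    linarith
  have h6 : ‖s.at' (u, v)‖ ≤ S := hmax (right_mem_Icc.2 hu)
  unfold dl
  linarith [h.D_nonneg]

theorem norm_rfv_le (h : s.IsSol) {p : ℝ × ℝ} (hp : p ∈ reg s.w) : s.r p * ‖s.fv p‖ ≤ 4 * s.dl := by
  have h1 := h.norm_at_le hp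
  have h2 := h.norm_f_le hp
  have h3 := h.lam_le' hp
  have h4 := h.lam_pos hp
  have e : s.r p * ‖s.fv p‖ = ‖s.at' p - s.lam p * s.f p‖ := by
    simp only [at', add_sub_cancel_right, norm_mul, Complex.norm_real,
      Real.norm_of_nonneg (h.r_pos p hp).le]
  have h5 : ‖(s.lam p : ℂ) * s.f p‖ ≤ 3 / 4 * (2 * s.Z) := by
    rw [norm_mul, Complex.norm_real, Real.norm_of_nonneg h4.le]
    gcongr
  rw [e]
  refine (norm_sub_le _ _).trans ?_
  linarith [h.Z_le_dl, h.dl_nonneg]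

theorem norm_x_le (h : s.IsSol) {p : ℝ × ℝ} (hp : p ∈ reg s.w) : ‖s.x p‖ ≤ 10 * s.dl := by
  have h1 := h.norm_rfv_le hp
  have h2 := h.lam_ge p hp
  have h3 := h.dl_nonneg
  rw [x, norm_mul, Complex.norm_real, Real.norm_of_nonneg
    (div_nonneg (h.r_pos p hp).le (h.lam_pos hp).le), div_mul_eq_mul_div,
    div_le_iff₀ (h.lam_pos hp)]
  nlinarith

theorem norm_Du_le (h : s.IsSol) {p : ℝ × ℝ} (hp : p ∈ reg s.w) :
    ‖s.Du p‖ ≤ ‖s.fu p‖ + s.Z / s.w / 100 := by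
  have h1 := h.norm_eA_φ_le hp
  refine (norm_add_le _ _).trans ?_
  rw [mul_assoc, norm_mul, Complex.norm_I, one_mul]
  linarith

theorem norm_fu_le (h : s.IsSol) {p : ℝ × ℝ} (hp : p ∈ reg s.w) :
    ‖s.fu p‖ ≤ ‖s.Du p‖ + s.Z / s.w / 100 := by
  have h1 := h.norm_eA_φ_le hp
  have e : s.fu p = s.Du p - I * (((s.e * s.A p : ℝ) : ℂ) * s.φ p) := by
    simp only [Du]; ring
  rw [e]
  refine (norm_sub_le _ _).trans ?_
  rw [norm_mul, Complex.norm_I, one_mul]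
  linarith

theorem norm_btv_le (h : s.IsSol) {p : ℝ × ℝ} (hp : p ∈ reg s.w) :
    ‖s.btv p‖ ≤ 2 * s.Z * (-s.lk p + s.Z * (s.Z / s.w) / 10) + s.Z / s.w / 200 := by
  have h1 := h.norm_eWq_φ_le hp
  have h2 := h.norm_lk_f_le hp
  refine (norm_sub_le _ _).trans ?_
  rw [mul_assoc I, norm_mul I, Complex.norm_I, one_mul]
  linarith

/-- Integration of ∂_v b̃̃ outward from the axis, where b̃̃ tends to νφ̃ because r D_uφ → 0. The
integral of lk·φ̃ is controlled by the variation of ν. -/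
theorem norm_rDu_le (h : s.IsSol) {p : ℝ × ℝ} (hp : p ∈ reg s.w) : s.r p * ‖s.Du p‖ ≤ 4 * s.Z := by
  obtain ⟨u, v⟩ := p
  have hp' := hp
  obtain ⟨hu, huv, hv⟩ : 0 ≤ u ∧ u < v ∧ v < s.w := hp
  obtain ⟨B, hB⟩ := h.bdd
  have hw := h.w_pos
  have hZ := h.Z_nonneg
  set m := s.Z * (s.Z / s.w) / 10 with hm
  have hνf : ∀ p ∈ reg s.w, ‖(s.nu p : ℂ) * s.f p‖ ≤ 4 / 3 * s.Z := by
    intro p hp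
    rw [norm_mul, Complex.norm_real, Real.norm_of_nonpos (h.nu_neg p hp).le]
    have h1 := h.norm_f_le hp
    have h2 := h.nu_ge p hp
    calc -s.nu p * ‖s.f p‖ ≤ 2 / 3 * (2 * s.Z) := by gcongr; linarith
      _ = _ := by ring
  -- The qualitative bound `B` only multiplies r at the starting point and is lost in the limit.
  have hlim : Tendsto (fun y => s.r (u, y) * (B + s.Z / s.w / 100) + 13 / 6 * s.Z) (𝓝[>] u)
      (𝓝 (0 * (B + s.Z / s.w / 100) + 13 / 6 * s.Z)) :=
    ((h.r_axis u hu (huv.trans hv)).mul_const _).add_const _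
  have hbt : ‖s.bt (u, v)‖ ≤ 0 * (B + s.Z / s.w / 100) + 13 / 6 * s.Z := by
    refine ge_of_tendsto hlim ?_
    filter_upwards [Ioo_mem_nhdsGT huv] with y hy
    have hy' : (u, y) ∈ reg s.w := ⟨hu, hy.1, hy.2.trans hv⟩
    have hs : Icc y v ⊆ Ioo u s.w := fun x hx => ⟨hy.1.trans_le hx.1, hx.2.trans_lt hv⟩
    have key := norm_sub_le_sub_of_norm_deriv_le hy.2.le (F := fun x => s.bt (u, x))
      (F' := fun x => s.btv (u, x))
      (B := fun x => 2 * s.Z * (-s.nu (u, x) + m * x) + s.Z / s.w / 200 * x)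
      (B' := fun x => 2 * s.Z * (-s.lk (u, x) + m) + s.Z / s.w / 200)
      ((slice_v_continuousOn h.cbt hu).mono hs)
      (fun x hx => h.bt_v u x hu (hy.1.trans hx.1) (hx.2.trans hv))
      (by
        have := (slice_v_continuousOn h.cnu hu).mono hs
        fun_prop)
      (fun x hx => by
        have h1 := ((h.nu_v u x hu (hy.1.trans hx.1) (hx.2.trans hv)).neg.add
          ((hasDerivAt_id x).const_mul m)).const_mul (2 * s.Z)
        have h2 := h1.add ((hasDerivAt_id x).const_mul (s.Z / s.w / 200))
        refine h2.congr_deriv ?_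
        ring)
      (fun x hx => h.norm_btv_le ⟨hu, hy.1.trans hx.1, hx.2.trans hv⟩)
    have h1 := h.nu_ge _ hp'
    have h2 := h.nu_le hy'
    have hvy : v - y ≤ s.w := by linarith [hy.1]
    have hm0 : 0 ≤ m := by rw [hm]; have := h.Zw_nonneg; positivity
    have hmx : m * (v - y) ≤ s.Z * s.Z / 10 := by
      calc m * (v - y) ≤ m * s.w := by gcongr
        _ = _ := by rw [hm]; field_simp
    have hcx : s.Z / s.w / 200 * (v - y) ≤ s.Z / 200 := by
      calc s.Z / s.w / 200 * (v - y) ≤ s.Z / s.w / 200 * s.w := by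
            have := h.Zw_nonneg; gcongr
        _ = _ := by field_simp
    -- -ν lies between 5/18 and 2/3, so it grows by at most 7/18; the remainder up to 4/10 covers
    -- the q² term.
    have h3 : 2 * s.Z * (-s.nu (u, v) + s.nu (u, y) + m * (v - y)) ≤ 2 * s.Z * (4 / 10) :=
      mul_le_mul_of_nonneg_left (by nlinarith [h.Z_le]) (by positivity)
    have h4 : ‖s.bt (u, y)‖ ≤ s.r (u, y) * (B + s.Z / s.w / 100) + 4 / 3 * s.Z := by
      refine (norm_add_le _ _).trans (add_le_add ?_ (hνf _ hy'))
      rw [norm_mul, Complex.norm_real, Real.norm_of_nonneg (h.r_pos _ hy').le]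
      have := (h.r_pos _ hy').le
      gcongr
      exact (h.norm_Du_le hy').trans (by gcongr; exact (hB _ hy').2.2.1)
    have h5 := norm_sub_norm_le (s.bt (u, v)) (s.bt (u, y))
    linarith
  have e : s.r (u, v) * ‖s.Du (u, v)‖ = ‖s.bt (u, v) - s.nu (u, v) * s.f (u, v)‖ := by
    simp only [bt, add_sub_cancel_right, norm_mul, Complex.norm_real,
      Real.norm_of_nonneg (h.r_pos _ hp').le]
  rw [e]
  refine (norm_sub_le _ _).trans ?_
  linarith [hνf _ hp']

theorem norm_y_le (h : s.IsSol) {p : ℝ × ℝ} (hp : p ∈ reg s.w) : ‖s.y p‖ ≤ 15 * s.dl := by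
  have h1 := h.norm_rDu_le hp
  have h2 := h.nu_le hp
  have h3 := h.Z_le_dl
  have h4 := h.Z_nonneg
  have hn := neg_pos.2 (h.nu_neg p hp)
  rw [y, norm_mul, Complex.norm_real, Real.norm_of_nonpos
    (div_nonpos_of_nonneg_of_nonpos (h.r_pos p hp).le (h.nu_neg p hp).le), ← div_neg,
    div_mul_eq_mul_div, div_le_iff₀ hn]
  nlinarith

theorem norm_ePsi_le (h : s.IsSol) {p : ℝ × ℝ} (hp : p ∈ reg s.w) :
    ‖s.ePsi p‖ ≤ s.Z / 50 / s.w := by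
  have h1 := h.norm_ePsi_le_at hp
  have h2 := h.norm_at_le hp
  have h3 := h.dl_le
  have h4 := h.Zw_nonneg
  have h5 : s.Z / s.w / 200 * ‖s.at' p‖ ≤ s.Z / s.w / 200 * 1 := by gcongr; linarith
  have h6 : s.Z / 50 / s.w = s.Z / s.w / 50 := by ring
  rw [h6]
  linarith

theorem norm_dv_rφ_le (h : s.IsSol) {p : ℝ × ℝ} (hp : p ∈ reg s.w) :
    ‖s.r p * s.fv p + s.lam p * s.φ p‖ ≤ s.M := by
  have h1 := h.norm_rfv_le hp
  have h2 := h.norm_φ_le hp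
  have h3 := h.lam_le' hp
  have h4 := h.lam_pos hp
  have hM := h.M_ge
  refine (norm_add_le _ _).trans ?_
  rw [norm_mul, norm_mul, Complex.norm_real, Complex.norm_real,
    Real.norm_of_nonneg (h.r_pos p hp).le, Real.norm_of_nonneg h4.le]
  have : s.lam p * ‖s.φ p‖ ≤ 3 / 4 * s.M := by gcongr
  linarith [h.dl_le]

end IsSol
end Reduced

end ChargedScalar
end

open Set Filter Topology MeasureTheory
open scoped ENNReal NNReal

noncomputable section

namespace ChargedScalar

namespace Reduced

open Complex (I)

variable {s : Reduced}

namespace IsSol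

/-! ### Slice bounds for the mass ratio -/

theorem out_fv (h : s.IsSol) : Out s.w (fun p => ‖s.fv p‖) s.Z :=
  Out.intro h.Z_nonneg h.cfv.norm h.X_le

theorem inn_fu (h : s.IsSol) : In s.w (fun p => ‖s.fu p‖) s.Z :=
  In.intro h.Z_nonneg h.cfu.norm h.Y_le

theorem out_const (h : s.IsSol) {c : ℝ} (hc : 0 ≤ c) : Out s.w (fun _ => c / s.w) c :=
  (majV_const h.w_pos hc).out

theorem inn_const (h : s.IsSol) {c : ℝ} (hc : 0 ≤ c) : In s.w (fun _ => c / s.w) c :=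
  (majU_const h.w_pos hc).inn

theorem inn_Du (h : s.IsSol) : In s.w (fun p => ‖s.Du p‖) (101 / 100 * s.Z) := by
  have hZ := h.Z_nonneg
  refine (h.inn_fu.add (h.inn_const (c := s.Z / 100) (by positivity))).mono h.cDu.norm
    (fun p hp => ?_) (by linarith)
  refine (h.norm_Du_le hp).trans (le_of_eq ?_)
  ring

theorem four_pi_le : 4 * Real.pi ≤ 12.6 := by linarith [Real.pi_lt_d2]

/-- One factor becomes x, small pointwise, and the other is integrable on slices, so that the
Raychaudhuri term is quadratic in δ. `Lu_eq` does the same with y. -/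
theorem Nv_eq (h : s.IsSol) {p : ℝ × ℝ} (hp : p ∈ reg s.w) :
    s.Nv p = 4 * Real.pi * (‖s.x p‖ * ‖s.fv p‖) := by
  rw [x, norm_mul, Complex.norm_real, Real.norm_of_nonneg
    (div_nonneg (h.r_pos p hp).le (h.lam_pos hp).le), Nv]
  ring

theorem Lu_eq (h : s.IsSol) {p : ℝ × ℝ} (hp : p ∈ reg s.w) :
    s.Lu p = -(4 * Real.pi * (‖s.y p‖ * ‖s.Du p‖)) := by
  rw [y, norm_mul, Complex.norm_real, Real.norm_of_nonpos
    (div_nonpos_of_nonneg_of_nonpos (h.r_pos p hp).le (h.nu_neg p hp).le), Lu]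
  ring

theorem out_Nv (h : s.IsSol) : Out s.w s.Nv (126 * s.dl ^ 2) := by
  have h0 := h.dl_nonneg
  refine (h.out_fv.const_mul (k := 126 * s.dl) (by positivity)).mono h.cNv (fun p hp => ?_) ?_
  · rw [h.Nv_eq hp]
    have h1 := h.norm_x_le hp
    calc 4 * Real.pi * (‖s.x p‖ * ‖s.fv p‖) ≤ 12.6 * (10 * s.dl * ‖s.fv p‖) := by
          gcongr
          exact four_pi_le
      _ = _ := by ring
  · nlinarith [h.Z_le_dl]

theorem inn_Lu (h : s.IsSol) : In s.w (fun p => |s.Lu p|) (200 * s.dl ^ 2) := by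
  have h0 := h.dl_nonneg
  refine (h.inn_Du.const_mul (k := 189 * s.dl) (by positivity)).mono (by
    have := h.cLu; fun_prop) (fun p hp => ?_) ?_
  · rw [h.Lu_eq hp, abs_neg, abs_of_nonneg (by positivity)]
    have h1 := h.norm_y_le hp
    calc 4 * Real.pi * (‖s.y p‖ * ‖s.Du p‖) ≤ 12.6 * (15 * s.dl * ‖s.Du p‖) := by
          gcongr
          exact four_pi_le
      _ = _ := by ring
  · nlinarith [h.Z_le_dl]

theorem out_q_sq (h : s.IsSol) : Out s.w (fun p => s.q p ^ 2 / s.r p) (s.dl ^ 2) := by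
  have hZ := h.Z_nonneg
  have hr := h.r_ne
  refine (h.out_const (c := s.Z * s.Z / 10) (by positivity)).mono
    (by fun_prop (disch := assumption)) (fun p hp => ?_) (by nlinarith [h.Z_le_dl])
  refine (h.q_sq_div_le hp).trans (le_of_eq ?_)
  ring

theorem inn_q_sq (h : s.IsSol) : In s.w (fun p => s.q p ^ 2 / s.r p) (s.dl ^ 2) := by
  have hZ := h.Z_nonneg
  have hr := h.r_ne
  refine (h.inn_const (c := s.Z * s.Z / 10) (by positivity)).mono
    (by fun_prop (disch := assumption)) (fun p hp => ?_) (by nlinarith [h.Z_le_dl])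
  refine (h.q_sq_div_le hp).trans (le_of_eq ?_)
  ring

/-- μ solves μ_v = S - (λ/r)μ with S quadratic in δ, so the Hardy inequality bounds the singular
quantity λμ/r by S. -/
theorem out_mu (h : s.IsSol) : Out s.w (fun p => s.lam p / s.r p * s.mu p) (127 * s.dl ^ 2) := by
  have hr := h.r_ne
  have h0 := h.dl_nonneg
  let S : ℝ × ℝ → ℝ := fun p => (1 - s.mu p) * s.Nv p + s.lam p * (s.q p ^ 2 / s.r p)
  have cS : ContinuousOn S (reg s.w) := by
    simp only [S]; fun_prop (disch := assumption)
  have hS : Out s.w (fun p => ‖S p‖) (127 * s.dl ^ 2) := by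
    refine (h.out_Nv.add h.out_q_sq).mono cS.norm (fun p hp => ?_) (by linarith)
    have h1 := h.Nv_nonneg hp
    have h2 := h.one_sub_mu_pos hp
    have h3 := h.lam_pos hp
    have h4 : 0 ≤ s.q p ^ 2 / s.r p := by have := h.r_pos p hp; positivity
    rw [Real.norm_of_nonneg (by positivity)]
    have h5 : (1 - s.mu p) * s.Nv p ≤ 1 * s.Nv p := by
      gcongr; linarith [h.mu_nonneg hp]
    have h6 : s.lam p * (s.q p ^ 2 / s.r p) ≤ 1 * (s.q p ^ 2 / s.r p) := by
      gcongr; linarith [h.lam_le' hp]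
    linarith
  refine Out.intro (by positivity) (by fun_prop (disch := assumption)) fun u hu huw => ?_
  have key := setLIntegral_mul_norm_le (a := u) (b := s.w) (P := fun v => s.mu (u, v))
    (S := fun v => S (u, v)) (κ := fun v => s.lam (u, v) / s.r (u, v))
    (fun v hv => by
      have hp : (u, v) ∈ reg s.w := ⟨hu, hv.1, hv.2⟩
      have h1 := h.r_ne _ hp
      have h2 := h.one_sub_mu_ne _ hp
      refine (h.mu_v u v hu hv.1 hv.2).congr_deriv ?_
      simp only [muv, pm, S, smul_eq_mul]
      field_simp
      ring)
    (slice_v_continuousOn (F := fun p => s.lam p / s.r p) (by fun_prop (disch := assumption)) hu)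
    (fun v hv => by
      have hp : (u, v) ∈ reg s.w := ⟨hu, hv.1, hv.2⟩
      exact div_nonneg (h.lam_pos hp).le (h.r_pos _ hp).le)
    (slice_v_continuousOn cS hu) (h.mu_axis u hu huw)
  refine le_trans ?_ (key.trans (hS.le hu))
  refine setLIntegral_mono' measurableSet_Ioo fun v hv => ?_
  have hp : (u, v) ∈ reg s.w := ⟨hu, hv.1, hv.2⟩
  rw [Real.norm_of_nonneg (h.mu_nonneg hp)]

theorem q_axis' (h : s.IsSol) {v : ℝ} (hv0 : 0 < v) (hv : v < s.w) :
    Tendsto (fun x => s.q (x, v)) (𝓝[<] v) (𝓝 0) := by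
  have hl : Tendsto (fun x => 3 / 10 * (s.Z / s.w) * s.r (x, v)) (𝓝[<] v) (𝓝 0) := by
    simpa using (h.r_axis' hv0 hv).const_mul (3 / 10 * (s.Z / s.w))
  refine squeeze_zero_norm' ?_ hl
  filter_upwards [Ioo_mem_nhdsLT hv0] with x hx using h.abs_q_le ⟨hx.1.le, hx.2, hv⟩

/-- The limit along incoming lines: `lk` is bounded and W ≥ 1/9, hence μ is at most q² plus a
multiple of r. -/
theorem mu_axis' (h : s.IsSol) {v : ℝ} (hv0 : 0 < v) (hv : v < s.w) :
    Tendsto (fun x => s.mu (x, v)) (𝓝[<] v) (𝓝 0) := by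
  obtain ⟨B, hB⟩ := h.bdd
  have hl : Tendsto (fun x => s.q (x, v) ^ 2 + 9 * s.r (x, v) * B) (𝓝[<] v) (𝓝 0) := by
    simpa using ((h.q_axis' hv0 hv).pow 2).add (((h.r_axis' hv0 hv).const_mul 9).mul_const B)
  refine squeeze_zero_norm' ?_ hl
  filter_upwards [Ioo_mem_nhdsLT hv0] with x hx
  have hp : (x, v) ∈ reg s.w := ⟨hx.1.le, hx.2, hv⟩
  have hr := h.r_pos _ hp
  rw [Real.norm_of_nonneg (h.mu_nonneg hp)]
  have h1 := h.lk_eq hp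
  have h2 := (neg_le_abs _).trans (hB _ hp).2.2.2.2.2.2
  have h3 := h.W_ge hp
  rw [h1, mul_div_assoc', ← neg_div, div_le_iff₀ hr] at h2
  rcases le_or_gt (s.mu (x, v)) (s.q (x, v) ^ 2) with h4 | h4
  · have : 0 ≤ B := (abs_nonneg _).trans (hB _ hp).1
    have : 0 ≤ 9 * s.r (x, v) * B := by positivity
    linarith
  · nlinarith

/-- Incoming version of `out_mu`, using the reflected Hardy inequality with κ = -ν/r and the limit μ
→ 0 at the right end. -/
theorem inn_mu (h : s.IsSol) : In s.w (fun p => -s.nu p / s.r p * s.mu p) (201 * s.dl ^ 2) := by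
  have hr := h.r_ne
  have h0 := h.dl_nonneg
  let S : ℝ × ℝ → ℝ := fun p => (1 - s.mu p) * s.Lu p + s.nu p * (s.q p ^ 2 / s.r p)
  have cS : ContinuousOn S (reg s.w) := by
    simp only [S]; fun_prop (disch := assumption)
  have hS : In s.w (fun p => ‖S p‖) (201 * s.dl ^ 2) := by
    refine (h.inn_Lu.add h.inn_q_sq).mono cS.norm (fun p hp => ?_) (by linarith)
    have h1 := abs_nonneg (s.Lu p)
    have h2 := h.one_sub_mu_pos hp
    have h4 : 0 ≤ s.q p ^ 2 / s.r p := by have := h.r_pos p hp; positivity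
    refine (norm_add_le _ _).trans ?_
    rw [norm_mul, norm_mul, Real.norm_of_nonneg h2.le, Real.norm_of_nonpos (h.nu_neg p hp).le,
      Real.norm_of_nonneg h4, Real.norm_eq_abs]
    have h5 : (1 - s.mu p) * |s.Lu p| ≤ 1 * |s.Lu p| := by
      gcongr; linarith [h.mu_nonneg hp]
    have h6 : -s.nu p * (s.q p ^ 2 / s.r p) ≤ 1 * (s.q p ^ 2 / s.r p) := by
      gcongr; linarith [h.nu_ge p hp]
    linarith
  refine In.intro (by positivity) (by fun_prop (disch := assumption)) fun v hv0 hv => ?_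
  have key := setLIntegral_mul_norm_le' (a := 0) (b := v) (P := fun u => s.mu (u, v))
    (S := fun u => S (u, v)) (κ := fun u => -s.nu (u, v) / s.r (u, v))
    (fun u hu => by
      have hp : (u, v) ∈ reg s.w := ⟨hu.1.le, hu.2, hv⟩
      have h1 := h.r_ne _ hp
      have h2 := h.one_sub_mu_ne _ hp
      refine (h.mu_u u v hu.1 hu.2 hv).congr_deriv ?_
      simp only [muu, pm, S, smul_eq_mul]
      field_simp
      ring)
    ((slice_u_continuousOn (F := fun p => -s.nu p / s.r p) (by fun_prop (disch := assumption))
      hv).mono Ioo_subset_Ico_self)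
    (fun u hu => by
      have hp : (u, v) ∈ reg s.w := ⟨hu.1.le, hu.2, hv⟩
      exact div_nonneg (neg_nonneg.2 (h.nu_neg _ hp).le) (h.r_pos _ hp).le)
    ((slice_u_continuousOn cS hv).mono Ioo_subset_Ico_self) (h.mu_axis' hv0 hv)
  refine le_trans ?_ (key.trans (hS.le hv))
  refine setLIntegral_mono' measurableSet_Ioo fun u hu => ?_
  have hp : (u, v) ∈ reg s.w := ⟨hu.1.le, hu.2, hv⟩
  rw [Real.norm_of_nonneg (h.mu_nonneg hp)]

theorem abs_pm_div_le (h : s.IsSol) {p : ℝ × ℝ} (hp : p ∈ reg s.w) :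
    |s.pm p / s.r p| ≤ 3 / 2 * (s.mu p / s.r p + s.q p ^ 2 / s.r p) := by
  have hr := h.r_pos p hp
  have hm := h.one_sub_mu_pos hp
  have h1 := h.mu_nonneg hp
  have h2 := h.mu_le p hp
  rw [abs_div, abs_of_pos hr, ← add_div, ← mul_div_assoc]
  gcongr
  rw [pm, abs_div, abs_of_pos hm, div_le_iff₀ hm]
  have h3 : |s.mu p - s.q p ^ 2| ≤ s.mu p + s.q p ^ 2 := by
    rw [abs_le]; constructor <;> nlinarith [sq_nonneg (s.q p)]
  nlinarith [sq_nonneg (s.q p)]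

/-- The outgoing derivative of `log |ν|`. -/
theorem out_lk (h : s.IsSol) : Out s.w (fun p => |s.lam p * (s.pm p / s.r p)|) (200 * s.dl ^ 2) := by
  have hr := h.r_ne
  refine ((h.out_mu.add h.out_q_sq).const_mul (k := 3 / 2) (by norm_num)).mono
    (ContinuousOn.abs (by fun_prop (disch := assumption))) (fun p hp => ?_)
    (by nlinarith [sq_nonneg s.dl])
  have h1 := h.abs_pm_div_le hp
  have h2 := h.lam_pos hp
  have h3 := h.lam_le' hp
  have h4 : 0 ≤ s.q p ^ 2 / s.r p := by have := h.r_pos p hp; positivity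
  rw [abs_mul, abs_of_pos h2]
  calc s.lam p * |s.pm p / s.r p| ≤ s.lam p * (3 / 2 * (s.mu p / s.r p + s.q p ^ 2 / s.r p)) := by
        gcongr
    _ = 3 / 2 * (s.lam p / s.r p * s.mu p + s.lam p * (s.q p ^ 2 / s.r p)) := by ring
    _ ≤ 3 / 2 * (s.lam p / s.r p * s.mu p + 1 * (s.q p ^ 2 / s.r p)) := by
        gcongr; linarith
    _ = _ := by ring

/-- The incoming derivative of `log λ`. -/
theorem inn_nk (h : s.IsSol) : In s.w (fun p => |s.nu p * (s.pm p / s.r p)|) (310 * s.dl ^ 2) := by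
  have hr := h.r_ne
  refine ((h.inn_mu.add h.inn_q_sq).const_mul (k := 3 / 2) (by norm_num)).mono
    (ContinuousOn.abs (by fun_prop (disch := assumption))) (fun p hp => ?_)
    (by nlinarith [sq_nonneg s.dl])
  have h1 := h.abs_pm_div_le hp
  have h2 := neg_pos.2 (h.nu_neg p hp)
  have h3 := h.nu_ge p hp
  have h4 : 0 ≤ s.q p ^ 2 / s.r p := by have := h.r_pos p hp; positivity
  rw [abs_mul, abs_of_neg (h.nu_neg p hp)]
  calc -s.nu p * |s.pm p / s.r p|
      ≤ -s.nu p * (3 / 2 * (s.mu p / s.r p + s.q p ^ 2 / s.r p)) := by gcongr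
    _ = 3 / 2 * (-s.nu p / s.r p * s.mu p + -s.nu p * (s.q p ^ 2 / s.r p)) := by ring
    _ ≤ 3 / 2 * (-s.nu p / s.r p * s.mu p + 1 * (s.q p ^ 2 / s.r p)) := by
        gcongr; linarith
    _ = _ := by ring

end IsSol
end Reduced

end ChargedScalar
end

open Set Filter Topology MeasureTheory
open scoped ENNReal NNReal

noncomputable section

namespace ChargedScalar

namespace Reduced

open Complex (I)

section Definitions

variable (s : Reduced) (p : ℝ × ℝ)

/-- `∂_v` of `ã / λ`. -/
def av : ℂ := (s.atv p - (s.x p + s.f p) * s.lamv p) / s.lam p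

/-- `∂_u` of `ã / λ`. -/
def au : ℂ := -(I * s.ePsi p + s.x p * s.lk p) / s.lam p

/-- The charge term in the equation for `∂_v` of the doubly renormalized `b̃`. -/
def eWq : ℂ := ((s.e * (s.W p * s.q p) : ℝ) : ℂ) * s.φ p

/-- `∂_v` of the doubly renormalized `b̃` over `ν`. -/
def bev : ℂ := -(I * s.eWq p + s.y p * s.lk p) / s.nu p

/-- `∂_u` of the doubly renormalized `b̃` over `ν`. -/
def beu : ℂ := (s.btu p - (s.y p + s.f p) * s.nuu p) / s.nu p

/-- `∂_v ã - φ̃ ∂_v λ`. -/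
def g : ℂ := s.atv p - s.f p * s.lamv p

/-- `∂_u` of the doubly renormalized `b̃`, minus `φ̃ ∂_u ν`. -/
def hh : ℂ := s.btu p - s.f p * s.nuu p

/-- `∂_v log (λ / (1 - μ))`, renormalized. -/
def Lh : ℝ := s.lamv p / s.lam p + s.Nv p - s.lam p * (s.pm p / s.r p)
  - 4 * Real.pi * inner ℝ (s.fv p) (s.y p)

/-- `∂_u log (|ν| / (1 - μ))`, renormalized. -/
def Nh : ℝ := s.nuu p / s.nu p + s.Lu p - s.nu p * (s.pm p / s.r p)
  - 4 * Real.pi * inner ℝ (s.fu p) (s.x p)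

/-- The charge correction to `Lh`. -/
def E : ℝ := inner ℝ (I * ((s.e * s.A p : ℝ) : ℂ) * s.φ p) (s.y p)

/-- `∂_v E`. -/
def Ev : ℝ := inner ℝ (I * ((s.e * s.A p : ℝ) : ℂ) * s.φ p) (s.bev p - s.fv p)
  + inner ℝ (I * ((s.e * s.Av p : ℝ) : ℂ) * s.φ p + I * ((s.e * s.A p : ℝ) : ℂ) * s.fv p) (s.y p)

/-- `∂_v pm`. -/
def pmv : ℝ := (1 + s.pm p) * (s.Nv p - s.lam p * (s.pm p / s.r p))
  - 2 * s.q p * s.qv p / (1 - s.mu p)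

/-- `∂_u pm`. -/
def pmu : ℝ := (1 + s.pm p) * (s.Lu p - s.nu p * (s.pm p / s.r p))
  - 2 * s.q p * s.qu p / (1 - s.mu p)

/-- `∂_v lk`. -/
def lkv : ℝ := (s.lamv p * s.nu p + s.lam p * s.lk p) * (s.pm p / s.r p)
  + s.lam p * s.nu p * ((s.pmv p * s.r p - s.pm p * s.lam p) / s.r p ^ 2)

/-- `∂_u lk`. -/
def lku : ℝ := (s.lk p * s.nu p + s.lam p * s.nuu p) * (s.pm p / s.r p)
  + s.lam p * s.nu p * ((s.pmu p * s.r p - s.pm p * s.nu p) / s.r p ^ 2)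

/-- `∂_v W`. -/
def Wv : ℝ := s.W p * (s.lamv p / s.lam p + s.Nv p)

/-- `∂_u W`. -/
def Wu : ℝ := s.W p * (s.nuu p / s.nu p + s.Lu p)

/-- `∂_v ePsi`. -/
def ePsiv : ℂ := ((s.e * s.Av p : ℝ) : ℂ) * (s.r p * s.fv p + s.lam p * s.φ p)
  + ((s.e * s.A p : ℝ) : ℂ) * (s.atv p + s.lamv p * s.φ0)
  - (((s.e * (s.Wv p * s.q p + s.W p * s.qv p) : ℝ) : ℂ) * s.φ p
    + ((s.e * (s.W p * s.q p) : ℝ) : ℂ) * s.fv p)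

/-- `∂_u eWq`. -/
def eWqu : ℂ := ((s.e * (s.Wu p * s.q p + s.W p * s.qu p) : ℝ) : ℂ) * s.φ p
    + ((s.e * (s.W p * s.q p) : ℝ) : ℂ) * s.fu p

/-- The Jacobian of `φ̃†` and `ã / λ`. -/
def J1 : ℂ := (starRingEnd ℂ) (s.fu p) * s.av p - (starRingEnd ℂ) (s.fv p) * s.au p

/-- The Jacobian of `φ̃†` and the doubly renormalized `b̃` over `ν`. -/
def J2 : ℂ := (starRingEnd ℂ) (s.fu p) * s.bev p - (starRingEnd ℂ) (s.fv p) * s.beu p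

/-- The Jacobian of `log λ` and `φ̃`. -/
def J3 : ℂ := (s.lk p * s.fv p - s.lamv p * s.fu p) / s.lam p

/-- The Jacobian of `log |ν|` and `φ̃`. -/
def J4 : ℂ := (s.nuu p * s.fv p - s.lk p * s.fu p) / s.nu p

/-- The Jacobian of `φ̃†` and `φ̃`. -/
def Jff : ℂ := (starRingEnd ℂ) (s.fu p) * s.fv p - (starRingEnd ℂ) (s.fv p) * s.fu p

/-- The Jacobian of `log (|ν| / (1 - μ))` and `φ̃`. -/
def JN : ℂ := ((s.nuu p / s.nu p + s.Lu p - s.nu p * (s.pm p / s.r p) : ℝ) : ℂ) * s.fv p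
  - (s.Nv p : ℂ) * s.fu p

/-- The Jacobian of `log (λ / (1 - μ))` and `φ̃`. -/
def JL : ℂ := (s.Lu p : ℂ) * s.fv p
  - ((s.lamv p / s.lam p + s.Nv p - s.lam p * (s.pm p / s.r p) : ℝ) : ℂ) * s.fu p

/-- The Jacobian of `q` and `φ̃`. -/
def Jq : ℂ := (s.qu p : ℂ) * s.fv p - (s.qv p : ℂ) * s.fu p

/-- The Jacobian of `log |ν|` and `ã / λ`. -/
def Jna : ℂ := ((s.nuu p / s.nu p : ℝ) : ℂ) * s.av p
  - ((s.lam p * (s.pm p / s.r p) : ℝ) : ℂ) * s.au p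

/-- The Jacobian of `log |ν|` and `log λ`. -/
def Jnl : ℝ := s.nuu p / s.nu p * (s.lamv p / s.lam p)
  - s.lam p * (s.pm p / s.r p) * (s.nu p * (s.pm p / s.r p))

end Definitions

variable {s : Reduced}

namespace IsSol

section Continuity

variable (h : s.IsSol)
include h

@[fun_prop]
theorem ceWq : ContinuousOn s.eWq (reg s.w) := by
  unfold eWq; fun_prop (disch := assumption)

@[fun_prop]
theorem cav : ContinuousOn s.av (reg s.w) := by
  have := h.lam_ne'
  unfold av; fun_prop (disch := assumption)

@[fun_prop]
theorem cau : ContinuousOn s.au (reg s.w) := by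
  have := h.lam_ne'
  unfold au; fun_prop (disch := assumption)

@[fun_prop]
theorem cbev : ContinuousOn s.bev (reg s.w) := by
  have := h.nu_ne'
  unfold bev; fun_prop (disch := assumption)

@[fun_prop]
theorem cbeu : ContinuousOn s.beu (reg s.w) := by
  have := h.nu_ne'
  unfold beu; fun_prop (disch := assumption)

@[fun_prop]
theorem cg : ContinuousOn s.g (reg s.w) := by
  unfold g; fun_prop (disch := assumption)

@[fun_prop]
theorem chh : ContinuousOn s.hh (reg s.w) := by
  unfold hh; fun_prop (disch := assumption)

@[fun_prop]
theorem cLh : ContinuousOn s.Lh (reg s.w) := by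
  have := h.lam_ne
  have := h.r_ne
  unfold Lh; fun_prop (disch := assumption)

@[fun_prop]
theorem cNh : ContinuousOn s.Nh (reg s.w) := by
  have := h.nu_ne
  have := h.r_ne
  unfold Nh; fun_prop (disch := assumption)

@[fun_prop]
theorem cEv : ContinuousOn s.Ev (reg s.w) := by
  unfold Ev; fun_prop (disch := assumption)

@[fun_prop]
theorem cpmv : ContinuousOn s.pmv (reg s.w) := by
  have := h.r_ne
  have := h.one_sub_mu_ne
  unfold pmv; fun_prop (disch := assumption)

@[fun_prop]
theorem cpmu : ContinuousOn s.pmu (reg s.w) := by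
  have := h.r_ne
  have := h.one_sub_mu_ne
  unfold pmu; fun_prop (disch := assumption)

@[fun_prop]
theorem clkv : ContinuousOn s.lkv (reg s.w) := by
  have := h.r_ne
  have : ∀ p ∈ reg s.w, s.r p ^ 2 ≠ 0 := fun p hp => pow_ne_zero 2 (h.r_ne p hp)
  unfold lkv; fun_prop (disch := assumption)

@[fun_prop]
theorem clku : ContinuousOn s.lku (reg s.w) := by
  have := h.r_ne
  have : ∀ p ∈ reg s.w, s.r p ^ 2 ≠ 0 := fun p hp => pow_ne_zero 2 (h.r_ne p hp)
  unfold lku; fun_prop (disch := assumption)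

@[fun_prop]
theorem cWv : ContinuousOn s.Wv (reg s.w) := by
  have := h.lam_ne
  unfold Wv; fun_prop (disch := assumption)

@[fun_prop]
theorem cWu : ContinuousOn s.Wu (reg s.w) := by
  have := h.nu_ne
  unfold Wu; fun_prop (disch := assumption)

@[fun_prop]
theorem cePsiv : ContinuousOn s.ePsiv (reg s.w) := by
  unfold ePsiv; fun_prop (disch := assumption)

@[fun_prop]
theorem ceWqu : ContinuousOn s.eWqu (reg s.w) := by
  unfold eWqu; fun_prop (disch := assumption)

@[fun_prop]
theorem cJ1 : ContinuousOn s.J1 (reg s.w) := by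
  unfold J1; fun_prop (disch := assumption)

@[fun_prop]
theorem cJ2 : ContinuousOn s.J2 (reg s.w) := by
  unfold J2; fun_prop (disch := assumption)

@[fun_prop]
theorem cJ3 : ContinuousOn s.J3 (reg s.w) := by
  have := h.lam_ne'
  unfold J3; fun_prop (disch := assumption)

@[fun_prop]
theorem cJ4 : ContinuousOn s.J4 (reg s.w) := by
  have := h.nu_ne'
  unfold J4; fun_prop (disch := assumption)

@[fun_prop]
theorem cJff : ContinuousOn s.Jff (reg s.w) := by
  unfold Jff; fun_prop (disch := assumption)

@[fun_prop]
theorem cJN : ContinuousOn s.JN (reg s.w) := by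
  have := h.nu_ne
  have := h.r_ne
  unfold JN; fun_prop (disch := assumption)

@[fun_prop]
theorem cJL : ContinuousOn s.JL (reg s.w) := by
  have := h.lam_ne
  have := h.r_ne
  unfold JL; fun_prop (disch := assumption)

@[fun_prop]
theorem cJq : ContinuousOn s.Jq (reg s.w) := by
  unfold Jq; fun_prop (disch := assumption)

@[fun_prop]
theorem cJna : ContinuousOn s.Jna (reg s.w) := by
  have := h.nu_ne
  have := h.r_ne
  unfold Jna; fun_prop (disch := assumption)

@[fun_prop]
theorem cJnl : ContinuousOn s.Jnl (reg s.w) := by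
  have := h.nu_ne
  have := h.lam_ne
  have := h.r_ne
  unfold Jnl; fun_prop (disch := assumption)

end Continuity

/-! ### Second derivatives -/

theorem pm_v (h : s.IsSol) : HasV s.w s.pm s.pmv := by
  intro u v hu huv hv
  have h2 := h.one_sub_mu_ne _ (show (u, v) ∈ reg s.w from ⟨hu, huv, hv⟩)
  refine (((h.mu_v u v hu huv hv).sub ((h.q_v u v hu huv hv).pow 2)).div
    ((h.mu_v u v hu huv hv).const_sub 1) h2).congr_deriv ?_
  simp only [pmv, muv, pm, Pi.pow_apply, Pi.sub_apply]
  field_simp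
  ring

theorem pm_u (h : s.IsSol) : HasU s.w s.pm s.pmu := by
  intro u v hu huv hv
  have h2 := h.one_sub_mu_ne _ (show (u, v) ∈ reg s.w from ⟨hu.le, huv, hv⟩)
  refine (((h.mu_u u v hu huv hv).sub ((h.q_u u v hu huv hv).pow 2)).div
    ((h.mu_u u v hu huv hv).const_sub 1) h2).congr_deriv ?_
  simp only [pmu, muu, pm, Pi.pow_apply, Pi.sub_apply]
  field_simp
  ring

theorem lk_v (h : s.IsSol) : HasV s.w s.lk s.lkv := by
  intro u v hu huv hv
  have h1 := h.r_ne _ (show (u, v) ∈ reg s.w from ⟨hu, huv, hv⟩)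
  exact ((h.lam_v u v hu huv hv).mul (h.nu_v u v hu huv hv)).mul
    ((h.pm_v u v hu huv hv).div (h.r_v u v hu huv hv) h1)

theorem lk_u (h : s.IsSol) : HasU s.w s.lk s.lku := by
  intro u v hu huv hv
  have h1 := h.r_ne _ (show (u, v) ∈ reg s.w from ⟨hu.le, huv, hv⟩)
  exact ((h.lam_u u v hu huv hv).mul (h.nu_u u v hu huv hv)).mul
    ((h.pm_u u v hu huv hv).div (h.r_u u v hu huv hv) h1)

theorem W_v (h : s.IsSol) : HasV s.w s.W s.Wv := by
  intro u v hu huv hv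
  have hp : (u, v) ∈ reg s.w := ⟨hu, huv, hv⟩
  have h0 := h.lam_ne _ hp
  have h1 := h.r_ne _ hp
  have h2 := h.one_sub_mu_ne _ hp
  refine (((h.lam_v u v hu huv hv).mul (h.nu_v u v hu huv hv)).neg.div
    ((h.mu_v u v hu huv hv).const_sub 1) h2).congr_deriv ?_
  simp only [Wv, muv, W, lk, Pi.mul_apply, Pi.neg_apply]
  field_simp
  ring

theorem W_u (h : s.IsSol) : HasU s.w s.W s.Wu := by
  intro u v hu huv hv
  have hp : (u, v) ∈ reg s.w := ⟨hu.le, huv, hv⟩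
  have h0 := h.nu_ne _ hp
  have h1 := h.r_ne _ hp
  have h2 := h.one_sub_mu_ne _ hp
  refine (((h.lam_u u v hu huv hv).mul (h.nu_u u v hu huv hv)).neg.div
    ((h.mu_u u v hu huv hv).const_sub 1) h2).congr_deriv ?_
  simp only [Wu, muu, W, lk, Pi.mul_apply, Pi.neg_apply]
  field_simp
  ring

theorem ePsi_v (h : s.IsSol) : HasV s.w s.ePsi s.ePsiv := by
  intro u v hu huv hv
  have h1 := ((h.at_v u v hu huv hv).add ((h.lam_v u v hu huv hv).ofReal_comp.mul_const s.φ0))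
  have h2 := ((h.A_v u v hu huv hv).const_mul s.e).ofReal_comp.mul h1
  have h3 := (((h.W_v u v hu huv hv).mul (h.q_v u v hu huv hv)).const_mul s.e).ofReal_comp.mul
    (h.φ_v u v hu huv hv)
  refine ((h2.sub h3).congr_deriv ?_).congr_of_eventuallyEq (Eventually.of_forall fun x => ?_)
  · simp only [ePsiv, at', φ, Pi.add_apply, Pi.mul_apply]; push_cast; ring
  · simp only [ePsi, at', φ, Pi.add_apply, Pi.mul_apply, Pi.sub_apply]; push_cast; ring

theorem eWq_u (h : s.IsSol) : HasU s.w s.eWq s.eWqu := by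
  intro u v hu huv hv
  refine ((((h.W_u u v hu huv hv).mul (h.q_u u v hu huv hv)).const_mul s.e).ofReal_comp.mul
    (h.φ_u u v hu huv hv)).congr_deriv ?_
  simp only [eWqu, Pi.mul_apply]

/-- λ is only C¹. Its mixed second derivative exists because `lk` = ∂_uλ is an explicit expression
with a continuous v-derivative. -/
theorem lamv_u (h : s.IsSol) : HasU s.w s.lamv s.lkv :=
  h.lam_u.mixed h.lam_v.toVi h.lk_v.toVi (h.clk) (h.clkv)

theorem nuu_v (h : s.IsSol) : HasVi s.w s.nuu s.lku :=
  HasVi.mixed h.nu_u h.nu_v.toVi h.lk_u (h.clk) (h.clku)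

theorem atv_u (h : s.IsSol) :
    HasU s.w s.atv (fun p => s.lkv p * s.f p + s.lk p * s.fv p - I * s.ePsiv p) := by
  refine h.at_u.mixed h.at_v.toVi (fun u v hu huv hv => ?_) h.catu (by fun_prop (disch := assumption))
  exact ((h.lk_v u v hu.le huv hv).ofReal_comp.mul (h.f_v u v hu.le huv hv)).sub
    ((h.ePsi_v u v hu.le huv hv).const_mul I)

theorem btv_eq (p : ℝ × ℝ) : s.btv p = s.lk p * s.f p - I * s.eWq p := by
  simp only [btv, eWq]; push_cast; ring

theorem btu_v (h : s.IsSol) :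
    HasVi s.w s.btu (fun p => s.lku p * s.f p + s.lk p * s.fu p - I * s.eWqu p) := by
  refine HasVi.mixed h.bt_u h.bt_v.toVi (fun u v hu huv hv => ?_) h.cbtv
    (by fun_prop (disch := assumption))
  refine (((h.lk_u u v hu huv hv).ofReal_comp.mul (h.f_u u v hu huv hv)).sub
    ((h.eWq_u u v hu huv hv).const_mul I)).congr_of_eventuallyEq
    (Eventually.of_forall fun x => ?_)
  simp only [btv_eq, Pi.sub_apply, Pi.mul_apply]

/-- Subtracting φ̃ ∂_vλ from ∂_vã removes the uncontrolled term φ̃ ∂_v`lk` and leaves a Jacobian of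
λ and φ̃. -/
theorem g_u (h : s.IsSol) : HasU s.w s.g (fun p => s.lam p * s.J3 p - I * s.ePsiv p) := by
  intro u v hu huv hv
  have h0 := h.lam_ne' _ (show (u, v) ∈ reg s.w from ⟨hu.le, huv, hv⟩)
  refine ((h.atv_u u v hu huv hv).sub ((h.f_u u v hu huv hv).mul
    (h.lamv_u u v hu huv hv).ofReal_comp)).congr_deriv ?_
  simp only [J3]
  field_simp
  ring

/-- Mirror image of `g_u`: the term φ̃ ∂_u`lk` cancels. -/
theorem hh_v (h : s.IsSol) : HasVi s.w s.hh (fun p => -(s.nu p * s.J4 p) - I * s.eWqu p) := by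
  intro u v hu huv hv
  have h0 := h.nu_ne' _ (show (u, v) ∈ reg s.w from ⟨hu.le, huv, hv⟩)
  refine ((h.btu_v u v hu huv hv).sub ((h.f_v u v hu.le huv hv).mul
    (h.nuu_v u v hu huv hv).ofReal_comp)).congr_deriv ?_
  simp only [J4]
  field_simp
  ring

/-- Uses x = ã/λ - φ̃, so that ∂_vx = ∂_v(ã/λ) - ∂_vφ. -/
theorem x_v (h : s.IsSol) : HasV s.w s.x (fun p => s.av p - s.fv p) := by
  intro u v hu huv hv
  have h0 := h.lam_ne' _ (show (u, v) ∈ reg s.w from ⟨hu, huv, hv⟩)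
  have h1 : ∀ᶠ y in 𝓝 v, s.x (u, y) = s.at' (u, y) / s.lam (u, y) - s.f (u, y) := by
    filter_upwards [Ioo_mem_nhds huv hv] with y hy
    have := h.lam_ne' _ (show (u, y) ∈ reg s.w from ⟨hu, hy.1, hy.2⟩)
    simp only [x, at']
    push_cast
    field_simp
    ring
  refine ((((h.at_v u v hu huv hv).div (h.lam_v u v hu huv hv).ofReal_comp h0).sub
    (h.f_v u v hu huv hv)).congr_deriv ?_).congr_of_eventuallyEq h1
  simp only [av, h1.self_of_nhds]
  field_simp
  ring

theorem x_u (h : s.IsSol) : HasU s.w s.x (fun p => s.au p - s.fu p) := by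
  intro u v hu huv hv
  have h0 := h.lam_ne' _ (show (u, v) ∈ reg s.w from ⟨hu.le, huv, hv⟩)
  have h1 : ∀ᶠ y in 𝓝 u, s.x (y, v) = s.at' (y, v) / s.lam (y, v) - s.f (y, v) := by
    filter_upwards [Ioo_mem_nhds hu huv] with y hy
    have := h.lam_ne' _ (show (y, v) ∈ reg s.w from ⟨hy.1.le, hy.2, hv⟩)
    simp only [x, at']
    push_cast
    field_simp
    ring
  refine ((((h.at_u u v hu huv hv).div (h.lam_u u v hu huv hv).ofReal_comp h0).sub
    (h.f_u u v hu huv hv)).congr_deriv ?_).congr_of_eventuallyEq h1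
  simp only [au, h1.self_of_nhds, atu]
  field_simp
  ring

theorem y_eq (h : s.IsSol) {p : ℝ × ℝ} (hp : p ∈ reg s.w) :
    s.y p = s.bt p / s.nu p - s.f p := by
  have := h.nu_ne' _ hp
  simp only [y, bt]
  push_cast
  field_simp
  ring

theorem y_v (h : s.IsSol) : HasV s.w s.y (fun p => s.bev p - s.fv p) := by
  intro u v hu huv hv
  have h0 := h.nu_ne' _ (show (u, v) ∈ reg s.w from ⟨hu, huv, hv⟩)
  have h1 : ∀ᶠ y in 𝓝 v, s.y (u, y) = s.bt (u, y) / s.nu (u, y) - s.f (u, y) := by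
    filter_upwards [Ioo_mem_nhds huv hv] with y hy
    exact h.y_eq (show (u, y) ∈ reg s.w from ⟨hu, hy.1, hy.2⟩)
  refine ((((h.bt_v u v hu huv hv).div (h.nu_v u v hu huv hv).ofReal_comp h0).sub
    (h.f_v u v hu huv hv)).congr_deriv ?_).congr_of_eventuallyEq h1
  simp only [bev, h1.self_of_nhds, btv_eq]
  field_simp
  ring

theorem y_u (h : s.IsSol) : HasU s.w s.y (fun p => s.beu p - s.fu p) := by
  intro u v hu huv hv
  have h0 := h.nu_ne' _ (show (u, v) ∈ reg s.w from ⟨hu.le, huv, hv⟩)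
  have h1 : ∀ᶠ y in 𝓝 u, s.y (y, v) = s.bt (y, v) / s.nu (y, v) - s.f (y, v) := by
    filter_upwards [Ioo_mem_nhds hu huv] with y hy
    exact h.y_eq (show (y, v) ∈ reg s.w from ⟨hy.1.le, hy.2, hv⟩)
  refine ((((h.bt_u u v hu huv hv).div (h.nu_u u v hu huv hv).ofReal_comp h0).sub
    (h.f_u u v hu huv hv)).congr_deriv ?_).congr_of_eventuallyEq h1
  simp only [beu, h1.self_of_nhds]
  field_simp
  ring

theorem Du_v (h : s.IsSol) : HasV s.w s.Du (fun p => s.fuv p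
    + (I * ((s.e * s.Av p : ℝ) : ℂ) * s.φ p + I * ((s.e * s.A p : ℝ) : ℂ) * s.fv p)) := by
  intro u v hu huv hv
  refine ((h.fu_v u v hu huv hv).add ((((h.A_v u v hu huv hv).const_mul
    s.e).ofReal_comp.const_mul I).mul (h.φ_v u v hu huv hv))).congr_deriv ?_
  simp only

/-- As a pairing of D_uφ with y, the Raychaudhuri term produces a Jacobian when differentiated in v.
-/
theorem Lu_eq_inner (h : s.IsSol) {p : ℝ × ℝ} (hp : p ∈ reg s.w) :
    s.Lu p = 4 * Real.pi * inner ℝ (s.Du p) (s.y p) := by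
  have := h.nu_ne p hp
  simp only [Lu, y]
  rw [← Complex.real_smul, real_inner_smul_right, real_inner_self_eq_norm_sq]
  ring

theorem Nv_eq_inner (h : s.IsSol) {p : ℝ × ℝ} (hp : p ∈ reg s.w) :
    s.Nv p = 4 * Real.pi * inner ℝ (s.fv p) (s.x p) := by
  have := h.lam_ne p hp
  simp only [Nv, x]
  rw [← Complex.real_smul, real_inner_smul_right, real_inner_self_eq_norm_sq]
  ring

theorem Lu_v (h : s.IsSol) : HasV s.w s.Lu (fun p => 4 * Real.pi *
    (inner ℝ (s.Du p) (s.bev p - s.fv p) + inner ℝ (s.fuv p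
    + (I * ((s.e * s.Av p : ℝ) : ℂ) * s.φ p + I * ((s.e * s.A p : ℝ) : ℂ) * s.fv p)) (s.y p))) := by
  intro u v hu huv hv
  have h1 : ∀ᶠ y in 𝓝 v, s.Lu (u, y) = 4 * Real.pi * inner ℝ (s.Du (u, y)) (s.y (u, y)) := by
    filter_upwards [Ioo_mem_nhds huv hv] with y hy
    exact h.Lu_eq_inner (show (u, y) ∈ reg s.w from ⟨hu, hy.1, hy.2⟩)
  exact (((h.Du_v u v hu huv hv).inner ℝ (h.y_v u v hu huv hv)).const_mul _).congr_of_eventuallyEq h1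

theorem Nv_u (h : s.IsSol) : HasU s.w s.Nv (fun p => 4 * Real.pi *
    (inner ℝ (s.fv p) (s.au p - s.fu p) + inner ℝ (s.fuv p) (s.x p))) := by
  intro u v hu huv hv
  have h1 : ∀ᶠ y in 𝓝 u, s.Nv (y, v) = 4 * Real.pi * inner ℝ (s.fv (y, v)) (s.x (y, v)) := by
    filter_upwards [Ioo_mem_nhds hu huv] with y hy
    exact h.Nv_eq_inner (show (y, v) ∈ reg s.w from ⟨hy.1.le, hy.2, hv⟩)
  exact (((h.fv_u u v hu huv hv).inner ℝ (h.x_u u v hu huv hv)).const_mul _).congr_of_eventuallyEq h1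

/-- ∂_u∂_v log(λ/(1-μ)) = ∂_v`Lu`. Both this and ∂_u of 4π⟨∂_vφ, y⟩ contain 4π⟨∂_u∂_vφ, y⟩, and
these cancel in the difference. What remains is the real part of J2, and `Ev` accounts for D_uφ
differing from ∂_uφ. -/
theorem Lh_u (h : s.IsSol) :
    HasU s.w s.Lh (fun p => 4 * Real.pi * ((s.J2 p).re + s.Ev p)) := by
  have hne := h.lam_ne
  have hr := h.r_ne
  have hU : HasU s.w (fun p => Real.log (s.lam p) - Real.log (1 - s.mu p)) s.Lu := by
    intro u v hu huv hv
    have hp : (u, v) ∈ reg s.w := ⟨hu.le, huv, hv⟩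
    have h0 := h.lam_ne _ hp
    have h1 := h.one_sub_mu_ne _ hp
    have h2 := h.r_ne _ hp
    refine (((h.lam_u u v hu huv hv).log h0).sub
      (((h.mu_u u v hu huv hv).const_sub 1).log h1)).congr_deriv ?_
    simp only [muu, lk]
    field_simp
    ring
  have hV : HasVi s.w (fun p => Real.log (s.lam p) - Real.log (1 - s.mu p))
      (fun p => s.lamv p / s.lam p + s.Nv p - s.lam p * (s.pm p / s.r p)) := by
    intro u v hu huv hv
    have hp : (u, v) ∈ reg s.w := ⟨hu.le, huv, hv⟩
    have h0 := h.lam_ne _ hp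
    have h1 := h.one_sub_mu_ne _ hp
    have h2 := h.r_ne _ hp
    refine (((h.lam_v u v hu.le huv hv).log h0).sub
      (((h.mu_v u v hu.le huv hv).const_sub 1).log h1)).congr_deriv ?_
    simp only [muv]
    field_simp
    ring
  -- The v-derivative of log(λ/(1-μ)) is differentiable in u because the u-derivative `Lu` has a
  -- continuous v-derivative.
  have hm := hU.mixed hV h.Lu_v.toVi h.cLu (by fun_prop (disch := assumption))
  intro u v hu huv hv
  refine ((hm u v hu huv hv).sub (((h.fv_u u v hu huv hv).inner ℝ
    (h.y_u u v hu huv hv)).const_mul (4 * Real.pi))).congr_deriv ?_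
  simp only [J2, Ev, Du, inner_add_left, inner_sub_right]
  have h1 := real_inner_comm (s.fu (u, v)) (s.fv (u, v))
  have h2 : (((starRingEnd ℂ) (s.fu (u, v)) * s.bev (u, v) -
      (starRingEnd ℂ) (s.fv (u, v)) * s.beu (u, v)).re : ℝ)
      = inner ℝ (s.fu (u, v)) (s.bev (u, v)) - inner ℝ (s.fv (u, v)) (s.beu (u, v)) := by
    rw [Complex.sub_re, Complex.inner, Complex.inner]
    simp only [mul_comm]
  rw [h2]
  linear_combination (4 * Real.pi) * h1

/-- Same cancellation as in `Lh_u`. No charge correction appears, since x contains the plain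
derivative ∂_vφ. -/
theorem Nh_v (h : s.IsSol) : HasVi s.w s.Nh (fun p => -(4 * Real.pi * (s.J1 p).re)) := by
  have hne := h.nu_ne
  have hr := h.r_ne
  have hV : HasVi s.w (fun p => Real.log (s.nu p) - Real.log (1 - s.mu p)) s.Nv := by
    intro u v hu huv hv
    have hp : (u, v) ∈ reg s.w := ⟨hu.le, huv, hv⟩
    have h0 := h.nu_ne _ hp
    have h1 := h.one_sub_mu_ne _ hp
    have h2 := h.r_ne _ hp
    refine (((h.nu_v u v hu.le huv hv).log h0).sub
      (((h.mu_v u v hu.le huv hv).const_sub 1).log h1)).congr_deriv ?_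
    simp only [muv, lk]
    field_simp
    ring
  have hU : HasU s.w (fun p => Real.log (s.nu p) - Real.log (1 - s.mu p))
      (fun p => s.nuu p / s.nu p + s.Lu p - s.nu p * (s.pm p / s.r p)) := by
    intro u v hu huv hv
    have hp : (u, v) ∈ reg s.w := ⟨hu.le, huv, hv⟩
    have h0 := h.nu_ne _ hp
    have h1 := h.one_sub_mu_ne _ hp
    have h2 := h.r_ne _ hp
    refine (((h.nu_u u v hu huv hv).log h0).sub
      (((h.mu_u u v hu huv hv).const_sub 1).log h1)).congr_deriv ?_
    simp only [muu]
    field_simp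
    ring
  have hm := HasVi.mixed hU hV h.Nv_u h.cNv (by fun_prop (disch := assumption))
  intro u v hu huv hv
  refine ((hm u v hu huv hv).sub (((h.fu_v u v hu.le huv hv).inner ℝ
    (h.x_v u v hu.le huv hv)).const_mul (4 * Real.pi))).congr_deriv ?_
  simp only [J1, inner_sub_right]
  have h1 := real_inner_comm (s.fu (u, v)) (s.fv (u, v))
  have h2 : (((starRingEnd ℂ) (s.fu (u, v)) * s.av (u, v) -
      (starRingEnd ℂ) (s.fv (u, v)) * s.au (u, v)).re : ℝ)
      = inner ℝ (s.fu (u, v)) (s.av (u, v)) - inner ℝ (s.fv (u, v)) (s.au (u, v)) := by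
    rw [Complex.sub_re, Complex.inner, Complex.inner]
    simp only [mul_comm]
  rw [h2]
  linear_combination (-(4 * Real.pi)) * h1

end IsSol
end Reduced

end ChargedScalar
end

open Set Filter Topology MeasureTheory
open scoped ENNReal NNReal

noncomputable section

namespace ChargedScalar

namespace Reduced

open Complex (I)

variable {s : Reduced}

theorem ofReal_inner_eq (a b : ℂ) : ((inner ℝ a b : ℝ) : ℂ) =
    ((starRingEnd ℂ) a * b + a * (starRingEnd ℂ) b) / 2 := by
  apply Complex.ext
  · simp [Complex.inner]
    ring
  · simp
    ring

namespace IsSol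

/-! ### Algebraic relations between the Jacobians -/

/-- Each product now pairs a derivative of φ with a quantity having a transverse majorant (`g`) or
of charge size, and the rest is a small factor x times J3. -/
theorem J1_eq (h : s.IsSol) {p : ℝ × ℝ} (hp : p ∈ reg s.w) :
    s.J1 p = ((starRingEnd ℂ) (s.fu p) * s.g p + (starRingEnd ℂ) (s.fv p) * (I * s.ePsi p)) / s.lam p
      + s.x p * (starRingEnd ℂ) (s.J3 p) := by
  have h0 := h.lam_ne' p hp
  simp only [J1, av, au, g, J3, map_div₀, map_sub, map_mul, Complex.conj_ofReal]
  field_simp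
  ring

theorem J2_eq (h : s.IsSol) {p : ℝ × ℝ} (hp : p ∈ reg s.w) :
    s.J2 p = -((starRingEnd ℂ) (s.fu p) * (I * s.eWq p) + (starRingEnd ℂ) (s.fv p) * s.hh p) / s.nu p
      + s.y p * (starRingEnd ℂ) (s.J4 p) := by
  have h0 := h.nu_ne' p hp
  simp only [J2, bev, beu, hh, J4, map_div₀, map_sub, map_mul, Complex.conj_ofReal]
  field_simp
  ring

theorem Jna_eq (h : s.IsSol) {p : ℝ × ℝ} (hp : p ∈ reg s.w) :
    s.Jna p = (((s.nuu p / s.nu p : ℝ) : ℂ) * s.g p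
      + ((s.lam p * (s.pm p / s.r p) : ℝ) : ℂ) * (I * s.ePsi p)) / s.lam p - s.x p * s.Jnl p := by
  have h0 := h.lam_ne' p hp
  have h1 := h.nu_ne' p hp
  have h2 := h.r_ne' p hp
  simp only [Jna, av, au, g, Jnl, lk]
  push_cast
  field_simp
  ring

/-- Inserting the definition of `Nh`, the real inner products with x combine antisymmetrically into
`Jff`. This term is special to complex fields; it vanishes for real φ. -/
theorem JN_eq (h : s.IsSol) {p : ℝ × ℝ} (hp : p ∈ reg s.w) :
    s.JN p = s.Nh p * s.fv p + 2 * Real.pi * s.x p * s.Jff p := by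
  rw [JN, h.Nv_eq_inner hp, Nh, Jff]
  push_cast
  rw [ofReal_inner_eq, ofReal_inner_eq]
  ring

theorem Lu_eq_inner' (h : s.IsSol) {p : ℝ × ℝ} (hp : p ∈ reg s.w) :
    s.Lu p = 4 * Real.pi * (inner ℝ (s.fu p) (s.y p) + s.E p) := by
  rw [h.Lu_eq_inner hp, Du, inner_add_left, E]

/-- As `JN_eq` with y in place of x. `Lu` contains D_uφ rather than ∂_uφ, and the discrepancy is
`E`. -/
theorem JL_eq (h : s.IsSol) {p : ℝ × ℝ} (hp : p ∈ reg s.w) :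
    s.JL p = 4 * Real.pi * s.E p * s.fv p - s.Lh p * s.fu p
      + 2 * Real.pi * s.y p * s.Jff p := by
  rw [JL, h.Lu_eq_inner' hp, Lh, Jff]
  push_cast
  rw [ofReal_inner_eq, ofReal_inner_eq]
  ring

/-- log λ = log|ν| + log(λ/(1-μ)) - log(|ν|/(1-μ)), and the Jacobian is linear in its first entry.
-/
theorem J3_eq (h : s.IsSol) {p : ℝ × ℝ} (hp : p ∈ reg s.w) :
    s.J3 p = s.J4 p + s.JL p - s.JN p := by
  have h0 := h.lam_ne' p hp
  have h1 := h.nu_ne' p hp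
  simp only [J3, J4, JL, JN, lk]
  push_cast
  field_simp
  ring

/-- The v- and u-derivatives of log λ are expressed through `Lh` and `Nh`; the remaining pairings
with x and y collect into one inner product with J4. -/
theorem Jnl_eq (h : s.IsSol) {p : ℝ × ℝ} (hp : p ∈ reg s.w) :
    s.Jnl p = s.nuu p / s.nu p * s.Lh p + 4 * Real.pi * inner ℝ (s.J4 p) (s.y p - s.x p)
      + s.lam p * (s.pm p / s.r p) * (s.Nh p - 4 * Real.pi * s.E p) := by
  have h1 := h.nu_ne p hp
  have e1 : s.J4 p = (s.nuu p / s.nu p) • s.fv p - (s.lam p * (s.pm p / s.r p)) • s.fu p := by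
    have h1 := h.nu_ne' p hp
    simp only [J4, lk, Complex.real_smul]
    push_cast
    field_simp
  rw [e1, Nh, Lh, Jnl, h.Nv_eq_inner hp, h.Lu_eq_inner' hp]
  simp only [inner_sub_left, inner_sub_right, real_inner_smul_left]
  ring

/-! ### Pointwise bounds for the Jacobians -/

theorem norm_div_lam_le (h : s.IsSol) {p : ℝ × ℝ} (hp : p ∈ reg s.w) (z : ℂ) :
    ‖z / s.lam p‖ ≤ 12 / 5 * ‖z‖ := by
  have h0 := h.lam_ge p hp
  have h1 := h.lam_pos hp
  rw [norm_div, Complex.norm_real, Real.norm_of_nonneg h1.le, div_le_iff₀ h1]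
  nlinarith [norm_nonneg z]

theorem norm_div_nu_le (h : s.IsSol) {p : ℝ × ℝ} (hp : p ∈ reg s.w) (z : ℂ) :
    ‖z / s.nu p‖ ≤ 18 / 5 * ‖z‖ := by
  have h0 := h.nu_le hp
  have h1 := h.nu_neg p hp
  rw [norm_div, Complex.norm_real, Real.norm_of_nonpos h1.le, div_le_iff₀ (by linarith)]
  nlinarith [norm_nonneg z]

theorem norm_J1_le (h : s.IsSol) {p : ℝ × ℝ} (hp : p ∈ reg s.w) :
    ‖s.J1 p‖ ≤ 12 / 5 * (‖s.fu p‖ * ‖s.g p‖ + ‖s.fv p‖ * (s.Z / 50 / s.w))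
      + 10 * s.dl * ‖s.J3 p‖ := by
  rw [h.J1_eq hp]
  refine (norm_add_le _ _).trans (add_le_add ((h.norm_div_lam_le hp _).trans ?_) ?_)
  · refine mul_le_mul_of_nonneg_left ((norm_add_le _ _).trans ?_) (by norm_num)
    simp only [norm_mul, RCLike.norm_conj, Complex.norm_I, one_mul]
    gcongr
    exact h.norm_ePsi_le hp
  · rw [norm_mul, RCLike.norm_conj]
    gcongr
    exact h.norm_x_le hp

theorem norm_eWq_le (h : s.IsSol) {p : ℝ × ℝ} (hp : p ∈ reg s.w) :
    ‖s.eWq p‖ ≤ s.Z / 200 / s.w := by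
  have h1 := h.norm_eWq_φ_le hp
  simp only [eWq, ← mul_assoc]
  refine h1.trans (le_of_eq ?_)
  ring

theorem norm_J2_le (h : s.IsSol) {p : ℝ × ℝ} (hp : p ∈ reg s.w) :
    ‖s.J2 p‖ ≤ 18 / 5 * (‖s.fu p‖ * (s.Z / 200 / s.w) + ‖s.fv p‖ * ‖s.hh p‖)
      + 15 * s.dl * ‖s.J4 p‖ := by
  rw [h.J2_eq hp]
  refine (norm_add_le _ _).trans (add_le_add ((h.norm_div_nu_le hp _).trans ?_) ?_)
  · refine mul_le_mul_of_nonneg_left ?_ (by norm_num)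
    rw [norm_neg]
    refine (norm_add_le _ _).trans ?_
    simp only [norm_mul, RCLike.norm_conj, Complex.norm_I, one_mul]
    gcongr
    exact h.norm_eWq_le hp
  · rw [norm_mul, RCLike.norm_conj]
    gcongr
    exact h.norm_y_le hp

theorem norm_Jna_le (h : s.IsSol) {p : ℝ × ℝ} (hp : p ∈ reg s.w) :
    ‖s.Jna p‖ ≤ 12 / 5 * (|s.nuu p / s.nu p| * ‖s.g p‖
      + |s.lam p * (s.pm p / s.r p)| * (s.Z / 50 / s.w)) + 10 * s.dl * |s.Jnl p| := by
  rw [h.Jna_eq hp]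
  refine (norm_sub_le _ _).trans (add_le_add ((h.norm_div_lam_le hp _).trans ?_) ?_)
  · refine mul_le_mul_of_nonneg_left ((norm_add_le _ _).trans ?_) (by norm_num)
    simp only [norm_mul, Complex.norm_real, Real.norm_eq_abs, Complex.norm_I, one_mul, abs_mul]
    have := h.norm_ePsi_le hp
    gcongr
  · rw [norm_mul, Complex.norm_real, Real.norm_eq_abs]
    gcongr
    exact h.norm_x_le hp

theorem two_pi_le : 2 * Real.pi ≤ 6.3 := by linarith [Real.pi_lt_d2]

theorem norm_JN_le (h : s.IsSol) {p : ℝ × ℝ} (hp : p ∈ reg s.w) :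
    ‖s.JN p‖ ≤ ‖s.fv p‖ * ‖s.Nh p‖ + 63 * s.dl * ‖s.Jff p‖ := by
  rw [h.JN_eq hp]
  refine (norm_add_le _ _).trans (add_le_add ?_ ?_)
  · rw [norm_mul, Complex.norm_real, mul_comm]
  · have e : 2 * (Real.pi : ℂ) * s.x p * s.Jff p = ((2 * Real.pi : ℝ) : ℂ) * (s.x p * s.Jff p) := by
      push_cast; ring
    rw [e, norm_mul, norm_mul, Complex.norm_real, Real.norm_of_nonneg (by positivity)]
    calc 2 * Real.pi * (‖s.x p‖ * ‖s.Jff p‖) ≤ 6.3 * (10 * s.dl * ‖s.Jff p‖) := by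
          have := h.norm_x_le hp
          have := two_pi_le
          gcongr
      _ = _ := by ring

theorem abs_E_le (h : s.IsSol) {p : ℝ × ℝ} (hp : p ∈ reg s.w) :
    |s.E p| ≤ s.dl * (s.Z / 6 / s.w) := by
  have h0 := h.dl_nonneg
  have h1 := h.norm_eA_φ_le hp
  have h2 := h.norm_y_le hp
  have h3 := h.Zw_nonneg
  refine (abs_real_inner_le_norm _ _).trans ?_
  rw [mul_assoc, norm_mul, Complex.norm_I, one_mul]
  calc _ ≤ s.Z / s.w / 100 * (15 * s.dl) := by gcongr
    _ = 15 / 100 * (s.dl * (s.Z / s.w)) := by ring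
    _ ≤ 1 / 6 * (s.dl * (s.Z / s.w)) :=
        mul_le_mul_of_nonneg_right (by norm_num) (mul_nonneg h0 h3)
    _ = _ := by ring

theorem norm_JL_le (h : s.IsSol) {p : ℝ × ℝ} (hp : p ∈ reg s.w) :
    ‖s.JL p‖ ≤ s.dl * (‖s.fv p‖ * (2.1 * s.Z / s.w)) + ‖s.fu p‖ * ‖s.Lh p‖
      + 94.5 * s.dl * ‖s.Jff p‖ := by
  have h0 := h.dl_nonneg
  have h3 := h.Zw_nonneg
  rw [h.JL_eq hp]
  refine (norm_add_le _ _).trans (add_le_add ((norm_sub_le _ _).trans (add_le_add ?_ ?_)) ?_)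
  · have e : 4 * (Real.pi : ℂ) * s.E p * s.fv p = ((4 * Real.pi * s.E p : ℝ) : ℂ) * s.fv p := by
      push_cast; ring
    rw [e, norm_mul, Complex.norm_real, Real.norm_eq_abs, abs_mul, abs_of_nonneg (by positivity)]
    calc 4 * Real.pi * |s.E p| * ‖s.fv p‖ ≤ 12.6 * (s.dl * (s.Z / 6 / s.w)) * ‖s.fv p‖ := by
          have := h.abs_E_le hp
          have := four_pi_le
          gcongr
      _ = _ := by ring
  · rw [norm_mul, Complex.norm_real, mul_comm]
  · have e : 2 * (Real.pi : ℂ) * s.y p * s.Jff p = ((2 * Real.pi : ℝ) : ℂ) * (s.y p * s.Jff p) := by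
      push_cast; ring
    rw [e, norm_mul, norm_mul, Complex.norm_real, Real.norm_of_nonneg (by positivity)]
    calc 2 * Real.pi * (‖s.y p‖ * ‖s.Jff p‖) ≤ 6.3 * (15 * s.dl * ‖s.Jff p‖) := by
          have := h.norm_y_le hp
          have := two_pi_le
          gcongr
      _ = _ := by ring

theorem abs_Jnl_le (h : s.IsSol) {p : ℝ × ℝ} (hp : p ∈ reg s.w) :
    |s.Jnl p| ≤ |s.nuu p / s.nu p| * ‖s.Lh p‖ + 315 * s.dl * ‖s.J4 p‖
      + |s.lam p * (s.pm p / s.r p)| * ‖s.Nh p‖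
      + s.dl * (|s.lam p * (s.pm p / s.r p)| * (2.1 * s.Z / s.w)) := by
  have h0 := h.dl_nonneg
  have h3 := h.Zw_nonneg
  have h4 : |4 * Real.pi * s.E p| ≤ s.dl * (2.1 * s.Z / s.w) := by
    rw [abs_mul, abs_of_nonneg (by positivity)]
    calc 4 * Real.pi * |s.E p| ≤ 12.6 * (s.dl * (s.Z / 6 / s.w)) := by
          have := h.abs_E_le hp
          have := four_pi_le
          gcongr
      _ = _ := by ring
  have h5 : |4 * Real.pi * inner ℝ (s.J4 p) (s.y p - s.x p)| ≤ 315 * s.dl * ‖s.J4 p‖ := by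
    rw [abs_mul, abs_of_nonneg (by positivity)]
    calc 4 * Real.pi * |inner ℝ (s.J4 p) (s.y p - s.x p)|
        ≤ 12.6 * (‖s.J4 p‖ * (25 * s.dl)) := by
          have := four_pi_le
          have h6 : ‖s.y p - s.x p‖ ≤ 25 * s.dl := by
            linarith [norm_sub_le (s.y p) (s.x p), h.norm_y_le hp, h.norm_x_le hp]
          have := (abs_real_inner_le_norm (s.J4 p) (s.y p - s.x p)).trans
            (mul_le_mul_of_nonneg_left h6 (norm_nonneg _))
          gcongr
      _ = _ := by ring
  rw [h.Jnl_eq hp]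
  refine (abs_add_three _ _ _).trans ?_
  rw [abs_mul (s.nuu p / s.nu p), abs_mul (s.lam p * (s.pm p / s.r p)), ← Real.norm_eq_abs (s.Lh p)]
  have h6 : |s.Nh p - 4 * Real.pi * s.E p| ≤ ‖s.Nh p‖ + s.dl * (2.1 * s.Z / s.w) :=
    (abs_sub _ _).trans (add_le_add le_rfl h4)
  have h7 := mul_le_mul_of_nonneg_left h6 (abs_nonneg (s.lam p * (s.pm p / s.r p)))
  linarith

theorem norm_J3_le (h : s.IsSol) {p : ℝ × ℝ} (hp : p ∈ reg s.w) :
    ‖s.J3 p‖ ≤ ‖s.J4 p‖ + ‖s.JL p‖ + ‖s.JN p‖ := by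
  rw [h.J3_eq hp]
  exact (norm_sub_le _ _).trans (add_le_add (norm_add_le _ _) le_rfl)

/-! ### Bounds for the charge terms -/

theorem four_pi_eMr_le (h : s.IsSol) {p : ℝ × ℝ} (hp : p ∈ reg s.w) :
    s.e * s.M * (4 * Real.pi * s.e * s.r p * s.M) ≤ 1 / 100 / s.w := by
  have hw := h.w_pos
  have hr := h.r_pos p hp
  have h0 := h.eM_nonneg
  have h1 : s.e * s.M * s.r p ≤ 3 / 128 / s.w * (3 / 4 * s.w) := by
    have := h.eM_le
    have := h.r_le_w hp
    gcongr
  have h2 : (3 : ℝ) / 128 / s.w * (3 / 4 * s.w) = 9 / 512 := by field_simp; norm_num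
  calc s.e * s.M * (4 * Real.pi * s.e * s.r p * s.M)
      = 4 * Real.pi * (s.e * s.M) * (s.e * s.M * s.r p) := by ring
    _ ≤ 12.6 * (3 / 128 / s.w) * (9 / 512) := by
        have := h.eM_le
        have := four_pi_le
        rw [h2] at h1
        gcongr
    _ = 12.6 * 3 / 128 * 9 / 512 * (1 / s.w) := by ring
    _ ≤ 1 / 100 * (1 / s.w) := mul_le_mul_of_nonneg_right (by norm_num) (by positivity)
    _ = _ := by ring

theorem abs_qv_le (h : s.IsSol) {p : ℝ × ℝ} (hp : p ∈ reg s.w) :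
    |s.qv p| ≤ 4 * Real.pi * s.e * s.r p * s.M * ‖s.fv p‖ + |s.q p| / s.r p := by
  have hr := h.r_pos p hp
  have he := h.e_nonneg
  rw [qv]
  refine (abs_sub _ _).trans (add_le_add ?_ ?_)
  · rw [abs_neg, abs_mul, abs_of_nonneg (by positivity), mul_assoc _ s.M]
    gcongr
    refine (Complex.abs_im_le_norm _).trans ?_
    rw [norm_mul, RCLike.norm_conj]
    gcongr
    exact h.norm_φ_le hp
  · rw [abs_div, abs_of_pos hr, abs_mul, abs_of_pos (h.lam_pos hp)]
    gcongr
    have := h.lam_le' hp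
    nlinarith [abs_nonneg (s.q p)]

theorem abs_qu_le (h : s.IsSol) {p : ℝ × ℝ} (hp : p ∈ reg s.w) :
    |s.qu p| ≤ 4 * Real.pi * s.e * s.r p * s.M * ‖s.Du p‖ + |s.q p| / s.r p := by
  have hr := h.r_pos p hp
  have he := h.e_nonneg
  rw [qu]
  refine (abs_sub _ _).trans (add_le_add ?_ ?_)
  · rw [abs_mul, abs_of_nonneg (by positivity), mul_assoc _ s.M]
    gcongr
    refine (Complex.abs_im_le_norm _).trans ?_
    rw [norm_mul, RCLike.norm_conj]
    gcongr
    exact h.norm_φ_le hp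
  · rw [abs_div, abs_of_pos hr, abs_mul, abs_of_neg (h.nu_neg p hp)]
    gcongr
    have := h.nu_ge p hp
    nlinarith [abs_nonneg (s.q p)]

theorem eMqv_le (h : s.IsSol) {p : ℝ × ℝ} (hp : p ∈ reg s.w) :
    s.e * s.M * |s.qv p| ≤ ‖s.fv p‖ * (1 / 100 / s.w) + s.Z / s.w ^ 2 / 100 := by
  refine (mul_le_mul_of_nonneg_left (h.abs_qv_le hp) h.eM_nonneg).trans ?_
  rw [mul_add]
  refine add_le_add ?_ (h.eMqr_le hp)
  have := mul_le_mul_of_nonneg_right (h.four_pi_eMr_le hp) (norm_nonneg (s.fv p))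
  linarith

theorem eMqu_le (h : s.IsSol) {p : ℝ × ℝ} (hp : p ∈ reg s.w) :
    s.e * s.M * |s.qu p| ≤ ‖s.Du p‖ * (1 / 100 / s.w) + s.Z / s.w ^ 2 / 100 := by
  refine (mul_le_mul_of_nonneg_left (h.abs_qu_le hp) h.eM_nonneg).trans ?_
  rw [mul_add]
  refine add_le_add ?_ (h.eMqr_le hp)
  have := mul_le_mul_of_nonneg_right (h.four_pi_eMr_le hp) (norm_nonneg (s.Du p))
  linarith

theorem norm_charge_φ_le (h : s.IsSol) {p : ℝ × ℝ} (hp : p ∈ reg s.w) (c : ℝ) :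
    ‖((s.e * c : ℝ) : ℂ) * s.φ p‖ ≤ s.e * s.M * |c| := by
  rw [norm_mul, Complex.norm_real, Real.norm_eq_abs, abs_mul, abs_of_nonneg h.e_nonneg]
  have := mul_le_mul_of_nonneg_left (h.norm_φ_le hp) (mul_nonneg h.e_nonneg (abs_nonneg c))
  linarith

theorem norm_charge_le (h : s.IsSol) (c : ℝ) (z : ℂ) :
    ‖((s.e * c : ℝ) : ℂ) * z‖ ≤ s.e * s.M * |c| * ‖z‖ := by
  rw [norm_mul, Complex.norm_real, Real.norm_eq_abs, abs_mul, abs_of_nonneg h.e_nonneg]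
  have h1 := h.M_ge
  have h2 : 0 ≤ s.e * |c| * ‖z‖ := by have := h.e_nonneg; positivity
  nlinarith

/-- The weights are arranged so that all powers of w cancel after integration over the triangle. The
linear terms Z/(50w²) and |∂_vφ|/(200w) are the ones that later require absorption. -/
theorem norm_ePsiv_le (h : s.IsSol) {p : ℝ × ℝ} (hp : p ∈ reg s.w) :
    ‖s.ePsiv p‖ ≤ s.Z / 50 / s.w ^ 2 + ‖s.atv p‖ * (s.Z / 100 / s.w)
      + |s.lamv p| * (s.Z / 100 / s.w)
      + (|s.lamv p / s.lam p| + s.Nv p) * (s.Z / 200 / s.w) + ‖s.fv p‖ * (1 / 200 / s.w)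
      + ‖s.fv p‖ * (s.Z / 100 / s.w) := by
  have hZw := h.Zw_nonneg
  have hZw2 := h.Zw2_nonneg
  have hW := h.W_pos hp
  have hW2 := h.W_le hp
  have hM := h.M_pos
  have heM := h.eM_nonneg
  have hN := h.Nv_nonneg hp
  have e1 : s.ePsiv p = ((s.e * s.Av p : ℝ) : ℂ) * (s.r p * s.fv p + s.lam p * s.φ p)
      + ((s.e * s.A p : ℝ) : ℂ) * s.atv p + ((s.e * s.A p : ℝ) : ℂ) * (s.lamv p * s.φ0)
      - ((s.e * (s.Wv p * s.q p) : ℝ) : ℂ) * s.φ p - ((s.e * (s.W p * s.qv p) : ℝ) : ℂ) * s.φ p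
      - ((s.e * (s.W p * s.q p) : ℝ) : ℂ) * s.fv p := by
    simp only [ePsiv]; push_cast; ring
  have b1 : ‖((s.e * s.Av p : ℝ) : ℂ) * (s.r p * s.fv p + s.lam p * s.φ p)‖
      ≤ s.Z / s.w ^ 2 / 100 := by
    rw [norm_mul, Complex.norm_real, Real.norm_eq_abs, abs_mul, abs_of_nonneg h.e_nonneg]
    have := mul_le_mul_of_nonneg_left (h.norm_dv_rφ_le hp)
      (mul_nonneg h.e_nonneg (abs_nonneg (s.Av p)))
    linarith [h.eMAv_le hp]
  have b2 : ‖((s.e * s.A p : ℝ) : ℂ) * s.atv p‖ ≤ s.Z / s.w / 100 * ‖s.atv p‖ :=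
    (h.norm_charge_le _ _).trans (mul_le_mul_of_nonneg_right (h.eMA_le hp) (norm_nonneg _))
  have b3 : ‖((s.e * s.A p : ℝ) : ℂ) * (s.lamv p * s.φ0)‖ ≤ s.Z / s.w / 100 * |s.lamv p| := by
    rw [norm_mul, norm_mul, Complex.norm_real, Complex.norm_real, Real.norm_eq_abs,
      Real.norm_eq_abs, abs_mul, abs_of_nonneg h.e_nonneg]
    have h1 := mul_le_mul_of_nonneg_right (h.eMA_le hp) (abs_nonneg (s.lamv p))
    have h2 : ‖s.φ0‖ ≤ s.M := by linarith [h.φ0_le]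
    have h3 := mul_le_mul_of_nonneg_left h2
      (mul_nonneg (mul_nonneg h.e_nonneg (abs_nonneg (s.A p))) (abs_nonneg (s.lamv p)))
    linarith
  have b4 : ‖((s.e * (s.Wv p * s.q p) : ℝ) : ℂ) * s.φ p‖
      ≤ (|s.lamv p / s.lam p| + s.Nv p) * (s.Z / 200 / s.w) := by
    refine (h.norm_charge_φ_le hp _).trans ?_
    rw [Wv, abs_mul, abs_mul, abs_of_pos hW]
    have h1 : |s.lamv p / s.lam p + s.Nv p| ≤ |s.lamv p / s.lam p| + s.Nv p := by
      refine (abs_add_le _ _).trans (le_of_eq ?_); rw [abs_of_nonneg hN]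
    calc s.e * s.M * (s.W p * |s.lamv p / s.lam p + s.Nv p| * |s.q p|)
        = s.W p * |s.lamv p / s.lam p + s.Nv p| * (s.e * s.M * |s.q p|) := by ring
      _ ≤ 1 / 2 * (|s.lamv p / s.lam p| + s.Nv p) * (s.Z / s.w / 100) := by
          have := h.eMq_le hp
          gcongr
      _ = _ := by ring
  have b5 : ‖((s.e * (s.W p * s.qv p) : ℝ) : ℂ) * s.φ p‖
      ≤ ‖s.fv p‖ * (1 / 200 / s.w) + s.Z / s.w ^ 2 / 200 := by
    refine (h.norm_charge_φ_le hp _).trans ?_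
    rw [abs_mul, abs_of_pos hW]
    calc s.e * s.M * (s.W p * |s.qv p|) = s.W p * (s.e * s.M * |s.qv p|) := by ring
      _ ≤ 1 / 2 * (‖s.fv p‖ * (1 / 100 / s.w) + s.Z / s.w ^ 2 / 100) := by
          have := h.eMqv_le hp
          gcongr
      _ = _ := by ring
  have b6 : ‖((s.e * (s.W p * s.q p) : ℝ) : ℂ) * s.fv p‖ ≤ ‖s.fv p‖ * (s.Z / 100 / s.w) := by
    refine (h.norm_charge_le _ _).trans ?_
    rw [abs_mul, abs_of_pos hW]
    calc s.e * s.M * (s.W p * |s.q p|) * ‖s.fv p‖ = s.W p * (s.e * s.M * |s.q p|) * ‖s.fv p‖ := by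
          ring
      _ ≤ 1 * (s.Z / s.w / 100) * ‖s.fv p‖ := by
          have := h.eMq_le hp
          gcongr
          linarith
      _ = _ := by ring
  rw [e1]
  refine (norm_sub_le _ _).trans ((add_le_add ((norm_sub_le _ _).trans (add_le_add
    ((norm_sub_le _ _).trans (add_le_add ((norm_add_le _ _).trans (add_le_add
      ((norm_add_le _ _).trans (add_le_add b1 b2)) b3)) b4)) b5)) b6).trans ?_)
  have e2 : s.Z / 50 / s.w ^ 2 = 2 * (s.Z / s.w ^ 2 / 100) := by ring
  have e3 : s.Z / 100 / s.w = s.Z / s.w / 100 := by ring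
  rw [e2, e3]
  linarith [hZw2]

theorem norm_eWqu_le (h : s.IsSol) {p : ℝ × ℝ} (hp : p ∈ reg s.w) :
    ‖s.eWqu p‖ ≤ s.Z / 200 / s.w ^ 2
      + (|s.nuu p / s.nu p| + |s.Lu p|) * (s.Z / 200 / s.w) + ‖s.Du p‖ * (1 / 200 / s.w)
      + ‖s.fu p‖ * (s.Z / 100 / s.w) := by
  have hZw := h.Zw_nonneg
  have hZw2 := h.Zw2_nonneg
  have hW := h.W_pos hp
  have hW2 := h.W_le hp
  have hM := h.M_pos
  have heM := h.eM_nonneg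
  have e1 : s.eWqu p = ((s.e * (s.Wu p * s.q p) : ℝ) : ℂ) * s.φ p
      + ((s.e * (s.W p * s.qu p) : ℝ) : ℂ) * s.φ p
      + ((s.e * (s.W p * s.q p) : ℝ) : ℂ) * s.fu p := by
    simp only [eWqu]; push_cast; ring
  have b4 : ‖((s.e * (s.Wu p * s.q p) : ℝ) : ℂ) * s.φ p‖
      ≤ (|s.nuu p / s.nu p| + |s.Lu p|) * (s.Z / 200 / s.w) := by
    refine (h.norm_charge_φ_le hp _).trans ?_
    rw [Wu, abs_mul, abs_mul, abs_of_pos hW]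
    have h1 := abs_add_le (s.nuu p / s.nu p) (s.Lu p)
    calc s.e * s.M * (s.W p * |s.nuu p / s.nu p + s.Lu p| * |s.q p|)
        = s.W p * |s.nuu p / s.nu p + s.Lu p| * (s.e * s.M * |s.q p|) := by ring
      _ ≤ 1 / 2 * (|s.nuu p / s.nu p| + |s.Lu p|) * (s.Z / s.w / 100) := by
          have := h.eMq_le hp
          gcongr
      _ = _ := by ring
  have b5 : ‖((s.e * (s.W p * s.qu p) : ℝ) : ℂ) * s.φ p‖
      ≤ ‖s.Du p‖ * (1 / 200 / s.w) + s.Z / s.w ^ 2 / 200 := by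
    refine (h.norm_charge_φ_le hp _).trans ?_
    rw [abs_mul, abs_of_pos hW]
    calc s.e * s.M * (s.W p * |s.qu p|) = s.W p * (s.e * s.M * |s.qu p|) := by ring
      _ ≤ 1 / 2 * (‖s.Du p‖ * (1 / 100 / s.w) + s.Z / s.w ^ 2 / 100) := by
          have := h.eMqu_le hp
          gcongr
      _ = _ := by ring
  have b6 : ‖((s.e * (s.W p * s.q p) : ℝ) : ℂ) * s.fu p‖ ≤ ‖s.fu p‖ * (s.Z / 100 / s.w) := by
    refine (h.norm_charge_le _ _).trans ?_
    rw [abs_mul, abs_of_pos hW]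
    calc s.e * s.M * (s.W p * |s.q p|) * ‖s.fu p‖ = s.W p * (s.e * s.M * |s.q p|) * ‖s.fu p‖ := by
          ring
      _ ≤ 1 * (s.Z / s.w / 100) * ‖s.fu p‖ := by
          have := h.eMq_le hp
          gcongr
          linarith
      _ = _ := by ring
  rw [e1]
  refine (norm_add_le _ _).trans ((add_le_add ((norm_add_le _ _).trans (add_le_add b4 b5)) b6).trans
    ?_)
  have e2 : s.Z / 200 / s.w ^ 2 = s.Z / s.w ^ 2 / 200 := by ring
  rw [e2]
  linarith

end IsSol
end Reduced

end ChargedScalar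
end

open Set Filter Topology MeasureTheory
open scoped ENNReal NNReal

noncomputable section

namespace ChargedScalar

/-! ### Boundedness on the triangle -/

/-- `F` is bounded on the triangle. -/
def BddReg {E : Type*} [Norm E] (w : ℝ) (F : ℝ × ℝ → E) : Prop :=
  ∃ B : ℝ, 0 ≤ B ∧ ∀ p ∈ reg w, ‖F p‖ ≤ B

namespace BddReg

variable {w : ℝ} {E E' : Type*} [SeminormedAddCommGroup E] [SeminormedAddCommGroup E']

theorem intro {F : ℝ × ℝ → E} {B : ℝ} (h : ∀ p ∈ reg w, ‖F p‖ ≤ B) : BddReg w F :=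
  ⟨max B 0, le_max_right _ _, fun p hp => (h p hp).trans (le_max_left _ _)⟩

theorem of_le {F : ℝ × ℝ → E} {G : ℝ × ℝ → ℝ} (hG : BddReg w G)
    (h : ∀ p ∈ reg w, ‖F p‖ ≤ G p) : BddReg w F := by
  obtain ⟨B, hB, hG⟩ := hG
  exact ⟨B, hB, fun p hp => ((h p hp).trans (le_abs_self _)).trans (hG p hp)⟩

theorem norm {F : ℝ × ℝ → E} (hF : BddReg w F) : BddReg w fun p => ‖F p‖ := by
  obtain ⟨B, hB, hF⟩ := hF
  exact ⟨B, hB, fun p hp => (norm_norm _).trans_le (hF p hp)⟩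

theorem abs {F : ℝ × ℝ → ℝ} (hF : BddReg w F) : BddReg w fun p => |F p| := hF.norm

theorem const (c : E) : BddReg w fun _ => c := ⟨‖c‖, norm_nonneg _, fun _ _ => le_rfl⟩

theorem add {F G : ℝ × ℝ → E} (hF : BddReg w F) (hG : BddReg w G) : BddReg w fun p => F p + G p := by
  obtain ⟨B, hB, hF⟩ := hF
  obtain ⟨C, hC, hG⟩ := hG
  exact ⟨B + C, add_nonneg hB hC, fun p hp =>
    (norm_add_le _ _).trans (add_le_add (hF p hp) (hG p hp))⟩

theorem mul {F G : ℝ × ℝ → ℝ} (hF : BddReg w F) (hG : BddReg w G) :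
    BddReg w fun p => F p * G p := by
  obtain ⟨B, hB, hF⟩ := hF
  obtain ⟨C, hC, hG⟩ := hG
  refine ⟨B * C, mul_nonneg hB hC, fun p hp => ?_⟩
  rw [norm_mul]
  have := hF p hp
  have := hG p hp
  gcongr

end BddReg

/-- A majorant depending on v alone survives the limit u → v, so it bounds the trace on the axis.
This carries information from incoming to outgoing integration. -/
theorem MajV.axis {E : Type*} [NormedAddCommGroup E] {w c : ℝ} {F : ℝ × ℝ → E} {G : ℝ → E}
    (h : MajV w (fun p => ‖F p‖) c)
    (hG : ∀ v, 0 < v → v < w → Tendsto (fun u => F (u, v)) (𝓝[<] v) (𝓝 (G v))) :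
    ∃ g : ℝ → ℝ≥0∞, (∀ v, 0 < v → v < w → ‖G v‖ₑ ≤ g v) ∧
      ∫⁻ v in Ioo 0 w, g v ≤ ENNReal.ofReal c := by
  obtain ⟨g, hg, hgc⟩ := h.ex
  refine ⟨g, fun v hv0 hv => ?_, hgc⟩
  refine le_of_tendsto (hG v hv0 hv).enorm ?_
  filter_upwards [Ioo_mem_nhdsLT hv0] with x hx
  rw [← ofReal_norm]
  exact hg (x, v) ⟨hx.1.le, hx.2, hv⟩

namespace Reduced

open Complex (I)

variable {s : Reduced}

namespace IsSol

theorem bdd_r (h : s.IsSol) : BddReg s.w s.r :=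
  .intro (B := 3 / 4 * s.w) fun p hp => by
    rw [Real.norm_of_nonneg (h.r_pos p hp).le]; exact h.r_le_w hp

theorem bdd_lamv (h : s.IsSol) : BddReg s.w s.lamv := by
  obtain ⟨B, hB⟩ := h.bdd
  exact .intro fun p hp => (hB p hp).1

theorem bdd_nuu (h : s.IsSol) : BddReg s.w s.nuu := by
  obtain ⟨B, hB⟩ := h.bdd
  exact .intro fun p hp => (hB p hp).2.1

theorem bdd_fu (h : s.IsSol) : BddReg s.w s.fu := by
  obtain ⟨B, hB⟩ := h.bdd
  exact .intro fun p hp => (hB p hp).2.2.1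

theorem bdd_fv (h : s.IsSol) : BddReg s.w s.fv := by
  obtain ⟨B, hB⟩ := h.bdd
  exact .intro fun p hp => (hB p hp).2.2.2.1

theorem bdd_atv (h : s.IsSol) : BddReg s.w s.atv := by
  obtain ⟨B, hB⟩ := h.bdd
  exact .intro fun p hp => (hB p hp).2.2.2.2.1

theorem bdd_bu (h : s.IsSol) : BddReg s.w s.bu := by
  obtain ⟨B, hB⟩ := h.bdd
  exact .intro fun p hp => (hB p hp).2.2.2.2.2.1

theorem bdd_lk (h : s.IsSol) : BddReg s.w s.lk := by
  obtain ⟨B, hB⟩ := h.bdd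
  exact .intro fun p hp => (hB p hp).2.2.2.2.2.2

theorem bdd_f (h : s.IsSol) : BddReg s.w s.f := .intro fun _ hp => h.norm_f_le hp

theorem bdd_Du (h : s.IsSol) : BddReg s.w s.Du :=
  (h.bdd_fu.norm.add (.const (s.Z / s.w / 100))).of_le fun _ hp => h.norm_Du_le hp

theorem abs_div_lam_le (h : s.IsSol) {p : ℝ × ℝ} (hp : p ∈ reg s.w) (z : ℝ) :
    |z / s.lam p| ≤ 12 / 5 * |z| := by
  have h0 := h.lam_ge p hp
  have h1 := h.lam_pos hp
  rw [abs_div, abs_of_pos h1, div_le_iff₀ h1]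
  nlinarith [abs_nonneg z]

theorem abs_div_nu_le (h : s.IsSol) {p : ℝ × ℝ} (hp : p ∈ reg s.w) (z : ℝ) :
    |z / s.nu p| ≤ 18 / 5 * |z| := by
  have h0 := h.nu_le hp
  have h1 := h.nu_neg p hp
  rw [abs_div, abs_of_neg h1, div_le_iff₀ (by linarith)]
  nlinarith [abs_nonneg z]

theorem bdd_lamv_div (h : s.IsSol) : BddReg s.w fun p => s.lamv p / s.lam p :=
  ((BddReg.const (12 / 5)).mul h.bdd_lamv.abs).of_le fun _ hp => h.abs_div_lam_le hp _

theorem bdd_nuu_div (h : s.IsSol) : BddReg s.w fun p => s.nuu p / s.nu p :=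
  ((BddReg.const (18 / 5)).mul h.bdd_nuu.abs).of_le fun _ hp => h.abs_div_nu_le hp _

theorem bdd_Nv (h : s.IsSol) : BddReg s.w s.Nv :=
  ((BddReg.const 126).mul h.bdd_fv.norm).of_le fun p hp => by
    rw [Real.norm_of_nonneg (h.Nv_nonneg hp), h.Nv_eq hp]
    calc 4 * Real.pi * (‖s.x p‖ * ‖s.fv p‖) ≤ 12.6 * (10 * 1 * ‖s.fv p‖) := by
          have h1 := h.norm_x_le hp
          have h2 := four_pi_le
          have h3 : s.dl ≤ 1 := by linarith [h.dl_le]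
          gcongr
          linarith
      _ = _ := by ring

theorem bdd_Lu (h : s.IsSol) : BddReg s.w s.Lu :=
  ((BddReg.const 189).mul h.bdd_Du.norm).of_le fun p hp => by
    rw [h.Lu_eq hp, norm_neg, Real.norm_of_nonneg (by positivity)]
    calc 4 * Real.pi * (‖s.y p‖ * ‖s.Du p‖) ≤ 12.6 * (15 * 1 * ‖s.Du p‖) := by
          have h1 := h.norm_y_le hp
          have h2 := four_pi_le
          have h3 : s.dl ≤ 1 := by linarith [h.dl_le]
          gcongr
          linarith
      _ = _ := by ring

theorem r_ge (h : s.IsSol) {p : ℝ × ℝ} (hp : p ∈ reg s.w) : 5 / 12 * (p.2 - p.1) ≤ s.r p := by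
  obtain ⟨u, v⟩ := p
  obtain ⟨hu, huv, hv⟩ : 0 ≤ u ∧ u < v ∧ v < s.w := hp
  have hV : HasV s.w (fun p => s.r p - 5 / 12 * p.2) (fun p => s.lam p - 5 / 12) :=
    fun u v hu huv hv =>
      ((h.r_v u v hu huv hv).sub ((hasDerivAt_id v).const_mul (5 / 12 : ℝ))).congr_deriv (by simp)
  have hl : Tendsto (fun y => s.r (u, y) - 5 / 12 * y) (𝓝[>] u) (𝓝 (0 - 5 / 12 * u)) :=
    (h.r_axis u hu (huv.trans hv)).sub
      ((Continuous.tendsto (by fun_prop) u).mono_left nhdsWithin_le_nhds)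
  have := hV.axis_le (h.cr.sub (by fun_prop)) hu huv hv hl fun y hy1 hy2 => by
    linarith [h.lam_ge (u, y) ⟨hu, hy1, hy2.trans hv⟩]
  simp only at this ⊢
  linarith

/-- The charge aspect vanishes to second order on the axis. -/
theorem exists_abs_q_le (h : s.IsSol) : ∃ C : ℝ, 0 ≤ C ∧ ∀ p ∈ reg s.w, |s.q p| ≤ C * s.r p ^ 2 := by
  obtain ⟨B, hB0, hB⟩ := h.bdd_fv
  have he := h.e_nonneg
  have hM := h.M_pos
  refine ⟨12 / 5 * (4 * Real.pi * s.e * (s.M * B)), by positivity, ?_⟩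
  rintro ⟨u, v⟩ hp
  have hr := h.r_pos _ hp
  have h3 := h.r_ge hp
  have hp' := hp
  obtain ⟨hu, huv, hv⟩ : 0 ≤ u ∧ u < v ∧ v < s.w := hp'
  have hV : HasV s.w (fun p => s.r p * s.q p)
      (fun p => -(4 * Real.pi * s.e * s.r p ^ 2 * ((starRingEnd ℂ) (s.φ p) * s.fv p).im)) := by
    intro u v hu huv hv
    have h1 := h.r_ne _ (show (u, v) ∈ reg s.w from ⟨hu, huv, hv⟩)
    refine ((h.r_v u v hu huv hv).mul (h.q_v u v hu huv hv)).congr_deriv ?_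
    simp only [qv]
    field_simp
    ring
  have hl : Tendsto (fun y => s.r (u, y) * s.q (u, y)) (𝓝[>] u) (𝓝 0) := by
    simpa using (h.r_axis u hu (huv.trans hv)).mul (h.q_axis u hu (huv.trans hv))
  have key := hV.norm_sub_axis_le (h.cr.mul h.cq) hu huv hv hl
    (C := 4 * Real.pi * s.e * s.r (u, v) ^ 2 * (s.M * B)) fun y hy1 hy2 => by
      have hy : (u, y) ∈ reg s.w := ⟨hu, hy1, hy2.trans hv⟩
      have h1 := h.r_mono hu hy1 hy2.le hv
      have h2 := h.r_pos _ hy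
      rw [norm_neg, norm_mul, Real.norm_of_nonneg (by positivity)]
      gcongr
      refine (Complex.abs_im_le_norm _).trans ?_
      rw [norm_mul, RCLike.norm_conj]
      have := h.norm_φ_le hy
      have := hB _ hy
      gcongr
  rw [sub_zero, norm_mul, Real.norm_of_nonneg hr.le, Real.norm_eq_abs] at key
  have h4 : v - u ≤ 12 / 5 * s.r (u, v) := by simp only at h3; linarith
  have h5 := key.trans (mul_le_mul_of_nonneg_left h4 (by positivity))
  refine le_of_mul_le_mul_left (h5.trans (le_of_eq ?_)) hr
  ring

/-- ∂_u∂_vA contains q/r², which is bounded because q = O(r²). -/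
theorem exists_Avu (h : s.IsSol) :
    ∃ Avu : ℝ × ℝ → ℝ, HasU s.w s.Av Avu ∧ BddReg s.w Avu := by
  refine ⟨fun p => -2 * ((s.Wu p * s.q p + s.W p * s.qu p) * s.r p - s.W p * s.q p * s.nu p)
    / s.r p ^ 2, ?_, ?_⟩
  · intro u v hu huv hv
    have h1 := h.r_ne _ (show (u, v) ∈ reg s.w from ⟨hu.le, huv, hv⟩)
    have e : s.Av = fun p => -2 * ((s.W p * s.q p) / s.r p) := by
      funext p; simp only [Av]; ring
    rw [e]
    refine ((((h.W_u u v hu huv hv).mul (h.q_u u v hu huv hv)).div (h.r_u u v hu huv hv)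
      h1).const_mul (-2 : ℝ)).congr_deriv ?_
    simp only [Pi.mul_apply]
    ring
  · obtain ⟨C, hC0, hC⟩ := h.exists_abs_q_le
    have he := h.e_nonneg
    have hM := h.M_pos
    refine BddReg.of_le (G := fun p => (|s.nuu p / s.nu p| + |s.Lu p|) * (C * |s.r p|)
        + (4 * Real.pi * s.e * s.M * ‖s.Du p‖ + C) + C)
      (((h.bdd_nuu_div.abs.add h.bdd_Lu.abs).mul ((BddReg.const C).mul h.bdd_r.abs)).add
        ((((BddReg.const (4 * Real.pi * s.e * s.M)).mul h.bdd_Du.norm)).add (BddReg.const C)) |>.add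
        (BddReg.const C)) fun p hp => ?_
    have hr := h.r_pos p hp
    have hW := h.W_pos hp
    have hW2 := h.W_le hp
    have hq := hC p hp
    have hqr : |s.q p| / s.r p ≤ C * s.r p := by
      rw [div_le_iff₀ hr]; linarith
    have hqr2 : |s.q p| / s.r p ^ 2 ≤ C := by
      rw [div_le_iff₀ (by positivity)]; exact hq
    have e : -2 * ((s.Wu p * s.q p + s.W p * s.qu p) * s.r p - s.W p * s.q p * s.nu p) / s.r p ^ 2
        = -(2 * s.W p) * ((s.nuu p / s.nu p + s.Lu p) * (s.q p / s.r p))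
          + -(2 * s.W p) * (s.qu p / s.r p) + (2 * s.W p) * (s.nu p * (s.q p / s.r p ^ 2)) := by
      simp only [Wu]; field_simp; ring
    have aux : ∀ a b : ℝ, |a| ≤ b → |2 * s.W p * a| ≤ b := fun a b hab => by
      rw [abs_mul, abs_of_pos (by positivity)]
      nlinarith [abs_nonneg a]
    have aux' : ∀ a b : ℝ, |a| ≤ b → |-(2 * s.W p) * a| ≤ b := fun a b hab => by
      rw [neg_mul, abs_neg]; exact aux a b hab
    rw [e, Real.norm_eq_abs]
    refine (abs_add_three _ _ _).trans (add_le_add (add_le_add (aux' _ _ ?_) (aux' _ _ ?_))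
      (aux _ _ ?_))
    · rw [abs_mul, abs_div, abs_of_pos hr]
      have := abs_add_le (s.nuu p / s.nu p) (s.Lu p)
      gcongr
    · rw [abs_div, abs_of_pos hr, div_le_iff₀ hr]
      refine (h.abs_qu_le hp).trans ?_
      rw [add_mul]
      refine add_le_add (le_of_eq (by ring)) hqr
    · rw [abs_mul, abs_div, abs_of_pos (show 0 < s.r p ^ 2 by positivity), abs_of_neg (h.nu_neg p hp)]
      have := h.nu_ge p hp
      have h1 : 0 ≤ |s.q p| / s.r p ^ 2 := by positivity
      nlinarith

theorem exists_abs_A_le (h : s.IsSol) :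
    ∃ C : ℝ, 0 ≤ C ∧ ∀ p ∈ reg s.w, |s.A p| ≤ C * (p.2 - p.1) ^ 2 := by
  obtain ⟨C, hC0, hC⟩ := h.exists_abs_q_le
  refine ⟨C, hC0, ?_⟩
  rintro ⟨u, v⟩ hp
  obtain ⟨hu, huv, hv⟩ : 0 ≤ u ∧ u < v ∧ v < s.w := hp
  have := h.A_v.norm_sub_axis_le h.cA hu huv hv (h.A_axis u hu (huv.trans hv))
    (C := C * (v - u)) fun y hy1 hy2 => by
      have hy : (u, y) ∈ reg s.w := ⟨hu, hy1, hy2.trans hv⟩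
      have h1 := h.r_pos _ hy
      have h2 := h.r_le hy
      refine (h.abs_Av_le hy).trans ?_
      rw [div_le_iff₀ h1]
      refine (hC _ hy).trans ?_
      rw [pow_two, ← mul_assoc]
      gcongr
      simp only at h2
      linarith
  rw [sub_zero, Real.norm_eq_abs] at this
  simp only
  linarith

/-- A is not assumed C¹ up to the axis. Difference quotients of A in u are written as an integral in
v of those of ∂_vA, which are bounded by `exists_Avu`, starting near the axis where A = O((v-u)²).
-/
theorem bdd_Au (h : s.IsSol) : BddReg s.w s.Au := by
  obtain ⟨Avu, hU, B, hB0, hB⟩ := h.exists_Avu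
  obtain ⟨C, hC0, hC⟩ := h.exists_abs_A_le
  have key : ∀ u v, 0 < u → u < v → v < s.w → ‖s.Au (u, v)‖ ≤ B * s.w := by
    intro u v hu huv hv
    have hd := (h.A_u u v hu huv hv).tendsto_slope_zero_right
    -- The starting height u + 2t lies at distances t and 2t from the axis, so the two starting
    -- values total at most C(t² + 4t²) = 5Ct².
    have hr : Tendsto (fun t : ℝ => 5 * C * t + B * s.w) (𝓝[>] 0) (𝓝 (5 * C * 0 + B * s.w)) :=
      (Continuous.tendsto (by fun_prop) 0).mono_left nhdsWithin_le_nhds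
    rw [mul_zero, zero_add] at hr
    refine le_of_tendsto_of_tendsto hd.norm hr ?_
    filter_upwards [Ioo_mem_nhdsGT (show (0 : ℝ) < (v - u) / 2 by linarith)] with t ht
    obtain ⟨ht0, ht1⟩ := ht
    have h2 : ‖(s.A (u + t, v) - s.A (u, v)) - (s.A (u + t, u + 2 * t) - s.A (u, u + 2 * t))‖
        ≤ B * t * v - B * t * (u + 2 * t) := by
      refine norm_sub_le_sub_of_norm_deriv_le (F := fun y => s.A (u + t, y) - s.A (u, y))
        (F' := fun y => s.Av (u + t, y) - s.Av (u, y))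
        (B := fun y => B * t * y) (B' := fun _ => B * t) (by linarith)
        ?_ (fun y hy => ?_) (by fun_prop)
        (fun y _ => by simpa using (hasDerivAt_id y).const_mul (B * t)) fun y hy => ?_
      · exact ((slice_v_continuousOn h.cA (by linarith)).mono fun y hy =>
          ⟨by linarith [hy.1], by linarith [hy.2]⟩).sub
          ((slice_v_continuousOn h.cA hu.le).mono fun y hy =>
          ⟨by linarith [hy.1], by linarith [hy.2]⟩)
      · exact (h.A_v (u + t) y (by linarith) (by linarith [hy.1]) (by linarith [hy.2])).sub
          (h.A_v u y hu.le (by linarith [hy.1]) (by linarith [hy.2]))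
      · have h3 := norm_sub_le_sub_of_norm_deriv_le (F := fun x => s.Av (x, y))
          (F' := fun x => Avu (x, y))
          (B := fun x => B * x) (B' := fun _ => B) (show u ≤ u + t by linarith)
          ((slice_u_continuousOn h.cAv (by linarith [hy.2])).mono fun x hx =>
            ⟨by linarith [hx.1], by linarith [hx.2, hy.1]⟩)
          (fun x hx => hU x y (by linarith [hx.1]) (by linarith [hx.2, hy.1]) (by linarith [hy.2]))
          (by fun_prop) (fun x _ => by simpa using (hasDerivAt_id x).const_mul B)
          (fun x hx => hB _ ⟨by linarith [hx.1], by linarith [hx.2, hy.1], by linarith [hy.2]⟩)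
        linarith
    have h3 := hC (u + t, u + 2 * t) ⟨by linarith, by linarith, by linarith⟩
    have h4 := hC (u, u + 2 * t) ⟨by linarith, by linarith, by linarith⟩
    simp only at h3 h4
    rw [norm_smul, norm_inv, Real.norm_of_nonneg ht0.le, inv_mul_le_iff₀ ht0]
    rw [Real.norm_eq_abs] at h2 ⊢
    rw [abs_le] at h2 h3 h4 ⊢
    have h5 : B * t * v - B * t * (u + 2 * t) ≤ B * t * s.w := by
      have : 0 ≤ B * t := by positivity
      nlinarith
    constructor <;> nlinarith
  refine ⟨B * s.w, mul_nonneg hB0 h.w_pos.le, ?_⟩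
  rintro ⟨u, v⟩ hp
  obtain ⟨hu, huv, hv⟩ : 0 ≤ u ∧ u < v ∧ v < s.w := hp
  rcases hu.lt_or_eq with hu | rfl
  · exact key u v hu huv hv
  -- The boundary line u = 0 follows by continuity.
  · have h1 := (slice_u_continuousOn h.cAu hv 0 ⟨le_rfl, huv⟩).mono_left
      (nhdsWithin_mono 0 (Ioo_subset_Ico_self (a := 0) (b := v)))
    have : (𝓝[Ioo 0 v] (0 : ℝ)).NeBot := by
      rw [nhdsWithin_Ioo_eq_nhdsGT huv]; infer_instance
    refine le_of_tendsto h1.norm ?_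
    filter_upwards [self_mem_nhdsWithin] with x hx using key x v hx.1 hx.2 hv

/-! ### Boundary values on the axis -/

/-- The charge part of ∂_u b̃̃ vanishes at the axis, since r and A tend to 0 while ∂_uA and ∂_uφ
stay bounded. What is left has limit -`gΓ`, the trace of -`g`. -/
theorem hh_axis (h : s.IsSol) {u : ℝ} (hu : 0 < u) (huw : u < s.w) :
    Tendsto (fun v => s.hh (u, v)) (𝓝[>] u) (𝓝 (-s.gΓ u)) := by
  obtain ⟨B, hB0, hB⟩ := h.bdd_Au
  obtain ⟨B', hB0', hB'⟩ := h.bdd_fu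
  have he := h.eM_nonneg
  have hz : Tendsto (fun v => s.e * s.M * (B * s.r (u, v) + |s.A (u, v)|
      + |s.A (u, v)| * s.w * B')) (𝓝[>] u) (𝓝 0) := by
    have hA := (h.A_axis u hu.le huw).abs
    have := (((h.r_axis u hu.le huw).const_mul B).add hA).add ((hA.mul_const s.w).mul_const B')
    simpa using this.const_mul (s.e * s.M)
  have hr : Tendsto (fun v => I * (((s.e * (s.Au (u, v) * s.r (u, v) + s.A (u, v) * s.nu (u, v)) :
      ℝ) : ℂ) * s.φ (u, v) + ((s.e * (s.A (u, v) * s.r (u, v)) : ℝ) : ℂ) * s.fu (u, v)))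
      (𝓝[>] u) (𝓝 0) := by
    refine squeeze_zero_norm' ?_ hz
    filter_upwards [Ioo_mem_nhdsGT huw] with v hv
    have hp : (u, v) ∈ reg s.w := ⟨hu.le, hv.1, hv.2⟩
    have hr := h.r_pos _ hp
    rw [norm_mul, Complex.norm_I, one_mul]
    refine ((norm_add_le _ _).trans (add_le_add (h.norm_charge_φ_le hp _)
      (h.norm_charge_le _ _))).trans ?_
    have h1 : |s.Au (u, v) * s.r (u, v) + s.A (u, v) * s.nu (u, v)|
        ≤ B * s.r (u, v) + |s.A (u, v)| := by
      refine (abs_add_le _ _).trans (add_le_add ?_ ?_)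
      · rw [abs_mul, abs_of_pos hr]
        have := hB _ hp
        rw [Real.norm_eq_abs] at this
        gcongr
      · rw [abs_mul, abs_of_neg (h.nu_neg _ hp)]
        nlinarith [abs_nonneg (s.A (u, v)), h.nu_ge _ hp]
    have h2 : |s.A (u, v) * s.r (u, v)| * ‖s.fu (u, v)‖ ≤ |s.A (u, v)| * s.w * B' := by
      rw [abs_mul, abs_of_pos hr]
      have := hB' _ hp
      have := h.r_le_w hp
      have := h.w_pos
      gcongr
      linarith
    calc s.e * s.M * |s.Au (u, v) * s.r (u, v) + s.A (u, v) * s.nu (u, v)|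
          + s.e * s.M * |s.A (u, v) * s.r (u, v)| * ‖s.fu (u, v)‖
        = s.e * s.M * (|s.Au (u, v) * s.r (u, v) + s.A (u, v) * s.nu (u, v)|
          + |s.A (u, v) * s.r (u, v)| * ‖s.fu (u, v)‖) := by ring
      _ ≤ _ := by gcongr
  have h3 := (h.b_axis u hu huw).add hr
  rw [add_zero] at h3
  refine h3.congr fun v => ?_
  simp only [hh, btu]
  ring

theorem tendsto_of_norm_le_r {E : Type*} [NormedAddCommGroup E] {l : Filter (ℝ × ℝ)}
    {F : ℝ × ℝ → E} {C : ℝ} (hr : Tendsto s.r l (𝓝 0)) (hl : ∀ᶠ p in l, p ∈ reg s.w)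
    (hF : ∀ p ∈ reg s.w, ‖F p‖ ≤ C * s.r p) : Tendsto F l (𝓝 0) := by
  refine squeeze_zero_norm' (hl.mono hF) ?_
  simpa using hr.const_mul C

theorem exists_vanishing (h : s.IsSol) : ∃ C : ℝ, ∀ p ∈ reg s.w, ‖s.Nv p‖ ≤ C * s.r p ∧
    ‖s.Lu p‖ ≤ C * s.r p ∧ ‖4 * Real.pi * inner ℝ (s.fv p) (s.y p)‖ ≤ C * s.r p ∧
    ‖4 * Real.pi * inner ℝ (s.fu p) (s.x p)‖ ≤ C * s.r p := by
  obtain ⟨B1, hB10, hB1⟩ := h.bdd_fv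
  obtain ⟨B2, hB20, hB2⟩ := h.bdd_fu
  obtain ⟨B3, hB30, hB3⟩ := h.bdd_Du
  refine ⟨12.6 * ((B1 + B2 + B3) * (18 / 5 * (B1 + B2 + B3))), fun p hp => ?_⟩
  have hr := h.r_pos p hp
  have h1 := hB1 p hp
  have h2 := hB2 p hp
  have h3 := hB3 p hp
  have hx : ‖s.x p‖ ≤ 18 / 5 * (B1 + B2 + B3) * s.r p := by
    rw [x, norm_mul, Complex.norm_real, Real.norm_eq_abs]
    have h4 := h.abs_div_lam_le hp (s.r p)
    rw [abs_of_pos hr] at h4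
    calc _ ≤ 12 / 5 * s.r p * B1 := by gcongr
      _ ≤ _ := by nlinarith [mul_nonneg hr.le hB10, mul_nonneg hr.le hB20, mul_nonneg hr.le hB30]
  have hy : ‖s.y p‖ ≤ 18 / 5 * (B1 + B2 + B3) * s.r p := by
    rw [y, norm_mul, Complex.norm_real, Real.norm_eq_abs]
    have h4 := h.abs_div_nu_le hp (s.r p)
    rw [abs_of_pos hr] at h4
    calc _ ≤ 18 / 5 * s.r p * B3 := by gcongr
      _ ≤ _ := by nlinarith [mul_nonneg hr.le hB10, mul_nonneg hr.le hB20, mul_nonneg hr.le hB30]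
  have aux : ∀ a b : ℂ, ‖a‖ ≤ B1 + B2 + B3 → ‖b‖ ≤ 18 / 5 * (B1 + B2 + B3) * s.r p →
      ‖4 * Real.pi * inner ℝ a b‖ ≤ 12.6 * ((B1 + B2 + B3) * (18 / 5 * (B1 + B2 + B3))) * s.r p := by
    intro a b ha hb
    rw [norm_mul, Real.norm_of_nonneg (by positivity)]
    calc _ ≤ 12.6 * ((B1 + B2 + B3) * (18 / 5 * (B1 + B2 + B3) * s.r p)) := by
          have := four_pi_le
          have := (norm_inner_le_norm (𝕜 := ℝ) a b).trans
            (mul_le_mul ha hb (norm_nonneg _) (by positivity))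
          gcongr
      _ = _ := by ring
  refine ⟨?_, ?_, aux _ _ (by linarith) hy, aux _ _ (by linarith) hx⟩
  · rw [h.Nv_eq_inner hp]; exact aux _ _ (by linarith) hx
  · rw [h.Lu_eq_inner hp]; exact aux _ _ (by linarith) hy

/-- All terms except ∂_uν/ν vanish at the axis. By λ = -ν there the limit agrees with that of `Lh`
in `Lh_axis`, so the majorant of `Lh` provides boundary data for `Nh`. -/
theorem Nh_axis (h : s.IsSol) {u : ℝ} (hu : 0 < u) (huw : u < s.w) :
    Tendsto (fun v => s.Nh (u, v)) (𝓝[>] u) (𝓝 (s.lΓ u / s.la u)) := by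
  obtain ⟨C, hC⟩ := h.exists_vanishing
  have hmap : Tendsto (fun v => (u, v)) (𝓝[>] u) (map (fun v => (u, v)) (𝓝[>] u)) := tendsto_map
  have hr : Tendsto s.r (map (fun v => (u, v)) (𝓝[>] u)) (𝓝 0) :=
    tendsto_map'_iff.2 (h.r_axis u hu.le huw)
  have hev : ∀ᶠ p in map (fun v => (u, v)) (𝓝[>] u), p ∈ reg s.w := by
    rw [eventually_map]
    filter_upwards [Ioo_mem_nhdsGT huw] with v hv using ⟨hu.le, hv.1, hv.2⟩
  have hla : -s.la u ≠ 0 := by linarith [h.la_ge u hu.le huw]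
  have h1 := (h.nuu_axis u hu huw).div (h.nu_axis u hu.le huw) hla
  have h2 := (tendsto_of_norm_le_r hr hev fun p hp => (hC p hp).2.1).comp hmap
  have h3 := (tendsto_of_norm_le_r hr hev fun p hp => (hC p hp).2.2.2).comp hmap
  have h4 : Tendsto (fun v => s.nu (u, v) * (s.pm (u, v) / s.r (u, v))) (𝓝[>] u) (𝓝 0) := by
    have h5 := (h.lk_axis u hu huw).abs.const_mul (12 / 5)
    rw [abs_zero, mul_zero] at h5
    refine squeeze_zero_norm' ?_ h5
    filter_upwards [Ioo_mem_nhdsGT huw] with v hv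
    have hp : (u, v) ∈ reg s.w := ⟨hu.le, hv.1, hv.2⟩
    have h6 := h.abs_div_lam_le hp (s.lk (u, v))
    have h7 : s.lk (u, v) / s.lam (u, v) = s.nu (u, v) * (s.pm (u, v) / s.r (u, v)) := by
      rw [lk, mul_assoc, mul_div_cancel_left₀ _ (h.lam_ne _ hp)]
    rwa [h7] at h6
  have := ((h1.add h2).sub h4).sub h3
  rw [neg_div_neg_eq, add_zero, sub_zero, sub_zero] at this
  exact this

theorem Lh_axis (h : s.IsSol) {v : ℝ} (hv0 : 0 < v) (hv : v < s.w) :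
    Tendsto (fun u => s.Lh (u, v)) (𝓝[<] v) (𝓝 (s.lΓ v / s.la v)) := by
  obtain ⟨C, hC⟩ := h.exists_vanishing
  have hmap : Tendsto (fun u => (u, v)) (𝓝[<] v) (map (fun u => (u, v)) (𝓝[<] v)) := tendsto_map
  have hr : Tendsto s.r (map (fun u => (u, v)) (𝓝[<] v)) (𝓝 0) :=
    tendsto_map'_iff.2 (h.r_axis' hv0 hv)
  have hev : ∀ᶠ p in map (fun u => (u, v)) (𝓝[<] v), p ∈ reg s.w := by
    rw [eventually_map]
    filter_upwards [Ioo_mem_nhdsLT hv0] with u hu using ⟨hu.1.le, hu.2, hv⟩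
  have hla : s.la v ≠ 0 := by linarith [h.la_ge v hv0.le hv]
  have h1 := (h.lamv_axis' v hv0 hv).div (h.lam_axis' v hv0 hv) hla
  have h2 := (tendsto_of_norm_le_r hr hev fun p hp => (hC p hp).1).comp hmap
  have h3 := (tendsto_of_norm_le_r hr hev fun p hp => (hC p hp).2.2.1).comp hmap
  have h4 : Tendsto (fun u => s.lam (u, v) * (s.pm (u, v) / s.r (u, v))) (𝓝[<] v) (𝓝 0) := by
    have h5 := (h.lk_axis' v hv0 hv).abs.const_mul (18 / 5)
    rw [abs_zero, mul_zero] at h5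
    refine squeeze_zero_norm' ?_ h5
    filter_upwards [Ioo_mem_nhdsLT hv0] with u hu
    have hp : (u, v) ∈ reg s.w := ⟨hu.1.le, hu.2, hv⟩
    have h6 := h.abs_div_nu_le hp (s.lk (u, v))
    have h7 : s.lk (u, v) / s.nu (u, v) = s.lam (u, v) * (s.pm (u, v) / s.r (u, v)) := by
      rw [lk, mul_right_comm, mul_div_cancel_right₀ _ (h.nu_ne _ hp)]
    rwa [h7] at h6
  have := ((h1.add h2).sub h4).sub h3
  rw [add_zero, sub_zero, sub_zero] at this
  exact this

end IsSol
end Reduced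

end ChargedScalar
end

open Set Filter Topology MeasureTheory
open scoped ENNReal NNReal

noncomputable section

namespace ChargedScalar

namespace Reduced

open Complex (I)

/-- Area bounds: `a` for the Jacobians with `ã / λ` and `b̃ / ν`, `c` for those with `log λ` and
`log |ν|`, and `b` for the charge terms. -/
structure Areas (s : Reduced) (a c b : ℝ) : Prop where
  J1 : Tri s.w (fun p => ‖s.J1 p‖) a
  J2 : Tri s.w (fun p => ‖s.J2 p‖) a
  J3 : Tri s.w (fun p => ‖s.J3 p‖) c
  J4 : Tri s.w (fun p => ‖s.J4 p‖) c
  P : Tri s.w (fun p => ‖s.ePsiv p‖) b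
  P' : Tri s.w (fun p => ‖s.eWqu p‖) b

variable {s : Reduced} {a c b a' c' b' : ℝ}

theorem Areas.mono (hA : s.Areas a c b) (ha : a ≤ a') (hc : c ≤ c') (hb : b ≤ b') :
    s.Areas a' c' b' :=
  ⟨hA.J1.mono_const ha, hA.J2.mono_const ha, hA.J3.mono_const hc, hA.J4.mono_const hc,
    hA.P.mono_const hb, hA.P'.mono_const hb⟩

theorem Areas.a_nonneg (hA : s.Areas a c b) : 0 ≤ a := hA.J1.nonneg

theorem Areas.c_nonneg (hA : s.Areas a c b) : 0 ≤ c := hA.J3.nonneg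

theorem Areas.b_nonneg (hA : s.Areas a c b) : 0 ≤ b := hA.P.nonneg

/-- The bound for the renormalized derivatives of `log λ` and `log |ν|`. -/
def kap (s : Reduced) (a : ℝ) : ℝ := 530 * s.dl ^ 2 + 26 * a

/-- The bound for the derivatives of `log λ` and `log |ν|` on slices. -/
def ell (s : Reduced) (a : ℝ) : ℝ := 1170 * s.dl ^ 2 + 26 * a

namespace IsSol

/-! ### Bounds for the renormalized derivatives -/

/-- Every term carries a factor e A or e ∂_vA, hence Z/w or Z/w², besides a second small factor; the
total is quadratic in δ. -/
theorem tri_Ev (h : s.IsSol) : Tri s.w (fun p => ‖s.Ev p‖) (s.dl ^ 2) := by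
  have hw := h.w_pos
  have hZ := h.Z_nonneg
  have h0 := h.dl_nonneg
  have hZw := h.Zw_nonneg
  have t1 := tri_const hw (d := s.Z * s.Z * (18 / 100000)) (by positivity)
  have t2 := h.out_lk.tri_div hw (fun p => abs_nonneg _) (d := 15 / 100 * s.dl * s.Z) (by positivity)
  have t3 := h.out_fv.tri_div hw (fun p => norm_nonneg _) (d := s.Z / 100) (by positivity)
  have t4 := tri_const hw (d := 15 / 100 * s.dl * s.Z) (by positivity)
  have t5 := h.out_fv.tri_div hw (fun p => norm_nonneg _) (d := 15 / 100 * s.dl * s.Z)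
    (by positivity)
  refine ((((t1.add t2).add t3).add t4).add t5).mono h.cEv.norm (fun p hp => ?_) ?_
  · have hr := h.r_pos p hp
    have e1 : ‖I * ((s.e * s.A p : ℝ) : ℂ) * s.φ p‖ ≤ s.Z / s.w / 100 := by
      rw [mul_assoc, norm_mul, Complex.norm_I, one_mul]; exact h.norm_eA_φ_le hp
    have e2 : ‖I * ((s.e * s.Av p : ℝ) : ℂ) * s.φ p‖ ≤ s.Z / s.w ^ 2 / 100 := by
      rw [mul_assoc, norm_mul, Complex.norm_I, one_mul]
      exact (h.norm_charge_φ_le hp _).trans (h.eMAv_le hp)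
    have e3 : ‖I * ((s.e * s.A p : ℝ) : ℂ) * s.fv p‖ ≤ s.Z / s.w / 100 * ‖s.fv p‖ := by
      rw [mul_assoc, norm_mul, Complex.norm_I, one_mul]
      exact (h.norm_charge_le _ _).trans
        (mul_le_mul_of_nonneg_right (h.eMA_le hp) (norm_nonneg _))
    have e4 : ‖s.bev p‖ ≤ 18 / 1000 * (s.Z / s.w)
        + 15 * s.dl * |s.lam p * (s.pm p / s.r p)| := by
      have e : s.bev p = -(I * s.eWq p) / s.nu p
          - s.y p * ((s.lam p * (s.pm p / s.r p) : ℝ) : ℂ) := by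
        have := h.nu_ne' p hp
        simp only [bev, lk]; push_cast; field_simp; ring
      rw [e]
      refine (norm_sub_le _ _).trans (add_le_add ((h.norm_div_nu_le hp _).trans ?_) ?_)
      · rw [norm_neg, norm_mul, Complex.norm_I, one_mul]
        have := h.norm_eWq_le hp
        have e' : s.Z / 200 / s.w = s.Z / s.w / 200 := by ring
        linarith
      · rw [norm_mul, Complex.norm_real, Real.norm_eq_abs]
        have := h.norm_y_le hp
        gcongr
    have e5 := h.norm_y_le hp
    rw [Ev]
    refine (norm_add_le _ _).trans ?_
    have i1 := norm_inner_le_norm (𝕜 := ℝ) (I * ((s.e * s.A p : ℝ) : ℂ) * s.φ p)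
      (s.bev p - s.fv p)
    have i2 := norm_inner_le_norm (𝕜 := ℝ) (I * ((s.e * s.Av p : ℝ) : ℂ) * s.φ p
      + I * ((s.e * s.A p : ℝ) : ℂ) * s.fv p) (s.y p)
    have i3 : ‖s.bev p - s.fv p‖ ≤ 18 / 1000 * (s.Z / s.w)
        + 15 * s.dl * |s.lam p * (s.pm p / s.r p)| + ‖s.fv p‖ :=
      (norm_sub_le _ _).trans (add_le_add e4 le_rfl)
    have i4 := (norm_add_le (I * ((s.e * s.Av p : ℝ) : ℂ) * s.φ p)
      (I * ((s.e * s.A p : ℝ) : ℂ) * s.fv p)).trans (add_le_add e2 e3)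
    have j1 := mul_le_mul e1 i3 (norm_nonneg _) (by positivity)
    have j2 := mul_le_mul i4 e5 (norm_nonneg _) (by
      have := h.Zw2_nonneg; positivity)
    refine (add_le_add (i1.trans j1) (i2.trans j2)).trans (le_of_eq ?_)
    field_simp
    ring
  · have h1 := h.Z_le_dl
    have h2 := h.dl_le
    have h3 : s.Z * s.Z ≤ s.dl ^ 2 := by nlinarith
    have h4 : s.dl * s.Z ≤ s.dl ^ 2 := by nlinarith
    have h5 : s.dl ^ 2 * (s.dl * s.Z) ≤ 1 / 10000 * s.dl ^ 2 := by
      have : s.dl * s.Z ≤ 1 / 10000 := by nlinarith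
      nlinarith [sq_nonneg s.dl]
    have h6 : s.Z * (s.dl * s.Z) ≤ s.dl ^ 2 := by nlinarith
    linarith [sq_nonneg s.dl]

section Majorants

variable (h : s.IsSol) (hA : s.Areas a c b)
include h hA

/-- Data on u = 0: λ is constant there, so `g` reduces to ∂_vã, whose integral is at most D. -/
theorem majV_g : MajV s.w (fun p => ‖s.g p‖) (s.D + (c + b)) := by
  have hT : Tri s.w (fun p => ‖(s.lam p : ℂ) * s.J3 p - I * s.ePsiv p‖) (c + b) := by
    refine (hA.J3.add hA.P).mono (by fun_prop (disch := assumption)) (fun p hp => ?_) le_rfl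
    refine (norm_sub_le _ _).trans ?_
    rw [norm_mul, norm_mul, Complex.norm_I, one_mul, Complex.norm_real,
      Real.norm_of_nonneg (h.lam_pos hp).le]
    have := h.lam_le' hp
    have := mul_le_mul_of_nonneg_right (show s.lam p ≤ 1 by linarith) (norm_nonneg (s.J3 p))
    linarith
  refine MajV.of_initial h.cg h.g_u (by fun_prop (disch := assumption)) h.D_nonneg ?_ hT
  refine le_trans (setLIntegral_mono' measurableSet_Ioo fun v hv => ?_) h.D_le
  simp only [g, h.lamv_init v hv.1 hv.2]
  simp

/-- The total c + b enters twice: once in carrying the bound for `g` from u = 0 to the axis, once in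
carrying it outward for `hh`. -/
theorem majU_hh : MajU s.w (fun p => ‖s.hh p‖) (s.D + 2 * (c + b)) := by
  have hT : Tri s.w (fun p => ‖-((s.nu p : ℂ) * s.J4 p) - I * s.eWqu p‖) (c + b) := by
    refine (hA.J4.add hA.P').mono (by fun_prop (disch := assumption)) (fun p hp => ?_) le_rfl
    refine (norm_sub_le _ _).trans ?_
    rw [norm_neg, norm_mul, norm_mul, Complex.norm_I, one_mul, Complex.norm_real,
      Real.norm_of_nonpos (h.nu_neg p hp).le]
    have := h.nu_ge p hp
    have := mul_le_mul_of_nonneg_right (show -s.nu p ≤ 1 by linarith) (norm_nonneg (s.J4 p))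
    linarith
  have hg := h.majV_g hA
  obtain ⟨g, h1, h2⟩ := hg.axis h.g_axis'
  refine (MajU.of_axis h.chh h.hh_v (by fun_prop (disch := assumption))
    (fun u hu huw => h.hh_axis hu huw) (fun u hu huw => ?_) hg.nonneg h2 hT).mono h.chh.norm
    (fun _ _ => le_rfl) (by linarith)
  rw [enorm_neg]
  exact h1 u hu huw

/-- On u = 0 the derivative of λ vanishes, so the initial value of `Lh` consists of terms quadratic
in δ. -/
theorem majV_Lh : MajV s.w (fun p => ‖s.Lh p‖) (528 * s.dl ^ 2 + 13 * a) := by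
  have h0 := h.dl_nonneg
  have ha := hA.a_nonneg
  have hT : Tri s.w (fun p => ‖4 * Real.pi * ((s.J2 p).re + s.Ev p)‖) (12.6 * (a + s.dl ^ 2)) := by
    have hc : ContinuousOn (fun p => (s.J2 p).re) (reg s.w) :=
      Complex.continuous_re.comp_continuousOn h.cJ2
    refine ((hA.J2.add h.tri_Ev).const_mul (k := 12.6) (by norm_num)).mono
      ((continuousOn_const.mul (hc.add h.cEv)).norm) (fun p hp => ?_) le_rfl
    rw [norm_mul, Real.norm_of_nonneg (by positivity)]
    have := four_pi_le
    have := (norm_add_le (s.J2 p).re (s.Ev p)).trans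
      (add_le_add (Complex.abs_re_le_norm _) le_rfl)
    gcongr
  have hi := (h.out_Nv.add h.out_lk).add (h.out_fv.const_mul (k := 189 * s.dl) (by positivity))
  have hcc : ContinuousOn (fun p => 4 * Real.pi * ((s.J2 p).re + s.Ev p)) (reg s.w) :=
    continuousOn_const.mul ((Complex.continuous_re.comp_continuousOn h.cJ2).add h.cEv)
  refine (MajV.of_initial h.cLh h.Lh_u hcc (c := 515 * s.dl ^ 2) (by positivity) ?_ hT).mono
    h.cLh.norm (fun _ _ => le_rfl) (by nlinarith [sq_nonneg s.dl])
  refine le_trans (setLIntegral_mono' measurableSet_Ioo fun v hv => ?_)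
    ((hi.le le_rfl).trans (ENNReal.ofReal_le_ofReal ?_))
  · have hp : (0, v) ∈ reg s.w := ⟨le_rfl, hv.1, hv.2⟩
    refine ENNReal.ofReal_le_ofReal ?_
    rw [Lh, h.lamv_init v hv.1 hv.2, zero_div, zero_add]
    refine (norm_sub_le _ _).trans (add_le_add ((norm_sub_le _ _).trans (add_le_add ?_ le_rfl)) ?_)
    · exact (Real.norm_of_nonneg (h.Nv_nonneg hp)).le
    · rw [norm_mul, Real.norm_of_nonneg (by positivity)]
      calc 4 * Real.pi * ‖inner ℝ (s.fv (0, v)) (s.y (0, v))‖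
          ≤ 12.6 * (‖s.fv (0, v)‖ * (15 * s.dl)) := by
            have := four_pi_le
            have := (norm_inner_le_norm (𝕜 := ℝ) (s.fv (0, v)) (s.y (0, v))).trans
              (mul_le_mul_of_nonneg_left (h.norm_y_le hp) (norm_nonneg _))
            gcongr
        _ = _ := by ring
  · nlinarith [h.Z_le_dl]

theorem majU_Nh : MajU s.w (fun p => ‖s.Nh p‖) (s.kap a) := by
  have ha := hA.a_nonneg
  have hc : ContinuousOn (fun p => -(4 * Real.pi * (s.J1 p).re)) (reg s.w) :=
    (continuousOn_const.mul (Complex.continuous_re.comp_continuousOn h.cJ1)).neg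
  have hT : Tri s.w (fun p => ‖-(4 * Real.pi * (s.J1 p).re)‖) (12.6 * a) := by
    refine (hA.J1.const_mul (k := 12.6) (by norm_num)).mono hc.norm (fun p hp => ?_) le_rfl
    rw [norm_neg, norm_mul, Real.norm_of_nonneg (by positivity)]
    have := four_pi_le
    have := Complex.abs_re_le_norm (s.J1 p)
    rw [Real.norm_eq_abs]
    gcongr
  have hg := h.majV_Lh hA
  obtain ⟨g, h1, h2⟩ := hg.axis (G := fun v => s.lΓ v / s.la v) fun v => h.Lh_axis
  exact (MajU.of_axis h.cNh h.Nh_v hc (fun u hu huw => h.Nh_axis hu huw) h1 hg.nonneg h2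
    hT).mono h.cNh.norm (fun _ _ => le_rfl) (by unfold kap; nlinarith [sq_nonneg s.dl])

theorem out_lamv : Out s.w (fun p => |s.lamv p / s.lam p|) (s.ell a) := by
  have h0 := h.dl_nonneg
  have ha := hA.a_nonneg
  have hne := h.lam_ne
  refine ((((h.majV_Lh hA).out.add h.out_Nv).add h.out_lk).add
    (h.out_fv.const_mul (k := 189 * s.dl) (by positivity))).mono
    (ContinuousOn.abs (by fun_prop (disch := assumption))) (fun p hp => ?_)
    (by unfold ell; nlinarith [h.Z_le_dl])
  have e : s.lamv p / s.lam p = s.Lh p - s.Nv p + s.lam p * (s.pm p / s.r p)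
      + 4 * Real.pi * inner ℝ (s.fv p) (s.y p) := by
    simp only [Lh]; ring
  rw [e]
  refine (abs_add_le _ _).trans (add_le_add ((abs_add_le _ _).trans
    (add_le_add ((abs_sub _ _).trans (add_le_add le_rfl ?_)) le_rfl)) ?_)
  · exact (abs_of_nonneg (h.Nv_nonneg hp)).le
  · rw [abs_mul, abs_of_nonneg (by positivity)]
    calc 4 * Real.pi * |inner ℝ (s.fv p) (s.y p)| ≤ 12.6 * (‖s.fv p‖ * (15 * s.dl)) := by
          have := four_pi_le
          have := (abs_real_inner_le_norm (s.fv p) (s.y p)).trans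
            (mul_le_mul_of_nonneg_left (h.norm_y_le hp) (norm_nonneg _))
          gcongr
      _ = _ := by ring

theorem inn_nuu : In s.w (fun p => |s.nuu p / s.nu p|) (s.ell a) := by
  have h0 := h.dl_nonneg
  have ha := hA.a_nonneg
  have hne := h.nu_ne
  refine ((((h.majU_Nh hA).inn.add h.inn_Lu).add h.inn_nk).add
    (h.inn_fu.const_mul (k := 126 * s.dl) (by positivity))).mono
    (ContinuousOn.abs (by fun_prop (disch := assumption))) (fun p hp => ?_)
    (by unfold ell kap; nlinarith [h.Z_le_dl])
  have e : s.nuu p / s.nu p = s.Nh p - s.Lu p + s.nu p * (s.pm p / s.r p)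
      + 4 * Real.pi * inner ℝ (s.fu p) (s.x p) := by
    simp only [Nh]; ring
  rw [e]
  refine (abs_add_le _ _).trans (add_le_add ((abs_add_le _ _).trans
    (add_le_add ((abs_sub _ _).trans (add_le_add le_rfl le_rfl)) le_rfl)) ?_)
  rw [abs_mul, abs_of_nonneg (by positivity)]
  calc 4 * Real.pi * |inner ℝ (s.fu p) (s.x p)| ≤ 12.6 * (‖s.fu p‖ * (10 * s.dl)) := by
        have := four_pi_le
        have := (abs_real_inner_le_norm (s.fu p) (s.x p)).trans
          (mul_le_mul_of_nonneg_left (h.norm_x_le hp) (norm_nonneg _))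
        gcongr
    _ = _ := by ring

/-- ∂_vã = `g` + φ̃ ∂_vλ, and |φ̃| ≤ 2Z ≤ 1/50. -/
theorem out_atv : Out s.w (fun p => ‖s.atv p‖) (s.D + (c + b) + s.ell a / 50) := by
  have hZ := h.Z_le
  have hl := (h.out_lamv hA).nonneg
  refine ((h.majV_g hA).out.add ((h.out_lamv hA).const_mul (k := 1 / 50) (by norm_num))).mono
    h.catv.norm (fun p hp => ?_) (by linarith)
  have e : s.atv p = s.g p + s.f p * s.lamv p := by simp only [g]; ring
  rw [e]
  refine (norm_add_le _ _).trans (add_le_add le_rfl ?_)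
  rw [norm_mul, Complex.norm_real, Real.norm_eq_abs]
  have h1 := h.lam_pos hp
  have h2 := h.lam_le' hp
  have e2 : |s.lamv p| = s.lam p * |s.lamv p / s.lam p| := by
    rw [abs_div, abs_of_pos h1]; field_simp
  rw [e2, ← mul_assoc]
  have h3 := h.norm_f_le hp
  have h4 : ‖s.f p‖ * s.lam p ≤ 1 / 50 * 1 := by
    have := h.Z_nonneg
    refine mul_le_mul (by linarith) (by linarith) h1.le (by norm_num)
  gcongr
  linarith

theorem inn_btu : In s.w (fun p => ‖s.btu p‖) (s.D + 2 * (c + b) + s.ell a / 50) := by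
  have hZ := h.Z_le
  have hl := (h.inn_nuu hA).nonneg
  refine ((h.majU_hh hA).inn.add ((h.inn_nuu hA).const_mul (k := 1 / 50) (by norm_num))).mono
    h.cbtu.norm (fun p hp => ?_) (by linarith)
  have e : s.btu p = s.hh p + s.f p * s.nuu p := by simp only [hh]; ring
  rw [e]
  refine (norm_add_le _ _).trans (add_le_add le_rfl ?_)
  rw [norm_mul, Complex.norm_real, Real.norm_eq_abs]
  have h1 := h.nu_neg p hp
  have h2 := h.nu_ge p hp
  have e2 : |s.nuu p| = -s.nu p * |s.nuu p / s.nu p| := by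
    rw [abs_div, abs_of_neg h1, div_neg, neg_mul_neg, mul_div_cancel₀ _ h1.ne]
  rw [e2, ← mul_assoc]
  have h3 := h.norm_f_le hp
  have h4 : ‖s.f p‖ * -s.nu p ≤ 1 / 50 * 1 := by
    have := h.Z_nonneg
    refine mul_le_mul (by linarith) (by linarith) (by linarith) (by norm_num)
  gcongr
  linarith

/-! ### Area estimates -/

theorem tri_J1 : Tri s.w (fun p => ‖s.J1 p‖) (4 * s.dl ^ 2 + 23 * s.dl * (c + b)) := by
  have h0 := h.dl_nonneg
  have hZ := h.Z_nonneg
  have t1 := h.inn_fu.mul_majV (h.majV_g hA) (fun p => norm_nonneg _)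
  have t2 := h.out_fv.tri_div h.w_pos (fun p => norm_nonneg _) (d := s.Z / 50) (by positivity)
  refine (((t1.add t2).const_mul (k := 12 / 5) (by norm_num)).add
    (hA.J3.const_mul (k := 10 * s.dl) (by positivity))).mono h.cJ1.norm
    (fun p hp => h.norm_J1_le hp) ?_
  have h1 := h.Z_le_dl
  have h2 := hA.c_nonneg
  have h3 := hA.b_nonneg
  have h4 : s.D = s.dl - s.Z := by simp [dl]
  have h5 : 0 ≤ s.D := h.D_nonneg
  have h6 : s.Z * (s.D + (c + b)) ≤ s.dl * (s.dl + (c + b)) := by gcongr; linarith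
  have h7 : s.Z * (s.Z / 50) ≤ s.dl * (s.dl / 50) := by gcongr
  nlinarith [mul_nonneg h0 h2, mul_nonneg h0 h3]

theorem tri_J2 : Tri s.w (fun p => ‖s.J2 p‖) (4 * s.dl ^ 2 + 23 * s.dl * (c + b)) := by
  have h0 := h.dl_nonneg
  have hZ := h.Z_nonneg
  have t1 := h.inn_fu.tri_div h.w_pos (fun p => norm_nonneg _) (d := s.Z / 200) (by positivity)
  have t2 := h.out_fv.mul_majU (h.majU_hh hA) (fun p => norm_nonneg _)
  refine (((t1.add t2).const_mul (k := 18 / 5) (by norm_num)).add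
    (hA.J4.const_mul (k := 15 * s.dl) (by positivity))).mono h.cJ2.norm
    (fun p hp => h.norm_J2_le hp) ?_
  have h1 := h.Z_le_dl
  have h2 := hA.c_nonneg
  have h3 := hA.b_nonneg
  have h4 : s.D = s.dl - s.Z := by simp [dl]
  have h5 : 0 ≤ s.D := h.D_nonneg
  have h6 : s.Z * (s.D + 2 * (c + b)) ≤ s.dl * (s.dl + 2 * (c + b)) := by gcongr; linarith
  have h7 : s.Z * (s.Z / 200) ≤ s.dl * (s.dl / 200) := by gcongr
  nlinarith [mul_nonneg h0 h2, mul_nonneg h0 h3]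

/-- (r/λ)·`Jff` solves a damped equation in v with rate 2λ/r and source J1 minus its conjugate. The
Hardy inequality gives 2∫|Jff| ≤ 2∫|J1| on each outgoing line. -/
theorem tri_Jff : Tri s.w (fun p => ‖s.Jff p‖) a := by
  have hr := h.r_ne
  refine hA.J1.of_slices h.cJff.norm fun u hu huw => ?_
  obtain ⟨B, hB0, hB⟩ := h.bdd_fu
  obtain ⟨B', hB0', hB'⟩ := h.bdd_fv
  have hP : ∀ p ∈ reg s.w, s.x p * (starRingEnd ℂ) (s.fu p) - (starRingEnd ℂ) (s.x p) * s.fu p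
      = ((s.r p / s.lam p : ℝ) : ℂ) * s.Jff p := fun p hp => by
    simp only [x, Jff, map_mul, Complex.conj_ofReal]; ring
  have key := setLIntegral_mul_norm_le (a := u) (b := s.w)
    (P := fun v => s.x (u, v) * (starRingEnd ℂ) (s.fu (u, v))
      - (starRingEnd ℂ) (s.x (u, v)) * s.fu (u, v))
    (S := fun v => s.J1 (u, v) - (starRingEnd ℂ) (s.J1 (u, v)))
    (κ := fun v => 2 * s.lam (u, v) / s.r (u, v))
    (fun v hv => by
      have hp : (u, v) ∈ reg s.w := ⟨hu.le, hv.1, hv.2⟩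
      have h1 := h.r_ne' _ hp
      have h2 := h.lam_ne' _ hp
      have hx := h.x_v u v hu.le hv.1 hv.2
      have hf := h.fu_v u v hu.le hv.1 hv.2
      refine ((hx.mul hf.star).sub (hx.star.mul hf)).congr_deriv ?_
      simp only [J1, au, fuv, x, Complex.real_smul, map_sub, map_mul, map_div₀, map_neg, map_add,
        Complex.conj_ofReal, Complex.conj_I, Complex.conj_conj, Complex.star_def]
      push_cast
      field_simp
      ring)
    (slice_v_continuousOn (F := fun p => 2 * s.lam p / s.r p) (by fun_prop (disch := assumption))
      hu.le)
    (fun v hv => by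
      have hp : (u, v) ∈ reg s.w := ⟨hu.le, hv.1, hv.2⟩
      have := h.lam_pos hp
      have := h.r_pos _ hp
      positivity)
    (slice_v_continuousOn (F := fun p => s.J1 p - (starRingEnd ℂ) (s.J1 p))
      (by fun_prop (disch := assumption)) hu.le) (by
      have hz := (h.r_axis u hu.le huw).const_mul (24 / 5 * B' * B)
      rw [mul_zero] at hz
      refine squeeze_zero_norm' ?_ hz
      filter_upwards [Ioo_mem_nhdsGT huw] with v hv
      have hp : (u, v) ∈ reg s.w := ⟨hu.le, hv.1, hv.2⟩
      have h1 := h.abs_div_lam_le hp (s.r (u, v))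
      rw [abs_of_pos (h.r_pos _ hp)] at h1
      have h0 := h.r_pos _ hp
      have h2 : ‖s.x (u, v)‖ ≤ 12 / 5 * s.r (u, v) * B' := by
        rw [x, norm_mul, Complex.norm_real, Real.norm_eq_abs]
        have := hB' _ hp
        gcongr
      have h3 := mul_le_mul h2 (hB _ hp) (norm_nonneg _) (by positivity)
      refine (norm_sub_le _ _).trans ?_
      rw [norm_mul, norm_mul, RCLike.norm_conj, RCLike.norm_conj]
      linarith)
  -- The damping rate times |(r/λ)`Jff`| is exactly 2|`Jff`|, so the singular weight disappears.
  have e2 : ∀ v ∈ Ioo u s.w, ENNReal.ofReal (2 * s.lam (u, v) / s.r (u, v) *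
      ‖s.x (u, v) * (starRingEnd ℂ) (s.fu (u, v)) - (starRingEnd ℂ) (s.x (u, v)) * s.fu (u, v)‖)
      = 2 * ENNReal.ofReal ‖s.Jff (u, v)‖ := fun v hv => by
    have hp : (u, v) ∈ reg s.w := ⟨hu.le, hv.1, hv.2⟩
    have h1 := h.r_pos _ hp
    have h2 := h.lam_pos hp
    rw [hP _ hp, norm_mul, Complex.norm_real, Real.norm_of_nonneg (by positivity),
      ← ENNReal.ofReal_ofNat, ← ENNReal.ofReal_mul (by norm_num)]
    congr 1
    field_simp
  rw [setLIntegral_congr_fun measurableSet_Ioo e2] at key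
  rw [lintegral_const_mul' _ _ (by simp)] at key
  have key2 : ∫⁻ v in Ioo u s.w, ENNReal.ofReal ‖s.J1 (u, v) - (starRingEnd ℂ) (s.J1 (u, v))‖
      ≤ 2 * ∫⁻ v in Ioo u s.w, ENNReal.ofReal ‖s.J1 (u, v)‖ := by
    rw [← lintegral_const_mul' _ _ (by simp)]
    refine lintegral_mono fun v => ?_
    rw [← ENNReal.ofReal_ofNat, ← ENNReal.ofReal_mul (by norm_num)]
    refine ENNReal.ofReal_le_ofReal ((norm_sub_le _ _).trans ?_)
    rw [RCLike.norm_conj, two_mul]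
  exact (ENNReal.mul_le_mul_iff_right (by simp) (by simp)).1 (key.trans key2)

theorem tri_JN : Tri s.w (fun p => ‖s.JN p‖) (s.dl * s.kap a + 63 * s.dl * a) := by
  have h0 := h.dl_nonneg
  have hk := (h.majU_Nh hA).nonneg
  have h1 := h.Z_le_dl
  refine ((h.out_fv.mul_majU (h.majU_Nh hA) fun p => norm_nonneg _).add
    ((h.tri_Jff hA).const_mul (k := 63 * s.dl) (by positivity))).mono h.cJN.norm
    (fun p hp => h.norm_JN_le hp) ?_
  gcongr

theorem tri_JL : Tri s.w (fun p => ‖s.JL p‖)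
    (2.1 * s.dl ^ 3 + s.dl * s.kap a + 94.5 * s.dl * a) := by
  have h0 := h.dl_nonneg
  have hZ := h.Z_nonneg
  have hk := (h.majV_Lh hA).nonneg
  have h1 := h.Z_le_dl
  have h2 := hA.a_nonneg
  refine ((((h.out_fv.tri_div h.w_pos (fun p => norm_nonneg _) (d := 2.1 * s.Z)
    (by positivity)).const_mul h0).add (h.inn_fu.mul_majV (h.majV_Lh hA) fun p => norm_nonneg _)).add
    ((h.tri_Jff hA).const_mul (k := 94.5 * s.dl) (by positivity))).mono h.cJL.norm
    (fun p hp => h.norm_JL_le hp) ?_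
  have h3 : s.dl * (s.Z * (2.1 * s.Z)) ≤ s.dl * (s.dl * (2.1 * s.dl)) := by gcongr
  have h4 : s.Z * (528 * s.dl ^ 2 + 13 * a) ≤ s.dl * s.kap a := by
    unfold kap
    gcongr <;> norm_num
  linarith

theorem tri_Jnl : Tri s.w (fun p => ‖s.Jnl p‖)
    (s.ell a * s.kap a + 315 * s.dl * c + 200 * s.dl ^ 2 * s.kap a + 420 * s.dl ^ 4) := by
  have h0 := h.dl_nonneg
  have hZ := h.Z_nonneg
  have hl := (h.inn_nuu hA).nonneg
  have h1 := h.Z_le_dl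
  have h2 := hA.a_nonneg
  refine (((((h.inn_nuu hA).mul_majV (h.majV_Lh hA) fun p => abs_nonneg _).add
    (hA.J4.const_mul (k := 315 * s.dl) (by positivity))).add
    (h.out_lk.mul_majU (h.majU_Nh hA) fun p => abs_nonneg _)).add
    ((h.out_lk.tri_div h.w_pos (fun p => abs_nonneg _) (d := 2.1 * s.Z)
    (by positivity)).const_mul h0)).mono h.cJnl.norm (fun p hp => h.abs_Jnl_le hp) ?_
  have h3 : s.dl * (200 * s.dl ^ 2 * (2.1 * s.Z)) ≤ s.dl * (200 * s.dl ^ 2 * (2.1 * s.dl)) := by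
    gcongr
  have h4 : s.ell a * (528 * s.dl ^ 2 + 13 * a) ≤ s.ell a * s.kap a := by
    unfold kap
    gcongr <;> norm_num
  linarith

theorem tri_Jna : Tri s.w (fun p => ‖s.Jna p‖)
    (12 / 5 * (s.ell a * (s.dl + c + b) + 4 * s.dl ^ 3) + 10 * s.dl *
      (s.ell a * s.kap a + 315 * s.dl * c + 200 * s.dl ^ 2 * s.kap a + 420 * s.dl ^ 4)) := by
  have h0 := h.dl_nonneg
  have hZ := h.Z_nonneg
  have hl := (h.inn_nuu hA).nonneg
  have h1 := h.Z_le_dl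
  have h2 := hA.a_nonneg
  refine (((((h.inn_nuu hA).mul_majV (h.majV_g hA) fun p => abs_nonneg _).add
    (h.out_lk.tri_div h.w_pos (fun p => abs_nonneg _) (d := s.Z / 50) (by positivity))).const_mul
    (k := 12 / 5) (by norm_num)).add
    ((h.tri_Jnl hA).const_mul (k := 10 * s.dl) (by positivity))).mono h.cJna.norm
    (fun p hp => h.norm_Jna_le hp) ?_
  have h3 : 200 * s.dl ^ 2 * (s.Z / 50) ≤ 200 * s.dl ^ 2 * (s.dl / 50) := by gcongr
  have h4 : s.ell a * (s.D + (c + b)) ≤ s.ell a * (s.dl + c + b) := by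
    have : s.D ≤ s.dl := by unfold dl; linarith
    exact mul_le_mul_of_nonneg_left (by linarith) hl
  linarith

end Majorants

end IsSol
end Reduced

end ChargedScalar
end

open Set Filter Topology MeasureTheory
open scoped ENNReal NNReal

noncomputable section

namespace ChargedScalar

namespace Reduced

open Complex (I)

variable {s : Reduced} {a c b : ℝ}

/-! ### Areas of the metric Jacobians and of the charge terms. -/

namespace IsSol

theorem bdd_J3 (h : s.IsSol) : BddReg s.w s.J3 :=
  ((BddReg.const (12 / 5)).mul ((h.bdd_lk.abs.mul h.bdd_fv.norm).add
    (h.bdd_lamv.abs.mul h.bdd_fu.norm))).of_le fun p hp => by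
    refine (h.norm_div_lam_le hp _).trans (mul_le_mul_of_nonneg_left ?_ (by norm_num))
    refine (norm_sub_le _ _).trans (le_of_eq ?_)
    simp only [norm_mul, Complex.norm_real, Real.norm_eq_abs]

theorem bdd_J4 (h : s.IsSol) : BddReg s.w s.J4 :=
  ((BddReg.const (18 / 5)).mul ((h.bdd_nuu.abs.mul h.bdd_fv.norm).add
    (h.bdd_lk.abs.mul h.bdd_fu.norm))).of_le fun p hp => by
    refine (h.norm_div_nu_le hp _).trans (mul_le_mul_of_nonneg_left ?_ (by norm_num))
    refine (norm_sub_le _ _).trans (le_of_eq ?_)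
    simp only [norm_mul, Complex.norm_real, Real.norm_eq_abs]

theorem abs_pm_le (h : s.IsSol) {p : ℝ × ℝ} (hp : p ∈ reg s.w) : |s.pm p| ≤ 1 / 2 := by
  have h1 := h.one_sub_mu_pos hp
  have h2 := h.mu_nonneg hp
  have h3 := h.mu_le p hp
  have h4 := h.abs_q_le' hp
  have h5 := h.Z_le
  have h6 : s.q p ^ 2 ≤ 1 / 100 := by
    rw [← sq_abs]; nlinarith [abs_nonneg (s.q p)]
  rw [pm, abs_div, abs_of_pos h1, div_le_iff₀ h1, abs_le]
  constructor <;> nlinarith [sq_nonneg (s.q p)]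

/-- The derivatives of q contain q/r; the extra factor |q| turns it into the bounded q²/r, and the
factor r in the Maxwell source is combined with r|∂_vφ| ≤ 4δ. -/
theorem norm_q_Jq_le (h : s.IsSol) {p : ℝ × ℝ} (hp : p ∈ reg s.w) :
    3 * (|s.q p| * ‖s.Jq p‖) ≤ ‖s.Du p‖ * (1.512 * s.dl * s.Z / s.w)
      + ‖s.fv p‖ * (0.3 * s.Z * s.Z / s.w) + ‖s.fu p‖ * (1.512 * s.dl * s.Z / s.w)
      + ‖s.fu p‖ * (0.3 * s.Z * s.Z / s.w) := by
  have h0 := h.dl_nonneg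
  have hZw := h.Zw_nonneg
  have hr := h.r_pos p hp
  have he := h.eM_nonneg
  have hq := h.q_sq_div_le hp
  have hq' := h.eMq_le hp
  have hqs : |s.q p| * (|s.q p| / s.r p) = s.q p ^ 2 / s.r p := by
    rw [← mul_div_assoc, ← pow_two, sq_abs]
  have aux : ∀ z w : ℂ, s.r p * ‖w‖ ≤ 4 * s.dl → |s.q p| *
      (4 * Real.pi * s.e * s.r p * s.M * ‖z‖ + |s.q p| / s.r p) * ‖w‖
      ≤ ‖z‖ * (0.504 * s.dl * s.Z / s.w) + ‖w‖ * (0.1 * s.Z * s.Z / s.w) := by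
    intro z w hw
    calc _ = 4 * Real.pi * (s.e * s.M * |s.q p|) * (s.r p * ‖w‖) * ‖z‖
          + ‖w‖ * (|s.q p| * (|s.q p| / s.r p)) := by ring
      _ ≤ 12.6 * (s.Z / s.w / 100) * (4 * s.dl) * ‖z‖ + ‖w‖ * (s.Z * (s.Z / s.w) / 10) := by
          rw [hqs]
          have := four_pi_le
          gcongr
      _ = _ := by ring
  have h1 := aux (s.Du p) (s.fv p) (h.norm_rfv_le hp)
  have hfu : s.r p * ‖s.fv p‖ ≤ 4 * s.dl := h.norm_rfv_le hp
  have h2 : |s.q p| * (4 * Real.pi * s.e * s.r p * s.M * ‖s.fv p‖ + |s.q p| / s.r p) * ‖s.fu p‖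
      ≤ ‖s.fu p‖ * (0.504 * s.dl * s.Z / s.w) + ‖s.fu p‖ * (0.1 * s.Z * s.Z / s.w) := by
    calc _ = 4 * Real.pi * (s.e * s.M * |s.q p|) * (s.r p * ‖s.fv p‖) * ‖s.fu p‖
          + ‖s.fu p‖ * (|s.q p| * (|s.q p| / s.r p)) := by ring
      _ ≤ 12.6 * (s.Z / s.w / 100) * (4 * s.dl) * ‖s.fu p‖
          + ‖s.fu p‖ * (s.Z * (s.Z / s.w) / 10) := by
          rw [hqs]
          have := four_pi_le
          gcongr
      _ = _ := by ring
  have h3 : ‖s.Jq p‖ ≤ |s.qu p| * ‖s.fv p‖ + |s.qv p| * ‖s.fu p‖ := by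
    refine (norm_sub_le _ _).trans (le_of_eq ?_)
    simp only [norm_mul, Complex.norm_real, Real.norm_eq_abs]
  have h4 : |s.q p| * ‖s.Jq p‖ ≤ |s.q p| *
      (4 * Real.pi * s.e * s.r p * s.M * ‖s.Du p‖ + |s.q p| / s.r p) * ‖s.fv p‖ + |s.q p| *
      (4 * Real.pi * s.e * s.r p * s.M * ‖s.fv p‖ + |s.q p| / s.r p) * ‖s.fu p‖ := by
    have h5 := h.abs_qu_le hp
    have h6 := h.abs_qv_le hp
    calc |s.q p| * ‖s.Jq p‖ ≤ |s.q p| * (|s.qu p| * ‖s.fv p‖ + |s.qv p| * ‖s.fu p‖) := by gcongr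
      _ = |s.q p| * |s.qu p| * ‖s.fv p‖ + |s.q p| * |s.qv p| * ‖s.fu p‖ := by ring
      _ ≤ _ := by gcongr
  have h5 := h4.trans (add_le_add h1 h2)
  refine (mul_le_mul_of_nonneg_left h5 (by norm_num : (0 : ℝ) ≤ 3)).trans (le_of_eq ?_)
  ring

/-- (r/λ)·J4 = x ∂_u log|ν| - `pm` ∂_uφ solves a damped equation in v with rate (2+`pm`)λ/r. Its
source consists of `Jna`, `JN` and q·`Jq`, each already estimated; J4 returns in the bound only
through `Jna`, with a factor δ². -/
theorem tri_J4 (h : s.IsSol) (hA : s.Areas a c b) : Tri s.w (fun p => ‖s.J4 p‖)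
    (12 / 5 * (s.ell a * (s.dl + c + b) + 4 * s.dl ^ 3) + 10 * s.dl *
      (s.ell a * s.kap a + 315 * s.dl * c + 200 * s.dl ^ 2 * s.kap a + 420 * s.dl ^ 4)
      + 3 / 2 * (s.dl * s.kap a + 63 * s.dl * a) + 4 * s.dl ^ 3) := by
  have hr := h.r_ne
  have hm := h.one_sub_mu_ne
  have h0 := h.dl_nonneg
  have hZ := h.Z_nonneg
  have hZd := h.Z_le_dl
  -- Source of the damped equation; the last term comes from differentiating q² in `pm`.
  let S : ℝ × ℝ → ℂ := fun p => s.Jna p + ((1 + s.pm p : ℝ) : ℂ) * s.JN p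
    - ((2 * s.q p / (1 - s.mu p) : ℝ) : ℂ) * s.Jq p
  have cS : ContinuousOn S (reg s.w) := by
    simp only [S]; fun_prop (disch := assumption)
  have hS : Tri s.w (fun p => ‖S p‖)
      (12 / 5 * (s.ell a * (s.dl + c + b) + 4 * s.dl ^ 3) + 10 * s.dl *
      (s.ell a * s.kap a + 315 * s.dl * c + 200 * s.dl ^ 2 * s.kap a + 420 * s.dl ^ 4)
      + 3 / 2 * (s.dl * s.kap a + 63 * s.dl * a) + 4 * s.dl ^ 3) := by
    have tq := (((h.inn_Du.tri_div h.w_pos (fun p => norm_nonneg _) (d := 1.512 * s.dl * s.Z)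
      (by positivity)).add (h.out_fv.tri_div h.w_pos (fun p => norm_nonneg _)
      (d := 0.3 * s.Z * s.Z) (by positivity))).add (h.inn_fu.tri_div h.w_pos
      (fun p => norm_nonneg _) (d := 1.512 * s.dl * s.Z) (by positivity))).add
      (h.inn_fu.tri_div h.w_pos (fun p => norm_nonneg _) (d := 0.3 * s.Z * s.Z) (by positivity))
    refine (((h.tri_Jna hA).add ((h.tri_JN hA).const_mul (k := 3 / 2) (by norm_num))).add tq).mono
      cS.norm (fun p hp => ?_) (add_le_add le_rfl ?_)
    · have h1 := h.norm_q_Jq_le hp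
      have h2 := h.abs_pm_le hp
      have h3 := h.one_sub_mu_pos hp
      have h4 := h.mu_le p hp
      refine (norm_sub_le _ _).trans (add_le_add ((norm_add_le _ _).trans (add_le_add le_rfl ?_))
        (le_trans ?_ h1))
      · rw [norm_mul, Complex.norm_real, Real.norm_eq_abs]
        rw [abs_le] at h2
        have h5 : |1 + s.pm p| ≤ 3 / 2 := by rw [abs_le]; constructor <;> linarith
        gcongr
      · rw [norm_mul, Complex.norm_real, Real.norm_eq_abs, abs_div, abs_of_pos h3, ← mul_assoc]
        refine mul_le_mul_of_nonneg_right ?_ (norm_nonneg _)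
        rw [div_le_iff₀ h3, abs_mul, abs_two]
        nlinarith [abs_nonneg (s.q p)]
    · have e1 : s.Z * (s.dl * s.Z) ≤ s.dl ^ 3 := by
        calc _ ≤ s.dl * (s.dl * s.dl) := by gcongr
          _ = _ := by ring
      have e2 : s.Z * (s.Z * s.Z) ≤ s.dl ^ 3 := by
        calc _ ≤ s.dl * (s.dl * s.dl) := by gcongr
          _ = _ := by ring
      have : 0 ≤ s.dl ^ 3 := by positivity
      linarith
  obtain ⟨B, hB0, hB⟩ := h.bdd_J4
  have hP : ∀ p ∈ reg s.w, s.x p * ((s.nuu p / s.nu p : ℝ) : ℂ) - (s.pm p : ℂ) * s.fu p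
      = ((s.r p / s.lam p : ℝ) : ℂ) * s.J4 p := fun p hp => by
    have h1 := h.r_ne' _ hp
    have h2 := h.lam_ne' _ hp
    have h3 := h.nu_ne' _ hp
    simp only [x, J4, lk]; push_cast; field_simp
  refine hS.of_slices h.cJ4.norm fun u hu huw => ?_
  have key := setLIntegral_mul_norm_le (a := u) (b := s.w)
    (P := fun v => s.x (u, v) * ((s.nuu (u, v) / s.nu (u, v) : ℝ) : ℂ)
      - (s.pm (u, v) : ℂ) * s.fu (u, v))
    (S := fun v => S (u, v))
    (κ := fun v => (2 + s.pm (u, v)) * (s.lam (u, v) / s.r (u, v)))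
    (fun v hv => by
      have hp : (u, v) ∈ reg s.w := ⟨hu.le, hv.1, hv.2⟩
      have h1 := h.r_ne' _ hp
      have h2 := h.lam_ne' _ hp
      have h3 := h.nu_ne' _ hp
      have h4 : (1 - s.mu (u, v) : ℂ) ≠ 0 := by exact_mod_cast h.one_sub_mu_ne _ hp
      have hx := h.x_v u v hu.le hv.1 hv.2
      have hf := h.fu_v u v hu.le hv.1 hv.2
      have hn := ((h.nuu_v u v hu hv.1 hv.2).div (h.nu_v u v hu.le hv.1 hv.2)
        (h.nu_ne _ hp)).ofReal_comp
      have hpm := (h.pm_v u v hu.le hv.1 hv.2).ofReal_comp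
      refine ((hx.mul hn).sub (hpm.mul hf)).congr_deriv ?_
      simp only [S, Jna, JN, Jq, av, au, lku, pmu, pmv, lk, fuv, x, Pi.div_apply,
        Complex.real_smul]
      push_cast
      field_simp
      ring)
    (slice_v_continuousOn (F := fun p => (2 + s.pm p) * (s.lam p / s.r p))
      (by fun_prop (disch := assumption)) hu.le)
    (fun v hv => by
      have hp : (u, v) ∈ reg s.w := ⟨hu.le, hv.1, hv.2⟩
      have := h.lam_pos hp
      have := h.r_pos _ hp
      have h2 := (abs_le.1 (h.abs_pm_le hp)).1
      have : 0 ≤ 2 + s.pm (u, v) := by linarith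
      positivity)
    (slice_v_continuousOn cS hu.le) (by
      have hz := (h.r_axis u hu.le huw).const_mul (12 / 5 * B)
      rw [mul_zero] at hz
      refine squeeze_zero_norm' ?_ hz
      filter_upwards [Ioo_mem_nhdsGT huw] with v hv
      have hp : (u, v) ∈ reg s.w := ⟨hu.le, hv.1, hv.2⟩
      have h0 := h.r_pos _ hp
      have h1 := h.abs_div_lam_le hp (s.r (u, v))
      rw [abs_of_pos h0] at h1
      rw [hP _ hp, norm_mul, Complex.norm_real, Real.norm_eq_abs]
      have h3 := mul_le_mul h1 (hB _ hp) (norm_nonneg _) (by positivity)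
      linarith)
  refine le_trans (setLIntegral_mono' measurableSet_Ioo fun v hv => ?_) key
  have hp : (u, v) ∈ reg s.w := ⟨hu.le, hv.1, hv.2⟩
  have h1 := h.r_pos _ hp
  have h2 := h.lam_pos hp
  have h3 := (abs_le.1 (h.abs_pm_le hp)).1
  refine ENNReal.ofReal_le_ofReal ?_
  rw [hP _ hp, norm_mul, Complex.norm_real, Real.norm_of_nonneg (by positivity)]
  have e : (2 + s.pm (u, v)) * (s.lam (u, v) / s.r (u, v)) *
      (s.r (u, v) / s.lam (u, v) * ‖s.J4 (u, v)‖) = (2 + s.pm (u, v)) * ‖s.J4 (u, v)‖ := by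
    field_simp
  rw [e]
  -- 2 + `pm` ≥ 3/2, so the weighted quantity dominates |J4|.
  nlinarith [norm_nonneg (s.J4 (u, v))]

/-- The contributions linear in Z are Z/50 and Z/200, with sum Z/40; all others carry an additional
factor δ. -/
theorem tri_ePsiv (h : s.IsSol) (hA : s.Areas a c b) : Tri s.w (fun p => ‖s.ePsiv p‖)
    (s.Z / 40 + s.dl * (s.dl + c + b + s.ell a)) := by
  have h0 := h.dl_nonneg
  have hZ := h.Z_nonneg
  have hw := h.w_pos
  have hl := (h.out_lamv hA).nonneg
  have hne := h.lam_ne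
  have hlam : Out s.w (fun p => |s.lamv p|) (s.ell a) :=
    (h.out_lamv hA).mono (h.clamv.abs) (fun p hp => by
      have h1 := h.lam_pos hp
      have h2 := h.lam_le' hp
      rw [abs_div, abs_of_pos h1, le_div_iff₀ h1]
      nlinarith [abs_nonneg (s.lamv p)]) le_rfl
  have t1 := tri_const hw (d := s.Z / 50) (by positivity)
  have t2 := (h.out_atv hA).tri_div hw (fun p => norm_nonneg _) (d := s.Z / 100) (by positivity)
  have t3 := hlam.tri_div hw (fun p => abs_nonneg _) (d := s.Z / 100) (by positivity)
  have t4 := ((h.out_lamv hA).add (h.out_Nv.mono (F := fun p => |s.Nv p|) h.cNv.abs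
    (fun p hp => (abs_of_nonneg (h.Nv_nonneg hp)).le) le_rfl)).tri_div hw
    (fun p => by positivity) (d := s.Z / 200) (by positivity)
  have t5 := h.out_fv.tri_div hw (fun p => norm_nonneg _) (d := 1 / 200) (by positivity)
  have t6 := h.out_fv.tri_div hw (fun p => norm_nonneg _) (d := s.Z / 100) (by positivity)
  refine (((((t1.add t2).add t3).add t4).add t5).add t6).mono h.cePsiv.norm (fun p hp => ?_) ?_
  · refine (h.norm_ePsiv_le hp).trans (le_of_eq ?_)
    rw [abs_of_nonneg (h.Nv_nonneg hp)]
  · have h1 := h.Z_le_dl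
    have h2 := h.dl_le
    have hc := hA.c_nonneg
    have hb := hA.b_nonneg
    have hD : s.D ≤ s.dl := by unfold dl; linarith
    have hD0 := h.D_nonneg
    have e1 : (s.D + (c + b) + s.ell a / 50) * (s.Z / 100)
        ≤ (s.dl + (c + b) + s.ell a / 50) * (s.dl / 100) := by gcongr
    have e2 : s.ell a * (s.Z / 100) ≤ s.ell a * (s.dl / 100) := by gcongr
    have e3 : (s.ell a + 126 * s.dl ^ 2) * (s.Z / 200)
        ≤ (s.ell a + 126 * s.dl ^ 2) * (s.dl / 200) := by gcongr
    have e4 : s.Z * (s.Z / 100) ≤ s.dl * (s.dl / 100) := by gcongr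
    have e5 : s.dl ^ 3 ≤ 1 / 100 * s.dl ^ 2 := by nlinarith [sq_nonneg s.dl]
    have e6 := mul_nonneg h0 hc
    have e7 := mul_nonneg h0 hb
    have e8 := mul_nonneg h0 hl
    nlinarith [sq_nonneg s.dl]

theorem tri_eWqu (h : s.IsSol) (hA : s.Areas a c b) : Tri s.w (fun p => ‖s.eWqu p‖)
    (s.Z / 40 + s.dl * (s.dl + c + b + s.ell a)) := by
  have h0 := h.dl_nonneg
  have hZ := h.Z_nonneg
  have hw := h.w_pos
  have hl := (h.inn_nuu hA).nonneg
  have t1 := tri_const hw (d := s.Z / 200) (by positivity)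
  have t4 := ((h.inn_nuu hA).add h.inn_Lu).tri_div hw
    (fun p => by positivity) (d := s.Z / 200) (by positivity)
  have t5 := h.inn_Du.tri_div hw (fun p => norm_nonneg _) (d := 1 / 200) (by positivity)
  have t6 := h.inn_fu.tri_div hw (fun p => norm_nonneg _) (d := s.Z / 100) (by positivity)
  refine (((t1.add t4).add t5).add t6).mono h.ceWqu.norm (fun p hp => h.norm_eWqu_le hp) ?_
  have h1 := h.Z_le_dl
  have h2 := h.dl_le
  have hc := hA.c_nonneg
  have hb := hA.b_nonneg
  have e3 : (s.ell a + 200 * s.dl ^ 2) * (s.Z / 200)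
      ≤ (s.ell a + 200 * s.dl ^ 2) * (s.dl / 200) := by gcongr
  have e4 : s.Z * (s.Z / 100) ≤ s.dl * (s.dl / 100) := by gcongr
  have e5 : s.dl ^ 3 ≤ 1 / 100 * s.dl ^ 2 := by nlinarith [sq_nonneg s.dl]
  have e6 := mul_nonneg h0 hc
  have e7 := mul_nonneg h0 hb
  have e8 := mul_nonneg h0 hl
  nlinarith [sq_nonneg s.dl]

/-- One improvement step for the area bounds. -/
theorem areas_step (h : s.IsSol) (hA : s.Areas a c b) :
    s.Areas (4 * s.dl ^ 2 + 23 * s.dl * (c + b))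
      (10 ^ 7 * ((s.dl ^ 2 + a) * (s.dl + c + b) + s.dl * (s.dl ^ 2 + a) ^ 2 + s.dl ^ 2 * c))
      (s.Z / 40 + s.dl * (s.dl + c + b + s.ell a)) := by
  have h0 := h.dl_nonneg
  have h1 := h.dl_le
  have ha := hA.a_nonneg
  have hc := hA.c_nonneg
  have hb := hA.b_nonneg
  have hJ3 : Tri s.w (fun p => ‖s.J3 p‖)
      (10 ^ 7 * ((s.dl ^ 2 + a) * (s.dl + c + b) + s.dl * (s.dl ^ 2 + a) ^ 2 + s.dl ^ 2 * c)) ∧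
      Tri s.w (fun p => ‖s.J4 p‖)
      (10 ^ 7 * ((s.dl ^ 2 + a) * (s.dl + c + b) + s.dl * (s.dl ^ 2 + a) ^ 2 + s.dl ^ 2 * c)) := by
    have t4 := h.tri_J4 hA
    have tL := h.tri_JL hA
    have tN := h.tri_JN hA
    have t3 := ((t4.add tL).add tN).mono h.cJ3.norm (fun p hp => h.norm_J3_le hp) le_rfl
    have l1 : s.ell a ≤ 1170 * (s.dl ^ 2 + a) := by unfold ell; linarith
    have k1 : s.kap a ≤ 530 * (s.dl ^ 2 + a) := by unfold kap; linarith
    have hk : 0 ≤ s.kap a := by unfold kap; positivity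
    have hE : s.dl ^ 2 ≤ s.dl ^ 2 + a := by linarith
    have haE : a ≤ s.dl ^ 2 + a := by linarith [sq_nonneg s.dl]
    have hd2 : s.dl ^ 2 ≤ 1 / 10000 := by nlinarith
    generalize s.ell a = l at *
    generalize s.kap a = k at *
    generalize s.dl ^ 2 + a = E at *
    generalize s.dl = d at *
    have hE0 : 0 ≤ E := ha.trans haE
    have e1 : l * (d + c + b) ≤ 1170 * E * (d + c + b) := by gcongr
    have e2 : d * (l * k) ≤ d * (1170 * E * (530 * E)) := by gcongr
    have e3 : d * k ≤ d * (530 * E) := by gcongr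
    have e4 : d * (d ^ 2 * k) ≤ d * (1 / 10000 * (530 * E)) := by gcongr
    have e5 : d * d ^ 2 ≤ d * E := by gcongr
    have e6 : d * (d ^ 2 * d ^ 2) ≤ d * (1 / 10000 * E) := by gcongr
    have e7 : d * a ≤ d * E := by gcongr
    have p1 : 0 ≤ d * E := by positivity
    have p2 : 0 ≤ E * c := by positivity
    have p3 : 0 ≤ E * b := by positivity
    have p4 : 0 ≤ d * E ^ 2 := by positivity
    have p5 : 0 ≤ d ^ 2 * c := by positivity
    exact ⟨t3.mono_const (by linarith), t4.mono_const (by linarith)⟩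
  exact ⟨h.tri_J1 hA, h.tri_J2 hA, hJ3.1, hJ3.2, h.tri_ePsiv hA, h.tri_eWqu hA⟩

end IsSol
end Reduced

end ChargedScalar
end

open Set Filter Topology MeasureTheory
open scoped ENNReal NNReal

noncomputable section

namespace ChargedScalar

/-! ### Continuous induction on the size of the triangle. -/

theorem reg_mono {w w' : ℝ} (h : w' ≤ w) : reg w' ⊆ reg w :=
  fun _ hp => ⟨hp.1, hp.2.1, hp.2.2.trans_le h⟩

theorem HasU.restrict {E : Type*} [NormedAddCommGroup E] [NormedSpace ℝ E] {w w' : ℝ}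
    {f f' : ℝ × ℝ → E} (hf : HasU w f f') (h : w' ≤ w) : HasU w' f f' :=
  fun u v hu huv hv => hf u v hu huv (hv.trans_le h)

theorem HasV.restrict {E : Type*} [NormedAddCommGroup E] [NormedSpace ℝ E] {w w' : ℝ}
    {f f' : ℝ × ℝ → E} (hf : HasV w f f') (h : w' ≤ w) : HasV w' f f' :=
  fun u v hu huv hv => hf u v hu huv (hv.trans_le h)

namespace Reduced

open Complex (I)

variable {s : Reduced} {a c b : ℝ}

/-- The same fields on a smaller triangle. -/
def restrict (s : Reduced) (w' : ℝ) : Reduced := { s with w := w' }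

/-- All hypotheses are inherited by smaller triangles: e M w only decreases, and Z and D remain
upper bounds for the slice integrals. -/
theorem IsSol.restrict (h : s.IsSol) {w' : ℝ} (hw' : 0 < w') (hle : w' ≤ s.w) :
    (s.restrict w').IsSol where
  e_nonneg := h.e_nonneg
  w_pos := hw'
  M_ge := h.M_ge
  φ0_le := h.φ0_le
  small := (mul_le_mul_of_nonneg_left hle h.eM_nonneg).trans h.small
  Z_nonneg := h.Z_nonneg
  D_nonneg := h.D_nonneg
  ZD_le := h.ZD_le
  cr := h.cr.mono (reg_mono hle)
  clam := h.clam.mono (reg_mono hle)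
  cnu := h.cnu.mono (reg_mono hle)
  cmu := h.cmu.mono (reg_mono hle)
  cq := h.cq.mono (reg_mono hle)
  cA := h.cA.mono (reg_mono hle)
  clamv := h.clamv.mono (reg_mono hle)
  cnuu := h.cnuu.mono (reg_mono hle)
  cAu := h.cAu.mono (reg_mono hle)
  cf := h.cf.mono (reg_mono hle)
  cfu := h.cfu.mono (reg_mono hle)
  cfv := h.cfv.mono (reg_mono hle)
  catv := h.catv.mono (reg_mono hle)
  cbu := h.cbu.mono (reg_mono hle)
  r_pos p hp := h.r_pos p (reg_mono hle hp)
  lam_ge p hp := h.lam_ge p (reg_mono hle hp)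
  nu_neg p hp := h.nu_neg p (reg_mono hle hp)
  nu_ge p hp := h.nu_ge p (reg_mono hle hp)
  mu_le p hp := h.mu_le p (reg_mono hle hp)
  bdd := h.bdd.imp fun _ hB p hp => hB p (reg_mono hle hp)
  r_u := h.r_u.restrict hle
  r_v := h.r_v.restrict hle
  lam_u := h.lam_u.restrict hle
  lam_v := h.lam_v.restrict hle
  nu_u := h.nu_u.restrict hle
  nu_v := h.nu_v.restrict hle
  f_u := h.f_u.restrict hle
  f_v := h.f_v.restrict hle
  fu_v := h.fu_v.restrict hle
  fv_u := h.fv_u.restrict hle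
  at_v := h.at_v.restrict hle
  b_u := h.b_u.restrict hle
  A_u := h.A_u.restrict hle
  A_v := h.A_v.restrict hle
  mu_u := h.mu_u.restrict hle
  mu_v := h.mu_v.restrict hle
  q_u := h.q_u.restrict hle
  q_v := h.q_v.restrict hle
  lam_init v hv0 hv := h.lam_init v hv0 (lt_of_lt_of_le hv hle)
  lamv_init v hv0 hv := h.lamv_init v hv0 (lt_of_lt_of_le hv hle)
  f_origin := h.f_origin
  at_origin := h.at_origin
  X_le u hu huw := (lintegral_mono_set (Ioo_subset_Ioo_right hle)).trans
    (h.X_le u hu (lt_of_lt_of_le huw hle))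
  Y_le v hv0 hv := h.Y_le v hv0 (lt_of_lt_of_le hv hle)
  D_le := (lintegral_mono_set (Ioo_subset_Ioo_right hle)).trans h.D_le
  r_axis u hu huw := h.r_axis u hu (lt_of_lt_of_le huw hle)
  mu_axis u hu huw := h.mu_axis u hu (lt_of_lt_of_le huw hle)
  q_axis u hu huw := h.q_axis u hu (lt_of_lt_of_le huw hle)
  A_axis u hu huw := h.A_axis u hu (lt_of_lt_of_le huw hle)
  nu_axis u hu huw := h.nu_axis u hu (lt_of_lt_of_le huw hle)
  la_ge u hu huw := h.la_ge u hu (lt_of_lt_of_le huw hle)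
  nuu_axis u hu huw := h.nuu_axis u hu (lt_of_lt_of_le huw hle)
  b_axis u hu huw := h.b_axis u hu (lt_of_lt_of_le huw hle)
  lk_axis u hu huw := h.lk_axis u hu (lt_of_lt_of_le huw hle)
  lk_axis' v hv0 hv := h.lk_axis' v hv0 (lt_of_lt_of_le hv hle)
  lam_axis' v hv0 hv := h.lam_axis' v hv0 (lt_of_lt_of_le hv hle)
  lamv_axis' v hv0 hv := h.lamv_axis' v hv0 (lt_of_lt_of_le hv hle)
  g_axis' v hv0 hv := h.g_axis' v hv0 (lt_of_lt_of_le hv hle)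

/-- The total area density. -/
def dens (s : Reduced) (p : ℝ × ℝ) : ℝ :=
  ‖s.J1 p‖ + ‖s.J2 p‖ + (‖s.J3 p‖ + ‖s.J4 p‖) + (‖s.ePsiv p‖ + ‖s.eWqu p‖)

namespace IsSol

theorem cdens (h : s.IsSol) : ContinuousOn s.dens (reg s.w) :=
  ((h.cJ1.norm.add h.cJ2.norm).add (h.cJ3.norm.add h.cJ4.norm)).add
    (h.cePsiv.norm.add h.ceWqu.norm)

theorem bdd_g (h : s.IsSol) : BddReg s.w s.g :=
  (h.bdd_atv.norm.add (h.bdd_f.norm.mul h.bdd_lamv.abs)).of_le fun p _ => by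
    refine (norm_sub_le _ _).trans (le_of_eq ?_)
    simp only [norm_mul, Complex.norm_real, Real.norm_eq_abs]

theorem bdd_A (h : s.IsSol) : BddReg s.w s.A :=
  .intro (B := 3 / 10 * (s.Z / s.w) * s.w) fun p hp => by
    refine (h.abs_A_le hp).trans ?_
    have h1 : p.2 - p.1 ≤ s.w := by linarith [hp.1, hp.2.2]
    have h2 := h.Zw_nonneg
    gcongr

theorem bdd_hh (h : s.IsSol) : BddReg s.w s.hh := by
  refine (((h.bdd_bu.norm.add (((BddReg.const (s.e * s.M)).mul
    ((h.bdd_Au.abs.mul h.bdd_r.abs).add h.bdd_A.abs)).add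
    ((BddReg.const (s.e * s.M)).mul ((h.bdd_A.abs.mul h.bdd_r.abs).mul h.bdd_fu.norm)))).add
    (h.bdd_f.norm.mul h.bdd_nuu.abs))).of_le fun p hp => ?_
  have heM := h.eM_nonneg
  refine (norm_sub_le _ _).trans (add_le_add ((norm_add_le _ _).trans (add_le_add le_rfl ?_)) ?_)
  · rw [norm_mul, Complex.norm_I, one_mul]
    refine (norm_add_le _ _).trans (add_le_add ((h.norm_charge_φ_le hp _).trans ?_)
      ((h.norm_charge_le _ _).trans ?_))
    · refine mul_le_mul_of_nonneg_left ((abs_add_le _ _).trans (add_le_add ?_ ?_)) heM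
      · rw [abs_mul]
      · rw [abs_mul, abs_of_neg (h.nu_neg p hp)]
        nlinarith [abs_nonneg (s.A p), h.nu_ge p hp]
    · rw [abs_mul, mul_assoc (s.e * s.M)]
  · rw [norm_mul, Complex.norm_real, Real.norm_eq_abs]

theorem bdd_dens (h : s.IsSol) : BddReg s.w s.dens := by
  have b3 := h.bdd_J3.norm
  have b4 := h.bdd_J4.norm
  have b1 : BddReg s.w s.J1 :=
    (((BddReg.const (12 / 5)).mul ((h.bdd_fu.norm.mul h.bdd_g.norm).add
      (h.bdd_fv.norm.mul (BddReg.const (s.Z / 50 / s.w))))).add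
      ((BddReg.const (10 * s.dl)).mul b3)).of_le fun p hp => h.norm_J1_le hp
  have b2 : BddReg s.w s.J2 :=
    (((BddReg.const (18 / 5)).mul ((h.bdd_fu.norm.mul (BddReg.const (s.Z / 200 / s.w))).add
      (h.bdd_fv.norm.mul h.bdd_hh.norm))).add
      ((BddReg.const (15 * s.dl)).mul b4)).of_le fun p hp => h.norm_J2_le hp
  have b5 : BddReg s.w s.ePsiv :=
    ((((((BddReg.const (s.Z / 50 / s.w ^ 2)).add (h.bdd_atv.norm.mul
      (BddReg.const (s.Z / 100 / s.w)))).add (h.bdd_lamv.abs.mul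
      (BddReg.const (s.Z / 100 / s.w)))).add ((h.bdd_lamv_div.abs.add h.bdd_Nv).mul
      (BddReg.const (s.Z / 200 / s.w)))).add (h.bdd_fv.norm.mul
      (BddReg.const (1 / 200 / s.w)))).add (h.bdd_fv.norm.mul
      (BddReg.const (s.Z / 100 / s.w)))).of_le fun p hp => h.norm_ePsiv_le hp
  have b6 : BddReg s.w s.eWqu :=
    ((((BddReg.const (s.Z / 200 / s.w ^ 2)).add ((h.bdd_nuu_div.abs.add h.bdd_Lu.abs).mul
      (BddReg.const (s.Z / 200 / s.w)))).add (h.bdd_Du.norm.mul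
      (BddReg.const (1 / 200 / s.w)))).add (h.bdd_fu.norm.mul
      (BddReg.const (s.Z / 100 / s.w)))).of_le fun p hp => h.norm_eWqu_le hp
  exact ((b1.norm.add b2.norm).add (b3.add b4)).add (b5.norm.add b6.norm)

theorem areas_of_dens (h : s.IsSol) {t : ℝ} (ht : Tri s.w s.dens t) : s.Areas t t t := by
  refine ⟨ht.mono h.cJ1.norm ?_ le_rfl, ht.mono h.cJ2.norm ?_ le_rfl, ht.mono h.cJ3.norm ?_ le_rfl,
    ht.mono h.cJ4.norm ?_ le_rfl, ht.mono h.cePsiv.norm ?_ le_rfl,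
    ht.mono h.ceWqu.norm ?_ le_rfl⟩ <;>
  · intro p _
    simp only [dens]
    linarith [norm_nonneg (s.J1 p), norm_nonneg (s.J2 p), norm_nonneg (s.J3 p),
      norm_nonneg (s.J4 p), norm_nonneg (s.ePsiv p), norm_nonneg (s.eWqu p)]

theorem dens_of_areas (h : s.IsSol) (hA : s.Areas a c b) :
    Tri s.w s.dens (a + a + (c + c) + (b + b)) :=
  ((hA.J1.add hA.J2).add (hA.J3.add hA.J4)).add (hA.P.add hA.P') |>.mono h.cdens
    (fun _ _ => le_rfl) le_rfl

/-- A priori bounds of order one improve to bounds proportional to `δ`. -/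
theorem areas_improve (h : s.IsSol) (hd : s.dl ≤ 1 / 10 ^ 30) (hA : s.Areas 1 1 1) :
    s.Areas (50 * s.dl) (2 * 10 ^ 9 * s.dl) (5 * s.dl) := by
  have h0 := h.dl_nonneg
  have h2 : s.dl ^ 2 ≤ 1 / 10 ^ 30 * s.dl := by nlinarith
  have hZ := h.Z_le_dl
  have h1 := h.areas_step hA
  have e1 : 4 * s.dl ^ 2 + 23 * s.dl * (1 + 1) ≤ 50 * s.dl := by linarith
  -- The improved bound for J1 and J2 has to be inserted first: the step for J3 and J4 contains the
  -- product a(c + b), which is not small while a = 1.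
  have hA2 : s.Areas (50 * s.dl) 1 1 :=
    ⟨h1.J1.mono_const e1, h1.J2.mono_const e1, hA.J3, hA.J4, hA.P, hA.P'⟩
  refine (h.areas_step hA2).mono ?_ ?_ ?_
  · linarith
  · have hE : s.dl ^ 2 + 50 * s.dl ≤ 51 * s.dl := by linarith
    have hE0 : 0 ≤ s.dl ^ 2 + 50 * s.dl := by positivity
    have a1 : (s.dl ^ 2 + 50 * s.dl) * (s.dl + 1 + 1) ≤ 51 * s.dl * 3 := by
      gcongr; linarith
    have a2 : s.dl * (s.dl ^ 2 + 50 * s.dl) ^ 2 ≤ s.dl * 1 ^ 2 := by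
      gcongr; linarith
    linarith
  · have a1 : s.ell (50 * s.dl) ≤ 1 := by unfold ell; linarith
    have a2 : s.dl * (s.dl + 1 + 1 + s.ell (50 * s.dl)) ≤ s.dl * 4 := by
      gcongr; linarith
    linarith

/-- Bounds proportional to `δ` improve to bounds of the order of the theorem. -/
theorem areas_improve' (h : s.IsSol) (hd : s.dl ≤ 1 / 10 ^ 30)
    (hA : s.Areas (50 * s.dl) (2 * 10 ^ 9 * s.dl) (5 * s.dl)) :
    s.Areas (5 * 10 ^ 10 * s.dl ^ 2) (2 * 10 ^ 27 * s.dl ^ 3)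
      (s.Z / 40 + 3 * 10 ^ 9 * s.dl ^ 2) := by
  have h0 := h.dl_nonneg
  have h1 := h.areas_step hA
  have s0 := sq_nonneg s.dl
  have h2 : s.dl ^ 2 ≤ 1 / 10 ^ 30 * s.dl := by nlinarith
  have h3 : s.dl ^ 3 ≤ 1 / 10 ^ 30 * s.dl ^ 2 := by nlinarith
  have p3 : 0 ≤ s.dl ^ 3 := by positivity
  have e1 : 4 * s.dl ^ 2 + 23 * s.dl * (2 * 10 ^ 9 * s.dl + 5 * s.dl) ≤ 5 * 10 ^ 10 * s.dl ^ 2 := by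
    nlinarith
  have e2 : s.Z / 40 + s.dl * (s.dl + 2 * 10 ^ 9 * s.dl + 5 * s.dl + s.ell (50 * s.dl))
      ≤ s.Z / 40 + 3 * 10 ^ 9 * s.dl ^ 2 := by
    unfold ell; nlinarith
  -- With a now quadratic and c + b linear in δ, the product in the next step is cubic.
  have hA2 : s.Areas (5 * 10 ^ 10 * s.dl ^ 2) (2 * 10 ^ 9 * s.dl) (5 * s.dl) :=
    ⟨h1.J1.mono_const e1, h1.J2.mono_const e1, hA.J3, hA.J4, hA.P, hA.P'⟩
  have h4 := h.areas_step hA2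
  have e3 : 10 ^ 7 * ((s.dl ^ 2 + 5 * 10 ^ 10 * s.dl ^ 2) * (s.dl + 2 * 10 ^ 9 * s.dl + 5 * s.dl)
      + s.dl * (s.dl ^ 2 + 5 * 10 ^ 10 * s.dl ^ 2) ^ 2 + s.dl ^ 2 * (2 * 10 ^ 9 * s.dl))
      ≤ 2 * 10 ^ 27 * s.dl ^ 3 := by
    have h5 : s.dl ^ 5 ≤ 1 / 10 ^ 30 * s.dl ^ 3 := by nlinarith
    nlinarith
  exact ⟨hA2.J1, hA2.J2, h4.J3.mono_const e3, h4.J4.mono_const e3, h1.P.mono_const e2,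
    h1.P'.mono_const e2⟩

/-- The area bounds, by continuous induction on the size of the triangle. -/
theorem areas_one (h : s.IsSol) (hd : s.dl ≤ 1 / 10 ^ 30) : s.Areas 1 1 1 := by
  have h0 := h.dl_nonneg
  obtain ⟨B, hB0, hB⟩ := h.bdd_dens
  have hw := h.w_pos
  -- The bootstrap: total area at most 1 on a smaller triangle implies at most 1/2, by
  -- `areas_improve` on the restricted system.
  have half : ∀ w', 0 < w' → w' ≤ s.w →
      ∫⁻ p in reg w', ENNReal.ofReal (s.dens p) ≤ ENNReal.ofReal 1 →
      ∫⁻ p in reg w', ENNReal.ofReal (s.dens p) ≤ ENNReal.ofReal (1 / 2) := by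
    intro w' hw' hle ht
    have h' := h.restrict hw' hle
    have hA := h'.areas_of_dens (t := 1) ⟨zero_le_one, h'.cdens, ht⟩
    have h1 := h'.dens_of_areas (h'.areas_improve hd hA)
    refine h1.le.trans (ENNReal.ofReal_le_ofReal ?_)
    have : (s.restrict w').dl = s.dl := rfl
    rw [this]
    linarith
  -- Induction on the number of strips of width η needed to exhaust the triangle.
  have key : ∀ n : ℕ, ∀ w', 0 < w' → w' ≤ s.w → w' * (2 * (B * s.w + 1)) ≤ n →
      ∫⁻ p in reg w', ENNReal.ofReal (s.dens p) ≤ ENNReal.ofReal (1 / 2) := by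
    intro n
    induction n with
    | zero =>
      intro w' hw' _ hn
      have : 0 < w' * (2 * (B * s.w + 1)) := by positivity
      simp only [Nat.cast_zero] at hn
      linarith
    | succ n ih =>
      intro w' hw' hle hn
      refine half w' hw' hle ?_
      have hK : 0 < 2 * (B * s.w + 1) := by positivity
      -- A strip of width η has measure at most wη, so the density, bounded by B, adds at most 1/2.
      -- The extra 1 keeps η defined when B = 0.
      let η := 1 / (2 * (B * s.w + 1))
      have hη : 0 < η := by positivity
      have hηK : η * (2 * (B * s.w + 1)) = 1 := by simp only [η]; field_simp
      have hsub : reg w' ⊆ reg (w' - η) ∪ (Icc 0 s.w ×ˢ Icc (w' - η) w' ∩ reg w') := fun p hp => by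
        rcases lt_or_ge p.2 (w' - η) with h1 | h1
        · exact Or.inl ⟨hp.1, hp.2.1, h1⟩
        · exact Or.inr ⟨⟨⟨hp.1, by linarith [hp.2.1, hp.2.2]⟩, h1, hp.2.2.le⟩, hp⟩
      have hprev : ∫⁻ p in reg (w' - η), ENNReal.ofReal (s.dens p) ≤ ENNReal.ofReal (1 / 2) := by
        rcases le_or_gt (w' - η) 0 with h1 | h1
        · have : reg (w' - η) = ∅ := by
            ext p
            simp only [reg, mem_ofPred_eq, mem_empty_iff_false, iff_false]
            rintro ⟨a, b, c⟩
            linarith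
          rw [this]; simp
        · refine ih _ h1 (by linarith) ?_
          push_cast at hn
          rw [sub_mul, hηK]
          linarith
      have hstrip : ∫⁻ p in Icc 0 s.w ×ˢ Icc (w' - η) w' ∩ reg w', ENNReal.ofReal (s.dens p)
          ≤ ENNReal.ofReal (1 / 2) := by
        calc _ ≤ ∫⁻ p in Icc 0 s.w ×ˢ Icc (w' - η) w' ∩ reg w', ENNReal.ofReal B := by
              refine setLIntegral_mono' ((measurableSet_Icc.prod measurableSet_Icc).inter
                (measurableSet_reg _)) fun p hp => ENNReal.ofReal_le_ofReal ?_
              exact (le_abs_self _).trans (hB p (reg_mono hle hp.2))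
          _ ≤ ∫⁻ p in Icc 0 s.w ×ˢ Icc (w' - η) w', ENNReal.ofReal B :=
              lintegral_mono_set inter_subset_left
          _ = ENNReal.ofReal (B * (s.w * η)) := by
              rw [setLIntegral_const, Measure.volume_eq_prod, Measure.prod_prod, Real.volume_Icc,
                Real.volume_Icc, ENNReal.ofReal_mul hB0, ENNReal.ofReal_mul hw.le]
              congr 3 <;> ring_nf
          _ ≤ _ := by
              refine ENNReal.ofReal_le_ofReal ?_
              have : B * (s.w * η) * 2 = η * (2 * (B * s.w + 1)) - 2 * η := by ring
              rw [hηK] at this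
              linarith
      calc _ ≤ ∫⁻ p in reg (w' - η) ∪ (Icc 0 s.w ×ˢ Icc (w' - η) w' ∩ reg w'),
            ENNReal.ofReal (s.dens p) := lintegral_mono_set hsub
        _ ≤ _ := lintegral_union_le _ _ _
        _ ≤ ENNReal.ofReal (1 / 2) + ENNReal.ofReal (1 / 2) := add_le_add hprev hstrip
        _ = ENNReal.ofReal 1 := by
            rw [← ENNReal.ofReal_add (by norm_num) (by norm_num)]; norm_num
  obtain ⟨n, hn⟩ := exists_nat_ge (s.w * (2 * (B * s.w + 1)))
  have h1 := key n s.w hw le_rfl hn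
  exact h.areas_of_dens ⟨zero_le_one, h.cdens, h1.trans (ENNReal.ofReal_le_ofReal (by norm_num))⟩

theorem areas (h : s.IsSol) (hd : s.dl ≤ 1 / 10 ^ 30) :
    s.Areas (5 * 10 ^ 10 * s.dl ^ 2) (2 * 10 ^ 27 * s.dl ^ 3)
      (s.Z / 40 + 3 * 10 ^ 9 * s.dl ^ 2) :=
  h.areas_improve' hd (h.areas_improve hd (h.areas_one hd))

/-! ### Recovering the bounds for the scalar field -/

/-- x solves x_v = ∂_v(ã/λ) - (λ/r)x, and (λ/r)|x| is exactly |∂_vφ|, so the Hardy inequality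
recovers ∂_vφ from the variation of ã/λ. -/
theorem out_fv_of_areas (h : s.IsSol) (hA : s.Areas a c b) : Out s.w (fun p => ‖s.fv p‖)
    (12 / 5 * (s.D + (c + b)) + 10 * s.dl * s.ell a) := by
  have hr := h.r_ne
  have h0 := h.dl_nonneg
  have hav : Out s.w (fun p => ‖s.av p‖) (12 / 5 * (s.D + (c + b)) + 10 * s.dl * s.ell a) := by
    refine (((h.majV_g hA).out.const_mul (k := 12 / 5) (by norm_num)).add
      ((h.out_lamv hA).const_mul (k := 10 * s.dl) (by positivity))).mono h.cav.norm
      (fun p hp => ?_) le_rfl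
    have e : s.av p = s.g p / s.lam p - s.x p * ((s.lamv p / s.lam p : ℝ) : ℂ) := by
      have := h.lam_ne' p hp
      simp only [av, g]; push_cast; field_simp; ring
    rw [e]
    refine (norm_sub_le _ _).trans (add_le_add (h.norm_div_lam_le hp _) ?_)
    rw [norm_mul, Complex.norm_real, Real.norm_eq_abs]
    have := h.norm_x_le hp
    gcongr
  obtain ⟨B, hB0, hB⟩ := h.bdd_fv
  refine Out.intro hav.nonneg h.cfv.norm fun u hu huw => ?_
  have key := setLIntegral_mul_norm_le (a := u) (b := s.w) (P := fun v => s.x (u, v))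
    (S := fun v => s.av (u, v)) (κ := fun v => s.lam (u, v) / s.r (u, v))
    (fun v hv => by
      have hp : (u, v) ∈ reg s.w := ⟨hu, hv.1, hv.2⟩
      have h1 := h.r_ne' _ hp
      have h2 := h.lam_ne' _ hp
      refine (h.x_v u v hu hv.1 hv.2).congr_deriv ?_
      simp only [x, Complex.real_smul]
      push_cast
      field_simp)
    (slice_v_continuousOn (F := fun p => s.lam p / s.r p) (by fun_prop (disch := assumption)) hu)
    (fun v hv => by
      have hp : (u, v) ∈ reg s.w := ⟨hu, hv.1, hv.2⟩
      exact div_nonneg (h.lam_pos hp).le (h.r_pos _ hp).le)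
    (slice_v_continuousOn h.cav hu) (by
      have hz := (h.r_axis u hu huw).const_mul (12 / 5 * B)
      rw [mul_zero] at hz
      refine squeeze_zero_norm' ?_ hz
      filter_upwards [Ioo_mem_nhdsGT huw] with v hv
      have hp : (u, v) ∈ reg s.w := ⟨hu, hv.1, hv.2⟩
      have h1 := h.abs_div_lam_le hp (s.r (u, v))
      have h2 := h.r_pos _ hp
      rw [abs_of_pos h2] at h1
      rw [x, norm_mul, Complex.norm_real, Real.norm_eq_abs]
      have := mul_le_mul h1 (hB _ hp) (norm_nonneg _) (by positivity)
      linarith)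
  refine le_trans (setLIntegral_mono' measurableSet_Ioo fun v hv => ?_) (key.trans (hav.le hu))
  have hp : (u, v) ∈ reg s.w := ⟨hu, hv.1, hv.2⟩
  have h1 := h.r_pos _ hp
  have h2 := h.lam_pos hp
  refine ENNReal.ofReal_le_ofReal (le_of_eq ?_)
  rw [x, norm_mul, Complex.norm_real, Real.norm_of_nonneg (by positivity)]
  field_simp

/-- Incoming analogue with y: (|ν|/r)|y| = |D_uφ|. Replacing ∂_uφ by D_uφ in the equation costs
Z/100, and returning from D_uφ to ∂_uφ costs the same again. -/
theorem inn_fu_of_areas (h : s.IsSol) (hA : s.Areas a c b) : In s.w (fun p => ‖s.fu p‖)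
    (18 / 5 * (s.D + 2 * (c + b)) + 15 * s.dl * s.ell a + s.Z / 50) := by
  have hr := h.r_ne
  have h0 := h.dl_nonneg
  have hZ := h.Z_nonneg
  let S : ℝ × ℝ → ℂ := fun p => s.beu p + I * (((s.e * s.A p : ℝ) : ℂ) * s.φ p)
  have cS : ContinuousOn S (reg s.w) := by
    simp only [S]; fun_prop (disch := assumption)
  have hS : In s.w (fun p => ‖S p‖)
      (18 / 5 * (s.D + 2 * (c + b)) + 15 * s.dl * s.ell a + s.Z / 100) := by
    refine ((((h.majU_hh hA).inn.const_mul (k := 18 / 5) (by norm_num)).add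
      ((h.inn_nuu hA).const_mul (k := 15 * s.dl) (by positivity))).add
      (h.inn_const (c := s.Z / 100) (by positivity))).mono cS.norm
      (fun p hp => ?_) le_rfl
    have e : s.beu p = s.hh p / s.nu p - s.y p * ((s.nuu p / s.nu p : ℝ) : ℂ) := by
      have := h.nu_ne' p hp
      simp only [beu, hh]; push_cast; field_simp; ring
    refine (norm_add_le _ _).trans (add_le_add ?_ ?_)
    · rw [e]
      refine (norm_sub_le _ _).trans (add_le_add (h.norm_div_nu_le hp _) ?_)
      rw [norm_mul, Complex.norm_real, Real.norm_eq_abs]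
      have := h.norm_y_le hp
      gcongr
    · rw [norm_mul, Complex.norm_I, one_mul]
      refine (h.norm_eA_φ_le hp).trans (le_of_eq (by ring))
  have hDu : In s.w (fun p => ‖s.Du p‖)
      (18 / 5 * (s.D + 2 * (c + b)) + 15 * s.dl * s.ell a + s.Z / 100) := by
    obtain ⟨B, hB0, hB⟩ := h.bdd_Du
    refine In.intro hS.nonneg h.cDu.norm fun v hv0 hv => ?_
    have key := setLIntegral_mul_norm_le' (a := 0) (b := v) (P := fun u => s.y (u, v))
      (S := fun u => S (u, v)) (κ := fun u => -s.nu (u, v) / s.r (u, v))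
      (fun u hu => by
        have hp : (u, v) ∈ reg s.w := ⟨hu.1.le, hu.2, hv⟩
        have h1 := h.r_ne' _ hp
        have h2 := h.nu_ne' _ hp
        refine (h.y_u u v hu.1 hu.2 hv).congr_deriv ?_
        simp only [S, y, Du, Complex.real_smul]
        push_cast
        field_simp
        ring)
      ((slice_u_continuousOn (F := fun p => -s.nu p / s.r p) (by fun_prop (disch := assumption))
        hv).mono Ioo_subset_Ico_self)
      (fun u hu => by
        have hp : (u, v) ∈ reg s.w := ⟨hu.1.le, hu.2, hv⟩
        exact div_nonneg (neg_nonneg.2 (h.nu_neg _ hp).le) (h.r_pos _ hp).le)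
      ((slice_u_continuousOn cS hv).mono Ioo_subset_Ico_self) (by
        have hz := (h.r_axis' hv0 hv).const_mul (18 / 5 * B)
        rw [mul_zero] at hz
        refine squeeze_zero_norm' ?_ hz
        filter_upwards [Ioo_mem_nhdsLT hv0] with u hu
        have hp : (u, v) ∈ reg s.w := ⟨hu.1.le, hu.2, hv⟩
        have h1 := h.abs_div_nu_le hp (s.r (u, v))
        have h2 := h.r_pos _ hp
        rw [abs_of_pos h2] at h1
        rw [y, norm_mul, Complex.norm_real, Real.norm_eq_abs]
        have := mul_le_mul h1 (hB _ hp) (norm_nonneg _) (by positivity)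
        linarith)
    refine le_trans (setLIntegral_mono' measurableSet_Ioo fun u hu => ?_) (key.trans (hS.le hv))
    have hp : (u, v) ∈ reg s.w := ⟨hu.1.le, hu.2, hv⟩
    have h1 := h.r_pos _ hp
    have h2 := h.nu_neg _ hp
    refine ENNReal.ofReal_le_ofReal (le_of_eq ?_)
    rw [y, norm_mul, Complex.norm_real, Real.norm_of_nonpos
      (div_nonpos_of_nonneg_of_nonpos h1.le h2.le)]
    have h3 := h1.ne'
    have h4 := h2.ne
    field_simp
  refine (hDu.add (h.inn_const (c := s.Z / 100) (by positivity))).mono h.cfu.norm (fun p hp => ?_)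
    (by linarith)
  refine (h.norm_fu_le hp).trans (le_of_eq (by ring))

/-- The closure of the estimates: `Z` is controlled by the initial data. -/
theorem Z_le_D (h : s.IsSol) (hd : s.dl ≤ 1 / 10 ^ 30)
    (hZ : ∀ k, Out s.w (fun p => ‖s.fv p‖) k → In s.w (fun p => ‖s.fu p‖) k → s.Z ≤ k) :
    s.Z ≤ 6 * s.D := by
  have h0 := h.dl_nonneg
  have hZ0 := h.Z_nonneg
  have hA := h.areas hd
  have hO := h.out_fv_of_areas hA
  have hI := h.inn_fu_of_areas hA
  have hl := (h.out_lamv hA).nonneg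
  have hc := hA.c_nonneg
  have hb := hA.b_nonneg
  have hD := h.D_nonneg
  -- The incoming bound is the larger one, so it is admissible for both families of slices.
  have h1 := hZ _ (hO.mono h.cfv.norm (fun _ _ => le_rfl) (d := 18 / 5 * (s.D + 2 *
    (2 * 10 ^ 27 * s.dl ^ 3 + (s.Z / 40 + 3 * 10 ^ 9 * s.dl ^ 2))) + 15 * s.dl *
    s.ell (5 * 10 ^ 10 * s.dl ^ 2) + s.Z / 50) (by
      have key : ∀ D c b t Z : ℝ, 0 ≤ D → 0 ≤ c → 0 ≤ b → 0 ≤ t → 0 ≤ Z →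
          12 / 5 * (D + (c + b)) + t ≤ 18 / 5 * (D + 2 * (c + b)) + 15 / 10 * t + Z / 50 :=
        fun D c b t Z _ _ _ _ _ => by linarith
      have := key _ _ _ _ _ hD hc hb (mul_nonneg (mul_nonneg (by norm_num : (0 : ℝ) ≤ 10) h0) hl)
        hZ0
      refine this.trans (le_of_eq (by ring)))) hI
  have h2 : s.dl ^ 2 ≤ 1 / 10 ^ 30 * s.dl := by nlinarith
  have h3 : s.dl ^ 3 ≤ 1 / 10 ^ 60 * s.dl := by
    have : s.dl ^ 3 ≤ 1 / 10 ^ 30 * s.dl ^ 2 := by nlinarith [sq_nonneg s.dl]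
    linarith
  have h4 : s.dl * s.ell (5 * 10 ^ 10 * s.dl ^ 2) ≤ 1 / 10 ^ 10 * s.dl := by
    have e : s.dl * s.ell (5 * 10 ^ 10 * s.dl ^ 2) = (1170 + 130 * 10 ^ 10) * s.dl ^ 3 := by
      unfold ell; ring
    rw [e]
    linarith
  -- The linear charge terms contribute Z with coefficient (18/5)·2/40 + 1/50 = 1/5, which is
  -- absorbed on the left; the higher powers of δ are negligible.
  have h5 : s.dl = s.Z + s.D := rfl
  linarith

end IsSol
end Reduced

end ChargedScalar
end

open Set Filter Topology MeasureTheory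
open scoped ENNReal NNReal

noncomputable section

namespace ChargedScalar

/-! ### Calculus on the closed triangle -/

section Triangle

variable {E : Type*} [NormedAddCommGroup E] [NormedSpace ℝ E] {v₀ : ℝ} {f : ℝ × ℝ → E}

theorem dom_subset_cdom (v₀ : ℝ) : dom v₀ ⊆ cdom v₀ := fun _ hp => ⟨hp.1, hp.2.1.le, hp.2.2⟩

theorem reg_subset_dom (v₀ : ℝ) : reg v₀ ⊆ dom v₀ := fun _ hp => ⟨hp.1, hp.2.1, hp.2.2.le⟩

theorem reg_subset_cdom (v₀ : ℝ) : reg v₀ ⊆ cdom v₀ :=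
  (reg_subset_dom v₀).trans (dom_subset_cdom v₀)

theorem isCompact_cdom (v₀ : ℝ) : IsCompact (cdom v₀) := by
  refine (isCompact_Icc (a := ((0 : ℝ), (0 : ℝ))) (b := (v₀, v₀))).of_isClosed_subset ?_ ?_
  · exact (isClosed_le continuous_const continuous_fst).inter
      ((isClosed_le continuous_fst continuous_snd).inter
        (isClosed_le continuous_snd continuous_const))
  · exact fun p hp => ⟨⟨hp.1, hp.1.trans hp.2.1⟩, ⟨hp.2.1.trans hp.2.2, hp.2.2⟩⟩

theorem convex_dom (v₀ : ℝ) : Convex ℝ (dom v₀) := by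
  have h : dom v₀ = {p : ℝ × ℝ | 0 ≤ p.1} ∩ ({p | p.1 - p.2 < 0} ∩ {p | p.2 ≤ v₀}) := by
    ext p
    simp only [dom, mem_ofPred_eq, mem_inter_iff, sub_neg]
  rw [h]
  refine (convex_halfSpace_ge ?_ _).inter
    ((convex_halfSpace_lt ?_ _).inter (convex_halfSpace_le ?_ _))
  · exact (LinearMap.fst ℝ ℝ ℝ).isLinear
  · exact (LinearMap.fst ℝ ℝ ℝ - LinearMap.snd ℝ ℝ ℝ).isLinear
  · exact (LinearMap.snd ℝ ℝ ℝ).isLinear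

theorem convex_cdom (v₀ : ℝ) : Convex ℝ (cdom v₀) := by
  have h : cdom v₀ = {p : ℝ × ℝ | 0 ≤ p.1} ∩ ({p | p.1 - p.2 ≤ 0} ∩ {p | p.2 ≤ v₀}) := by
    ext p
    simp only [cdom, mem_ofPred_eq, mem_inter_iff, sub_nonpos]
  rw [h]
  refine (convex_halfSpace_ge ?_ _).inter
    ((convex_halfSpace_le ?_ _).inter (convex_halfSpace_le ?_ _))
  · exact (LinearMap.fst ℝ ℝ ℝ).isLinear
  · exact (LinearMap.fst ℝ ℝ ℝ - LinearMap.snd ℝ ℝ ℝ).isLinear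
  · exact (LinearMap.snd ℝ ℝ ℝ).isLinear

theorem interior_dom_nonempty (hv : 0 < v₀) : (interior (dom v₀)).Nonempty :=
  ⟨(v₀ / 3, v₀ / 2), interior_maximal ((tri_subset_reg v₀).trans (reg_subset_dom v₀))
    (isOpen_tri v₀) ⟨by positivity, by simp only; linarith, by simp only; linarith⟩⟩

theorem uniqueDiffOn_dom (hv : 0 < v₀) : UniqueDiffOn ℝ (dom v₀) :=
  uniqueDiffOn_convex (convex_dom v₀) (interior_dom_nonempty hv)

theorem uniqueDiffOn_cdom (hv : 0 < v₀) : UniqueDiffOn ℝ (cdom v₀) :=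
  uniqueDiffOn_convex (convex_cdom v₀)
    ((interior_dom_nonempty hv).mono (interior_mono (dom_subset_cdom v₀)))

theorem cdom_eventuallyEq_dom {p : ℝ × ℝ} (hp : p ∈ dom v₀) : cdom v₀ =ᶠ[𝓝 p] dom v₀ := by
  filter_upwards [(isOpen_lt continuous_fst continuous_snd).mem_nhds hp.2.1] with q hq
  exact propext ⟨fun h => ⟨h.1, hq, h.2.2⟩, fun h => dom_subset_cdom v₀ h⟩

theorem _root_.DifferentiableWithinAt.of_dom {p : ℝ × ℝ}
    (hf : DifferentiableWithinAt ℝ f (dom v₀) p) (hp : p ∈ dom v₀) :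
    DifferentiableWithinAt ℝ f (cdom v₀) p :=
  (differentiableWithinAt_congr_set (cdom_eventuallyEq_dom hp)).2 hf

theorem continuousOn_fderivWithin_dom (hv : 0 < v₀) (hf : ContDiffOn ℝ 1 f (dom v₀)) :
    ContinuousOn (fderivWithin ℝ f (cdom v₀)) (dom v₀) :=
  (hf.continuousOn_fderivWithin (uniqueDiffOn_dom hv) le_rfl).congr fun _ hp =>
    fderivWithin_congr_set (cdom_eventuallyEq_dom hp)

theorem continuousOn_pu_dom (hv : 0 < v₀) (hf : ContDiffOn ℝ 1 f (dom v₀)) :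
    ContinuousOn (pu v₀ f) (dom v₀) :=
  (continuousOn_fderivWithin_dom hv hf).clm_apply continuousOn_const

theorem continuousOn_pv_dom (hv : 0 < v₀) (hf : ContDiffOn ℝ 1 f (dom v₀)) :
    ContinuousOn (pv v₀ f) (dom v₀) :=
  (continuousOn_fderivWithin_dom hv hf).clm_apply continuousOn_const

theorem continuousOn_pu (hv : 0 < v₀) (hf : ContDiffOn ℝ 1 f (cdom v₀)) :
    ContinuousOn (pu v₀ f) (cdom v₀) :=
  (hf.continuousOn_fderivWithin (uniqueDiffOn_cdom hv) le_rfl).clm_apply continuousOn_const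

theorem continuousOn_pv (hv : 0 < v₀) (hf : ContDiffOn ℝ 1 f (cdom v₀)) :
    ContinuousOn (pv v₀ f) (cdom v₀) :=
  (hf.continuousOn_fderivWithin (uniqueDiffOn_cdom hv) le_rfl).clm_apply continuousOn_const

theorem hasDerivAt_pu {u v : ℝ} (hf : DifferentiableWithinAt ℝ f (cdom v₀) (u, v)) (hu : 0 < u)
    (huv : u < v) (hv : v ≤ v₀) : HasDerivAt (fun x => f (x, v)) (pu v₀ f (u, v)) u := by
  refine hf.hasFDerivWithinAt.comp_hasDerivAt u
    ((hasDerivAt_id u).prodMk (hasDerivAt_const u v)) ?_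
  filter_upwards [Ioo_mem_nhds hu huv] with x hx using ⟨hx.1.le, hx.2.le, hv⟩

theorem hasDerivAt_pv {u v : ℝ} (hf : DifferentiableWithinAt ℝ f (cdom v₀) (u, v)) (hu : 0 ≤ u)
    (huv : u < v) (hv : v < v₀) : HasDerivAt (fun y => f (u, y)) (pv v₀ f (u, v)) v := by
  refine hf.hasFDerivWithinAt.comp_hasDerivAt v
    ((hasDerivAt_const v u).prodMk (hasDerivAt_id v)) ?_
  filter_upwards [Ioo_mem_nhds huv hv] with x hx using ⟨hu, hx.1.le, hx.2.le⟩

theorem hasDerivAt_diag {u : ℝ} (hf : DifferentiableWithinAt ℝ f (cdom v₀) (u, u)) (hu : 0 < u)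
    (hu' : u < v₀) : HasDerivAt (fun x => f (x, x)) (pu v₀ f (u, u) + pv v₀ f (u, u)) u := by
  have h := HasFDerivWithinAt.comp_hasDerivAt (f := fun x : ℝ => (x, x)) u hf.hasFDerivWithinAt
    ((hasDerivAt_id u).prodMk (hasDerivAt_id u)) (by
      filter_upwards [Ioo_mem_nhds hu hu'] with x hx using ⟨hx.1.le, le_rfl, hx.2.le⟩)
  refine h.congr_deriv ?_
  rw [pu, pv, ← map_add]
  simp

theorem hasU_pu (hf : DifferentiableOn ℝ f (dom v₀)) : HasU v₀ f (pu v₀ f) :=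
  fun u v hu huv hv => by
    have hp : (u, v) ∈ dom v₀ := ⟨hu.le, huv, hv.le⟩
    exact hasDerivAt_pu ((hf _ hp).of_dom hp) hu huv hv.le

theorem hasV_pv (hf : DifferentiableOn ℝ f (dom v₀)) : HasV v₀ f (pv v₀ f) :=
  fun u v hu huv hv => by
    have hp : (u, v) ∈ dom v₀ := ⟨hu, huv, hv.le⟩
    exact hasDerivAt_pv ((hf _ hp).of_dom hp) hu huv hv

theorem tendsto_axis_out {X : Type*} [TopologicalSpace X] {F : ℝ × ℝ → X}
    (hF : ContinuousOn F (cdom v₀)) {u : ℝ} (hu : 0 ≤ u) (hu' : u < v₀) :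
    Tendsto (fun v => F (u, v)) (𝓝[>] u) (𝓝 (F (u, u))) := by
  have h : ContinuousOn (fun v => F (u, v)) (Icc u v₀) :=
    hF.comp (by fun_prop) fun v hv => ⟨hu, hv.1, hv.2⟩
  exact (h u (left_mem_Icc.2 hu'.le)).tendsto.mono_left
    (nhdsWithin_le_of_mem (mem_of_superset (Ioo_mem_nhdsGT hu') Ioo_subset_Icc_self))

theorem tendsto_axis_in {X : Type*} [TopologicalSpace X] {F : ℝ × ℝ → X}
    (hF : ContinuousOn F (cdom v₀)) {v : ℝ} (hv : 0 < v) (hv' : v ≤ v₀) :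
    Tendsto (fun u => F (u, v)) (𝓝[<] v) (𝓝 (F (v, v))) := by
  have h : ContinuousOn (fun u => F (u, v)) (Icc 0 v) :=
    hF.comp (by fun_prop) fun u hu => ⟨hu.1, hu.2, hv'⟩
  exact (h v (right_mem_Icc.2 hv.le)).tendsto.mono_left
    (nhdsWithin_le_of_mem (mem_of_superset (Ioo_mem_nhdsLT hv) Ioo_subset_Icc_self))

theorem ContinuousOn.bound_cdom {X : Type*} [SeminormedAddCommGroup X] {F : ℝ × ℝ → X} (hF : ContinuousOn F (cdom v₀)) :
    ∃ B : ℝ, ∀ p ∈ reg v₀, ‖F p‖ ≤ B := by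
  obtain ⟨B, hB⟩ := (isCompact_cdom v₀).exists_bound_of_continuousOn hF
  exact ⟨B, fun p hp => hB p (reg_subset_cdom v₀ hp)⟩

/-- A function on the triangle is a.e. determined by its values in the interior. -/
theorem setLIntegral_dom_le {F G : ℝ × ℝ → ℝ≥0∞}
    (h : ∀ u v, 0 < u → u < v → v < v₀ → F (u, v) ≤ G (u, v)) :
    ∫⁻ p in dom v₀, F p ≤ ∫⁻ p in reg v₀, G p := by
  have hnull : volume ({0} ×ˢ (univ : Set ℝ) ∪ (univ : Set ℝ) ×ˢ {v₀} : Set (ℝ × ℝ)) = 0 := by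
    refine measure_union_null ?_ ?_ <;> simp [Measure.volume_eq_prod, Measure.prod_prod]
  have hT : dom v₀ =ᵐ[volume] {p : ℝ × ℝ | 0 < p.1 ∧ p.1 < p.2 ∧ p.2 < v₀} := by
    filter_upwards [measure_eq_zero_iff_ae_notMem.1 hnull] with p hp
    have h1 : p.1 ≠ 0 := fun h => hp (Or.inl ⟨h, mem_univ _⟩)
    have h2 : p.2 ≠ v₀ := fun h => hp (Or.inr ⟨mem_univ _, h⟩)
    exact propext ⟨fun hd => ⟨lt_of_le_of_ne hd.1 h1.symm, hd.2.1, lt_of_le_of_ne hd.2.2 h2⟩,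
      fun hd => ⟨hd.1.le, hd.2.1, hd.2.2.le⟩⟩
  rw [setLIntegral_congr hT]
  refine (setLIntegral_mono' (isOpen_tri v₀).measurableSet fun p hp =>
    h p.1 p.2 hp.1 hp.2.1 hp.2.2).trans (lintegral_mono_set (tri_subset_reg v₀))

end Triangle

/-! ### Estimates in terms of the initial data -/

namespace Reduced

variable {s : Reduced}

namespace IsSol

theorem dl_le_D (hZD : s.Z ≤ 6 * s.D) : s.dl ≤ 7 * s.D := by
  unfold dl; linarith

/-- With δ ≤ 7D the powers of δ become powers of D. The charge area stays linear: Z/40 ≤ 6D/40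
leaves room for the quadratic term below D. -/
theorem areas_D (h : s.IsSol) (hd : s.dl ≤ 1 / 10 ^ 30) (hZD : s.Z ≤ 6 * s.D) :
    s.Areas (10 ^ 13 * s.D ^ 2) (10 ^ 30 * s.D ^ 3) s.D := by
  have h0 := h.dl_nonneg
  have h1 := dl_le_D hZD
  have h2 : s.dl ^ 2 ≤ 49 * s.D ^ 2 := by
    have := pow_le_pow_left₀ h0 h1 2
    linarith
  have h3 : s.dl ^ 3 ≤ 343 * s.D ^ 3 := by
    have := pow_le_pow_left₀ h0 h1 3
    linarith
  have hD := h.D_nonneg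
  have h4 : s.dl ^ 2 ≤ 1 / 10 ^ 30 * s.dl := by nlinarith
  have hD3 := pow_nonneg hD 3
  refine (h.areas hd).mono (by nlinarith) ?_ (by nlinarith)
  generalize s.D ^ 3 = x at *
  generalize s.dl ^ 3 = y at *
  norm_num
  linarith

theorem ell_le_D (h : s.IsSol) (hZD : s.Z ≤ 6 * s.D) :
    s.ell (10 ^ 13 * s.D ^ 2) ≤ 10 ^ 15 * s.D ^ 2 := by
  have h2 : s.dl ^ 2 ≤ 49 * s.D ^ 2 := by
    have := pow_le_pow_left₀ h.dl_nonneg (dl_le_D hZD) 2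
    linarith
  unfold ell
  nlinarith [sq_nonneg s.D]

theorem D_sq_le (h : s.IsSol) (hd : s.dl ≤ 1 / 10 ^ 30) : s.D ^ 2 ≤ 1 / 10 ^ 30 * s.D := by
  have h1 : s.D ≤ s.dl := by unfold dl; linarith [h.Z_nonneg]
  nlinarith [h.D_nonneg]

theorem D_cube_le (h : s.IsSol) (hd : s.dl ≤ 1 / 10 ^ 30) : 10 ^ 30 * s.D ^ 3 ≤ s.D := by
  have h1 := h.D_sq_le hd
  have hD := h.D_nonneg
  have h2 : s.D ≤ 1 := by
    have h1 : s.D ≤ s.dl := by unfold dl; linarith [h.Z_nonneg]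
    linarith
  have h3 : s.D ^ 3 ≤ 1 / 10 ^ 30 * s.D ^ 2 := by nlinarith
  have h4 : s.D ^ 2 ≤ s.D := by nlinarith
  generalize s.D ^ 3 = x at *
  generalize s.D ^ 2 = y at *
  norm_num at *
  linarith

theorem ell_div_le (h : s.IsSol) (hd : s.dl ≤ 1 / 10 ^ 30) (hZD : s.Z ≤ 6 * s.D) :
    s.ell (10 ^ 13 * s.D ^ 2) ≤ s.D := by
  have h1 := h.ell_le_D hZD
  have h2 := h.D_sq_le hd
  have := h.D_nonneg
  nlinarith

theorem out_lamv_D (h : s.IsSol) (hd : s.dl ≤ 1 / 10 ^ 30) (hZD : s.Z ≤ 6 * s.D) :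
    Out s.w (fun p => |s.lamv p / s.lam p|) (10 ^ 30 * s.D ^ 2) := by
  have h1 := h.out_lamv (h.areas_D hd hZD)
  exact h1.mono h1.cont (fun _ _ => le_rfl)
    ((h.ell_le_D hZD).trans (by nlinarith [sq_nonneg s.D]))

theorem inn_nuu_D (h : s.IsSol) (hd : s.dl ≤ 1 / 10 ^ 30) (hZD : s.Z ≤ 6 * s.D) :
    In s.w (fun p => |s.nuu p / s.nu p|) (10 ^ 30 * s.D ^ 2) := by
  have h1 := h.inn_nuu (h.areas_D hd hZD)
  exact h1.mono h1.cont (fun _ _ => le_rfl)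
    ((h.ell_le_D hZD).trans (by nlinarith [sq_nonneg s.D]))

theorem out_atv_D (h : s.IsSol) (hd : s.dl ≤ 1 / 10 ^ 30) (hZD : s.Z ≤ 6 * s.D) :
    Out s.w (fun p => ‖s.atv p‖) (10 ^ 30 * s.D) := by
  have h1 := h.out_atv (h.areas_D hd hZD)
  have h2 := h.ell_div_le hd hZD
  have h3 := h.D_cube_le hd
  have hD := h.D_nonneg
  refine h1.mono h1.cont (fun _ _ => le_rfl) ?_
  have h4 : 10 * s.D ≤ 10 ^ 30 * s.D := mul_le_mul_of_nonneg_right (by norm_num) hD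
  generalize s.ell (10 ^ 13 * s.D ^ 2) = t at *
  generalize 10 ^ 30 * s.D ^ 3 = c at *
  generalize 10 ^ 30 * s.D = b at *
  linarith

theorem inn_btu_D (h : s.IsSol) (hd : s.dl ≤ 1 / 10 ^ 30) (hZD : s.Z ≤ 6 * s.D) :
    In s.w (fun p => ‖s.btu p‖) (10 ^ 30 * s.D) := by
  have h1 := h.inn_btu (h.areas_D hd hZD)
  have h2 := h.ell_div_le hd hZD
  have h3 := h.D_cube_le hd
  have hD := h.D_nonneg
  refine h1.mono h1.cont (fun _ _ => le_rfl) ?_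
  have h4 : 10 * s.D ≤ 10 ^ 30 * s.D := mul_le_mul_of_nonneg_right (by norm_num) hD
  generalize s.ell (10 ^ 13 * s.D ^ 2) = t at *
  generalize 10 ^ 30 * s.D ^ 3 = c at *
  generalize 10 ^ 30 * s.D = b at *
  linarith

theorem axis_Lh (h : s.IsSol) (hd : s.dl ≤ 1 / 10 ^ 30) (hZD : s.Z ≤ 6 * s.D) :
    ∫⁻ v in Ioo 0 s.w, ‖s.lΓ v / s.la v‖ₑ ≤ ENNReal.ofReal (10 ^ 30 * s.D ^ 2) := by
  obtain ⟨g, hg, hgc⟩ := (h.majV_Lh (h.areas_D hd hZD)).axis fun v hv0 hv => h.Lh_axis hv0 hv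
  refine ((setLIntegral_mono' measurableSet_Ioo fun v hv => hg v hv.1 hv.2).trans hgc).trans
    (ENNReal.ofReal_le_ofReal ?_)
  have h2 : s.dl ^ 2 ≤ 49 * s.D ^ 2 := by
    have := pow_le_pow_left₀ h.dl_nonneg (dl_le_D hZD) 2
    linarith
  nlinarith [sq_nonneg s.D]

/-- On the axis ∂_vã is `gΓ` plus the trace of φ̃ times `lΓ`; the two parts are bounded through the
majorants of `g` and `Lh`. -/
theorem axis_atv (h : s.IsSol) (hd : s.dl ≤ 1 / 10 ^ 30) (hZD : s.Z ≤ 6 * s.D) {F : ℝ → ℂ}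
    (hF : ∀ v, 0 < v → v < s.w → Tendsto (fun u => s.f (u, v)) (𝓝[<] v) (𝓝 (F v)))
    (hm : AEMeasurable (fun v => ‖s.lΓ v / s.la v‖ₑ) (volume.restrict (Ioo 0 s.w))) :
    ∫⁻ v in Ioo 0 s.w, ‖s.gΓ v + F v * s.lΓ v‖ₑ ≤ ENNReal.ofReal (10 ^ 30 * s.D) := by
  have hD := h.D_nonneg
  obtain ⟨g, hg, hgc⟩ := (h.majV_g (h.areas_D hd hZD)).axis h.g_axis'
  have hFl : ∀ v ∈ Ioo 0 s.w, ‖F v * s.lΓ v‖ₑ ≤ ‖s.lΓ v / s.la v‖ₑ := by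
    intro v hv
    have h1 : ‖F v‖ ≤ 2 * s.Z := le_of_tendsto (hF v hv.1 hv.2).norm (by
      filter_upwards [Ioo_mem_nhdsLT hv.1] with u hu
      exact h.norm_f_le ⟨hu.1.le, hu.2, hv.2⟩)
    have h2 : s.la v ≤ 3 / 4 := le_of_tendsto (h.lam_axis' v hv.1 hv.2) (by
      filter_upwards [Ioo_mem_nhdsLT hv.1] with u hu
      exact h.lam_le' ⟨hu.1.le, hu.2, hv.2⟩)
    have h3 := h.la_ge v hv.1.le hv.2
    rw [← ofReal_norm, ← ofReal_norm]
    refine ENNReal.ofReal_le_ofReal ?_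
    rw [norm_mul, Complex.norm_real, norm_div, Real.norm_of_nonneg (show 0 ≤ s.la v by linarith),
      le_div_iff₀ (by linarith)]
    have h4 := h.Z_le
    have h5 : ‖F v‖ * s.la v ≤ 1 := by nlinarith [norm_nonneg (F v)]
    nlinarith [norm_nonneg (s.lΓ v)]
  have hle : ∫⁻ v in Ioo 0 s.w, ‖s.gΓ v + F v * s.lΓ v‖ₑ ≤
      ∫⁻ v in Ioo 0 s.w, (g v + ‖s.lΓ v / s.la v‖ₑ) :=
    setLIntegral_mono' measurableSet_Ioo fun v hv => (enorm_add_le _ _).trans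
      (add_le_add (hg v hv.1 hv.2) (hFl v hv))
  rw [lintegral_add_right' _ hm] at hle
  refine (hle.trans (add_le_add hgc (h.axis_Lh hd hZD))).trans ?_
  have h2 : 10 ^ 30 * s.D ^ 2 ≤ s.D := by
    have := h.D_sq_le hd
    generalize s.D ^ 2 = x at *
    norm_num at *
    linarith
  have h3 := h.D_cube_le hd
  have h4 : 10 * s.D ≤ 10 ^ 30 * s.D := mul_le_mul_of_nonneg_right (by norm_num) hD
  rw [← ENNReal.ofReal_add (by positivity) (by positivity)]
  refine ENNReal.ofReal_le_ofReal ?_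
  generalize 10 ^ 30 * s.D ^ 3 = c at *
  generalize 10 ^ 30 * s.D ^ 2 = d at *
  generalize 10 ^ 30 * s.D = b at *
  linarith

end IsSol
end Reduced

end ChargedScalar
end

open Set Filter Topology MeasureTheory
open scoped ENNReal NNReal

noncomputable section

namespace ChargedScalar

/-! ### From solutions of the field equations to the reduced system. -/

section ProductRule

variable {v₀ : ℝ} {r : ℝ × ℝ → ℝ} {g : ℝ × ℝ → ℂ} {p : ℝ × ℝ}

theorem fderivWithin_ofReal_mul (hv : 0 < v₀) (hp : p ∈ cdom v₀)
    (hr : DifferentiableWithinAt ℝ r (cdom v₀) p) (hg : DifferentiableWithinAt ℝ g (cdom v₀) p)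
    (x : ℝ × ℝ) : fderivWithin ℝ (fun q => (r q : ℂ) * g q) (cdom v₀) p x =
      r p * fderivWithin ℝ g (cdom v₀) p x + fderivWithin ℝ r (cdom v₀) p x * g p := by
  have h := (hr.hasFDerivWithinAt.smul hg.hasFDerivWithinAt).fderivWithin
    (uniqueDiffOn_cdom hv p hp)
  have e : (fun q => (r q : ℂ) * g q) = r • g := by
    ext q; simp
  rw [e, h]
  simp

theorem pv_ofReal_mul (hv : 0 < v₀) (hp : p ∈ cdom v₀)
    (hr : DifferentiableWithinAt ℝ r (cdom v₀) p) (hg : DifferentiableWithinAt ℝ g (cdom v₀) p) :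
    pv v₀ (fun q => (r q : ℂ) * g q) p = r p * pv v₀ g p + pv v₀ r p * g p :=
  fderivWithin_ofReal_mul hv hp hr hg _

theorem pu_ofReal_mul (hv : 0 < v₀) (hp : p ∈ cdom v₀)
    (hr : DifferentiableWithinAt ℝ r (cdom v₀) p) (hg : DifferentiableWithinAt ℝ g (cdom v₀) p) :
    pu v₀ (fun q => (r q : ℂ) * g q) p = r p * pu v₀ g p + pu v₀ r p * g p :=
  fderivWithin_ofReal_mul hv hp hr hg _

end ProductRule

namespace Fields

open Complex (I)

variable {S : Fields} {e v₀ : ℝ}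

theorem pu_φt : pu v₀ S.φt = pu v₀ S.φ := by
  ext p
  change fderivWithin ℝ (fun q => S.φ q - S.φ₀) (cdom v₀) p (1, 0) = _
  rw [fderivWithin_sub_const, pu]

theorem pv_φt : pv v₀ S.φt = pv v₀ S.φ := by
  ext p
  change fderivWithin ℝ (fun q => S.φ q - S.φ₀) (cdom v₀) p (0, 1) = _
  rw [fderivWithin_sub_const, pv]

/-- The reduced system associated with a solution. -/
def reduced (S : Fields) (e v₀ : ℝ) : Reduced where
  e := e
  w := v₀
  M := ‖S.φ₀‖ + 2
  Z := (S.Z v₀).toReal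
  D := (S.D v₀).toReal
  r := S.r
  lam := S.lam v₀
  nu := S.nu v₀
  mu := S.mu v₀
  q p := S.Q p / S.r p
  A := S.A
  lamv := pv v₀ (S.lam v₀)
  nuu := pu v₀ (S.nu v₀)
  Au := pu v₀ S.A
  f := S.φt
  fu := pu v₀ S.φ
  fv := pv v₀ S.φ
  atv := pv v₀ (S.atil v₀)
  bu := pu v₀ (S.btil v₀)
  φ0 := S.φ₀
  la u := S.lam v₀ (u, u)
  lΓ u := pv v₀ (S.lam v₀) (u, u)
  gΓ u := pv v₀ (S.atil v₀) (u, u) - S.φt (u, u) * pv v₀ (S.lam v₀) (u, u)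

theorem reduced_φ (p : ℝ × ℝ) : (S.reduced e v₀).φ p = S.φ p := sub_add_cancel _ _

theorem reduced_Du (p : ℝ × ℝ) : (S.reduced e v₀).Du p = S.Duφ e v₀ p := by
  rw [Reduced.Du, reduced_φ, Duφ]
  simp only [reduced]
  push_cast
  ring

namespace IsC1Solution

/-! ### Regularity -/

section Regularity

variable (hS : S.IsC1Solution e v₀) (hv : 0 < v₀)
include hS

theorem φt_C1 : ContDiffOn ℝ 1 S.φt (cdom v₀) := hS.φ_C1.sub contDiffOn_const

theorem φ_diff : DifferentiableOn ℝ S.φ (cdom v₀) := hS.φ_C1.differentiableOn one_ne_zero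

theorem φt_diff : DifferentiableOn ℝ S.φt (cdom v₀) := hS.φt_C1.differentiableOn one_ne_zero

theorem r_ne {p : ℝ × ℝ} (hp : p ∈ dom v₀) : S.r p ≠ 0 := (hS.r_pos p hp).ne'

theorem Ω_ne {p : ℝ × ℝ} (hp : p ∈ dom v₀) : S.Ω p ≠ 0 := (hS.Ω_pos p hp).ne'

theorem mu_eq {p : ℝ × ℝ} (hp : p ∈ dom v₀) :
    S.mu v₀ p = 1 + 4 * S.nu v₀ p * S.lam v₀ p / S.Ω p ^ 2 := by
  have h1 := hS.r_ne hp
  rw [mu, mass]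
  field_simp

theorem one_sub_mu_pos {p : ℝ × ℝ} (hp : p ∈ dom v₀) : 0 < 1 - S.mu v₀ p := by
  have h1 := hS.Ω_pos p hp
  have h2 := mul_neg_of_neg_of_pos (hS.nu_neg p hp) (hS.lam_pos p hp)
  rw [hS.mu_eq hp]
  have := div_neg_of_neg_of_pos (show 4 * S.nu v₀ p * S.lam v₀ p < 0 by linarith) (pow_pos h1 2)
  linarith

theorem W_eq {p : ℝ × ℝ} (hp : p ∈ dom v₀) : (S.reduced e v₀).W p = S.Ω p ^ 2 / 4 := by
  have h1 := (hS.one_sub_mu_pos hp).ne'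
  have h2 := hS.Ω_ne hp
  simp only [Reduced.W, reduced]
  rw [div_eq_iff h1, hS.mu_eq hp]
  field_simp
  ring

include hv

/-- r is only assumed differentiable; its derivative is the combination of ν and λ, which are
continuous up to the boundary. -/
theorem r_C1 : ContDiffOn ℝ 1 S.r (cdom v₀) := by
  rw [show (1 : WithTop ℕ∞) = 0 + 1 by rfl,
    contDiffOn_succ_iff_fderivWithin (uniqueDiffOn_cdom hv)]
  refine ⟨hS.r_diff, by simp, ?_⟩
  rw [contDiffOn_zero]
  have e1 : ∀ p, fderivWithin ℝ S.r (cdom v₀) p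
      = S.nu v₀ p • ContinuousLinearMap.fst ℝ ℝ ℝ + S.lam v₀ p • ContinuousLinearMap.snd ℝ ℝ ℝ := by
    intro p
    ext <;> simp [nu, lam, pu, pv]
  rw [show fderivWithin ℝ S.r (cdom v₀) = _ from funext e1]
  exact (hS.nu_C1.continuousOn.smul continuousOn_const).add
    (hS.lam_C1.continuousOn.smul continuousOn_const)

theorem atil_eq {p : ℝ × ℝ} (hp : p ∈ cdom v₀) :
    S.atil v₀ p = S.r p * pv v₀ S.φ p + S.lam v₀ p * S.φt p := by
  rw [atil, pv_ofReal_mul hv hp (hS.r_diff p hp) (hS.φt_diff p hp), pv_φt, lam]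

theorem btil_eq {p : ℝ × ℝ} (hp : p ∈ cdom v₀) :
    S.btil v₀ p = S.r p * pu v₀ S.φ p + S.nu v₀ p * S.φt p := by
  rw [btil, pu_ofReal_mul hv hp (hS.r_diff p hp) (hS.φt_diff p hp), pu_φt, nu]

theorem atil_C1 : ContDiffOn ℝ 1 (S.atil v₀) (cdom v₀) :=
  (hS.rφv_C1.add ((Complex.ofRealCLM.contDiff.comp_contDiffOn hS.lam_C1).mul hS.φt_C1)).congr
    fun _ hp => hS.atil_eq hv hp

theorem btil_C1 : ContDiffOn ℝ 1 (S.btil v₀) (cdom v₀) :=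
  (hS.rφu_C1.add ((Complex.ofRealCLM.contDiff.comp_contDiffOn hS.nu_C1).mul hS.φt_C1)).congr
    fun _ hp => hS.btil_eq hv hp

/-- Away from the axis r is positive and C¹ and can be divided out. Hence ∂_uφ and ∂_vφ are C¹ on
the half-open triangle. -/
theorem contDiffOn_of_r_mul {g : ℝ × ℝ → ℂ}
    (hg : ContDiffOn ℝ 1 (fun p => (S.r p : ℂ) * g p) (cdom v₀)) : ContDiffOn ℝ 1 g (dom v₀) := by
  have h1 := ((hS.r_C1 hv).mono (dom_subset_cdom v₀)).inv fun p hp => hS.r_ne hp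
  refine ((Complex.ofRealCLM.contDiff.comp_contDiffOn h1).mul (hg.mono (dom_subset_cdom v₀))).congr
    fun p hp => ?_
  have : (S.r p : ℂ) ≠ 0 := Complex.ofReal_ne_zero.2 (hS.r_ne hp)
  simp
  field_simp

theorem φu_C1 : ContDiffOn ℝ 1 (pu v₀ S.φ) (dom v₀) := hS.contDiffOn_of_r_mul hv hS.rφu_C1

theorem φv_C1 : ContDiffOn ℝ 1 (pv v₀ S.φ) (dom v₀) := hS.contDiffOn_of_r_mul hv hS.rφv_C1

theorem Q_C1 : ContDiffOn ℝ 1 S.Q (dom v₀) := by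
  refine ((hS.Qr_C1.mono (dom_subset_cdom v₀)).mul
    ((hS.r_C1 hv).mono (dom_subset_cdom v₀))).congr fun p hp => ?_
  have := hS.r_ne hp
  field_simp

end Regularity

/-! ### The equations in reduced form -/

section Equations

variable (hS : S.IsC1Solution e v₀) (hv : 0 < v₀)
include hS

theorem nu_v_eq {p : ℝ × ℝ} (hp : p ∈ dom v₀) :
    pv v₀ (S.nu v₀) p = (S.reduced e v₀).lk p := by
  have h1 := (hS.equations p hp).wave_r
  have h2 := hS.one_sub_mu_pos hp
  have h3 := hS.r_ne hp
  have h4 := hS.W_eq hp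
  rw [← h4] at h1
  change S.r p * pv v₀ (S.nu v₀) p + S.lam v₀ p * S.nu v₀ p = _ at h1
  simp only [Reduced.W, reduced, Reduced.lk, Reduced.pm] at h1 ⊢
  have h5 := h2.ne'
  rw [div_pow]
  field_simp at h1 ⊢
  linear_combination h1

theorem φv_u_eq {p : ℝ × ℝ} (hv : 0 < v₀) (hp : p ∈ dom v₀) :
    pu v₀ (pv v₀ S.φ) p = (S.reduced e v₀).fuv p := by
  have h1 := (hS.equations p hp).wave_φ
  have h3 : (S.r p : ℂ) ≠ 0 := Complex.ofReal_ne_zero.2 (hS.r_ne hp)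
  have hc := dom_subset_cdom v₀ hp
  rw [Psi, pv_ofReal_mul hv hc (hS.r_diff p hc) (hS.φ_diff p hc)] at h1
  rw [Reduced.fuv, Reduced.ePsi, reduced_φ, hS.W_eq hp]
  simp only [reduced]
  change _ + (S.nu v₀ p : ℂ) * _ + (S.lam v₀ p : ℂ) * _ + e * I * (_ * (_ + (S.lam v₀ p : ℂ) * _) - _) = 0 at h1
  push_cast at h1 ⊢
  field_simp at h1 ⊢
  linear_combination h1

theorem A_v_eq {p : ℝ × ℝ} (hp : p ∈ dom v₀) : pv v₀ S.A p = (S.reduced e v₀).Av p := by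
  have h1 := (hS.equations p hp).potential
  have h3 := hS.r_ne hp
  have h4 := hS.Ω_ne hp
  rw [Reduced.Av, hS.W_eq hp]
  simp only [reduced]
  rw [h1]
  field_simp
  ring

theorem hasV_Ω : HasV v₀ (fun q => S.lam v₀ q / S.Ω q ^ 2)
    (fun p => -4 * Real.pi * S.r p / S.Ω p ^ 2 * ‖pv v₀ S.φ p‖ ^ 2) := fun u v hu huv hvw => by
  have hp : (u, v) ∈ dom v₀ := ⟨hu, huv, hvw.le⟩
  have h := (hS.equations _ hp).raych_v
  refine (hasV_pv (f := fun q => pv v₀ S.r q / S.Ω q ^ 2) ?_ u v hu huv hvw).congr_deriv h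
  exact ((hS.lam_C1.mono (dom_subset_cdom v₀)).div (hS.Ω_C1.pow 2) fun p hp =>
    pow_ne_zero 2 (hS.Ω_ne hp)).differentiableOn one_ne_zero

theorem hasU_Ω : HasU v₀ (fun q => S.nu v₀ q / S.Ω q ^ 2)
    (fun p => -4 * Real.pi * S.r p / S.Ω p ^ 2 * ‖S.Duφ e v₀ p‖ ^ 2) := fun u v hu huv hvw => by
  have hp : (u, v) ∈ dom v₀ := ⟨hu.le, huv, hvw.le⟩
  have h := (hS.equations _ hp).raych_u
  refine (hasU_pu (f := fun q => pu v₀ S.r q / S.Ω q ^ 2) ?_ u v hu huv hvw).congr_deriv h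
  exact ((hS.nu_C1.mono (dom_subset_cdom v₀)).div (hS.Ω_C1.pow 2) fun p hp =>
    pow_ne_zero 2 (hS.Ω_ne hp)).differentiableOn one_ne_zero

theorem hasV_nu : HasV v₀ (S.nu v₀) (S.reduced e v₀).lk := fun u v hu huv hvw => by
  rw [← hS.nu_v_eq ⟨hu, huv, hvw.le⟩]
  exact hasV_pv ((hS.nu_C1.differentiableOn one_ne_zero).mono (dom_subset_cdom v₀)) u v hu huv hvw

theorem continuousOn_lk (hv : 0 < v₀) : ContinuousOn (S.reduced e v₀).lk (reg v₀) :=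
  ((continuousOn_pv hv hS.nu_C1).mono (reg_subset_cdom v₀)).congr fun _ hp =>
    (hS.nu_v_eq (reg_subset_dom v₀ hp)).symm

/-- The wave equation for r provides ∂_vν; symmetry of mixed derivatives gives the same value for
∂_uλ. -/
theorem hasU_lam (hv : 0 < v₀) : HasU v₀ (S.lam v₀) (S.reduced e v₀).lk :=
  HasU.mixed (hasU_pu (hS.r_diff.mono (dom_subset_cdom v₀)))
    (hasV_pv (hS.r_diff.mono (dom_subset_cdom v₀))).toVi hS.hasV_nu.toVi
    (hS.nu_C1.continuousOn.mono (reg_subset_cdom v₀)) (hS.continuousOn_lk hv)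

/-- From μ = 1 + 4ν(λ/Ω²): the wave equation differentiates ν, and the Raychaudhuri equation
differentiates λ/Ω². -/
theorem hasV_mu : HasV v₀ (S.mu v₀) (S.reduced e v₀).muv := fun u v hu huv hvw => by
  have hp : (u, v) ∈ dom v₀ := ⟨hu, huv, hvw.le⟩
  have h := ((hS.hasV_nu u v hu huv hvw).mul (hS.hasV_Ω u v hu huv hvw)).const_mul 4
  refine ((h.const_add 1).congr_of_eventuallyEq ?_).congr_deriv ?_
  · filter_upwards [Ioo_mem_nhds huv hvw] with y hy
    rw [hS.mu_eq ⟨hu, hy.1, hy.2.le⟩]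
    simp only [Pi.mul_apply]
    ring
  · have h1 := (hS.lam_pos _ hp).ne'
    have h2 := hS.Ω_ne hp
    have h3 : 1 - S.mu v₀ (u, v) = -(4 * S.nu v₀ (u, v) * S.lam v₀ (u, v) / S.Ω (u, v) ^ 2) := by
      rw [hS.mu_eq hp]; ring
    rw [Reduced.muv, Reduced.lk, Reduced.Nv]
    generalize (S.reduced e v₀).pm (u, v) / (S.reduced e v₀).r (u, v) = t
    simp only [reduced]
    rw [h3]
    field_simp
    ring

theorem hasU_mu (hv : 0 < v₀) : HasU v₀ (S.mu v₀) (S.reduced e v₀).muu := fun u v hu huv hvw => by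
  have hp : (u, v) ∈ dom v₀ := ⟨hu.le, huv, hvw.le⟩
  have h := ((hS.hasU_lam hv u v hu huv hvw).mul (hS.hasU_Ω u v hu huv hvw)).const_mul 4
  refine ((h.const_add 1).congr_of_eventuallyEq ?_).congr_deriv ?_
  · filter_upwards [Ioo_mem_nhds hu huv] with y hy
    rw [hS.mu_eq ⟨hy.1.le, hy.2, hvw.le⟩]
    simp only [Pi.mul_apply]
    ring
  · have h1 := (hS.nu_neg _ hp).ne
    have h2 := hS.Ω_ne hp
    have h3 : 1 - S.mu v₀ (u, v) = -(4 * S.nu v₀ (u, v) * S.lam v₀ (u, v) / S.Ω (u, v) ^ 2) := by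
      rw [hS.mu_eq hp]; ring
    rw [Reduced.muu, Reduced.lk, Reduced.Lu, reduced_Du]
    generalize (S.reduced e v₀).pm (u, v) / (S.reduced e v₀).r (u, v) = t
    simp only [reduced]
    rw [h3]
    field_simp
    ring

theorem hasV_q (hv : 0 < v₀) :
    HasV v₀ (fun p => S.Q p / S.r p) (S.reduced e v₀).qv := fun u v hu huv hvw => by
  have hp : (u, v) ∈ dom v₀ := ⟨hu, huv, hvw.le⟩
  have h1 := hasV_pv ((hS.Q_C1 hv).differentiableOn one_ne_zero) u v hu huv hvw
  have h2 := hasV_pv (hS.r_diff.mono (dom_subset_cdom v₀)) u v hu huv hvw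
  have h3 := hS.r_ne hp
  refine (h1.div h2 h3).congr_deriv ?_
  rw [(hS.equations _ hp).maxwell_v, Reduced.qv, reduced_φ]
  simp only [reduced, lam]
  field_simp

theorem hasU_q (hv : 0 < v₀) :
    HasU v₀ (fun p => S.Q p / S.r p) (S.reduced e v₀).qu := fun u v hu huv hvw => by
  have hp : (u, v) ∈ dom v₀ := ⟨hu.le, huv, hvw.le⟩
  have h1 := hasU_pu ((hS.Q_C1 hv).differentiableOn one_ne_zero) u v hu huv hvw
  have h2 := hasU_pu (hS.r_diff.mono (dom_subset_cdom v₀)) u v hu huv hvw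
  have h3 := hS.r_ne hp
  refine (h1.div h2 h3).congr_deriv ?_
  rw [(hS.equations _ hp).maxwell_u, Reduced.qu, reduced_φ, reduced_Du]
  simp only [reduced, nu]
  field_simp

end Equations

end IsC1Solution

end Fields

end ChargedScalar
end

open Set Filter Topology MeasureTheory
open scoped ENNReal NNReal

noncomputable section

namespace ChargedScalar
namespace Fields

open Complex (I)

variable {S : Fields} {e v₀ : ℝ}

namespace IsC1Solution

/-! ### Behaviour at the axis -/

section Axis

variable (hS : S.IsC1Solution e v₀) (hb : S.PointwiseBounds v₀)
include hS

theorem tendsto_r {u : ℝ} (hu : 0 ≤ u) (hu' : u < v₀) :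
    Tendsto (fun v => S.r (u, v)) (𝓝[>] u) (𝓝 0) := by
  have h := tendsto_axis_out hS.r_diff.continuousOn hu hu'
  rwa [hS.r_axis u ⟨hu, hu'.le⟩] at h

theorem tendsto_q {u : ℝ} (hu : 0 ≤ u) (hu' : u < v₀) :
    Tendsto (fun v => S.Q (u, v) / S.r (u, v)) (𝓝[>] u) (𝓝 0) := by
  have h := tendsto_axis_out hS.Qr_C1.continuousOn hu hu'
  rwa [hS.r_axis u ⟨hu, hu'.le⟩, div_zero] at h

theorem tendsto_nu {u : ℝ} (hu : 0 ≤ u) (hu' : u < v₀) :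
    Tendsto (fun v => S.nu v₀ (u, v)) (𝓝[>] u) (𝓝 (-S.lam v₀ (u, u))) := by
  have h := tendsto_axis_out hS.nu_C1.continuousOn hu hu'
  rwa [show S.nu v₀ (u, u) = -S.lam v₀ (u, u) by
    rw [hS.lam_axis u ⟨hu, hu'.le⟩, neg_neg]] at h

include hb in
theorem lam_axis_ge {u : ℝ} (hu : 0 ≤ u) (hu' : u < v₀) : 5 / 12 ≤ S.lam v₀ (u, u) := by
  refine ge_of_tendsto (tendsto_axis_out hS.lam_C1.continuousOn hu hu') ?_
  filter_upwards [Ioo_mem_nhdsGT hu'] with v hv using hb.lam_ge _ ⟨hu, hv.1, hv.2.le⟩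

include hb in
-- The wave equation for r solved for the mass: 1 - μ = λν(1 - q²)/(λν + r ∂_vν), and r and q tend
-- to 0 at the axis.
theorem tendsto_mu {u : ℝ} (hu : 0 ≤ u) (hu' : u < v₀) :
    Tendsto (fun v => S.mu v₀ (u, v)) (𝓝[>] u) (𝓝 0) := by
  have hv0 : 0 < v₀ := hu.trans_lt hu'
  have hl := hS.lam_axis_ge hb hu hu'
  have t1 := tendsto_axis_out hS.lam_C1.continuousOn hu hu'
  have t2 := hS.tendsto_nu hu hu'
  have t3 := hS.tendsto_q hu hu'
  have t4 := (hS.tendsto_r hu hu').mul (tendsto_axis_out (continuousOn_pv hv0 hS.nu_C1) hu hu')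
  have t5 := (t1.mul t2).add t4
  have t6 := (((t1.mul t2).mul ((t3.pow 2).const_sub 1)).div t5 (by nlinarith)).const_sub 1
  have hne : S.lam v₀ (u, u) * -S.lam v₀ (u, u) ≠ 0 := by nlinarith
  rw [zero_mul, add_zero, zero_pow two_ne_zero, sub_zero, mul_one, div_self hne, sub_self] at t6
  refine t6.congr' ?_
  filter_upwards [Ioo_mem_nhdsGT hu', t5.eventually_ne (by rw [zero_mul, add_zero]; exact hne)]
    with v hv hne
  have hp : (u, v) ∈ dom v₀ := ⟨hu, hv.1, hv.2.le⟩
  have h1 := (hS.equations _ hp).wave_r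
  have h3 := (hS.one_sub_mu_pos hp).ne'
  have h4 := hS.W_eq hp
  rw [← h4] at h1
  change S.r (u, v) * pv v₀ (S.nu v₀) (u, v) + S.lam v₀ (u, v) * S.nu v₀ (u, v) = _ at h1
  simp only [Reduced.W, reduced] at h1
  rw [Pi.div_apply, sub_eq_iff_eq_add, ← sub_eq_iff_eq_add', eq_div_iff hne, div_pow, add_comm, h1]
  field_simp

include hb in
-- Let K be the axis value of ∂_vν and l that of λ. By the wave equation (μ - q²)/r tends to -K/l²,
-- while l'Hôpital's rule and the equation for ∂_vμ give K/l². Hence K = 0.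
theorem nu_v_axis {u : ℝ} (hu : 0 ≤ u) (hu' : u < v₀) : pv v₀ (S.nu v₀) (u, u) = 0 := by
  have hv0 : 0 < v₀ := hu.trans_lt hu'
  have hl := hS.lam_axis_ge hb hu hu'
  have t1 := tendsto_axis_out hS.lam_C1.continuousOn hu hu'
  have t2 := hS.tendsto_nu hu hu'
  have tq := hS.tendsto_q hu hu'
  have tm := hS.tendsto_mu hb hu hu'
  have tr := hS.tendsto_r hu hu'
  have tk := tendsto_axis_out (continuousOn_pv hv0 hS.nu_C1) hu hu'
  have tqv := tendsto_axis_out (continuousOn_pv hv0 hS.Qr_C1) hu hu'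
  have tfv : Tendsto (fun v => S.r (u, v) * ‖pv v₀ S.φ (u, v)‖ ^ 2) (𝓝[>] u) (𝓝 0) := by
    have := tr.mul ((tendsto_axis_out (continuousOn_pv hv0 hS.φ_C1) hu hu').norm.pow 2)
    rwa [zero_mul] at this
  set l := S.lam v₀ (u, u) with hlam
  set K := pv v₀ (S.nu v₀) (u, u) with hK
  have hne : l * -l ≠ 0 := by nlinarith
  -- the limit of `(μ - q²) / r` computed from its definition
  have lim1 : Tendsto (fun v => (S.mu v₀ (u, v) - (S.Q (u, v) / S.r (u, v)) ^ 2) / S.r (u, v))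
      (𝓝[>] u) (𝓝 (K / (l * -l))) := by
    have h1 := (tk.div (t1.mul t2) hne).mul (tm.const_sub 1)
    rw [sub_zero, mul_one] at h1
    refine h1.congr' ?_
    filter_upwards [Ioo_mem_nhdsGT hu'] with v hv
    have hp : (u, v) ∈ dom v₀ := ⟨hu, hv.1, hv.2.le⟩
    have h2 := (hS.one_sub_mu_pos hp).ne'
    have h3 := hS.r_ne hp
    have h4 := (hS.lam_pos _ hp).ne'
    have h5 := (hS.nu_neg _ hp).ne
    rw [Pi.div_apply, hS.nu_v_eq hp]
    simp only [Reduced.lk, Reduced.pm, reduced]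
    generalize S.Q (u, v) / S.r (u, v) = q
    field_simp
  -- and by l'Hôpital's rule
  have lim2 : Tendsto (fun v => (S.mu v₀ (u, v) - (S.Q (u, v) / S.r (u, v)) ^ 2) / S.r (u, v))
      (𝓝[>] u) (𝓝 (-(K / (l * -l)))) := by
    have hqv : ∀ᶠ v in 𝓝[>] u, HasDerivAt (fun v => S.Q (u, v) / S.r (u, v))
        (pv v₀ (fun p => S.Q p / S.r p) (u, v)) v := by
      filter_upwards [Ioo_mem_nhdsGT hu'] with v hv
      exact hasV_pv ((hS.Qr_C1.differentiableOn one_ne_zero).mono (dom_subset_cdom v₀))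
        u v hu hv.1 hv.2
    refine HasDerivAt.lhopital_zero_nhdsGT
      (f' := fun v => (S.reduced e v₀).muv (u, v) -
        2 * (S.Q (u, v) / S.r (u, v)) * pv v₀ (fun p => S.Q p / S.r p) (u, v))
      (g' := fun v => S.lam v₀ (u, v)) ?_ ?_ ?_ ?_ tr ?_
    · filter_upwards [Ioo_mem_nhdsGT hu', hqv] with v hv hq
      refine ((hS.hasV_mu u v hu hv.1 hv.2).sub (hq.pow 2)).congr_deriv ?_
      norm_num
    · filter_upwards [Ioo_mem_nhdsGT hu'] with v hv
      exact hasV_pv (hS.r_diff.mono (dom_subset_cdom v₀)) u v hu hv.1 hv.2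
    · filter_upwards [Ioo_mem_nhdsGT hu'] with v hv
      exact (hS.lam_pos _ ⟨hu, hv.1, hv.2.le⟩).ne'
    · have := tm.sub (tq.pow 2)
      rwa [zero_pow two_ne_zero, sub_zero] at this
    · have h1 := ((tm.const_sub 1).mul (((tfv.const_mul (4 * Real.pi)).div t1
        (by linarith)).sub (tk.div t2 (by linarith)))).sub ((tq.const_mul 2).mul tqv)
      have h2 := h1.div t1 (by linarith)
      have e1 : ((1 - 0) * (4 * Real.pi * 0 / l - K / -l) - 2 * 0 *
          pv v₀ (fun p => S.Q p / S.r p) (u, u)) / l = -(K / (l * -l)) := by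
        have : l ≠ 0 := by linarith
        field_simp
        ring
      rw [e1] at h2
      refine h2.congr' ?_
      filter_upwards [Ioo_mem_nhdsGT hu'] with v hv
      have hp : (u, v) ∈ dom v₀ := ⟨hu, hv.1, hv.2.le⟩
      have h3 := hS.r_ne hp
      have h4 := (hS.lam_pos _ hp).ne'
      have h5 := (hS.nu_neg _ hp).ne
      simp only [Pi.div_apply]
      rw [hS.nu_v_eq hp]
      simp only [Reduced.muv, Reduced.lk, Reduced.Nv]
      generalize (S.reduced e v₀).pm (u, v) / (S.reduced e v₀).r (u, v) = t
      simp only [reduced]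
      rw [mul_right_comm (S.lam v₀ (u, v)), mul_div_cancel_right₀ _ h5]
      ring
  have h := tendsto_nhds_unique lim1 lim2
  have h1 : K / (l * -l) = 0 := by linarith
  rcases div_eq_zero_iff.1 h1 with h2 | h2
  · exact h2
  · exact absurd h2 hne

include hb in
theorem lam_u_axis {u : ℝ} (hu : 0 < u) (hu' : u < v₀) : pu v₀ (S.lam v₀) (u, u) = 0 := by
  have hv0 : 0 < v₀ := hu.trans hu'
  have t1 := tendsto_axis_out (continuousOn_pu hv0 hS.lam_C1) hu.le hu'
  have t2 := tendsto_axis_out (continuousOn_pv hv0 hS.nu_C1) hu.le hu'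
  rw [hS.nu_v_axis hb hu.le hu'] at t2
  refine tendsto_nhds_unique (t1.congr' ?_) t2
  filter_upwards [Ioo_mem_nhdsGT hu'] with v hv
  have hp : (u, v) ∈ dom v₀ := ⟨hu.le, hv.1, hv.2.le⟩
  rw [hS.nu_v_eq hp]
  exact (hasU_pu ((hS.lam_C1.differentiableOn one_ne_zero).mono (dom_subset_cdom v₀))
    u v hu hv.1 hv.2).unique (hS.hasU_lam hv0 u v hu hv.1 hv.2)

include hb in
-- Differentiate λ = -ν along the diagonal; the cross derivatives ∂_uλ and ∂_vν vanish there.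
theorem nu_u_axis {u : ℝ} (hu : 0 < u) (hu' : u < v₀) :
    pu v₀ (S.nu v₀) (u, u) = -pv v₀ (S.lam v₀) (u, u) := by
  have hc : (u, u) ∈ cdom v₀ := ⟨hu.le, le_rfl, hu'.le⟩
  have h1 := hasDerivAt_diag ((hS.lam_C1.differentiableOn one_ne_zero) _ hc) hu hu'
  have h2 := hasDerivAt_diag ((hS.nu_C1.differentiableOn one_ne_zero) _ hc) hu hu'
  have h3 := h1.unique (h2.neg.congr_of_eventuallyEq (by
    filter_upwards [Ioo_mem_nhds hu hu'] with x hx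
    exact hS.lam_axis x ⟨hx.1.le, hx.2.le⟩))
  rw [hS.lam_u_axis hb hu hu', hS.nu_v_axis hb hu.le hu'] at h3
  linarith

include hb in
theorem tendsto_ePsi {u : ℝ} (hu : 0 ≤ u) (hu' : u < v₀) :
    Tendsto (fun v => (S.reduced e v₀).ePsi (u, v)) (𝓝[>] u) (𝓝 0) := by
  have hv0 : 0 < v₀ := hu.trans_lt hu'
  have tA := (Complex.continuous_ofReal.tendsto _).comp ((hS.A_axis u ⟨hu, hu'⟩).const_mul e)
  have tr := (Complex.continuous_ofReal.tendsto _).comp (hS.tendsto_r hu hu')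
  have tl := (Complex.continuous_ofReal.tendsto _).comp
    (tendsto_axis_out hS.lam_C1.continuousOn hu hu')
  have tφ := tendsto_axis_out hS.φ_C1.continuousOn hu hu'
  have tfv := tendsto_axis_out (continuousOn_pv hv0 hS.φ_C1) hu hu'
  have tW := ((tendsto_axis_out hS.lam_C1.continuousOn hu hu').mul
    (hS.tendsto_nu hu hu')).neg.div ((hS.tendsto_mu hb hu hu').const_sub 1) (by norm_num)
  have tWq := (Complex.continuous_ofReal.tendsto _).comp
    ((tW.const_mul e).mul (hS.tendsto_q hu hu'))
  have h := (tA.mul ((tr.mul tfv).add (tl.mul tφ))).sub (tWq.mul tφ)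
  have e0 : ∀ a b : ℂ, ((e * 0 : ℝ) : ℂ) * a -
      ((e * (-(S.lam v₀ (u, u) * -S.lam v₀ (u, u)) / (1 - 0)) * 0 : ℝ) : ℂ) * b = 0 := by
    intro a b; simp
  rw [e0] at h
  refine h.congr fun v => ?_
  rw [Reduced.ePsi, reduced_φ]
  rfl

include hb in
-- ∂_uã is φ̃ ∂_vν minus i times the charge term, and both tend to 0 at the axis.
theorem atil_u_axis {u : ℝ} (hu : 0 < u) (hu' : u < v₀) : pu v₀ (S.atil v₀) (u, u) = 0 := by
  have hv0 : 0 < v₀ := hu.trans hu'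
  have t1 := tendsto_axis_out (continuousOn_pu hv0 (hS.atil_C1 hv0)) hu.le hu'
  have t2 := (Complex.continuous_ofReal.tendsto _).comp
    (tendsto_axis_out (continuousOn_pv hv0 hS.nu_C1) hu.le hu')
  rw [hS.nu_v_axis hb hu.le hu'] at t2
  have t3 := (t2.mul (tendsto_axis_out hS.φt_C1.continuousOn hu.le hu')).sub
    ((hS.tendsto_ePsi hb hu.le hu').const_mul I)
  rw [mul_zero, sub_zero, Complex.ofReal_zero, zero_mul] at t3
  refine tendsto_nhds_unique (t1.congr' ?_) t3
  filter_upwards [Ioo_mem_nhdsGT hu'] with v hv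
  have hp : (u, v) ∈ dom v₀ := ⟨hu.le, hv.1, hv.2.le⟩
  have hr : (S.r (u, v) : ℂ) ≠ 0 := Complex.ofReal_ne_zero.2 (hS.r_ne hp)
  have h1 := hasU_pu (hS.r_diff.mono (dom_subset_cdom v₀)) u v hu hv.1 hv.2
  have h2 := hasU_pu ((hS.φv_C1 hv0).differentiableOn one_ne_zero) u v hu hv.1 hv.2
  have h3 := hS.hasU_lam hv0 u v hu hv.1 hv.2
  have h4 := hasU_pu (hS.φt_diff.mono (dom_subset_cdom v₀)) u v hu hv.1 hv.2
  have h5 := (h1.ofReal_comp.mul h2).add (h3.ofReal_comp.mul h4)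
  have h6 := hasU_pu (((hS.atil_C1 hv0).differentiableOn one_ne_zero).mono (dom_subset_cdom v₀))
    u v hu hv.1 hv.2
  rw [h6.unique (h5.congr_of_eventuallyEq (by
    filter_upwards [Ioo_mem_nhds hu hv.1] with x hx
    exact hS.atil_eq hv0 ⟨hx.1.le, hx.2.le, hv.2.le⟩))]
  rw [hS.φv_u_eq hv0 hp, pu_φt, Function.comp_apply, hS.nu_v_eq hp, Reduced.fuv]
  simp only [reduced, nu, lam]
  field_simp
  ring

theorem continuousOn_fuv (hv0 : 0 < v₀) : ContinuousOn (S.reduced e v₀).fuv (reg v₀) :=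
  ((continuousOn_pu_dom hv0 (hS.φv_C1 hv0)).mono (reg_subset_dom v₀)).congr fun _ hp =>
    (hS.φv_u_eq hv0 (reg_subset_dom v₀ hp)).symm

theorem hasU_φv (hv0 : 0 < v₀) : HasU v₀ (pv v₀ S.φ) (S.reduced e v₀).fuv :=
  fun u v hu huv hv => (hasU_pu ((hS.φv_C1 hv0).differentiableOn one_ne_zero) u v hu huv
    hv).congr_deriv (hS.φv_u_eq hv0 ⟨hu.le, huv, hv.le⟩)

/-- For u > 0 this is symmetry of mixed derivatives; the boundary line u = 0, where no two-sided
u-derivative exists, follows by continuity. -/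
theorem hasV_φu (hv0 : 0 < v₀) : HasV v₀ (pu v₀ S.φ) (S.reduced e v₀).fuv := by
  have hd := hasV_pv ((hS.φu_C1 hv0).differentiableOn one_ne_zero)
  have hi : HasVi v₀ (pu v₀ S.φ) (S.reduced e v₀).fuv :=
    HasVi.mixed (hasU_pu (hS.φ_diff.mono (dom_subset_cdom v₀)))
      (hasV_pv (hS.φ_diff.mono (dom_subset_cdom v₀))).toVi (hS.hasU_φv hv0)
      ((hS.φv_C1 hv0).continuousOn.mono (reg_subset_dom v₀)) (hS.continuousOn_fuv hv0)
  have key : ∀ u v, 0 < u → u < v → v < v₀ →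
      pv v₀ (pu v₀ S.φ) (u, v) = (S.reduced e v₀).fuv (u, v) := fun u v hu huv hv =>
    (hd u v hu.le huv hv).unique (hi u v hu huv hv)
  intro u v hu huv hv
  refine (hd u v hu huv hv).congr_deriv ?_
  rcases hu.eq_or_lt with rfl | hu
  · have c1 := slice_u_continuousOn ((continuousOn_pv_dom hv0 (hS.φu_C1 hv0)).mono
      (reg_subset_dom v₀)) hv
    have c2 := slice_u_continuousOn (hS.continuousOn_fuv hv0) hv
    have hle : 𝓝[>] (0 : ℝ) ≤ 𝓝[Ico 0 v] 0 :=
      nhdsWithin_le_of_mem (mem_of_superset (Ioo_mem_nhdsGT huv) Ioo_subset_Ico_self)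
    refine tendsto_nhds_unique ((c1 0 ⟨le_rfl, huv⟩).tendsto.mono_left hle)
      (((c2 0 ⟨le_rfl, huv⟩).tendsto.mono_left hle).congr' ?_)
    filter_upwards [Ioo_mem_nhdsGT huv] with x hx using (key x v hx.1 hx.2 hv).symm
  · exact key u v hu huv hv

include hb in
theorem btil_v_axis {u : ℝ} (hu : 0 < u) (hu' : u < v₀) : pv v₀ (S.btil v₀) (u, u) = 0 := by
  have hv0 : 0 < v₀ := hu.trans hu'
  have t1 := tendsto_axis_out (continuousOn_pv hv0 (hS.btil_C1 hv0)) hu.le hu'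
  have t2 := (Complex.continuous_ofReal.tendsto _).comp
    (tendsto_axis_out (continuousOn_pv hv0 hS.nu_C1) hu.le hu')
  rw [hS.nu_v_axis hb hu.le hu'] at t2
  have t3 := (t2.mul (tendsto_axis_out hS.φt_C1.continuousOn hu.le hu')).sub
    ((hS.tendsto_ePsi hb hu.le hu').const_mul I)
  rw [mul_zero, sub_zero, Complex.ofReal_zero, zero_mul] at t3
  refine tendsto_nhds_unique (t1.congr' ?_) t3
  filter_upwards [Ioo_mem_nhdsGT hu'] with v hv
  have hp : (u, v) ∈ dom v₀ := ⟨hu.le, hv.1, hv.2.le⟩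
  have hr : (S.r (u, v) : ℂ) ≠ 0 := Complex.ofReal_ne_zero.2 (hS.r_ne hp)
  have h1 := hasV_pv (hS.r_diff.mono (dom_subset_cdom v₀)) u v hu.le hv.1 hv.2
  have h2 := hS.hasV_φu hv0 u v hu.le hv.1 hv.2
  have h3 := hS.hasV_nu u v hu.le hv.1 hv.2
  have h4 := hasV_pv (hS.φt_diff.mono (dom_subset_cdom v₀)) u v hu.le hv.1 hv.2
  have h5 := (h1.ofReal_comp.mul h2).add (h3.ofReal_comp.mul h4)
  have h6 := hasV_pv (((hS.btil_C1 hv0).differentiableOn one_ne_zero).mono (dom_subset_cdom v₀))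
    u v hu.le hv.1 hv.2
  rw [h6.unique (h5.congr_of_eventuallyEq (by
    filter_upwards [Ioo_mem_nhds hv.1 hv.2] with x hx
    exact hS.btil_eq hv0 ⟨hu.le, hx.1.le, hx.2.le⟩))]
  rw [pv_φt, Function.comp_apply, hS.nu_v_eq hp, Reduced.fuv]
  simp only [reduced, nu, lam]
  field_simp
  ring

include hb in
-- Since r = 0 on the axis, ã = λφ̃ and b̃ = νφ̃ are opposite there. Differentiating along the
-- diagonal and discarding the vanishing cross derivatives relates ∂_u b̃ to ∂_vã.
theorem btil_u_axis {u : ℝ} (hu : 0 < u) (hu' : u < v₀) :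
    pu v₀ (S.btil v₀) (u, u) = -pv v₀ (S.atil v₀) (u, u) := by
  have hv0 : 0 < v₀ := hu.trans hu'
  have hc : (u, u) ∈ cdom v₀ := ⟨hu.le, le_rfl, hu'.le⟩
  have h1 := hasDerivAt_diag (((hS.atil_C1 hv0).differentiableOn one_ne_zero) _ hc) hu hu'
  have h2 := hasDerivAt_diag (((hS.btil_C1 hv0).differentiableOn one_ne_zero) _ hc) hu hu'
  have h3 := h2.unique (h1.neg.congr_of_eventuallyEq (by
    filter_upwards [Ioo_mem_nhds hu hu'] with x hx
    have hx' : x ∈ Icc 0 v₀ := ⟨hx.1.le, hx.2.le⟩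
    have hxc : (x, x) ∈ cdom v₀ := ⟨hx'.1, le_rfl, hx'.2⟩
    rw [Pi.neg_apply, hS.btil_eq hv0 hxc, hS.atil_eq hv0 hxc, hS.r_axis x hx', hS.lam_axis x hx']
    push_cast
    ring))
  rw [hS.atil_u_axis hb hu hu', hS.btil_v_axis hb hu hu'] at h3
  rw [add_zero, zero_add] at h3
  exact h3

end Axis

end IsC1Solution
end Fields
end ChargedScalar
end

open Set Filter Topology MeasureTheory
open scoped ENNReal NNReal

noncomputable section

namespace ChargedScalar
namespace Fields

open Complex (I)

variable {S : Fields} {e v₀ : ℝ}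

namespace IsC1Solution

section Solution

variable (hS : S.IsC1Solution e v₀) (hv0 : 0 < v₀)
include hS

theorem lam_init {v : ℝ} (hv : 0 < v) (hv' : v < v₀) : S.lam v₀ (0, v) = 1 / 2 := by
  refine (hasV_pv (hS.r_diff.mono (dom_subset_cdom v₀)) 0 v le_rfl hv hv').unique
    (((hasDerivAt_id v).div_const 2).congr_of_eventuallyEq ?_)
  filter_upwards [Ioo_mem_nhds hv hv'] with y hy
  have := hS.gauge_r y ⟨hy.1.le, hy.2.le⟩
  simp only [id]
  linarith

theorem lam_v_init {v : ℝ} (hv : 0 < v) (hv' : v < v₀) : pv v₀ (S.lam v₀) (0, v) = 0 := by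
  refine (hasV_pv ((hS.lam_C1.differentiableOn one_ne_zero).mono (dom_subset_cdom v₀)) 0 v le_rfl
    hv hv').unique ((hasDerivAt_const v (1 / 2 : ℝ)).congr_of_eventuallyEq ?_)
  filter_upwards [Ioo_mem_nhds hv hv'] with y hy using hS.lam_init hy.1 hy.2

include hv0

theorem hasV_atil : HasV v₀ (S.reduced e v₀).at' (pv v₀ (S.atil v₀)) := fun u v hu huv hv => by
  refine (hasV_pv (((hS.atil_C1 hv0).differentiableOn one_ne_zero).mono (dom_subset_cdom v₀))
    u v hu huv hv).congr_of_eventuallyEq ?_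
  filter_upwards [Ioo_mem_nhds huv hv] with y hy
  exact (hS.atil_eq hv0 ⟨hu, hy.1.le, hy.2.le⟩).symm

theorem hasU_btil : HasU v₀ (fun p => S.r p * pu v₀ S.φ p + S.nu v₀ p * S.φt p)
    (pu v₀ (S.btil v₀)) := fun u v hu huv hv => by
  refine (hasU_pu (((hS.btil_C1 hv0).differentiableOn one_ne_zero).mono (dom_subset_cdom v₀))
    u v hu huv hv).congr_of_eventuallyEq ?_
  filter_upwards [Ioo_mem_nhds hu huv] with y hy
  exact (hS.btil_eq hv0 ⟨hy.1.le, hy.2.le, hv.le⟩).symm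

/-- X is a supremum over u > 0 only; the slice u = 0 is reached as a limit, by dominated convergence
on compact v-intervals. -/
theorem X_bound {u : ℝ} (hu : 0 ≤ u) (hu' : u < v₀) :
    ∫⁻ v in Ioo u v₀, ‖pv v₀ S.φ (u, v)‖ₑ ≤ S.X v₀ := by
  have key : ∀ x, 0 < x → x < v₀ → ∫⁻ v in Ioo x v₀, ‖pv v₀ S.φ (x, v)‖ₑ ≤ S.X v₀ :=
    fun x hx hx' => le_iSup₂_of_le x ⟨hx, hx'⟩ le_rfl
  rcases hu.eq_or_lt with rfl | hu
  swap
  · exact key u hu hu'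
  have hc := continuousOn_pv hv0 hS.φ_C1
  obtain ⟨B, hB⟩ := (isCompact_cdom v₀).exists_bound_of_continuousOn hc
  refine setLIntegral_Ioo_le_of_forall_Icc fun c d h0c hcd hd => ?_
  have hmem : ∀ x ∈ Ico 0 c, ∀ v ∈ Icc c d, (x, v) ∈ cdom v₀ := fun x hx v hv =>
    ⟨hx.1, hx.2.le.trans hv.1, hv.2.trans hd.le⟩
  obtain ⟨x, -, hx, hx0⟩ := exists_seq_strictAnti_tendsto' h0c
  have hlim : Tendsto (fun n => ∫⁻ v in Icc c d, ‖pv v₀ S.φ (x n, v)‖ₑ) atTop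
      (𝓝 (∫⁻ v in Icc c d, ‖pv v₀ S.φ (0, v)‖ₑ)) := by
    refine tendsto_lintegral_of_dominated_convergence' (fun _ => ENNReal.ofReal B) (fun n => ?_)
      (fun n => ?_) ?_ ?_
    · have h1 : ContinuousOn (fun v => pv v₀ S.φ (x n, v)) (Icc c d) :=
        hc.comp (by fun_prop) fun v hv => hmem _ ⟨(hx n).1.le, (hx n).2⟩ v hv
      exact (h1.aestronglyMeasurable measurableSet_Icc).enorm
    · filter_upwards [ae_restrict_mem measurableSet_Icc] with v hv
      rw [← ofReal_norm]
      exact ENNReal.ofReal_le_ofReal (hB _ (hmem _ ⟨(hx n).1.le, (hx n).2⟩ v hv))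
    · simp [ENNReal.mul_eq_top]
    · filter_upwards [ae_restrict_mem measurableSet_Icc] with v hv
      have h1 : ContinuousOn (fun x => pv v₀ S.φ (x, v)) (Ico 0 c) :=
        hc.comp (by fun_prop) fun x hx => hmem x hx v hv
      exact ((h1 0 ⟨le_rfl, h0c⟩).tendsto.comp (tendsto_nhdsWithin_iff.2 ⟨hx0,
        Eventually.of_forall fun n => Ioo_subset_Ico_self (hx n)⟩)).enorm
  refine le_of_tendsto' hlim fun n => ?_
  refine (lintegral_mono_set fun v hv => ?_).trans
    (key _ (hx n).1 (((hx n).2.trans_le hcd).trans hd))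
  exact ⟨(hx n).2.trans_le hv.1, hv.2.trans_lt hd⟩

theorem isSol_reduced (he : 0 ≤ e) (hs : S.SmallV₀ e v₀) (hb : S.PointwiseBounds v₀)
    (hZ : S.Z v₀ ≠ ⊤) (hD : S.D v₀ ≠ ⊤) (hZD : (S.Z v₀).toReal + (S.D v₀).toReal ≤ 1 / 100) :
    (S.reduced e v₀).IsSol where
  e_nonneg := he
  w_pos := hv0
  M_ge := by simp [reduced]
  φ0_le := by simp [reduced]
  -- Uses the last smallness condition, with M = |φ₀| + 2 ≤ |φ₀| + 12.
  small := by
    have h1 := hs.le₄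
    have h2 := mul_nonneg he hv0.le
    simp only [reduced]
    nlinarith
  Z_nonneg := ENNReal.toReal_nonneg
  D_nonneg := ENNReal.toReal_nonneg
  ZD_le := hZD
  cr := hS.r_diff.continuousOn.mono (reg_subset_cdom v₀)
  clam := hS.lam_C1.continuousOn.mono (reg_subset_cdom v₀)
  cnu := hS.nu_C1.continuousOn.mono (reg_subset_cdom v₀)
  cmu := by
    have h : ContinuousOn (fun p => 1 + 4 * S.nu v₀ p * S.lam v₀ p / S.Ω p ^ 2) (dom v₀) := by
      have h1 := hS.nu_C1.continuousOn.mono (dom_subset_cdom v₀)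
      have h2 := hS.lam_C1.continuousOn.mono (dom_subset_cdom v₀)
      have h3 := hS.Ω_C1.continuousOn
      exact continuousOn_const.add (((continuousOn_const.mul h1).mul h2).div (h3.pow 2)
        fun p hp => pow_ne_zero 2 (hS.Ω_ne hp))
    exact (h.congr fun p hp => hS.mu_eq hp).mono (reg_subset_dom v₀)
  cq := hS.Qr_C1.continuousOn.mono (reg_subset_cdom v₀)
  cA := hS.A_C1.continuousOn.mono (reg_subset_dom v₀)
  clamv := (continuousOn_pv hv0 hS.lam_C1).mono (reg_subset_cdom v₀)
  cnuu := (continuousOn_pu hv0 hS.nu_C1).mono (reg_subset_cdom v₀)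
  cAu := (continuousOn_pu_dom hv0 hS.A_C1).mono (reg_subset_dom v₀)
  cf := hS.φt_C1.continuousOn.mono (reg_subset_cdom v₀)
  cfu := (continuousOn_pu hv0 hS.φ_C1).mono (reg_subset_cdom v₀)
  cfv := (continuousOn_pv hv0 hS.φ_C1).mono (reg_subset_cdom v₀)
  catv := (continuousOn_pv hv0 (hS.atil_C1 hv0)).mono (reg_subset_cdom v₀)
  cbu := (continuousOn_pu hv0 (hS.btil_C1 hv0)).mono (reg_subset_cdom v₀)
  r_pos p hp := hS.r_pos p (reg_subset_dom v₀ hp)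
  lam_ge p hp := hb.lam_ge p (reg_subset_dom v₀ hp)
  nu_neg p hp := hS.nu_neg p (reg_subset_dom v₀ hp)
  nu_ge p hp := by
    have := hb.nu_le p (reg_subset_dom v₀ hp)
    simp only [reduced]
    linarith
  mu_le p hp := hb.mu_le p (reg_subset_dom v₀ hp)
  bdd := by
    obtain ⟨B1, h1⟩ := ContinuousOn.bound_cdom (continuousOn_pv hv0 hS.lam_C1)
    obtain ⟨B2, h2⟩ := ContinuousOn.bound_cdom (continuousOn_pu hv0 hS.nu_C1)
    obtain ⟨B3, h3⟩ := ContinuousOn.bound_cdom (continuousOn_pu hv0 hS.φ_C1)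
    obtain ⟨B4, h4⟩ := ContinuousOn.bound_cdom (continuousOn_pv hv0 hS.φ_C1)
    obtain ⟨B5, h5⟩ := ContinuousOn.bound_cdom (continuousOn_pv hv0 (hS.atil_C1 hv0))
    obtain ⟨B6, h6⟩ := ContinuousOn.bound_cdom (continuousOn_pu hv0 (hS.btil_C1 hv0))
    obtain ⟨B7, h7⟩ := ContinuousOn.bound_cdom (continuousOn_pv hv0 hS.nu_C1)
    refine ⟨|B1| + |B2| + |B3| + |B4| + |B5| + |B6| + |B7|, fun p hp => ?_⟩
    have e7 := h7 p hp
    rw [hS.nu_v_eq (reg_subset_dom v₀ hp)] at e7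
    have := h1 p hp
    have := h2 p hp
    have := h3 p hp
    have := h4 p hp
    have := h5 p hp
    have := h6 p hp
    simp only [Real.norm_eq_abs] at *
    have a1 := le_abs_self B1
    have a2 := le_abs_self B2
    have a3 := le_abs_self B3
    have a4 := le_abs_self B4
    have a5 := le_abs_self B5
    have a6 := le_abs_self B6
    have a7 := le_abs_self B7
    have b1 := abs_nonneg B1
    have b2 := abs_nonneg B2
    have b3 := abs_nonneg B3
    have b4 := abs_nonneg B4
    have b5 := abs_nonneg B5
    have b6 := abs_nonneg B6
    have b7 := abs_nonneg B7
    refine ⟨?_, ?_, ?_, ?_, ?_, ?_, ?_⟩ <;> simp only [reduced] at e7 ⊢ <;> linarith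
  r_u := hasU_pu (hS.r_diff.mono (dom_subset_cdom v₀))
  r_v := hasV_pv (hS.r_diff.mono (dom_subset_cdom v₀))
  lam_u := hS.hasU_lam hv0
  lam_v := hasV_pv ((hS.lam_C1.differentiableOn one_ne_zero).mono (dom_subset_cdom v₀))
  nu_u := hasU_pu ((hS.nu_C1.differentiableOn one_ne_zero).mono (dom_subset_cdom v₀))
  nu_v := hS.hasV_nu
  f_u := by
    have h := hasU_pu (hS.φt_diff.mono (dom_subset_cdom v₀))
    rwa [pu_φt] at h
  f_v := by
    have h := hasV_pv (hS.φt_diff.mono (dom_subset_cdom v₀))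
    rwa [pv_φt] at h
  fu_v := hS.hasV_φu hv0
  fv_u := hS.hasU_φv hv0
  at_v := hS.hasV_atil hv0
  b_u := hS.hasU_btil hv0
  A_u := hasU_pu (hS.A_C1.differentiableOn one_ne_zero)
  A_v := fun u v hu huv hv => (hasV_pv (hS.A_C1.differentiableOn one_ne_zero) u v hu huv
    hv).congr_deriv (hS.A_v_eq ⟨hu, huv, hv.le⟩)
  mu_u := hS.hasU_mu hv0
  mu_v := hS.hasV_mu
  q_u := hS.hasU_q hv0
  q_v := hS.hasV_q hv0
  lam_init v hv hv' := hS.lam_init hv hv'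
  lamv_init v hv hv' := hS.lam_v_init hv hv'
  f_origin := by
    have h := tendsto_axis_out hS.φt_C1.continuousOn le_rfl hv0
    rwa [show S.φt (0, 0) = 0 from sub_self _] at h
  at_origin := by
    have h := tendsto_axis_out (hS.atil_C1 hv0).continuousOn le_rfl hv0
    rw [hS.atil_eq hv0 ⟨le_rfl, le_rfl, hv0.le⟩, hS.r_axis 0 ⟨le_rfl, hv0.le⟩,
      show S.φt (0, 0) = 0 from sub_self _, Complex.ofReal_zero, zero_mul, mul_zero, add_zero] at h
    refine h.congr' ?_
    filter_upwards [Ioo_mem_nhdsGT hv0] with v hv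
    exact hS.atil_eq hv0 ⟨le_rfl, hv.1.le, hv.2.le⟩
  X_le u hu hu' := by
    simp only [reduced, ofReal_norm]
    rw [ENNReal.ofReal_toReal hZ]
    exact (hS.X_bound hv0 hu hu').trans (le_max_left _ _)
  Y_le v hv hv' := by
    simp only [reduced, ofReal_norm]
    rw [ENNReal.ofReal_toReal hZ]
    exact (le_iSup₂_of_le (f := fun v (_ : v ∈ Ioo 0 v₀) => ∫⁻ u in Ioo 0 v, ‖pu v₀ S.φ (u, v)‖ₑ)
      v ⟨hv, hv'⟩ le_rfl).trans (le_max_right _ _)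
  D_le := by
    simp only [reduced, ofReal_norm]
    rw [ENNReal.ofReal_toReal hD]
    refine setLIntegral_deriv_le_eVariationOn_Ioo (F := fun v => S.atil v₀ (0, v))
      (fun v hv => hasV_pv (((hS.atil_C1 hv0).differentiableOn one_ne_zero).mono
        (dom_subset_cdom v₀)) 0 v le_rfl hv.1 hv.2)
      ((slice_v_continuousOn ((continuousOn_pv hv0 (hS.atil_C1 hv0)).mono
        (reg_subset_cdom v₀)) le_rfl))
  r_axis u hu hu' := hS.tendsto_r hu hu'
  mu_axis u hu hu' := hS.tendsto_mu hb hu hu'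
  q_axis u hu hu' := hS.tendsto_q hu hu'
  A_axis u hu hu' := hS.A_axis u ⟨hu, hu'⟩
  nu_axis u hu hu' := hS.tendsto_nu hu hu'
  la_ge u hu hu' := hS.lam_axis_ge hb hu hu'
  nuu_axis u hu hu' := by
    have h := tendsto_axis_out (continuousOn_pu hv0 hS.nu_C1) hu.le hu'
    rwa [hS.nu_u_axis hb hu hu'] at h
  b_axis u hu hu' := by
    have h := (tendsto_axis_out (continuousOn_pu hv0 (hS.btil_C1 hv0)) hu.le hu').sub
      ((tendsto_axis_out hS.φt_C1.continuousOn hu.le hu').mul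
        ((Complex.continuous_ofReal.tendsto _).comp
          (tendsto_axis_out (continuousOn_pu hv0 hS.nu_C1) hu.le hu')))
    rw [hS.nu_u_axis hb hu hu', hS.btil_u_axis hb hu hu'] at h
    have e1 : -pv v₀ (S.atil v₀) (u, u) - S.φt (u, u) * ((-pv v₀ (S.lam v₀) (u, u) : ℝ) : ℂ)
        = -(pv v₀ (S.atil v₀) (u, u) - S.φt (u, u) * pv v₀ (S.lam v₀) (u, u)) := by
      push_cast
      ring
    rw [e1] at h
    exact h
  lk_axis u hu hu' := by
    have h := tendsto_axis_out (continuousOn_pv hv0 hS.nu_C1) hu.le hu'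
    rw [hS.nu_v_axis hb hu.le hu'] at h
    refine h.congr' ?_
    filter_upwards [Ioo_mem_nhdsGT hu'] with v hv using hS.nu_v_eq ⟨hu.le, hv.1, hv.2.le⟩
  lk_axis' v hv hv' := by
    have h := tendsto_axis_in (continuousOn_pv hv0 hS.nu_C1) hv hv'.le
    rw [hS.nu_v_axis hb hv.le hv'] at h
    refine h.congr' ?_
    filter_upwards [Ioo_mem_nhdsLT hv] with u hu using hS.nu_v_eq ⟨hu.1.le, hu.2, hv'.le⟩
  lam_axis' v hv hv' := tendsto_axis_in hS.lam_C1.continuousOn hv hv'.le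
  lamv_axis' v hv hv' := tendsto_axis_in (continuousOn_pv hv0 hS.lam_C1) hv hv'.le
  g_axis' v hv hv' := (tendsto_axis_in (continuousOn_pv hv0 (hS.atil_C1 hv0)) hv hv'.le).sub
    ((tendsto_axis_in hS.φt_C1.continuousOn hv hv'.le).mul
      ((Complex.continuous_ofReal.tendsto _).comp
        (tendsto_axis_in (continuousOn_pv hv0 hS.lam_C1) hv hv'.le)))

end Solution

end IsC1Solution
end Fields
end ChargedScalar
end

open Set Filter Topology MeasureTheory
open scoped ENNReal NNReal

noncomputable section

namespace ChargedScalar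

/-! ### Total variations and areas from slice derivatives -/

section Conversion

variable {E : Type*} [NormedAddCommGroup E] [NormedSpace ℝ E] {v₀ c : ℝ}

theorem supTVout_le [CompleteSpace E] {F F' : ℝ × ℝ → E} (hF : HasV v₀ F F')
    (cF : ContinuousOn F' (reg v₀)) (hc : Out v₀ (fun p => ‖F' p‖) c) :
    supTVout v₀ F ≤ ENNReal.ofReal c := by
  refine iSup₂_le fun u hu => ?_
  refine (eVariationOn_Ioo_le_setLIntegral_deriv (fun v hv => hF u v hu.1.le hv.1 hv.2)
    (slice_v_continuousOn cF hu.1.le)).trans ?_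
  have h := (hc u hu.1.le).le
  rw [setLIntegral_outMeas hu.1.le] at h
  simpa only [ofReal_norm] using h

theorem supTVin_le [CompleteSpace E] {F F' : ℝ × ℝ → E} (hF : HasU v₀ F F')
    (cF : ContinuousOn F' (reg v₀)) (hc : In v₀ (fun p => ‖F' p‖) c) :
    supTVin v₀ F ≤ ENNReal.ofReal c := by
  refine iSup₂_le fun v hv => ?_
  refine (eVariationOn_Ioo_le_setLIntegral_deriv (fun u hu => hF u v hu.1 hu.2 hv.2)
    ((slice_u_continuousOn cF hv.2).mono Ioo_subset_Ico_self)).trans ?_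
  have h := (hc v hv.2).le
  rw [setLIntegral_inMeas hv.2] at h
  simpa only [ofReal_norm] using h

theorem pu_eq {F F' : ℝ × ℝ → E} (hd : DifferentiableOn ℝ F (dom v₀)) (hF : HasU v₀ F F') {u v : ℝ}
    (hu : 0 < u) (huv : u < v) (hv : v < v₀) : pu v₀ F (u, v) = F' (u, v) :=
  (hasU_pu hd u v hu huv hv).unique (hF u v hu huv hv)

theorem pv_eq {F F' : ℝ × ℝ → E} (hd : DifferentiableOn ℝ F (dom v₀)) (hF : HasV v₀ F F') {u v : ℝ}
    (hu : 0 < u) (huv : u < v) (hv : v < v₀) : pv v₀ F (u, v) = F' (u, v) :=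
  (hasV_pv hd u v hu.le huv hv).unique (hF u v hu.le huv hv)

/-- The integrand of the area is compared in the open triangle, where the one-sided derivatives are
identified with slice derivatives; the boundary is null. -/
theorem area_le {F Fu Fv G Gu Gv : ℝ × ℝ → ℂ} {H : ℝ × ℝ → ℝ}
    (hF : DifferentiableOn ℝ F (dom v₀)) (hG : DifferentiableOn ℝ G (dom v₀))
    (hFu : HasU v₀ F Fu) (hFv : HasV v₀ F Fv) (hGu : HasU v₀ G Gu) (hGv : HasV v₀ G Gv)
    (hH : Tri v₀ H c) (hle : ∀ p ∈ reg v₀, ‖Fu p * Gv p - Fv p * Gu p‖ ≤ H p) :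
    area v₀ F G ≤ ENNReal.ofReal c := by
  refine (setLIntegral_dom_le fun u v hu huv hv => ?_).trans hH.le
  rw [jac, pu_eq hF hFu hu huv hv, pu_eq hG hGu hu huv hv, pv_eq hF hFv hu huv hv,
    pv_eq hG hGv hu huv hv, ← ofReal_norm]
  exact ENNReal.ofReal_le_ofReal (hle (u, v) ⟨hu.le, huv, hv⟩)

theorem contDiffOn_div_ofReal {F : ℝ × ℝ → ℂ} {G : ℝ × ℝ → ℝ} {s : Set (ℝ × ℝ)}
    (hF : ContDiffOn ℝ 1 F s) (hG : ContDiffOn ℝ 1 G s) (h0 : ∀ p ∈ s, G p ≠ 0) :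
    ContDiffOn ℝ 1 (fun p => F p / G p) s := by
  refine (hF.mul (Complex.ofRealCLM.contDiff.comp_contDiffOn (hG.inv h0))).congr fun p hp => ?_
  simp [div_eq_mul_inv]

theorem continuousOn_diag {X : Type*} [TopologicalSpace X] {F : ℝ × ℝ → X}
    (hF : ContinuousOn F (cdom v₀)) : ContinuousOn (fun u => F (u, u)) (Ioo 0 v₀) :=
  hF.comp (by fun_prop) fun _ hu => ⟨hu.1.le, le_rfl, hu.2.le⟩

theorem ofReal_mul_toReal_pow {D : ℝ≥0∞} (hD : D ≠ ⊤) (c : ℝ≥0) (n : ℕ) :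
    ENNReal.ofReal (c * D.toReal ^ n) = c * D ^ n := by
  rw [ENNReal.ofReal_mul c.coe_nonneg, ENNReal.ofReal_coe_nnreal,
    ENNReal.ofReal_pow ENNReal.toReal_nonneg, ENNReal.ofReal_toReal hD]

end Conversion

namespace Fields

open Complex (I)

variable {S : Fields} {e v₀ : ℝ}

namespace IsC1Solution

section Conclusion

variable (hS : S.IsC1Solution e v₀) (hv0 : 0 < v₀)
include hS hv0

theorem bt_eq {p : ℝ × ℝ} (hp : p ∈ cdom v₀) : (S.reduced e v₀).bt p = S.btt e v₀ p := by
  rw [Reduced.bt, reduced_Du, btt, hS.btil_eq hv0 hp, Duφ]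
  simp only [reduced]
  ring

theorem at_eq {p : ℝ × ℝ} (hp : p ∈ cdom v₀) : (S.reduced e v₀).at' p = S.atil v₀ p :=
  (hS.atil_eq hv0 hp).symm

variable (h : (S.reduced e v₀).IsSol)
include h

theorem hasU_btt : HasU v₀ (S.btt e v₀) (S.reduced e v₀).btu := fun u v hu huv hv => by
  refine (h.bt_u u v hu huv hv).congr_of_eventuallyEq ?_
  filter_upwards [Ioo_mem_nhds hu huv] with x hx
  exact (hS.bt_eq hv0 ⟨hx.1.le, hx.2.le, hv.le⟩).symm

theorem hasU_atil_div :
    HasU v₀ (fun p => S.atil v₀ p / S.lam v₀ p) (S.reduced e v₀).au := fun u v hu huv hv => by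
  refine (((h.x_u u v hu huv hv).add (h.f_u u v hu huv hv)).congr_deriv
    (sub_add_cancel _ _)).congr_of_eventuallyEq ?_
  filter_upwards [Ioo_mem_nhds hu huv] with x hx
  have hl := h.lam_ne' (x, v) ⟨hx.1.le, hx.2, hv⟩
  rw [← hS.at_eq hv0 ⟨hx.1.le, hx.2.le, hv.le⟩, Pi.add_apply, Reduced.x, Reduced.at']
  change _ / ((S.reduced e v₀).lam (x, v) : ℂ) = _
  push_cast
  field_simp

theorem hasV_atil_div :
    HasV v₀ (fun p => S.atil v₀ p / S.lam v₀ p) (S.reduced e v₀).av := fun u v hu huv hv => by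
  refine (((h.x_v u v hu huv hv).add (h.f_v u v hu huv hv)).congr_deriv
    (sub_add_cancel _ _)).congr_of_eventuallyEq ?_
  filter_upwards [Ioo_mem_nhds huv hv] with y hy
  have hl := h.lam_ne' (u, y) ⟨hu, hy.1, hy.2⟩
  rw [← hS.at_eq hv0 ⟨hu, hy.1.le, hy.2.le⟩, Pi.add_apply, Reduced.x, Reduced.at']
  change _ / ((S.reduced e v₀).lam (u, y) : ℂ) = _
  push_cast
  field_simp

theorem hasU_btt_div :
    HasU v₀ (fun p => S.btt e v₀ p / S.nu v₀ p) (S.reduced e v₀).beu := fun u v hu huv hv => by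
  refine (((h.y_u u v hu huv hv).add (h.f_u u v hu huv hv)).congr_deriv
    (sub_add_cancel _ _)).congr_of_eventuallyEq ?_
  filter_upwards [Ioo_mem_nhds hu huv] with x hx
  rw [← hS.bt_eq hv0 ⟨hx.1.le, hx.2.le, hv.le⟩, Pi.add_apply, h.y_eq ⟨hx.1.le, hx.2, hv⟩,
    sub_add_cancel]
  rfl

theorem hasV_btt_div :
    HasV v₀ (fun p => S.btt e v₀ p / S.nu v₀ p) (S.reduced e v₀).bev := fun u v hu huv hv => by
  refine (((h.y_v u v hu huv hv).add (h.f_v u v hu huv hv)).congr_deriv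
    (sub_add_cancel _ _)).congr_of_eventuallyEq ?_
  filter_upwards [Ioo_mem_nhds huv hv] with y hy
  rw [← hS.bt_eq hv0 ⟨hu, hy.1.le, hy.2.le⟩, Pi.add_apply, h.y_eq ⟨hu, hy.1, hy.2⟩,
    sub_add_cancel]
  rfl

omit h in
theorem differentiableOn_atil_div :
    DifferentiableOn ℝ (fun p => S.atil v₀ p / S.lam v₀ p) (dom v₀) :=
  (contDiffOn_div_ofReal ((hS.atil_C1 hv0).mono (dom_subset_cdom v₀))
    (hS.lam_C1.mono (dom_subset_cdom v₀)) fun p hp => (hS.lam_pos p hp).ne').differentiableOn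
    one_ne_zero

omit h in
theorem differentiableOn_btt_div :
    DifferentiableOn ℝ (fun p => S.btt e v₀ p / S.nu v₀ p) (dom v₀) := by
  have h1 := (hS.btil_C1 hv0).mono (dom_subset_cdom v₀)
  have h2 := Complex.ofRealCLM.contDiff.comp_contDiffOn hS.A_C1
  have h3 := Complex.ofRealCLM.contDiff.comp_contDiffOn ((hS.r_C1 hv0).mono (dom_subset_cdom v₀))
  have h4 := hS.φ_C1.mono (dom_subset_cdom v₀)
  exact (contDiffOn_div_ofReal
    (h1.add ((((contDiffOn_const (c := I * e)).mul h2).mul h3).mul h4))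
    (hS.nu_C1.mono (dom_subset_cdom v₀)) fun p hp => (hS.nu_neg p hp).ne).differentiableOn
    one_ne_zero

theorem area_atil_le {c : ℝ} (hJ : Tri v₀ (fun p => ‖(S.reduced e v₀).J1 p‖) c) :
    area v₀ (fun p => (starRingEnd ℂ) (S.φt p)) (fun p => S.atil v₀ p / S.lam v₀ p)
      ≤ ENNReal.ofReal c :=
  area_le (Fu := fun p => (starRingEnd ℂ) ((S.reduced e v₀).fu p))
    (Fv := fun p => (starRingEnd ℂ) ((S.reduced e v₀).fv p)) ((hS.φt_diff.mono (dom_subset_cdom v₀)).star) (hS.differentiableOn_atil_div hv0)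
    (fun u v hu huv hv => (h.f_u u v hu huv hv).star)
    (fun u v hu huv hv => (h.f_v u v hu huv hv).star)
    (hS.hasU_atil_div hv0 h) (hS.hasV_atil_div hv0 h) hJ fun _ _ => le_rfl

theorem area_btt_le {c : ℝ} (hJ : Tri v₀ (fun p => ‖(S.reduced e v₀).J2 p‖) c) :
    area v₀ (fun p => (starRingEnd ℂ) (S.φt p)) (fun p => S.btt e v₀ p / S.nu v₀ p)
      ≤ ENNReal.ofReal c :=
  area_le (Fu := fun p => (starRingEnd ℂ) ((S.reduced e v₀).fu p))
    (Fv := fun p => (starRingEnd ℂ) ((S.reduced e v₀).fv p)) ((hS.φt_diff.mono (dom_subset_cdom v₀)).star) (hS.differentiableOn_btt_div hv0)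
    (fun u v hu huv hv => (h.f_u u v hu huv hv).star)
    (fun u v hu huv hv => (h.f_v u v hu huv hv).star)
    (hS.hasU_btt_div hv0 h) (hS.hasV_btt_div hv0 h) hJ fun _ _ => le_rfl

omit hv0 in
theorem area_lam_le {c : ℝ} (hJ : Tri v₀ (fun p => ‖(S.reduced e v₀).J3 p‖) c) :
    area v₀ (fun p => (S.lam v₀ p : ℂ)) S.φt ≤ ENNReal.ofReal c := by
  refine area_le (Fu := fun p => ((S.reduced e v₀).lk p : ℂ))
    (Fv := fun p => ((S.reduced e v₀).lamv p : ℂ)) ((Complex.ofRealCLM.contDiff.comp_contDiffOn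
    (hS.lam_C1.mono (dom_subset_cdom v₀))).differentiableOn one_ne_zero)
    (hS.φt_diff.mono (dom_subset_cdom v₀))
    (fun u v hu huv hv => (h.lam_u u v hu huv hv).ofReal_comp)
    (fun u v hu huv hv => (h.lam_v u v hu huv hv).ofReal_comp) h.f_u h.f_v hJ fun p hp => ?_
  have h1 := h.lam_ne' p hp
  have e1 : (S.reduced e v₀).lk p * (S.reduced e v₀).fv p -
      (S.reduced e v₀).lamv p * (S.reduced e v₀).fu p =
      (S.reduced e v₀).lam p * (S.reduced e v₀).J3 p := by
    rw [Reduced.J3]; field_simp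
  rw [e1, norm_mul, Complex.norm_real, Real.norm_of_nonneg (h.lam_pos hp).le]
  have := h.lam_le' hp
  exact mul_le_of_le_one_left (norm_nonneg _) (by linarith)

omit hv0 in
theorem area_nu_le {c : ℝ} (hJ : Tri v₀ (fun p => ‖(S.reduced e v₀).J4 p‖) c) :
    area v₀ (fun p => (S.nu v₀ p : ℂ)) S.φt ≤ ENNReal.ofReal c := by
  refine area_le (Fu := fun p => ((S.reduced e v₀).nuu p : ℂ))
    (Fv := fun p => ((S.reduced e v₀).lk p : ℂ)) ((Complex.ofRealCLM.contDiff.comp_contDiffOn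
    (hS.nu_C1.mono (dom_subset_cdom v₀))).differentiableOn one_ne_zero)
    (hS.φt_diff.mono (dom_subset_cdom v₀))
    (fun u v hu huv hv => (h.nu_u u v hu huv hv).ofReal_comp)
    (fun u v hu huv hv => (h.nu_v u v hu huv hv).ofReal_comp) h.f_u h.f_v hJ fun p hp => ?_
  have h1 := h.nu_ne' p hp
  have e1 : (S.reduced e v₀).nuu p * (S.reduced e v₀).fv p -
      (S.reduced e v₀).lk p * (S.reduced e v₀).fu p =
      (S.reduced e v₀).nu p * (S.reduced e v₀).J4 p := by
    rw [Reduced.J4]; field_simp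
  rw [e1, norm_mul, Complex.norm_real, Real.norm_of_nonpos (h.nu_neg p hp).le]
  have := h.nu_ge p hp
  exact mul_le_of_le_one_left (norm_nonneg _) (by linarith)

omit hS hv0 in
theorem supTVout_log_lam_le {c : ℝ}
    (hc : Out v₀ (fun p => |(S.reduced e v₀).lamv p / (S.reduced e v₀).lam p|) c) :
    supTVout v₀ (fun p => Real.log (S.lam v₀ p)) ≤ ENNReal.ofReal c :=
  supTVout_le (F' := fun p => (S.reduced e v₀).lamv p / (S.reduced e v₀).lam p) (fun u v hu huv hv => (h.lam_v u v hu huv hv).log (h.lam_ne _ ⟨hu, huv, hv⟩))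
    (h.clamv.div h.clam h.lam_ne) hc

omit hS hv0 in
theorem supTVin_log_nu_le {c : ℝ}
    (hc : In v₀ (fun p => |(S.reduced e v₀).nuu p / (S.reduced e v₀).nu p|) c) :
    supTVin v₀ (fun p => Real.log |S.nu v₀ p|) ≤ ENNReal.ofReal c := by
  simp only [Real.log_abs]
  exact supTVin_le (F' := fun p => (S.reduced e v₀).nuu p / (S.reduced e v₀).nu p) (fun u v hu huv hv => (h.nu_u u v hu huv hv).log (h.nu_ne _ ⟨hu.le, huv, hv⟩))
    (h.cnuu.div h.cnu h.nu_ne) hc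

omit h

/-- Along the diagonal the derivative of λ is ∂_uλ + ∂_vλ, and the first term vanishes on the axis.
-/
theorem tvAxis_log_lam_le (hb : S.PointwiseBounds v₀) :
    tvAxis v₀ (fun p => Real.log (S.lam v₀ p)) ≤
      ∫⁻ v in Ioo 0 v₀, ‖(S.reduced e v₀).lΓ v / (S.reduced e v₀).la v‖ₑ := by
  refine eVariationOn_Ioo_le_setLIntegral_deriv (fun u hu => ?_) ?_
  · have h1 := hasDerivAt_diag ((hS.lam_C1.differentiableOn one_ne_zero) (u, u)
      ⟨hu.1.le, le_rfl, hu.2.le⟩) hu.1 hu.2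
    rw [hS.lam_u_axis hb hu.1 hu.2, zero_add] at h1
    exact h1.log (by linarith [hS.lam_axis_ge hb hu.1.le hu.2])
  · refine (continuousOn_diag (continuousOn_pv hv0 hS.lam_C1)).div
      (continuousOn_diag hS.lam_C1.continuousOn) fun u hu => ?_
    have := hS.lam_axis_ge hb hu.1.le hu.2
    exact ne_of_gt (show 0 < S.lam v₀ (u, u) by linarith)

theorem tvAxis_atil_le (hb : S.PointwiseBounds v₀) :
    tvAxis v₀ (S.atil v₀) ≤
      ∫⁻ v in Ioo 0 v₀, ‖(S.reduced e v₀).gΓ v + S.φt (v, v) * (S.reduced e v₀).lΓ v‖ₑ := by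
  have e1 : ∀ v, (S.reduced e v₀).gΓ v + S.φt (v, v) * (S.reduced e v₀).lΓ v =
      pv v₀ (S.atil v₀) (v, v) := fun v => by
    simp only [reduced]; ring
  simp only [e1]
  refine eVariationOn_Ioo_le_setLIntegral_deriv (fun u hu => ?_)
    (continuousOn_diag (continuousOn_pv hv0 (hS.atil_C1 hv0)))
  have h1 := hasDerivAt_diag (((hS.atil_C1 hv0).differentiableOn one_ne_zero) (u, u)
    ⟨hu.1.le, le_rfl, hu.2.le⟩) hu.1 hu.2
  rwa [hS.atil_u_axis hb hu.1 hu.2, zero_add] at h1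

omit hS hv0 in
theorem Z_le_of_slices {k : ℝ} (hO : Out v₀ (fun p => ‖pv v₀ S.φ p‖) k)
    (hI : In v₀ (fun p => ‖pu v₀ S.φ p‖) k) : (S.Z v₀).toReal ≤ k := by
  refine ENNReal.toReal_le_of_le_ofReal hO.nonneg (max_le ?_ ?_)
  · refine iSup₂_le fun u hu => ?_
    have h1 := (hO u hu.1.le).le
    rw [setLIntegral_outMeas hu.1.le] at h1
    simpa only [ofReal_norm] using h1
  · refine iSup₂_le fun v hv => ?_
    have h1 := (hI v hv.2).le
    rw [setLIntegral_inMeas hv.2] at h1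
    simpa only [ofReal_norm] using h1

end Conclusion

end IsC1Solution
end Fields
end ChargedScalar
end

theorem mainTheorem6 (e : ℝ) (he : 0 ≤ e) (ρ : ℝ) (hρ : 0 ≤ ρ) :
    ∃ ε₀ : ℝ≥0, 0 < ε₀ ∧ ε₀ ≤ 1 ∧ ∃ c : ℝ≥0,
      ∀ (v₀ : ℝ) (S : ChargedScalar.Fields),
        S.IsC1Solution e v₀ → ‖S.φ₀‖ = ρ → S.SmallV₀ e v₀ → S.PointwiseBounds v₀ →
        S.Z v₀ ≤ ε₀ → S.D v₀ ≤ ε₀ →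
          S.Z v₀ ≤ c * S.D v₀ ∧
          -- total variations of the renormalized quantities
          ChargedScalar.supTVout v₀ (S.atil v₀) ≤ c * S.D v₀ ∧
          ChargedScalar.supTVin v₀ (S.btt e v₀) ≤ c * S.D v₀ ∧
          ChargedScalar.tvAxis v₀ (S.atil v₀) ≤ c * S.D v₀ ∧
          -- total variations of the logarithms
          ChargedScalar.supTVout v₀ (fun p => Real.log (S.lam v₀ p)) ≤ c * S.D v₀ ^ 2 ∧
          ChargedScalar.supTVin v₀ (fun p => Real.log |S.nu v₀ p|) ≤ c * S.D v₀ ^ 2 ∧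
          ChargedScalar.tvAxis v₀ (fun p => Real.log (S.lam v₀ p)) ≤ c * S.D v₀ ^ 2 ∧
          -- areas
          ChargedScalar.area v₀ (fun p => (starRingEnd ℂ) (S.φt p))
            (fun p => S.atil v₀ p / S.lam v₀ p) ≤ c * S.D v₀ ^ 2 ∧
          ChargedScalar.area v₀ (fun p => (starRingEnd ℂ) (S.φt p))
            (fun p => S.btt e v₀ p / S.nu v₀ p) ≤ c * S.D v₀ ^ 2 ∧
          ChargedScalar.area v₀ (fun p => (S.lam v₀ p : ℂ)) S.φt ≤ c * S.D v₀ ^ 3 ∧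
          ChargedScalar.area v₀ (fun p => (S.nu v₀ p : ℂ)) S.φt ≤ c * S.D v₀ ^ 3 := by
  -- The same numbers serve for all e and ρ, because the conditions on v₀ absorb the coupling and
  -- |φ₀|. Bounding Z and D by 10⁻³¹ each ensures δ ≤ 10⁻³⁰.
  refine ⟨1 / 10 ^ 31, by positivity,
    div_le_one_of_le₀ (one_le_pow₀ (by norm_num)) (by positivity), 10 ^ 30, ?_⟩
  intro v₀ S hS _ hs hb hZ hD
  have hv0 := hs.pos
  have hZt : S.Z v₀ ≠ ⊤ := ne_top_of_le_ne_top ENNReal.coe_ne_top hZ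
  have hDt : S.D v₀ ≠ ⊤ := ne_top_of_le_ne_top ENNReal.coe_ne_top hD
  have hZr : (S.Z v₀).toReal ≤ 1 / 10 ^ 31 := by
    simpa using ENNReal.toReal_mono ENNReal.coe_ne_top hZ
  have hDr : (S.D v₀).toReal ≤ 1 / 10 ^ 31 := by
    simpa using ENNReal.toReal_mono ENNReal.coe_ne_top hD
  have hZD : (S.Z v₀).toReal + (S.D v₀).toReal ≤ 1 / 10 ^ 30 := by
    norm_num at hZr hDr ⊢
    linarith
  have h := hS.isSol_reduced hv0 he hs hb hZt hDt (hZD.trans (by norm_num))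
  have hd : (S.reduced e v₀).dl ≤ 1 / 10 ^ 30 := hZD
  -- Z is defined as a supremum of slice integrals, so any common slice bound dominates it.
  have hZ6 := h.Z_le_D hd fun k hO hI =>
    ChargedScalar.Fields.IsC1Solution.Z_le_of_slices hO hI
  have hA := h.areas_D hd hZ6
  have conv : ∀ n, ENNReal.ofReal (10 ^ 30 * (S.D v₀).toReal ^ n) =
      ((10 ^ 30 : ℝ≥0) : ℝ≥0∞) * S.D v₀ ^ n := fun n => by
    rw [← ChargedScalar.ofReal_mul_toReal_pow hDt]
    norm_num
  have conv1 : ENNReal.ofReal (10 ^ 30 * (S.D v₀).toReal) = ((10 ^ 30 : ℝ≥0) : ℝ≥0∞) * S.D v₀ := by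
    simpa using conv 1
  have hA2 : (10 : ℝ) ^ 13 * (S.D v₀).toReal ^ 2 ≤ 10 ^ 30 * (S.D v₀).toReal ^ 2 :=
    mul_le_mul_of_nonneg_right (by norm_num) (sq_nonneg _)
  have hm : AEMeasurable (fun v => ‖(S.reduced e v₀).lΓ v / (S.reduced e v₀).la v‖ₑ)
      (volume.restrict (Ioo 0 (S.reduced e v₀).w)) := by
    refine (ContinuousOn.aestronglyMeasurable (ContinuousOn.div ?_ ?_ fun u hu => ?_)
      measurableSet_Ioo).enorm
    · exact ChargedScalar.continuousOn_diag (ChargedScalar.continuousOn_pv hv0 hS.lam_C1)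
    · exact ChargedScalar.continuousOn_diag hS.lam_C1.continuousOn
    · have := h.la_ge u hu.1.le hu.2
      exact ne_of_gt (by linarith)
  rw [← conv1, ← conv 2, ← conv 3]
  refine ⟨?_, ?_, ?_, ?_, ?_, ?_, ?_, ?_, ?_, ?_, ?_⟩
  · rw [← ENNReal.ofReal_toReal hZt]
    refine ENNReal.ofReal_le_ofReal (hZ6.trans ?_)
    exact mul_le_mul_of_nonneg_right (by norm_num) ENNReal.toReal_nonneg
  · exact ChargedScalar.supTVout_le (fun u v hu huv hv =>
      ChargedScalar.hasV_pv (((hS.atil_C1 hv0).differentiableOn one_ne_zero).mono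
        (ChargedScalar.dom_subset_cdom v₀)) u v hu huv hv) h.catv (h.out_atv_D hd hZ6)
  · exact ChargedScalar.supTVin_le (hS.hasU_btt hv0 h) h.cbtu (h.inn_btu_D hd hZ6)
  · exact (hS.tvAxis_atil_le hv0 hb).trans (h.axis_atv hd hZ6 (fun v hv hv' =>
      ChargedScalar.tendsto_axis_in hS.φt_C1.continuousOn hv hv'.le) hm)
  · exact ChargedScalar.Fields.IsC1Solution.supTVout_log_lam_le h (h.out_lamv_D hd hZ6)
  · exact ChargedScalar.Fields.IsC1Solution.supTVin_log_nu_le h (h.inn_nuu_D hd hZ6)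
  · exact (hS.tvAxis_log_lam_le hv0 hb).trans (h.axis_Lh hd hZ6)
  · exact (hS.area_atil_le hv0 h hA.J1).trans (ENNReal.ofReal_le_ofReal hA2)
  · exact (hS.area_btt_le hv0 h hA.J2).trans (ENNReal.ofReal_le_ofReal hA2)
  · exact hS.area_lam_le h hA.J3
  · exact hS.area_nu_le h hA.J4
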